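/- **Setting.** All complex manifolds are Hausdorff, second countable and pure-dimensional; they may be disconnected or empty. Let $Y$, $Z$ be complex manifolds of dimensions $n$, $n+k$, let $p:Z\to Y$ be a proper holomorphic submersion, and let $\mathcal L$ be a holomorphic line bundle on $Y$. Put $K_{Z/Y}=K_Z\otimes p^*K_Y^{-1}$ and $\mathcal M=p^*\mathcal L\otimes K_{Z/Y}$. For a holomorphic line bundle $\mathcal A$ on a complex manifold $X$ with transition functions $g_{ij}$, let $|\mathcal A|^2$ be the $C^\infty$ complex line bundle with transition functions $|g_{ij}|^2$, and $\mathcal C^\infty_{X,|\mathcal A|^2}$ its sheaf of $C^\infty$ sections. Let $\mathcal D_X$ be the sheaf of holomorphic differential operators on $X$ and $\mathcal D_{X,\mathcal A}=\mathcal A\otimes_{\mathcal O_X}\mathcal D_X\otimes_{\mathcal O_X}\mathcal A^{-1}$. It acts on $\mathcal C^\infty_{X,|\mathcal A|^2}$ by applying the operator in each trivialization of $\mathcal A$. Let $\Theta_{Z/Y}$ be the sheaf of holomorphic vector fields on $Z$ tangent to the fibers of $p$, and let $\mathcal D_{Z\to Y}=\mathcal D_Z/(\mathcal D_Z\cdot\Theta_{Z/Y})$,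 a $(\mathcal D_Z,p^{-1}\mathcal D_Y)$-bimodule. Let $\mathcal D_{Y\leftarrow Z}=K_Z\otimes_{\mathcal O_Z}\mathcal D_{Z\to Y}\otimes_{p^{-1}\mathcal O_Y}p^{-1}K_Y^{-1}$, a $(p^{-1}\mathcal D_Y,\mathcal D_Z)$-bimodule through the usual right $\mathcal D$-module structures of the canonical bundles (in local coordinates: by formal transposes). Let $$\widetilde{\mathcal D}=\mathcal L\otimes_{\mathcal O_Y}H^0p^{\mathcal D}_*(\mathcal D_Z\otimes_{\mathcal O_Z}\mathcal M^{-1})=\mathcal L\otimes_{\mathcal O_Y}p_*\bigl(\mathcal D_{Y\leftarrow Z}\otimes_{\mathcal O_Z}\mathcal M^{-1}\bigr).$$ The unit section $1\in\Gamma(Y,\widetilde{\mathcal D})$ is the section represented by the identity operator in all local trivializations; here one uses $\mathcal L\otimes K_Z\otimes K_Y^{-1}\otimes\mathcal M^{-1}\cong\mathcal O_Z$. Finally, $|\mathcal M|^2=p^*|\mathcal L|^2\otimes|K_{Z/Y}|^2$, where $|K_{Z/Y}|^2$ is the bundle of $C^\infty$ densities along the fibers (in local fiber coordinates $x\in\mathbb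 C^k$, the section $|dx|^2$ is Lebesgue measure on $\mathbb C^k$). Let $p_!:p_*\mathcal C^\infty_{Z,|\mathcal M|^2}\to\mathcal C^\infty_{Y,|\mathcal L|^2}$ denote integration along the fibers. **Proposition.** The left action of $\mathcal D_{Y,\mathcal L}$ and the right action of $p_*\mathcal D_{Z,\mathcal M}$ on $\widetilde{\mathcal D}$ induced by the actions above are well defined. There is exactly one homomorphism of sheaves of $(\mathcal D_{Y,\mathcal L},\,p_*\mathcal D_{Z,\mathcal M})$-bimodules on $Y$ $$\Phi:\ \widetilde{\mathcal D}\longrightarrow \mathcal{H}om_{\mathbb C}\bigl(p_*\mathcal C^\infty_{Z,|\mathcal M|^2},\ \mathcal C^\infty_{Y,|\mathcal L|^2}\bigr)$$ with $\Phi(1)=p_!$, where the bimodule structure of the target is $S\cdot\varphi\cdot R=S\circ\varphi\circ R$. This $\Phi$ is injective. -/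

import Mathlib

open Set TopologicalSpace MeasureTheory
open scoped Manifold ContDiff Topology

noncomputable section
namespace DPush

/-- The model space `ℂ^d` of `d`-dimensional complex manifolds. -/
abbrev Cn (d : ℕ) : Type := Fin d → ℂ

section Presheaves

universe u v w w'

/-- A presheaf of complex vector spaces on `X`.  (All instances below are sheaves.) -/
structure ModPresheaf (X : Type u) [TopologicalSpace X] where
  sec : Opens X → Type v
  [grp : ∀ U, AddCommGroup (sec U)]
  [mod : ∀ U, Module ℂ (sec U)]
  res : ∀ {U V : Opens X}, V ≤ U → sec U →ₗ[ℂ] sec V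
  res_self : ∀ (U : Opens X) (s : sec U), res (le_refl U) s = s
  res_res : ∀ {U V W : Opens X} (h : V ≤ U) (h' : W ≤ V) (s : sec U),
    res h' (res h s) = res (h'.trans h) s

attribute [instance] ModPresheaf.grp ModPresheaf.mod

variable {X : Type u} [TopologicalSpace X]

/-- Compatible systems of linear maps `F(V) → G(V)`, for `V ⊆ W` open. -/
def homSub (F : ModPresheaf.{u, v} X) (G : ModPresheaf.{u, w} X) (W : Opens X) :
    Submodule ℂ (∀ V : Set.Iic W, F.sec V →ₗ[ℂ] G.sec V) where
  carrier := {φ | ∀ (V V' : Set.Iic W) (h : V'.1 ≤ V.1) (s : F.sec V),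
    G.res h (φ V s) = φ V' (F.res h s)}
  add_mem' := by
    intro φ ψ hφ hψ V V' h s
    simp only [Pi.add_apply, LinearMap.add_apply, map_add, hφ V V' h s, hψ V V' h s]
  zero_mem' := by
    intro V V' h s
    simp
  smul_mem' := by
    intro c φ hφ V V' h s
    simp only [Pi.smul_apply, LinearMap.smul_apply, map_smul, hφ V V' h s]

/-- `Hom(F|_W, G|_W)`: the sections over `W` of the internal Hom sheaf `ℋom(F, G)`. -/
def HomOn (F : ModPresheaf.{u, v} X) (G : ModPresheaf.{u, w} X) (W : Opens X) :
    Type (max u v w) := homSub F G W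

instance (F : ModPresheaf.{u, v} X) (G : ModPresheaf.{u, w} X) (W : Opens X) :
    AddCommGroup (HomOn F G W) := inferInstanceAs (AddCommGroup (homSub F G W))

instance (F : ModPresheaf.{u, v} X) (G : ModPresheaf.{u, w} X) (W : Opens X) :
    Module ℂ (HomOn F G W) := inferInstanceAs (Module ℂ (homSub F G W))

namespace HomOn
variable {F : ModPresheaf.{u, v} X} {G : ModPresheaf.{u, w} X} {W : Opens X}

/-- The component over `V ⊆ W` of a morphism `F|_W → G|_W`. -/
def app (φ : HomOn F G W) (V : Opens X) (h : V ≤ W) : F.sec V →ₗ[ℂ] G.sec V := φ.1 ⟨V, h⟩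

theorem res_app (φ : HomOn F G W) {V V' : Opens X} (h : V ≤ W) (h' : V' ≤ V) (s : F.sec V) :
    G.res h' (φ.app V h s) = φ.app V' (h'.trans h) (F.res h' s) :=
  φ.2 ⟨V, h⟩ ⟨V', h'.trans h⟩ h' s

@[ext] theorem ext {φ ψ : HomOn F G W} (h : ∀ V hV s, φ.app V hV s = ψ.app V hV s) : φ = ψ :=
  Subtype.ext (funext fun V => LinearMap.ext fun s => h V.1 V.2 s)

/-- Constructor from a compatible family of linear maps. -/
def mk' (a : ∀ V : Opens X, V ≤ W → (F.sec V →ₗ[ℂ] G.sec V))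
    (ha : ∀ (V V' : Opens X) (h : V ≤ W) (h' : V' ≤ V) (s : F.sec V),
      G.res h' (a V h s) = a V' (h'.trans h) (F.res h' s)) : HomOn F G W :=
  ⟨fun V => a V.1 V.2, fun V V' h s => ha V.1 V'.1 V.2 h s⟩

/-- Restriction of a morphism to a smaller open set. -/
def restr {W' : Opens X} (h : W' ≤ W) : HomOn F G W →ₗ[ℂ] HomOn F G W' where
  toFun φ := mk' (fun V hV => φ.app V (hV.trans h)) (fun _ _ _ h' s => φ.res_app _ h' s)
  map_add' _ _ := rfl
  map_smul' _ _ := rfl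

/-- Composition of morphisms. -/
def comp {H : ModPresheaf.{u, w'} X} (φ : HomOn G H W) (ψ : HomOn F G W) : HomOn F H W :=
  mk' (fun V hV => (φ.app V hV).comp (ψ.app V hV)) (fun _ _ h h' s => by
    simp only [LinearMap.comp_apply, res_app])

/-- The identity morphism. -/
def one (F : ModPresheaf.{u, v} X) (W : Opens X) : HomOn F F W :=
  mk' (fun _ _ => LinearMap.id) (fun _ _ _ _ _ => rfl)

theorem add_comp {H : ModPresheaf.{u, w'} X} (φ φ' : HomOn G H W) (ψ : HomOn F G W) :
    (φ + φ').comp ψ = φ.comp ψ + φ'.comp ψ := rfl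

theorem smul_comp {H : ModPresheaf.{u, w'} X} (c : ℂ) (φ : HomOn G H W) (ψ : HomOn F G W) :
    (c • φ).comp ψ = c • φ.comp ψ := rfl

theorem comp_add {H : ModPresheaf.{u, w'} X} (φ : HomOn G H W) (ψ ψ' : HomOn F G W) :
    φ.comp (ψ + ψ') = φ.comp ψ + φ.comp ψ' :=
  ext fun V hV s => map_add (φ.app V hV) (ψ.app V hV s) (ψ'.app V hV s)

theorem comp_smul {H : ModPresheaf.{u, w'} X} (c : ℂ) (φ : HomOn G H W) (ψ : HomOn F G W) :
    φ.comp (c • ψ) = c • φ.comp ψ :=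
  ext fun V hV s => map_smul (φ.app V hV) c (ψ.app V hV s)

theorem comp_zero {H : ModPresheaf.{u, w'} X} (φ : HomOn G H W) :
    φ.comp (0 : HomOn F G W) = 0 :=
  ext fun V hV _ => map_zero (φ.app V hV)

end HomOn

/-- The internal Hom sheaf `ℋom(F, G)` of complex vector spaces. -/
def internalHom (F : ModPresheaf.{u, v} X) (G : ModPresheaf.{u, w} X) :
    ModPresheaf.{u, max u v w} X where
  sec W := HomOn F G W
  res h := HomOn.restr h
  res_self _ _ := rfl
  res_res _ _ _ := rfl

variable {Z : Type*} [TopologicalSpace Z]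
/-- The sheaf-theoretic push-forward: `(p_* F)(U) = F(p⁻¹ U)`. -/
def pushforward (p : C(Z, X)) (F : ModPresheaf.{_, v} Z) : ModPresheaf.{u, v} X where
  sec U := F.sec (Opens.comap p U)
  res h := F.res (Opens.comap_mono p h)
  res_self _ s := F.res_self _ s
  res_res _ _ s := F.res_res _ _ s

/-- The morphism `p_* F → p_* G` over `U` induced by a morphism `F → G` over `p⁻¹ U`. -/
def pushHom (p : C(Z, X)) {F : ModPresheaf.{_, v} Z} {G : ModPresheaf.{_, w} Z} {U : Opens X}
    (φ : HomOn F G (Opens.comap p U)) : HomOn (pushforward p F) (pushforward p G) U :=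
  HomOn.mk' (fun V hV => φ.app (Opens.comap p V) (Opens.comap_mono p hV))
    (fun _ _ _ _ s => φ.res_app _ _ s)

end Presheaves

section Functions

variable (d : ℕ) {X : Type*} [TopologicalSpace X] [ChartedSpace (Cn d) X]

/-- `f` is holomorphic on `U`. -/
abbrev HolOn (f : X → ℂ) (U : Set X) : Prop := ContMDiffOn 𝓘(ℂ, Cn d) 𝓘(ℂ, ℂ) ω f U

/-- `f` is `C^∞` on `U`, for the underlying real manifold structure. -/
abbrev SmoothOn (f : X → ℂ) (U : Set X) : Prop := ContMDiffOn 𝓘(ℝ, Cn d) 𝓘(ℝ, ℂ) ∞ f U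

theorem HolOn.smoothOn {f : X → ℂ} {U : Set X} (h : HolOn d f U) : SmoothOn d f U := by
  intro x hx
  have h1 := h x hx
  rw [contMDiffWithinAt_iff] at h1 ⊢
  refine ⟨h1.1, ?_⟩
  have h2 : ContDiffWithinAt ℝ ω _ _ _ := h1.2.restrict_scalars ℝ
  exact h2.of_le le_top

variable (X) in
/-- The holomorphic charts of `X` (the maximal holomorphic atlas). -/
abbrev Chart : Type _ := IsManifold.maximalAtlas 𝓘(ℂ, Cn d) ω X

theorem isManifold_real [IsManifold 𝓘(ℂ, Cn d) ω X] : IsManifold 𝓘(ℝ, Cn d) ∞ X := by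
  refine isManifold_of_contDiffOn _ _ _ fun e e' he he' => ?_
  have h := (contDiffGroupoid ω 𝓘(ℂ, Cn d)).compatible he he'
  rw [contDiffGroupoid, mem_groupoid_of_pregroupoid] at h
  have h2 : ContDiffOn ℂ ω _ _ := h.1
  have h3 : ContDiffOn ℝ ω _ _ := h2.restrict_scalars ℝ
  exact h3.of_le le_top

theorem Chart.mem_real [IsManifold 𝓘(ℂ, Cn d) ω X] (a : Chart d X) :
    a.1 ∈ IsManifold.maximalAtlas 𝓘(ℝ, Cn d) ∞ X := by
  intro e he
  have h := a.2 e he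
  rw [contDiffGroupoid, mem_groupoid_of_pregroupoid, mem_groupoid_of_pregroupoid] at h
  have key : ∀ {f : Cn d → Cn d} {s : Set (Cn d)}, (contDiffPregroupoid ω 𝓘(ℂ, Cn d)).property f s →
      (contDiffPregroupoid ∞ 𝓘(ℝ, Cn d)).property f s := by
    intro f s h
    have h2 : ContDiffOn ℂ ω _ _ := h
    have h3 : ContDiffOn ℝ ω _ _ := h2.restrict_scalars ℝ
    exact h3.of_le le_top
  rw [contDiffGroupoid, mem_groupoid_of_pregroupoid, mem_groupoid_of_pregroupoid]
  exact ⟨⟨key h.1.1, key h.1.2⟩, ⟨key h.2.1, key h.2.2⟩⟩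

/-- `C^∞(U)`: smooth complex functions on `U`, stored as functions on `X` that vanish off `U`
(so that equality of sections is equality on `U`). -/
def smoothFun (U : Opens X) : Submodule ℂ (X → ℂ) where
  carrier := {f | SmoothOn d f U ∧ ∀ x ∉ U, f x = 0}
  add_mem' := fun hf hg => ⟨hf.1.add hg.1, fun x hx => by simp [hf.2 x hx, hg.2 x hx]⟩
  zero_mem' := ⟨contMDiffOn_const, fun _ _ => rfl⟩
  smul_mem' := fun c f hf => ⟨by
    have := (contDiff_const_smul (𝕜 := ℝ) (F := ℂ) (n := ∞) c).contMDiff.comp_contMDiffOn hf.1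
    exact this, fun x hx => by simp [hf.2 x hx]⟩

theorem smoothOn_indicator {f : X → ℂ} {U V : Set X} (hf : SmoothOn d f U) (h : V ⊆ U) :
    SmoothOn d (Set.indicator V f) V :=
  (hf.mono h).congr fun _ hx => Set.indicator_of_mem hx f

theorem indicator_mem_smoothFun {f : X → ℂ} {U : Set X} {V : Opens X} (hf : SmoothOn d f U)
    (h : (V : Set X) ⊆ U) : Set.indicator (V : Set X) f ∈ smoothFun d V :=
  ⟨smoothOn_indicator d hf h, fun _ hx => Set.indicator_of_notMem hx f⟩

variable (X) in
/-- The sheaf `C^∞_X` of smooth complex-valued functions. -/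
def smoothSheaf : ModPresheaf X where
  sec U := smoothFun d U
  res {U V} h :=
    { toFun := fun f => ⟨Set.indicator (V : Set X) f.1, indicator_mem_smoothFun d f.2.1 h⟩
      map_add' := fun f g => Subtype.ext (Set.indicator_add _ _ _)
      map_smul' := fun c f => Subtype.ext (Set.indicator_const_smul (V : Set X) c f.1) }
  res_self U s := Subtype.ext (by
    ext x
    by_cases hx : x ∈ U
    · simp [hx]
    · simp [hx, s.2.2 x hx])
  res_res h h' s := Subtype.ext (by
    simp only [LinearMap.coe_mk, AddHom.coe_mk, Set.indicator_indicator]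
    rw [Set.inter_eq_self_of_subset_left h'])

/-- The sections over `W` of the endomorphism sheaf of `C^∞_X`. -/
abbrev LocOp (W : Opens X) : Type _ := HomOn (smoothSheaf d X) (smoothSheaf d X) W

theorem SmoothOn.mul {f g : X → ℂ} {U : Set X} (hf : SmoothOn d f U) (hg : SmoothOn d g U) :
    SmoothOn d (fun x => f x * g x) U := by
  have h : ContDiff ℝ ∞ (fun q : ℂ × ℂ => q.1 * q.2) := contDiff_fst.mul contDiff_snd
  exact h.contMDiff.comp_contMDiffOn (hf.prodMk_space hg)

/-- Multiplication by `f` on `C^∞(V)`. -/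
def mulSmooth (f : X → ℂ) {W : Opens X} (hf : SmoothOn d f W) (V : Opens X) (hV : V ≤ W) :
    smoothFun d V →ₗ[ℂ] smoothFun d V where
  toFun g := ⟨fun x => f x * g.1 x, SmoothOn.mul d (hf.mono hV) g.2.1,
    fun x hx => by simp [g.2.2 x hx]⟩
  map_add' _ _ := Subtype.ext (funext fun _ => mul_add _ _ _)
  map_smul' _ _ := Subtype.ext (funext fun _ => mul_left_comm _ _ _)

open Classical in
/-- Multiplication by a function `f` smooth on `W`, as an operator on `C^∞_W`
(the value `0` for non-smooth `f` is never used). -/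
def mulOp (f : X → ℂ) (W : Opens X) : LocOp d W :=
  if hf : SmoothOn d f W then
    HomOn.mk' (mulSmooth d f hf) (fun _ V' _ _ s => Subtype.ext (by
      funext x
      change Set.indicator (V' : Set X) (fun x => f x * s.1 x) x =
        f x * Set.indicator (V' : Set X) s.1 x
      by_cases hx : x ∈ V' <;> simp [hx]))
  else 0

/-- The derivative `∂f/∂z_j = (∂f/∂x_j - i ∂f/∂y_j)/2` in the holomorphic chart `a`. -/
def wirtinger (a : Chart d X) (j : Fin d) (f : X → ℂ) (x : X) : ℂ :=
  (1 / 2) * (fderiv ℝ (f ∘ a.1.symm) (a.1 x) (Pi.single j 1) -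
    Complex.I * fderiv ℝ (f ∘ a.1.symm) (a.1 x) (Pi.single j Complex.I))

theorem Chart.contDiffOn_symm [IsManifold 𝓘(ℂ, Cn d) ω X] (a : Chart d X) {f : X → ℂ}
    {V : Opens X} (hf : SmoothOn d f V) :
    ContDiffOn ℝ ∞ (f ∘ a.1.symm) (a.1.target ∩ a.1.symm ⁻¹' V) := by
  have : IsManifold 𝓘(ℝ, Cn d) ∞ X := isManifold_real d
  have h := contMDiffOn_symm_of_mem_maximalAtlas (a.mem_real)
  have h2 : ContMDiffOn 𝓘(ℝ, Cn d) 𝓘(ℝ, ℂ) ∞ (f ∘ a.1.symm) (a.1.target ∩ a.1.symm ⁻¹' V) :=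
    hf.comp (h.mono Set.inter_subset_left) (fun x hx => hx.2)
  exact h2.contDiffOn

theorem Chart.isOpen_preimage (a : Chart d X) (V : Opens X) :
    IsOpen (a.1.target ∩ a.1.symm ⁻¹' V) :=
  a.1.symm.isOpen_inter_preimage V.2

theorem Chart.differentiableAt [IsManifold 𝓘(ℂ, Cn d) ω X] (a : Chart d X) {f : X → ℂ}
    {V : Opens X} (hV : (V : Set X) ⊆ a.1.source) (hf : SmoothOn d f V) {x : X} (hx : x ∈ V) :
    DifferentiableAt ℝ (f ∘ a.1.symm) (a.1 x) := by
  refine ((a.contDiffOn_symm d hf).contDiffAt ((a.isOpen_preimage d V).mem_nhds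
    ⟨a.1.map_source (hV hx), ?_⟩)).differentiableAt (by simp)
  simpa [a.1.left_inv (hV hx)] using hx

theorem wirtinger_smooth [IsManifold 𝓘(ℂ, Cn d) ω X] (a : Chart d X) (j : Fin d) {f : X → ℂ}
    {V : Opens X} (hV : (V : Set X) ⊆ a.1.source) (hf : SmoothOn d f V) :
    SmoothOn d (wirtinger d a j f) V := by
  have : IsManifold 𝓘(ℝ, Cn d) ∞ X := isManifold_real d
  have h1 := a.contDiffOn_symm d hf
  have h2 : ContDiffOn ℝ ∞ (fderiv ℝ (f ∘ a.1.symm)) (a.1.target ∩ a.1.symm ⁻¹' V) :=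
    h1.fderiv_of_isOpen (a.isOpen_preimage d V) (by simp)
  have h3 : ∀ v : Cn d, ContDiffOn ℝ ∞ (fun y => fderiv ℝ (f ∘ a.1.symm) y v)
      (a.1.target ∩ a.1.symm ⁻¹' V) := fun v => h2.clm_apply contDiffOn_const
  have h4 := contDiffOn_const (c := (1 / 2 : ℂ)).mul ((h3 (Pi.single j 1)).sub
    ((contDiffOn_const (c := Complex.I)).mul (h3 (Pi.single j Complex.I))))
  have h5 := (contMDiffOn_of_mem_maximalAtlas (a.mem_real)).mono hV
  refine (h4.contMDiffOn.comp h5 fun x hx => ⟨a.1.map_source (hV hx), ?_⟩)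
  simpa [a.1.left_inv (hV hx)] using hx

theorem wirtinger_indicator (a : Chart d X) (j : Fin d) (f : X → ℂ) {V : Opens X} {x : X}
    (hV : x ∈ a.1.source) (hx : x ∈ V) :
    wirtinger d a j (Set.indicator (V : Set X) f) x = wirtinger d a j f x := by
  have : (Set.indicator (V : Set X) f) ∘ a.1.symm =ᶠ[𝓝 (a.1 x)] f ∘ a.1.symm := by
    filter_upwards [(a.isOpen_preimage d V).mem_nhds
      ⟨a.1.map_source hV, by simpa [a.1.left_inv hV] using hx⟩] with y hy
    exact Set.indicator_of_mem (s := (V : Set X)) hy.2 f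
  simp only [wirtinger, this.fderiv_eq]

/-- `∂/∂z_j` as a linear endomorphism of `C^∞(V)`. -/
def coordDerivSmooth [IsManifold 𝓘(ℂ, Cn d) ω X] (a : Chart d X) (j : Fin d) (V : Opens X)
    (hV : (V : Set X) ⊆ a.1.source) : smoothFun d V →ₗ[ℂ] smoothFun d V where
  toFun g := ⟨Set.indicator (V : Set X) (wirtinger d a j g.1),
    indicator_mem_smoothFun d (wirtinger_smooth d a j hV g.2.1) le_rfl⟩
  map_add' g g' := Subtype.ext (by
    funext x
    change Set.indicator (V : Set X) (wirtinger d a j (g.1 + g'.1)) x =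
      Set.indicator (V : Set X) (wirtinger d a j g.1) x +
      Set.indicator (V : Set X) (wirtinger d a j g'.1) x
    by_cases hx : x ∈ V
    · have h1 := a.differentiableAt d hV g.2.1 hx
      have h2 := a.differentiableAt d hV g'.2.1 hx
      have h3 : (g.1 + g'.1) ∘ a.1.symm = g.1 ∘ a.1.symm + g'.1 ∘ a.1.symm := rfl
      simp only [SetLike.mem_coe, hx, Set.indicator_of_mem, wirtinger, h3, fderiv_add h1 h2,
        _root_.add_apply]
      ring
    · simp [hx])
  map_smul' c g := Subtype.ext (by
    funext x
    change Set.indicator (V : Set X) (wirtinger d a j (c • g.1)) x =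
      c * Set.indicator (V : Set X) (wirtinger d a j g.1) x
    by_cases hx : x ∈ V
    · have h1 := a.differentiableAt d hV g.2.1 hx
      have h3 : (c • g.1) ∘ a.1.symm = c • (g.1 ∘ a.1.symm) := rfl
      simp only [SetLike.mem_coe, hx, Set.indicator_of_mem, wirtinger, h3,
        fderiv_const_smul h1 c, _root_.smul_apply, smul_eq_mul]
      ring
    · simp [hx])

/-- The coordinate vector field `∂/∂z_j` of the chart `a`, as an operator on `C^∞_W`. -/
def coordDeriv [IsManifold 𝓘(ℂ, Cn d) ω X] (a : Chart d X) (j : Fin d) (W : Opens X)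
    (hW : (W : Set X) ⊆ a.1.source) : LocOp d W :=
  HomOn.mk' (fun V hV => coordDerivSmooth d a j V (Set.Subset.trans hV hW))
    (fun V V' h h' s => Subtype.ext (by
      funext x
      change Set.indicator (V' : Set X) (Set.indicator (V : Set X) (wirtinger d a j s.1)) x =
        Set.indicator (V' : Set X) (wirtinger d a j (Set.indicator (V' : Set X) s.1)) x
      by_cases hx : x ∈ V'
      · have hx' : x ∈ V := h' hx
        simp [hx, hx', wirtinger_indicator d a j s.1 (hW (h hx')) hx]
      · simp [hx]))

/-- Holomorphic differential operators: `𝒟_X` is the smallest subsheaf of algebras of the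
endomorphism sheaf of `C^∞_X` that contains the holomorphic functions and the coordinate vector
fields `∂/∂z_j` of all holomorphic charts, that is, the sheaf of rings generated by `𝒪_X` and the
holomorphic vector fields. -/
inductive IsHolDiffOp [IsManifold 𝓘(ℂ, Cn d) ω X] : ∀ {W : Opens X}, LocOp d W → Prop
  | mul {W : Opens X} (f : X → ℂ) (hf : HolOn d f W) : IsHolDiffOp (mulOp d f W)
  | deriv {W : Opens X} (a : Chart d X) (j : Fin d) (hW : (W : Set X) ⊆ a.1.source) :
      IsHolDiffOp (coordDeriv d a j W hW)
  | add {W : Opens X} {P Q : LocOp d W} : IsHolDiffOp P → IsHolDiffOp Q → IsHolDiffOp (P + Q)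
  | comp {W : Opens X} {P Q : LocOp d W} : IsHolDiffOp P → IsHolDiffOp Q →
      IsHolDiffOp (P.comp Q)
  | locally {W : Opens X} {P : LocOp d W} (V : X → Opens X) (hV : ∀ x ∈ W, V x ≤ W)
      (hx : ∀ x ∈ W, x ∈ V x)
      (hP : ∀ (x : X) (h : x ∈ W), IsHolDiffOp (HomOn.restr (hV x h) P)) : IsHolDiffOp P

/-- `IsTranspose a P P'`: the operator `P'` is the formal transpose of `P` in the coordinates of the
chart `a`, for the anti-automorphism of `𝒟` with `f ↦ f` and `∂/∂z_j ↦ -∂/∂z_j`.  It describes the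
right action of `𝒟_X` on `K_X`: `(f dz) · P = (P' f) dz`, where `dz = dz_1 ∧ ⋯ ∧ dz_d`. -/
inductive IsTranspose [IsManifold 𝓘(ℂ, Cn d) ω X] (a : Chart d X) :
    ∀ {W : Opens X}, LocOp d W → LocOp d W → Prop
  | mul {W : Opens X} (f : X → ℂ) (hf : HolOn d f W) :
      IsTranspose a (mulOp d f W) (mulOp d f W)
  | deriv {W : Opens X} (j : Fin d) (hW : (W : Set X) ⊆ a.1.source) :
      IsTranspose a (coordDeriv d a j W hW) (-coordDeriv d a j W hW)
  | add {W : Opens X} {P P' Q Q' : LocOp d W} : IsTranspose a P P' → IsTranspose a Q Q' →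
      IsTranspose a (P + Q) (P' + Q')
  | comp {W : Opens X} {P P' Q Q' : LocOp d W} : IsTranspose a P P' → IsTranspose a Q Q' →
      IsTranspose a (P.comp Q) (Q'.comp P')
  | locally {W : Opens X} {P P' : LocOp d W} (V : X → Opens X) (hV : ∀ x ∈ W, V x ≤ W)
      (hx : ∀ x ∈ W, x ∈ V x)
      (hP : ∀ (x : X) (h : x ∈ W),
        IsTranspose a (HomOn.restr (hV x h) P) (HomOn.restr (hV x h) P')) : IsTranspose a P P'

end Functions

section LineBundles

/-- A holomorphic line bundle given by an open cover and holomorphic transition functions; sections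
are families `s_i` on `dom i` with `s_i = g_ij s_j`. -/
structure HolLineBundle (d : ℕ) (X : Type*) [TopologicalSpace X] [ChartedSpace (Cn d) X] where
  ι : Type*
  dom : ι → Opens X
  cover : ∀ x, ∃ i, x ∈ dom i
  g : ι → ι → X → ℂ
  hol : ∀ i j, HolOn d (g i j) (dom i ⊓ dom j : Opens X)
  ne_zero : ∀ i j x, x ∈ dom i → x ∈ dom j → g i j x ≠ 0
  cocycle : ∀ i j l x, x ∈ dom i → x ∈ dom j → x ∈ dom l → g i j x * g j l x = g i l x

variable {d : ℕ} {X : Type*} [TopologicalSpace X] [ChartedSpace (Cn d) X]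

theorem HolOn.mul {f g : X → ℂ} {U : Set X} (hf : HolOn d f U) (hg : HolOn d g U) :
    HolOn d (fun x => f x * g x) U := by
  have h : ContDiff ℂ ω (fun q : ℂ × ℂ => q.1 * q.2) := contDiff_fst.mul contDiff_snd
  exact h.contMDiff.comp_contMDiffOn (hf.prodMk_space hg)

theorem HolOn.inv {f : X → ℂ} {U : Set X} (hf : HolOn d f U) (h0 : ∀ x ∈ U, f x ≠ 0) :
    HolOn d (fun x => (f x)⁻¹) U := by
  intro x hx
  have h : ContDiffAt ℂ ω (fun z : ℂ => z⁻¹) (f x) := contDiffAt_inv ℂ (h0 x hx)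
  exact h.contMDiffAt.comp_contMDiffWithinAt x (hf x hx)

namespace HolLineBundle

/-- Tensor product of line bundles. -/
def tensor (A : HolLineBundle d X) (B : HolLineBundle d X) : HolLineBundle d X where
  ι := A.ι × B.ι
  dom i := A.dom i.1 ⊓ B.dom i.2
  cover x := (A.cover x).elim fun i hi => (B.cover x).elim fun j hj => ⟨(i, j), hi, hj⟩
  g i j x := A.g i.1 j.1 x * B.g i.2 j.2 x
  hol i j := HolOn.mul ((A.hol i.1 j.1).mono fun _ h => ⟨h.1.1, h.2.1⟩)
    ((B.hol i.2 j.2).mono fun _ h => ⟨h.1.2, h.2.2⟩)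
  ne_zero i j x hi hj := mul_ne_zero (A.ne_zero _ _ x hi.1 hj.1) (B.ne_zero _ _ x hi.2 hj.2)
  cocycle i j l x hi hj hl := by
    rw [← A.cocycle i.1 j.1 l.1 x hi.1 hj.1 hl.1, ← B.cocycle i.2 j.2 l.2 x hi.2 hj.2 hl.2]
    ring

/-- The inverse line bundle. -/
def dual (A : HolLineBundle d X) : HolLineBundle d X where
  ι := A.ι
  dom := A.dom
  cover := A.cover
  g i j x := (A.g i j x)⁻¹
  hol i j := HolOn.inv (A.hol i j) fun x hx => A.ne_zero i j x hx.1 hx.2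
  ne_zero i j x hi hj := inv_ne_zero (A.ne_zero i j x hi hj)
  cocycle i j l x hi hj hl := by rw [← A.cocycle i j l x hi hj hl, mul_inv]

/-- Pull-back of a line bundle along a holomorphic map. -/
def pullback {e : ℕ} {Z : Type*} [TopologicalSpace Z] [ChartedSpace (Cn e) Z] (p : C(Z, X))
    (hp : ContMDiff 𝓘(ℂ, Cn e) 𝓘(ℂ, Cn d) ω p) (A : HolLineBundle d X) : HolLineBundle e Z where
  ι := A.ι
  dom i := Opens.comap p (A.dom i)
  cover z := A.cover (p z)
  g i j z := A.g i j (p z)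
  hol i j := (A.hol i j).comp hp.contMDiffOn fun _ hz => hz
  ne_zero i j z hi hj := A.ne_zero i j (p z) hi hj
  cocycle i j l z hi hj hl := A.cocycle i j l (p z) hi hj hl

open Bundle in
/-- The transition functions of a holomorphic line bundle, for all its local trivializations. -/
def ofVectorBundle (L : X → Type*) [∀ x, AddCommGroup (L x)] [∀ x, Module ℂ (L x)]
    [∀ x, TopologicalSpace (L x)] [TopologicalSpace (TotalSpace ℂ L)] [FiberBundle ℂ L]
    [VectorBundle ℂ ℂ L] [ContMDiffVectorBundle ω ℂ L 𝓘(ℂ, Cn d)] : HolLineBundle d X where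
  ι := {e : Trivialization ℂ (π ℂ L) // MemTrivializationAtlas e}
  dom e := ⟨e.1.baseSet, e.1.open_baseSet⟩
  cover x := ⟨⟨trivializationAt ℂ L x, inferInstance⟩, mem_baseSet_trivializationAt ℂ L x⟩
  g i j x :=
    letI := i.2
    letI := j.2
    j.1.coordChangeL ℂ i.1 x 1
  hol i j := by
    have := i.2
    have := j.2
    have h := contMDiffOn_coordChangeL (n := ω) (IB := 𝓘(ℂ, Cn d)) j.1 i.1
    rw [Set.inter_comm] at h
    exact ((ContinuousLinearMap.apply ℂ ℂ (1 : ℂ)).contDiff.contMDiff).comp_contMDiffOn h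
  ne_zero i j x hi hj := by
    have := i.2
    have := j.2
    intro h
    have h1 : (j.1.coordChangeL ℂ i.1 x) 1 = (j.1.coordChangeL ℂ i.1 x) 0 := by
      rw [map_zero]; exact h
    exact one_ne_zero ((j.1.coordChangeL ℂ i.1 x).injective h1)
  cocycle i j l x hi hj hl := by
    have := i.2
    have := j.2
    have := l.2
    have lin : ∀ c : ℂ, j.1.coordChangeL ℂ i.1 x c = c * j.1.coordChangeL ℂ i.1 x 1 := by
      intro c
      rw [← smul_eq_mul, ← map_smul, smul_eq_mul, mul_one]
    rw [mul_comm, ← lin, Trivialization.coordChangeL_apply l.1 j.1 ⟨hl, hj⟩,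
      Trivialization.coordChangeL_apply j.1 i.1 ⟨hj, hi⟩,
      Trivialization.coordChangeL_apply l.1 i.1 ⟨hl, hi⟩]
    congr 2
    exact congrArg (TotalSpace.mk' ℂ x) (j.1.symm_apply_apply_mk hj _)

/-- The Jacobian determinant `∂(coordinates of b)/∂(coordinates of a)`. -/
def jac (a b : Chart d X) (x : X) : ℂ :=
  (fderiv ℂ (b.1 ∘ a.1.symm) (a.1 x)).det

theorem trans_contDiffOn (a b : Chart d X) :
    ContDiffOn ℂ ω (b.1 ∘ a.1.symm) (a.1.symm ≫ₕ b.1).source := by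
  have h := StructureGroupoid.compatible_of_mem_maximalAtlas a.2 b.2
  rw [contDiffGroupoid, mem_groupoid_of_pregroupoid] at h
  have h2 : ContDiffOn ℂ ω _ _ := h.1
  refine ContDiffOn.mono (f := b.1 ∘ a.1.symm) h2 ?_
  intro y hy
  simpa using hy

theorem trans_mem {a b : Chart d X} {x : X} (ha : x ∈ a.1.source) (hb : x ∈ b.1.source) :
    a.1 x ∈ (a.1.symm ≫ₕ b.1).source := by
  simp [a.1.left_inv ha, ha, hb]

theorem trans_differentiableAt {a b : Chart d X} {x : X} (ha : x ∈ a.1.source)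
    (hb : x ∈ b.1.source) : DifferentiableAt ℂ (b.1 ∘ a.1.symm) (a.1 x) :=
  ((trans_contDiffOn a b).contDiffAt
    ((a.1.symm ≫ₕ b.1).open_source.mem_nhds (trans_mem ha hb))).differentiableAt (by simp)

theorem jac_mul (a b c : Chart d X) {x : X} (ha : x ∈ a.1.source) (hb : x ∈ b.1.source)
    (hc : x ∈ c.1.source) : jac a b x * jac b c x = jac a c x := by
  have h1 : c.1 ∘ a.1.symm =ᶠ[𝓝 (a.1 x)] (c.1 ∘ b.1.symm) ∘ (b.1 ∘ a.1.symm) := by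
    filter_upwards [(a.1.symm ≫ₕ b.1).open_source.mem_nhds (trans_mem ha hb)] with y hy
    have hy2 : a.1.symm y ∈ b.1.source := by simpa using hy.2
    simp [b.1.left_inv hy2]
  have hx : (b.1 ∘ a.1.symm) (a.1 x) = b.1 x := by simp [a.1.left_inv ha]
  have h2 : DifferentiableAt ℂ (c.1 ∘ b.1.symm) ((b.1 ∘ a.1.symm) (a.1 x)) := by
    rw [hx]; exact trans_differentiableAt hb hc
  unfold jac
  rw [h1.fderiv_eq, fderiv_comp _ h2 (trans_differentiableAt ha hb), hx, mul_comm]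
  exact (LinearMap.det_comp _ _).symm

theorem jac_self (a : Chart d X) {x : X} (ha : x ∈ a.1.source) : jac a a x = 1 := by
  have h1 : a.1 ∘ a.1.symm =ᶠ[𝓝 (a.1 x)] id := by
    filter_upwards [a.1.open_target.mem_nhds (a.1.map_source ha)] with y hy
    exact a.1.right_inv hy
  unfold jac
  rw [h1.fderiv_eq, fderiv_id]
  simp [ContinuousLinearMap.det]

theorem contDiff_det : ContDiff ℂ ω (fun T : Cn d →L[ℂ] Cn d => T.det) := by
  have h : (fun T : Cn d →L[ℂ] Cn d => T.det) = fun T =>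
      (Matrix.of fun i j => T (Pi.single j 1) i).det := by
    funext T
    rw [ContinuousLinearMap.det, ← LinearMap.det_toMatrix']
    rfl
  rw [h]
  simp only [Matrix.det_apply]
  refine ContDiff.sum fun σ _ => ContDiff.const_smul _ (contDiff_prod fun i _ => ?_)
  exact (contDiff_apply ℂ ℂ (σ i)).comp
    ((ContinuousLinearMap.apply ℂ (Cn d) (Pi.single i 1 : Cn d)).contDiff)

variable (d X) in
/-- The canonical line bundle `K_X`; in the chart `a` it is trivialized by `dz_1 ∧ ⋯ ∧ dz_d`. -/
def canonical [IsManifold 𝓘(ℂ, Cn d) ω X] : HolLineBundle d X where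
  ι := Chart d X
  dom a := ⟨a.1.source, a.1.open_source⟩
  cover x := ⟨⟨chartAt (Cn d) x, IsManifold.chart_mem_maximalAtlas x⟩, mem_chart_source _ x⟩
  g a b x := jac a b x
  hol a b := by
    have h1 := (trans_contDiffOn a b).fderiv_of_isOpen (m := ω)
      (a.1.symm ≫ₕ b.1).open_source (by simp)
    have h2 := contDiff_det.comp_contDiffOn h1
    have h3 := (contMDiffOn_of_mem_maximalAtlas a.2).mono
      (Set.inter_subset_left (t := b.1.source))
    exact h2.contMDiffOn.comp h3 fun x hx => trans_mem hx.1 hx.2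
  ne_zero a b x ha hb := by
    have h := jac_mul a b a ha hb ha
    rw [jac_self a ha] at h
    exact left_ne_zero_of_mul_eq_one h
  cocycle a b c x ha hb hc := jac_mul a b c ha hb hc

/-- The smooth sections over `U` of `|A|²`, the line bundle with transition functions `|g_ij|²`. -/
def absSec (A : HolLineBundle d X) (U : Opens X) : Submodule ℂ (A.ι → X → ℂ) where
  carrier := {s | (∀ i, s i ∈ smoothFun d (U ⊓ A.dom i)) ∧
    ∀ i j x, x ∈ U → x ∈ A.dom i → x ∈ A.dom j → s i x = (‖A.g i j x‖ ^ 2 : ℝ) * s j x}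
  add_mem' := fun hs ht => ⟨fun i => Submodule.add_mem _ (hs.1 i) (ht.1 i),
    fun i j x hx hi hj => by
      rw [Pi.add_apply, Pi.add_apply, hs.2 i j x hx hi hj, ht.2 i j x hx hi hj, ← mul_add]
      rfl⟩
  zero_mem' := ⟨fun i => Submodule.zero_mem _, fun _ _ _ _ _ _ => by simp⟩
  smul_mem' := fun c s hs => ⟨fun i => Submodule.smul_mem _ c (hs.1 i),
    fun i j x hx hi hj => by
      rw [Pi.smul_apply, Pi.smul_apply, hs.2 i j x hx hi hj, ← mul_smul_comm]
      rfl⟩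

/-- The sheaf `C^∞_{X,|A|²}` of smooth sections of `|A|²`. -/
def absSheaf (A : HolLineBundle d X) : ModPresheaf X where
  sec U := A.absSec U
  res {U V} h :=
    { toFun := fun s => ⟨fun i => Set.indicator (V : Set X) (s.1 i), fun i => by
          have h1 := indicator_mem_smoothFun d (V := V ⊓ A.dom i) (s.2.1 i).1
            (fun x hx => ⟨h hx.1, hx.2⟩)
          convert h1 using 1
          ext x
          by_cases hx : x ∈ V <;> by_cases hi : x ∈ A.dom i <;> simp [hx, hi]
          exact (s.2.1 i).2 x fun hh => hi hh.2, fun i j x hx hi hj => by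
            beta_reduce
            rw [Set.indicator_of_mem (s := (V : Set X)) hx, Set.indicator_of_mem (s := (V : Set X)) hx]
            exact s.2.2 i j x (h hx) hi hj⟩
      map_add' := fun s t => Subtype.ext (funext fun i => Set.indicator_add _ _ _)
      map_smul' := fun c s => Subtype.ext (funext fun i =>
        Set.indicator_const_smul (V : Set X) c (s.1 i)) }
  res_self U s := Subtype.ext (by
    funext i x
    by_cases hx : x ∈ U
    · simp [hx]
    · simpa [hx] using ((s.2.1 i).2 x fun hh => hx hh.1).symm)
  res_res h h' s := Subtype.ext (by
    funext i
    simp only [LinearMap.coe_mk, AddHom.coe_mk, Set.indicator_indicator]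
    rw [Set.inter_eq_self_of_subset_left h'])

end HolLineBundle
end LineBundles

section TwistedOperators

variable {d : ℕ} {X : Type*} [TopologicalSpace X] [ChartedSpace (Cn d) X]

theorem mulOp_app {f : X → ℂ} {W : Opens X} (hf : SmoothOn d f W) {V : Opens X} (hV : V ≤ W)
    (s : smoothFun d V) (x : X) : ((mulOp d f W).app V hV s).1 x = f x * s.1 x := by
  rw [mulOp, dif_pos hf]
  rfl

theorem smoothFun_ext {V : Opens X} {s t : smoothFun d V} (h : ∀ x ∈ V, s.1 x = t.1 x) : s = t :=
  Subtype.ext (funext fun x => by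
    by_cases hx : x ∈ V
    · exact h x hx
    · rw [s.2.2 x hx, t.2.2 x hx])

theorem LocOp.app_eq {W : Opens X} (P : LocOp d W) {V V' : Opens X} (hV : V ≤ W) (h : V' ≤ V)
    (s : smoothFun d V) {x : X} (hx : x ∈ V') :
    (P.app V hV s).1 x = (P.app V' (h.trans hV) ((smoothSheaf d X).res h s)).1 x := by
  rw [← P.res_app hV h s]
  exact (Set.indicator_of_mem (s := (V' : Set X)) hx _).symm

theorem smoothSheaf_res_apply {V V' : Opens X} (h : V' ≤ V) (s : smoothFun d V) {x : X}
    (hx : x ∈ V') : ((smoothSheaf d X).res h s).1 x = s.1 x :=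
  Set.indicator_of_mem (s := (V' : Set X)) hx _

/-- The complex conjugate function. -/
def conjFun (f : X → ℂ) (x : X) : ℂ := (starRingEnd ℂ) (f x)

theorem SmoothOn.conj {f : X → ℂ} {U : Set X} (hf : SmoothOn d f U) :
    SmoothOn d (conjFun f) U := by
  have h : ContDiff ℝ ∞ (fun z : ℂ => (starRingEnd ℂ) z) := Complex.conjCLE.contDiff
  exact h.contMDiff.comp_contMDiffOn hf

theorem wirtinger_conj_mul [IsManifold 𝓘(ℂ, Cn d) ω X] (a : Chart d X) (j : Fin d)
    {f s : X → ℂ} {V : Opens X} (hV : (V : Set X) ⊆ a.1.source) (hf : HolOn d f V)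
    (hs : SmoothOn d s V) {x : X} (hx : x ∈ V) :
    wirtinger d a j (fun y => conjFun f y * s y) x = conjFun f x * wirtinger d a j s x := by
  have h1 := a.differentiableAt d hV hs hx
  have h2 : DifferentiableAt ℂ (f ∘ a.1.symm) (a.1 x) := by
    have h3 : ContMDiffOn 𝓘(ℂ, Cn d) 𝓘(ℂ, ℂ) ω (f ∘ a.1.symm) (a.1.target ∩ a.1.symm ⁻¹' V) :=
      hf.comp ((contMDiffOn_symm_of_mem_maximalAtlas a.2).mono Set.inter_subset_left)
        (fun y hy => hy.2)
    refine (h3.contDiffOn.contDiffAt ((a.isOpen_preimage d V).mem_nhds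
      ⟨a.1.map_source (hV hx), ?_⟩)).differentiableAt (by simp)
    simpa [a.1.left_inv (hV hx)] using hx
  have h4 : HasFDerivAt (conjFun f ∘ a.1.symm) ((Complex.conjCLE : ℂ →L[ℝ] ℂ).comp
      ((fderiv ℂ (f ∘ a.1.symm) (a.1 x)).restrictScalars ℝ)) (a.1 x) :=
    (Complex.conjCLE : ℂ →L[ℝ] ℂ).hasFDerivAt.comp (a.1 x)
      (h2.hasFDerivAt.restrictScalars ℝ)
  have h5 : ((fun y => conjFun f y * s y) ∘ a.1.symm) =
      (conjFun f ∘ a.1.symm) * (s ∘ a.1.symm) := rfl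
  have h6 : (Pi.single j Complex.I : Cn d) = Complex.I • Pi.single j (1 : ℂ) := by
    rw [← Pi.single_smul, smul_eq_mul, mul_one]
  have h7 : (conjFun f ∘ a.1.symm) (a.1 x) = conjFun f x := by simp [a.1.left_inv (hV hx)]
  have h8 : (s ∘ a.1.symm) (a.1 x) = s x := by simp [a.1.left_inv (hV hx)]
  have h9 := (h4.mul h1.hasFDerivAt).fderiv
  simp only [wirtinger, h5, h9, h7, h8]
  have e1 : ((Complex.conjCLE : ℂ →L[ℝ] ℂ).comp
      ((fderiv ℂ (f ∘ a.1.symm) (a.1 x)).restrictScalars ℝ)) (Pi.single j Complex.I) =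
      -Complex.I * ((Complex.conjCLE : ℂ →L[ℝ] ℂ).comp
      ((fderiv ℂ (f ∘ a.1.symm) (a.1 x)).restrictScalars ℝ)) (Pi.single j 1) := by
    simp [h6]
  simp only [_root_.add_apply, _root_.smul_apply, smul_eq_mul, e1]
  have hI := Complex.I_mul_I
  linear_combination (1 / 2) * (s x * ((Complex.conjCLE : ℂ →L[ℝ] ℂ).comp
      ((fderiv ℂ (f ∘ a.1.symm) (a.1 x)).restrictScalars ℝ)) (Pi.single j 1)) * hI

theorem IsHolDiffOp.conj_mul [IsManifold 𝓘(ℂ, Cn d) ω X] {W : Opens X} {P : LocOp d W}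
    (hP : IsHolDiffOp d P) : ∀ (f : X → ℂ) (V : Opens X) (hV : V ≤ W), HolOn d f V →
      ∀ s t : smoothFun d V, (∀ x ∈ V, t.1 x = conjFun f x * s.1 x) →
      ∀ x ∈ V, (P.app V hV t).1 x = conjFun f x * (P.app V hV s).1 x := by
  induction hP with
  | mul g hg =>
    intro f V hV hf s t hst x hx
    rw [mulOp_app (hg.smoothOn d), mulOp_app (hg.smoothOn d), hst x hx, mul_left_comm]
  | deriv a j hW =>
    intro f V hV hf s t hst x hx
    have ht : t = ⟨Set.indicator (V : Set X) (fun y => conjFun f y * s.1 y),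
        indicator_mem_smoothFun d (SmoothOn.mul d (hf.smoothOn d).conj s.2.1) le_rfl⟩ :=
      smoothFun_ext fun y hy => by simp [hst y hy, hy]
    subst ht
    change Set.indicator (V : Set X) (wirtinger d a j (Set.indicator (V : Set X) _)) x =
      conjFun f x * Set.indicator (V : Set X) (wirtinger d a j s.1) x
    rw [Set.indicator_of_mem (s := (V : Set X)) hx, Set.indicator_of_mem (s := (V : Set X)) hx,
      wirtinger_indicator d a j _ (hW (hV hx)) hx]
    exact wirtinger_conj_mul a j (Set.Subset.trans hV hW) hf s.2.1 hx
  | add _ _ ih1 ih2 =>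
    intro f V hV hf s t hst x hx
    have h1 := ih1 f V hV hf s t hst x hx
    have h2 := ih2 f V hV hf s t hst x hx
    exact (congrArg₂ (· + ·) h1 h2).trans (mul_add _ _ _).symm
  | comp _ _ ih1 ih2 =>
    intro f V hV hf s t hst x hx
    exact ih1 f V hV hf _ _ (ih2 f V hV hf s t hst) x hx
  | @locally W P N hN hxN _ ih =>
    intro f V hV hf s t hst x hx
    have h1 : V ⊓ N x ≤ V := inf_le_left
    have hx' : x ∈ V ⊓ N x := ⟨hx, hxN x (hV hx)⟩
    rw [LocOp.app_eq P hV h1 t hx', LocOp.app_eq P hV h1 s hx']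
    exact ih x (hV hx) f (V ⊓ N x) inf_le_right (hf.mono h1) _ _ (fun y hy => by
      rw [smoothSheaf_res_apply h1 t hy, smoothSheaf_res_apply h1 s hy, hst y hy.1]) x hx'

/-- The sections over `U` of `𝒟_{X,A} = A ⊗ 𝒟_X ⊗ A⁻¹`: families of holomorphic differential
operators `R_i` on `U ∩ dom i` with `R_i = g_ij R_j g_ij⁻¹`. -/
structure TwDiffOp [IsManifold 𝓘(ℂ, Cn d) ω X] (A : HolLineBundle d X) (U : Opens X) where
  op : ∀ i, LocOp d (U ⊓ A.dom i)
  isHol : ∀ i, IsHolDiffOp d (op i)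
  glue : ∀ (i j : A.ι) (V : Opens X) (hi : V ≤ U ⊓ A.dom i) (hj : V ≤ U ⊓ A.dom j),
    HomOn.restr hi (op i) = (mulOp d (A.g i j) V).comp
      ((HomOn.restr hj (op j)).comp (mulOp d (fun x => (A.g i j x)⁻¹) V))

namespace TwDiffOp
variable [IsManifold 𝓘(ℂ, Cn d) ω X] {A : HolLineBundle d X} {U : Opens X}

theorem act_glue (R : TwDiffOp A U) {V : Opens X} (hV : V ≤ U) (s : A.absSec V) (i j : A.ι)
    {x : X} (hx : x ∈ V) (hi : x ∈ A.dom i) (hj : x ∈ A.dom j) :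
    ((R.op i).app (V ⊓ A.dom i) (inf_le_inf_right _ hV) ⟨s.1 i, s.2.1 i⟩).1 x =
      (‖A.g i j x‖ ^ 2 : ℝ) *
        ((R.op j).app (V ⊓ A.dom j) (inf_le_inf_right _ hV) ⟨s.1 j, s.2.1 j⟩).1 x := by
  set N : Opens X := V ⊓ (A.dom i ⊓ A.dom j) with hN
  have hxN : x ∈ N := ⟨hx, hi, hj⟩
  have hNi : N ≤ V ⊓ A.dom i := inf_le_inf_left _ inf_le_left
  have hNj : N ≤ V ⊓ A.dom j := inf_le_inf_left _ inf_le_right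
  have hUi : N ≤ U ⊓ A.dom i := hNi.trans (inf_le_inf_right _ hV)
  have hUj : N ≤ U ⊓ A.dom j := hNj.trans (inf_le_inf_right _ hV)
  have hg : HolOn d (A.g i j) N := (A.hol i j).mono fun y hy => hy.2
  have hg' : HolOn d (fun x => (A.g i j x)⁻¹) N :=
    hg.inv fun y hy => A.ne_zero i j y hy.2.1 hy.2.2
  rw [LocOp.app_eq (R.op i) _ hNi _ hxN, LocOp.app_eq (R.op j) _ hNj _ hxN]
  have key := congrArg (fun Q : LocOp d N => (Q.app N le_rfl
    ((smoothSheaf d X).res hNi ⟨s.1 i, s.2.1 i⟩)).1 x) (R.glue i j N hUi hUj)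
  change ((R.op i).app N _ ((smoothSheaf d X).res hNi ⟨s.1 i, s.2.1 i⟩)).1 x = _ at key
  rw [key]
  change ((mulOp d (A.g i j) N).app N le_rfl ((R.op j).app N hUj _)).1 x = _
  refine (mulOp_app (hg.smoothOn d) le_rfl _ x).trans ?_
  refine (congrArg (A.g i j x * ·) ((R.isHol j).conj_mul (A.g i j) N hUj hg
      ((smoothSheaf d X).res hNj ⟨s.1 j, s.2.1 j⟩) _ ?_ x hxN)).trans ?_
  rotate_left
  · rw [← mul_assoc, conjFun, Complex.mul_conj, Complex.normSq_eq_norm_sq]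
  · intro y hy
    refine (mulOp_app (hg'.smoothOn d) le_rfl _ y).trans ?_
    rw [smoothSheaf_res_apply hNi _ hy, smoothSheaf_res_apply hNj _ hy]
    change (A.g i j y)⁻¹ * s.1 i y = _ * s.1 j y
    have h0 := A.ne_zero i j y hy.2.1 hy.2.2
    rw [s.2.2 i j y hy.1 hy.2.1 hy.2.2, conjFun, ← Complex.normSq_eq_norm_sq, ← Complex.mul_conj]
    field_simp

/-- The action of `𝒟_{X,A}` on the smooth sections of `|A|²`: `(R s)_i = R_i s_i`.  It is well defined
since holomorphic differential operators commute with antiholomorphic functions. -/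
def act (R : TwDiffOp A U) : HomOn A.absSheaf A.absSheaf U :=
  HomOn.mk' (fun V hV =>
    { toFun := fun s => ⟨fun i => ((R.op i).app (V ⊓ A.dom i) (inf_le_inf_right _ hV)
          ⟨s.1 i, s.2.1 i⟩).1,
        fun i => ((R.op i).app (V ⊓ A.dom i) (inf_le_inf_right _ hV) ⟨s.1 i, s.2.1 i⟩).2,
        fun i j _ hx hi hj => R.act_glue hV s i j hx hi hj⟩
      map_add' := fun s t => Subtype.ext (funext fun i => congrArg Subtype.val
        (map_add ((R.op i).app (V ⊓ A.dom i) (inf_le_inf_right _ hV))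
          ⟨s.1 i, s.2.1 i⟩ ⟨t.1 i, t.2.1 i⟩))
      map_smul' := fun c s => Subtype.ext (funext fun i => congrArg Subtype.val
        (map_smul ((R.op i).app (V ⊓ A.dom i) (inf_le_inf_right _ hV)) c ⟨s.1 i, s.2.1 i⟩)) })
    (fun V V' hV h s => Subtype.ext (funext fun i => by
      have hi : V' ⊓ A.dom i ≤ V ⊓ A.dom i := inf_le_inf_right _ h
      have h1 := congrArg Subtype.val
        ((R.op i).res_app (inf_le_inf_right _ hV) hi ⟨s.1 i, s.2.1 i⟩)
      have cutEq : ∀ t : smoothFun d (V ⊓ A.dom i),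
          Set.indicator (V' : Set X) t.1 = Set.indicator ((V' ⊓ A.dom i : Opens X) : Set X) t.1 := by
        intro t
        ext x
        by_cases hx : x ∈ V' <;> by_cases hxi : x ∈ A.dom i <;> simp [hx, hxi]
        exact t.2.2 x fun hh => hxi hh.2
      refine (cutEq _).trans (h1.trans ?_)
      congr 2
      exact Subtype.ext (cutEq ⟨s.1 i, s.2.1 i⟩).symm))

end TwDiffOp
end TwistedOperators

section Submersion

variable {n k : ℕ} {Y Z : Type*} [TopologicalSpace Y] [ChartedSpace (Cn n) Y]
  [TopologicalSpace Z] [ChartedSpace (Cn (n + k)) Z]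
  [IsManifold 𝓘(ℂ, Cn (n + k)) ω Z]

/-- Sections of the relative tangent sheaf `Θ_{Z/Y}`: holomorphic vector fields `ξ` (that is,
holomorphic differential operators that are derivations) which kill functions pulled back from `Y`. -/
structure IsVertical (p : C(Z, Y)) {V : Opens Z} (ξ : LocOp (n + k) V) : Prop where
  isHol : IsHolDiffOp (n + k) ξ
  leibniz : ∀ (V' : Opens Z) (h : V' ≤ V) (f g q : smoothFun (n + k) V'),
    (∀ z, q.1 z = f.1 z * g.1 z) →
    ∀ z, (ξ.app V' h q).1 z = (ξ.app V' h f).1 z * g.1 z + f.1 z * (ξ.app V' h g).1 z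
  kills : ∀ (V' : Opens Z) (h : V' ≤ V) (B : Opens Y) (f : smoothFun n B)
    (q : smoothFun (n + k) V'), V' ≤ Opens.comap p B → (∀ z ∈ V', q.1 z = f.1 (p z)) →
    ξ.app V' h q = 0

/-- The sheaf of left ideals `𝒟_Z · Θ_{Z/Y} ⊆ 𝒟_Z`. -/
inductive InVertIdeal (p : C(Z, Y)) : ∀ {V : Opens Z}, LocOp (n + k) V → Prop
  | comp {V : Opens Z} {P ξ : LocOp (n + k) V} (hP : IsHolDiffOp (n + k) P)
      (hξ : IsVertical (n := n) p ξ) : InVertIdeal p (P.comp ξ)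
  | add {V : Opens Z} {P Q : LocOp (n + k) V} : InVertIdeal p P → InVertIdeal p Q →
      InVertIdeal p (P + Q)
  | locally {V : Opens Z} {P : LocOp (n + k) V} (N : Z → Opens Z) (hN : ∀ z ∈ V, N z ≤ V)
      (hz : ∀ z ∈ V, z ∈ N z)
      (hP : ∀ (z : Z) (h : z ∈ V), InVertIdeal p (HomOn.restr (hN z h) P)) : InVertIdeal p P

theorem mulOp_const_comp {d : ℕ} {X : Type*} [TopologicalSpace X] [ChartedSpace (Cn d) X]
    (c : ℂ) {W : Opens X} (P : LocOp d W) : (mulOp d (fun _ => c) W).comp P = c • P :=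
  HomOn.ext fun V hV s => Subtype.ext (funext fun x =>
    mulOp_app (f := fun _ => c) contMDiffOn_const hV (P.app V hV s) x)

theorem IsHolDiffOp.smul {d : ℕ} {X : Type*} [TopologicalSpace X] [ChartedSpace (Cn d) X]
    [IsManifold 𝓘(ℂ, Cn d) ω X] (c : ℂ) {W : Opens X} {P : LocOp d W} (hP : IsHolDiffOp d P) :
    IsHolDiffOp d (c • P) := by
  rw [← mulOp_const_comp]
  exact .comp (.mul _ contMDiffOn_const) hP

theorem isHolDiffOp_one {d : ℕ} {X : Type*} [TopologicalSpace X] [ChartedSpace (Cn d) X]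
    [IsManifold 𝓘(ℂ, Cn d) ω X] (W : Opens X) : IsHolDiffOp d (HomOn.one (smoothSheaf d X) W) := by
  have h : (mulOp d (fun _ => 1) W : LocOp d W) = HomOn.one _ W :=
    HomOn.ext fun V hV s => Subtype.ext (funext fun x =>
      (mulOp_app (f := fun _ => 1) contMDiffOn_const hV s x).trans (one_mul _))
  rw [← h]
  exact .mul _ contMDiffOn_const

theorem mulOp_restr {d : ℕ} {X : Type*} [TopologicalSpace X] [ChartedSpace (Cn d) X]
    {f : X → ℂ} {W V : Opens X} (hf : SmoothOn d f W) (h : V ≤ W) :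
    HomOn.restr h (mulOp d f W) = mulOp d f V :=
  HomOn.ext fun _ hN s => Subtype.ext (funext fun x =>
    (mulOp_app hf (hN.trans h) s x).trans (mulOp_app (hf.mono h) hN s x).symm)

theorem IsHolDiffOp.restr {d : ℕ} {X : Type*} [TopologicalSpace X] [ChartedSpace (Cn d) X]
    [IsManifold 𝓘(ℂ, Cn d) ω X] {W : Opens X} {P : LocOp d W} (hP : IsHolDiffOp d P) :
    ∀ {V : Opens X} (h : V ≤ W), IsHolDiffOp d (HomOn.restr h P) := by
  induction hP with
  | mul f hf =>
    intro V h
    rw [mulOp_restr (hf.smoothOn d) h]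
    exact .mul f (hf.mono h)
  | deriv a j hW => exact fun h => .deriv a j (Set.Subset.trans h hW)
  | add _ _ ih1 ih2 => exact fun h => .add (ih1 h) (ih2 h)
  | comp _ _ ih1 ih2 => exact fun h => .comp (ih1 h) (ih2 h)
  | @locally W P N hN hx _ ih =>
    intro V h
    exact .locally (fun x => V ⊓ N x) (fun _ _ => inf_le_left) (fun x hxV => ⟨hxV, hx x (h hxV)⟩)
      fun x hxV => ih x (h hxV) (inf_le_right : V ⊓ N x ≤ N x)

theorem isVertical_zero (p : C(Z, Y)) (V : Opens Z) :
    IsVertical (n := n) p (0 : LocOp (n + k) V) where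
  isHol := by
    have h := (isHolDiffOp_one (d := n + k) V).smul 0
    rwa [zero_smul] at h
  leibniz _ _ f g _ _ z := by
    change (0 : ℂ) = 0 * g.1 z + f.1 z * 0
    simp
  kills _ _ _ _ _ _ _ := rfl

theorem InVertIdeal.zero (p : C(Z, Y)) (V : Opens Z) :
    InVertIdeal (n := n) p (0 : LocOp (n + k) V) := by
  have h := InVertIdeal.comp (isHolDiffOp_one V) (isVertical_zero (n := n) (k := k) p V)
  exact h

theorem InVertIdeal.smul {p : C(Z, Y)} (c : ℂ) {V : Opens Z} {P : LocOp (n + k) V}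
    (hP : InVertIdeal (n := n) p P) : InVertIdeal (n := n) p (c • P) := by
  induction hP with
  | comp hP hξ =>
    rw [← HomOn.smul_comp]
    exact .comp (hP.smul c) hξ
  | add _ _ ih1 ih2 =>
    rw [smul_add]
    exact .add ih1 ih2
  | locally N hN hz _ ih =>
    refine .locally N hN hz fun z h => ?_
    rw [map_smul]
    exact ih z h

/-- The family `x` of operators, one for each open set, defines near `z` a section of the quotient sheaf
`𝒟_{Z→Y} = 𝒟_Z / (𝒟_Z · Θ_{Z/Y})`: all `x V` with `V` small are congruent to one operator. -/
def IsRepresentedAt (p : C(Z, Y)) (x : ∀ V : Opens Z, LocOp (n + k) V) (z : Z) : Prop :=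
  ∃ (V₀ : Opens Z) (P : LocOp (n + k) V₀), z ∈ V₀ ∧ IsHolDiffOp (n + k) P ∧
    ∀ (V : Opens Z) (h : V ≤ V₀), InVertIdeal (n := n) p (x V - HomOn.restr h P)

/-- The families `x` and `y` agree modulo `𝒟_Z · Θ_{Z/Y}` on all small open sets near `z`. -/
def AgreeAt (p : C(Z, Y)) (x y : ∀ V : Opens Z, LocOp (n + k) V) (z : Z) : Prop :=
  ∃ V₀ : Opens Z, z ∈ V₀ ∧ ∀ V : Opens Z, V ≤ V₀ → InVertIdeal (n := n) p (x V - y V)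

theorem InVertIdeal.add_sub {p : C(Z, Y)} {V : Opens Z} {P P' Q Q' : LocOp (n + k) V}
    (h : InVertIdeal (n := n) p (P - Q)) (h' : InVertIdeal (n := n) p (P' - Q')) :
    InVertIdeal (n := n) p (P + P' - (Q + Q')) := by
  rw [add_sub_add_comm]
  exact h.add h'

theorem InVertIdeal.smul_sub {p : C(Z, Y)} (c : ℂ) {V : Opens Z} {P Q : LocOp (n + k) V}
    (h : InVertIdeal (n := n) p (P - Q)) : InVertIdeal (n := n) p (c • P - c • Q) := by
  rw [← _root_.smul_sub]
  exact h.smul c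

theorem InVertIdeal.of_eq {p : C(Z, Y)} {V : Opens Z} {P Q : LocOp (n + k) V} (h : P = Q) :
    InVertIdeal (n := n) p (P - Q) := by
  rw [h, sub_self]
  exact .zero p V

theorem IsRepresentedAt.add {p : C(Z, Y)} {x y : ∀ V : Opens Z, LocOp (n + k) V} {z : Z}
    (hx : IsRepresentedAt (n := n) p x z) (hy : IsRepresentedAt (n := n) p y z) :
    IsRepresentedAt (n := n) p (fun V => x V + y V) z := by
  obtain ⟨V, P, hzV, hP, h⟩ := hx
  obtain ⟨V', P', hzV', hP', h'⟩ := hy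
  exact ⟨V ⊓ V', HomOn.restr inf_le_left P + HomOn.restr inf_le_right P', ⟨hzV, hzV'⟩,
    (hP.restr _).add (hP'.restr _), fun N hN => by
      rw [map_add]
      exact (h N (hN.trans inf_le_left)).add_sub (h' N (hN.trans inf_le_right))⟩

theorem IsRepresentedAt.smul {p : C(Z, Y)} (c : ℂ) {x : ∀ V : Opens Z, LocOp (n + k) V} {z : Z}
    (hx : IsRepresentedAt (n := n) p x z) : IsRepresentedAt (n := n) p (fun V => c • x V) z := by
  obtain ⟨V, P, hzV, hP, h⟩ := hx
  exact ⟨V, c • P, hzV, hP.smul c, fun N hN => by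
    rw [map_smul]
    exact (h N hN).smul_sub c⟩

theorem AgreeAt.add {p : C(Z, Y)} {x y x' y' : ∀ V : Opens Z, LocOp (n + k) V} {z : Z}
    (h : AgreeAt (n := n) p x y z) (h' : AgreeAt (n := n) p x' y' z) :
    AgreeAt (n := n) p (fun V => x V + x' V) (fun V => y V + y' V) z := by
  obtain ⟨V, hzV, h⟩ := h
  obtain ⟨V', hzV', h'⟩ := h'
  exact ⟨V ⊓ V', ⟨hzV, hzV'⟩, fun N hN =>
    (h N (hN.trans inf_le_left)).add_sub (h' N (hN.trans inf_le_right))⟩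

theorem AgreeAt.smul {p : C(Z, Y)} (c : ℂ) {x y : ∀ V : Opens Z, LocOp (n + k) V} {z : Z}
    (h : AgreeAt (n := n) p x y z) :
    AgreeAt (n := n) p (fun V => c • x V) (fun V => c • y V) z := by
  obtain ⟨V, hzV, h⟩ := h
  exact ⟨V, hzV, fun N hN => (h N hN).smul_sub c⟩

theorem AgreeAt.of_eq {p : C(Z, Y)} {x y : ∀ V : Opens Z, LocOp (n + k) V} {z : Z}
    (h : x = y) : AgreeAt (n := n) p x y z :=
  ⟨⊤, trivial, fun V _ => .of_eq (congrFun h V)⟩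

variable [IsManifold 𝓘(ℂ, Cn n) ω Y]

/-- The relative canonical bundle `K_{Z/Y} = K_Z ⊗ p^*K_Y⁻¹`. -/
abbrev relCanonical (p : C(Z, Y)) (hp : ContMDiff 𝓘(ℂ, Cn (n + k)) 𝓘(ℂ, Cn n) ω p) :
    HolLineBundle (n + k) Z :=
  (HolLineBundle.canonical (n + k) Z).tensor ((HolLineBundle.canonical n Y).pullback p hp).dual

/-- The line bundle `M = p^*L ⊗ K_{Z/Y}`.  Its trivializations `τ = (i, (a, b))` consist of a
trivialization `i` of `L`, a chart `a` of `Z` and a chart `b` of `Y`. -/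
abbrev twistM (p : C(Z, Y)) (hp : ContMDiff 𝓘(ℂ, Cn (n + k)) 𝓘(ℂ, Cn n) ω p)
    (L : HolLineBundle n Y) : HolLineBundle (n + k) Z :=
  (L.pullback p hp).tensor (relCanonical p hp)

/-- A choice of an operator on every open `V ⊆ Z`, for every trivialization `τ`. -/
abbrev RawFamily (p : C(Z, Y)) (hp : ContMDiff 𝓘(ℂ, Cn (n + k)) 𝓘(ℂ, Cn n) ω p)
    (L : HolLineBundle n Y) : Type _ :=
  ∀ (_ : (twistM p hp L).ι) (V : Opens Z), LocOp (n + k) V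

variable (p : C(Z, Y)) (hp : ContMDiff 𝓘(ℂ, Cn (n + k)) 𝓘(ℂ, Cn n) ω p) (L : HolLineBundle n Y)

/-- The transition function of `K_Z ⊗ M⁻¹`. -/
def leftFactor (τ τ' : (twistM p hp L).ι) (z : Z) : ℂ :=
  (HolLineBundle.canonical (n + k) Z).g τ.2.1 τ'.2.1 z * ((twistM p hp L).g τ τ' z)⁻¹

/-- The (pulled back) transition function of `K_Y⁻¹ ⊗ L`. -/
def rightFactor (τ τ' : (twistM p hp L).ι) (z : Z) : ℂ :=
  ((HolLineBundle.canonical n Y).g τ.2.2 τ'.2.2 (p z))⁻¹ * L.g τ.1 τ'.1 (p z)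

/-- The change of trivialization for `K_Z ⊗ 𝒟_{Z→Y} ⊗ p⁻¹K_Y⁻¹ ⊗ M⁻¹`, twisted by `L`: the factors `K_Z`
and `M⁻¹` are tensored over `𝒪_Z`, which acts on `𝒟_{Z→Y}` from the left (the right `𝒪_Z`-structure
of `𝒟_{Y←Z} = K_Z ⊗ 𝒟_{Z→Y} ⊗ p⁻¹K_Y⁻¹` is this one, since functions are their own transposes), and
the factors `K_Y⁻¹` and `L` are tensored over `p⁻¹𝒪_Y`, which acts from the right. -/
def changeTriv (τ τ' : (twistM p hp L).ι) {V : Opens Z} (P : LocOp (n + k) V) :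
    LocOp (n + k) V :=
  (mulOp (n + k) (leftFactor p hp L τ τ') V).comp
    (P.comp (mulOp (n + k) (rightFactor p hp L τ τ') V))

theorem changeTriv_add (τ τ' : (twistM p hp L).ι) {V : Opens Z} (P Q : LocOp (n + k) V) :
    changeTriv p hp L τ τ' (P + Q) = changeTriv p hp L τ τ' P + changeTriv p hp L τ τ' Q := by
  rw [changeTriv, HomOn.add_comp, HomOn.comp_add]
  rfl

theorem changeTriv_smul (τ τ' : (twistM p hp L).ι) (c : ℂ) {V : Opens Z} (P : LocOp (n + k) V) :
    changeTriv p hp L τ τ' (c • P) = c • changeTriv p hp L τ τ' P := by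
  rw [changeTriv, HomOn.smul_comp, HomOn.comp_smul]
  rfl

theorem changeTriv_zero (τ τ' : (twistM p hp L).ι) {V : Opens Z} :
    changeTriv p hp L τ τ' (0 : LocOp (n + k) V) = 0 := by
  simpa using changeTriv_smul p hp L τ τ' 0 (0 : LocOp (n + k) V)

/-- Families of local representatives of sections of `L ⊗ p_*(𝒟_{Y←Z} ⊗ M⁻¹)` over `U`, that is: for
each trivialization `τ` a section of `𝒟_{Z→Y}` over `p⁻¹U ∩ dom τ`, compatibly with the changes of
trivialization. -/
def transferFamilies (U : Opens Y) : Submodule ℂ (RawFamily p hp L) where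
  carrier := {x |
    (∀ (τ : (twistM p hp L).ι) (z : Z), p z ∈ U → z ∈ (twistM p hp L).dom τ →
      IsRepresentedAt (n := n) p (x τ) z) ∧
    (∀ (τ τ' : (twistM p hp L).ι) (z : Z), p z ∈ U → z ∈ (twistM p hp L).dom τ →
      z ∈ (twistM p hp L).dom τ' →
        AgreeAt (n := n) p (x τ) (fun V => changeTriv p hp L τ τ' (x τ' V)) z)}
  add_mem' := by
    rintro x y ⟨hx1, hx2⟩ ⟨hy1, hy2⟩
    refine ⟨fun τ z hz hτ => (hx1 τ z hz hτ).add (hy1 τ z hz hτ), fun τ τ' z hz hτ hτ' => ?_⟩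
    have h := (hx2 τ τ' z hz hτ hτ').add (hy2 τ τ' z hz hτ hτ')
    simp only [← changeTriv_add] at h
    exact h
  zero_mem' := by
    refine ⟨fun τ z hz hτ => ⟨⊤, 0, trivial, (isVertical_zero (n := n) p ⊤).isHol,
      fun V h => .of_eq (map_zero (HomOn.restr h)).symm⟩,
      fun τ τ' z hz hτ hτ' => .of_eq (funext fun V => (changeTriv_zero p hp L τ τ').symm)⟩
  smul_mem' := by
    rintro c x ⟨hx1, hx2⟩
    refine ⟨fun τ z hz hτ => (hx1 τ z hz hτ).smul c, fun τ τ' z hz hτ hτ' => ?_⟩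
    have h := (hx2 τ τ' z hz hτ hτ').smul c
    simp only [← changeTriv_smul] at h
    exact h

/-- The families that represent the zero section over `p⁻¹U`. -/
def nullFamilies (U : Opens Y) : Submodule ℂ (RawFamily p hp L) where
  carrier := {x | ∀ (τ : (twistM p hp L).ι) (z : Z), p z ∈ U → z ∈ (twistM p hp L).dom τ →
    AgreeAt (n := n) p (x τ) (fun _ => 0) z}
  add_mem' := by
    intro x y hx hy τ z hz hτ
    have h := (hx τ z hz hτ).add (hy τ z hz hτ)
    simp only [add_zero] at h
    exact h
  zero_mem' := fun _ _ _ _ => .of_eq rfl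
  smul_mem' := by
    intro c x hx τ z hz hτ
    have h := (hx τ z hz hτ).smul c
    simp only [smul_zero] at h
    exact h

theorem transferFamilies_mono {U U' : Opens Y} (h : U' ≤ U) :
    transferFamilies p hp L U ≤ transferFamilies p hp L U' :=
  fun _ hx => ⟨fun τ z hz => hx.1 τ z (h hz), fun τ τ' z hz => hx.2 τ τ' z (h hz)⟩

theorem nullFamilies_mono {U U' : Opens Y} (h : U' ≤ U) :
    nullFamilies p hp L U ≤ nullFamilies p hp L U' :=
  fun _ hx τ z hz => hx τ z (h hz)

/-- `nullFamilies`, as a subspace of `transferFamilies`. -/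
abbrev nullIn (U : Opens Y) : Submodule ℂ (transferFamilies p hp L U) :=
  (nullFamilies p hp L U).comap (transferFamilies p hp L U).subtype

/-- The sheaf `L ⊗ p_*(𝒟_{Y←Z} ⊗ M⁻¹) = L ⊗ H⁰p^D_*(𝒟_Z ⊗ M⁻¹)` on `Y`, with
`𝒟_{Y←Z} = K_Z ⊗ 𝒟_{Z→Y} ⊗ p⁻¹K_Y⁻¹` and `𝒟_{Z→Y} = 𝒟_Z / (𝒟_Z · Θ_{Z/Y})`: compatible families of
local representatives modulo families that represent zero. -/
def transferSheaf : ModPresheaf Y where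
  sec U := transferFamilies p hp L U ⧸ nullIn p hp L U
  res {U V} h := Submodule.mapQ (nullIn p hp L U) (nullIn p hp L V)
    (Submodule.inclusion (transferFamilies_mono p hp L h))
    (fun _ hx => nullFamilies_mono p hp L h hx)
  res_self U s := by
    obtain ⟨x, rfl⟩ := Submodule.Quotient.mk_surjective _ s
    rfl
  res_res h h' s := by
    obtain ⟨x, rfl⟩ := Submodule.Quotient.mk_surjective _ s
    rfl

/-- The section represented by a family. -/
abbrev transferMk {U : Opens Y} (x : transferFamilies p hp L U) : (transferSheaf p hp L).sec U :=
  Submodule.Quotient.mk x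

theorem factor_mul (τ τ' : (twistM p hp L).ι) {z : Z} (hτ : z ∈ (twistM p hp L).dom τ)
    (hτ' : z ∈ (twistM p hp L).dom τ') :
    leftFactor p hp L τ τ' z * rightFactor p hp L τ τ' z = 1 := by
  have h1 := (HolLineBundle.canonical (n + k) Z).ne_zero τ.2.1 τ'.2.1 z hτ.2.1 hτ'.2.1
  have h2 := (HolLineBundle.canonical n Y).ne_zero τ.2.2 τ'.2.2 (p z) hτ.2.2 hτ'.2.2
  have h3 := L.ne_zero τ.1 τ'.1 (p z) hτ.1 hτ'.1
  change _ * (L.g τ.1 τ'.1 (p z) * ((HolLineBundle.canonical (n + k) Z).g τ.2.1 τ'.2.1 z *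
    ((HolLineBundle.canonical n Y).g τ.2.2 τ'.2.2 (p z))⁻¹))⁻¹ *
    (((HolLineBundle.canonical n Y).g τ.2.2 τ'.2.2 (p z))⁻¹ * L.g τ.1 τ'.1 (p z)) = 1
  field_simp

theorem leftFactor_hol (τ τ' : (twistM p hp L).ι) : HolOn (n + k) (leftFactor p hp L τ τ')
    ((twistM p hp L).dom τ ⊓ (twistM p hp L).dom τ' : Opens Z) :=
  (((HolLineBundle.canonical (n + k) Z).hol τ.2.1 τ'.2.1).mono
    fun _ h => ⟨h.1.2.1, h.2.2.1⟩).mul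
    (((twistM p hp L).hol τ τ').inv fun z h => (twistM p hp L).ne_zero τ τ' z h.1 h.2)

theorem rightFactor_hol (τ τ' : (twistM p hp L).ι) : HolOn (n + k) (rightFactor p hp L τ τ')
    ((twistM p hp L).dom τ ⊓ (twistM p hp L).dom τ' : Opens Z) :=
  ((((HolLineBundle.canonical n Y).pullback p hp).dual.hol τ.2.2 τ'.2.2).mono
    fun _ h => ⟨h.1.2.2, h.2.2.2⟩).mul
    (((L.pullback p hp).hol τ.1 τ'.1).mono fun _ h => ⟨h.1.1, h.2.1⟩)

/-- The unit section, represented by the identity operator in every trivialization. -/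
def transferOne : (transferSheaf p hp L).sec ⊤ :=
  transferMk p hp L ⟨fun _ V => HomOn.one _ V,
    fun τ z _ hτ => ⟨⊤, HomOn.one _ ⊤, trivial, isHolDiffOp_one ⊤, fun V h => .of_eq rfl⟩,
    fun τ τ' z _ hτ hτ' => ⟨(twistM p hp L).dom τ ⊓ (twistM p hp L).dom τ', ⟨hτ, hτ'⟩,
      fun V hV => .of_eq <| Eq.symm <| HomOn.ext fun N hN s => smoothFun_ext fun z hz => by
        refine (mulOp_app (HolOn.smoothOn _ ((leftFactor_hol p hp L τ τ').mono hV)) hN _ z).trans ?_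
        refine (congrArg (leftFactor p hp L τ τ' z * ·)
          (mulOp_app (HolOn.smoothOn _ ((rightFactor_hol p hp L τ τ').mono hV)) hN s z)).trans ?_
        rw [← mul_assoc, factor_mul p hp L τ τ' (hV (hN hz)).1 (hV (hN hz)).2, one_mul]
        rfl⟩⟩

/-- `T` on `V ⊆ p⁻¹B` lifts the operator `S` on `B`: `T(f ∘ p) = (S f) ∘ p`.  The class of such a `T` in
`𝒟_Z / (𝒟_Z · Θ_{Z/Y})` is the one that corresponds to `S` under the identification of `p⁻¹𝒟_Y` with the
`Θ_{Z/Y}`-invariants, and `Q · S` is the class of `Q T`. -/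
def IsLift {B : Opens Y} {V : Opens Z} (S : LocOp n B) (T : LocOp (n + k) V) : Prop :=
  ∀ (B' : Opens Y) (hB : B' ≤ B) (V' : Opens Z) (hV : V' ≤ V), V' ≤ Opens.comap p B' →
    ∀ (f : smoothFun n B') (q : smoothFun (n + k) V'), (∀ z ∈ V', q.1 z = f.1 (p z)) →
      ∀ z ∈ V', (T.app V' hV q).1 z = (S.app B' hB f).1 (p z)

/-- `η = S · ξ` for the left action of `𝒟_{Y,L}`.  The left `𝒟_Y`-action on
`K_Z ⊗ 𝒟_{Z→Y} ⊗ p⁻¹K_Y⁻¹` comes from the right `𝒟_Y`-action on `𝒟_{Z→Y}` and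
`𝒟_Y^op ≅ K_Y ⊗ 𝒟_Y ⊗ K_Y⁻¹`: in the coordinates `b` of `Y` it is right multiplication by the transpose. -/
def IsLeftMul {U : Opens Y} (S : TwDiffOp L U) (ξ η : (transferSheaf p hp L).sec U) : Prop :=
  ∃ x y : transferFamilies p hp L U, transferMk p hp L x = ξ ∧ transferMk p hp L y = η ∧
    ∀ (τ : (twistM p hp L).ι) (z : Z), p z ∈ U → z ∈ (twistM p hp L).dom τ →
      ∃ (B : Opens Y) (hB : B ≤ U ⊓ L.dom τ.1) (S' : LocOp n B)
        (V₀ : Opens Z) (T : LocOp (n + k) V₀),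
        z ∈ V₀ ∧ V₀ ≤ Opens.comap p B ∧ (B : Set Y) ⊆ τ.2.2.1.source ∧
        IsTranspose n τ.2.2 (HomOn.restr hB (S.op τ.1)) S' ∧
        IsHolDiffOp (n + k) T ∧ IsLift p S' T ∧
        ∀ (V : Opens Z) (h : V ≤ V₀),
          InVertIdeal (n := n) p (y.1 τ V - (x.1 τ V).comp (HomOn.restr h T))

/-- `η = ξ · R` for the right action of `p_*𝒟_{Z,M}`, which is induced by the right `𝒟_Z`-action on
`𝒟_{Y←Z} = K_Z ⊗ 𝒟_{Z→Y} ⊗ p⁻¹K_Y⁻¹`: in the coordinates `a` of `Z`, it is left multiplication by the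
transpose. -/
def IsRightMul {U : Opens Y} (ξ : (transferSheaf p hp L).sec U)
    (R : TwDiffOp (twistM p hp L) (Opens.comap p U)) (η : (transferSheaf p hp L).sec U) : Prop :=
  ∃ x y : transferFamilies p hp L U, transferMk p hp L x = ξ ∧ transferMk p hp L y = η ∧
    ∀ (τ : (twistM p hp L).ι) (z : Z), p z ∈ U → z ∈ (twistM p hp L).dom τ →
      ∃ (V₀ : Opens Z) (hV₀ : V₀ ≤ Opens.comap p U ⊓ (twistM p hp L).dom τ)
        (R' : LocOp (n + k) V₀), z ∈ V₀ ∧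
        IsTranspose (n + k) τ.2.1 (HomOn.restr hV₀ (R.op τ)) R' ∧
        ∀ (V : Opens Z) (h : V ≤ V₀),
          InVertIdeal (n := n) p (y.1 τ V - (HomOn.restr h R').comp (x.1 τ V))

/-- `ℋom(p_* C^∞_{Z,|M|²}, C^∞_{Y,|L|²})`. -/
abbrev homSheaf : ModPresheaf Y :=
  internalHom (pushforward p (twistM p hp L).absSheaf) L.absSheaf

/-- A morphism of sheaves of complex vector spaces that is a homomorphism of
`(𝒟_{Y,L}, p_*𝒟_{Z,M})`-bimodules, where the bimodule structure on the Hom sheaf is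
`φ ↦ S ∘ φ ∘ R`. -/
def IsBimoduleHom (Φ : HomOn (transferSheaf p hp L) (homSheaf p hp L) ⊤) : Prop :=
  (∀ (U : Opens Y) (S : TwDiffOp L U) (ξ η : (transferSheaf p hp L).sec U),
    IsLeftMul p hp L S ξ η → Φ.app U le_top η = S.act.comp (Φ.app U le_top ξ)) ∧
  (∀ (U : Opens Y) (ξ : (transferSheaf p hp L).sec U)
    (R : TwDiffOp (twistM p hp L) (Opens.comap p U)) (η : (transferSheaf p hp L).sec U),
    IsRightMul p hp L ξ R η →
      Φ.app U le_top η = HomOn.comp (Φ.app U le_top ξ) (pushHom p R.act))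

/-- A pair of charts `a` of `Z` and `b` of `Y` in which `p` is the projection `ℂ^n × ℂ^k → ℂ^n`. -/
structure AdaptedChart where
  a : Chart (n + k) Z
  b : Chart n Y
  mapsTo : ∀ z ∈ a.1.source, p z ∈ b.1.source
  proj : ∀ z ∈ a.1.source, ∀ j : Fin n, a.1 z (Fin.castAdd k j) = b.1 (p z) j

variable {p}

/-- The coordinates `x ∈ ℂ^k` on the fiber over `y`, in an adapted chart. -/
def AdaptedChart.fiberParam (t : AdaptedChart (n := n) (k := k) p) (y : Y) (x : Cn k) : Z :=
  t.a.1.symm (Fin.append (t.b.1 y) x)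

variable (p)

/-- The integral over the fiber `p⁻¹(y)` of a section `h` of `|M|² = |p^*L|² ⊗ Ω_{Z/Y}`, in the
trivialization `i` of `L` and computed with a finite system `t` of adapted charts that covers the
fiber: in an adapted chart the density `h` is `h_τ(y, x) dx` with `dx` the Lebesgue measure of `ℂ^k`, and
the fiber is cut into the disjoint pieces (domain of `t_j`) minus (domains of the earlier `t_l`). -/
def fiberIntegralWith {N : ℕ} (t : Fin N → AdaptedChart (n := n) (k := k) p)
    (h : (twistM p hp L).ι → Z → ℂ) (i : L.ι) (y : Y) : ℂ :=
  ∑ j : Fin N, ∫ x in {x : Cn k | Fin.append ((t j).b.1 y) x ∈ (t j).a.1.target ∧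
      p ((t j).fiberParam y x) = y ∧
      ∀ l < j, (t j).fiberParam y x ∉ (t l).a.1.source},
    h (i, ((t j).a, (t j).b)) ((t j).fiberParam y x)

open Classical in
/-- Fiber integration, computed with some finite system of adapted charts that covers the fiber. -/
def fiberIntegral (h : (twistM p hp L).ι → Z → ℂ) (i : L.ι) (y : Y) : ℂ :=
  if H : ∃ (N : ℕ) (t : Fin N → AdaptedChart (n := n) (k := k) p),
      ∀ z, p z = y → ∃ j, z ∈ (t j).a.1.source then
    fiberIntegralWith p hp L H.choose_spec.choose h i y
  else 0

/-- `φ` is the fiber integration map `p_! : p_* C^∞_{Z,|M|²} → C^∞_{Y,|L|²}`. -/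
def IsFiberIntegration (φ : (homSheaf p hp L).sec ⊤) : Prop :=
  ∀ (U : Opens Y) (h : (twistM p hp L).absSec (Opens.comap p U)) (i : L.ι) (y : Y),
    y ∈ U → y ∈ L.dom i →
      (HomOn.app (F := pushforward p (twistM p hp L).absSheaf) (G := L.absSheaf) φ U le_top h).1 i y
        = fiberIntegral p hp L h.1 i y

end Submersion

end DPush
end

/-! A section ξ of the transfer sheaf is studied through its action on functions. In a
trivialization τ = (i, (a, b)) it is a differential operator on Z modulo 𝒟_Z·Θ_{Z/Y}, and a
holomorphic operator lies in this left ideal exactly when it kills all functions pulled back from Y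
(`inVertIdeal_of_ev`). Indeed, in coordinates where p is a projection, every operator is congruent
to some ∑ c_w ∂^w with derivatives along the base only, and its values on the exponentials exp(l·y)
recover the polynomial ∑ c_w l^w, hence the coefficients. So ξ amounts to the maps f ↦ `hat ξ τ f`
from functions on Y to functions on Z; any such family that is locally given by operators and obeys
the change of trivialization comes from a section.

The formal transpose Pᵗ is the adjoint of P for the integral ∫ f g over a chart. Adjointness makes
it unique and gives its behaviour under a change of coordinates: the Jacobian enters as |J|², and
the factor conj J drops out since holomorphic operators commute with antiholomorphic functions. In
terms of `hat`, the left and right actions are f ↦ ξ(Sᵗ f) and f ↦ Rᵗ(ξ f). The transformation rule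
of transposes matches the change of trivialization, so both actions are well defined.

The homomorphism Φ is defined by duality. For a section h of |M|², the section u = Φ(ξ)(h) of |L|²
is characterized by ∫_Y f u = ∫_Y p_!((ξ f) h) for all test functions f supported in the domain of a
trivialization of L and of a chart (`pairing`). A priori the right side is only a distribution in f.
Properness makes it a smooth function: over a small open set B of Y there is a finite expansion ξ f
= ∑ c_s · (∂^s f ∘ p) with c_s holomorphic on p⁻¹(B) (`exists_expansion`), so u = ∑ (∂^s)ᵗ p_!(c_s
h) is a solution (`exists_isLocSol`). The fundamental lemma of the calculus of variations gives
uniqueness, `pairing_change` gives the transformation law, and the local solutions glue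
(`exists_sol`).

The required properties are read off from the pairing. For ξ = 1 it is the projection formula p_!((f
∘ p) h) = f p_!(h). The left action is the identity ∫ f S(u) = ∫ (Sᵗ f) u. For the right action, a
partition of unity reduces to h with support in one adapted chart, where Fubini turns the pairing
into ∫_Z (ξ f) h and R can be moved to the other factor. If Φ(ξ) = 0, these integrals vanish for all
such h, so ξ f = 0 for all f, and ξ = 0. Finally the expansion says that locally ξ = ∑ Q_s · 1 ·
c_s, where Q_s has transpose ∂^s, so a bimodule homomorphism is determined by the image of 1.

Fiber integration is defined with an arbitrary finite system of charts and disjoint pieces of the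
fiber. For a density concentrated in one adapted chart, the change of variables formula identifies
the result with the integral over the slice of that chart (`Concentrated.pieces`). A partition of
unity near the fiber reduces the general case to this one and shows that the integral is smooth in
the base point. -/

noncomputable section
namespace DPush
set_option linter.unusedSectionVars false

/-! ### Operators acting on germs of smooth functions -/

section GermEvaluation

variable {d : ℕ} {X : Type*} [TopologicalSpace X] [ChartedSpace (Cn d) X]

variable (d) in
/-- The largest open set on which `F` is smooth. -/
def smoothLocus (F : X → ℂ) : Opens X := sSup {V | SmoothOn d F V}

theorem mem_smoothLocus {F : X → ℂ} {x : X} :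
    x ∈ smoothLocus d F ↔ ∃ V : Opens X, x ∈ V ∧ SmoothOn d F V := by
  simp [smoothLocus, and_comm]

theorem smoothOn_smoothLocus (F : X → ℂ) : SmoothOn d F (smoothLocus d F) := by
  intro x hx
  obtain ⟨V, hxV, hV⟩ := mem_smoothLocus.1 hx
  exact ((hV x hxV).contMDiffAt (V.2.mem_nhds hxV)).contMDiffWithinAt

theorem SmoothOn.le_smoothLocus {F : X → ℂ} {V : Opens X} (h : SmoothOn d F V) :
    V ≤ smoothLocus d F := le_sSup h

theorem SmoothOn.mem_smoothLocus {F : X → ℂ} {V : Opens X} (h : SmoothOn d F V) {x : X}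
    (hx : x ∈ V) : x ∈ smoothLocus d F := h.le_smoothLocus hx

theorem smoothLocus_congr {F G : X → ℂ} {x : X} (h : F =ᶠ[𝓝 x] G) (hF : x ∈ smoothLocus d F) :
    x ∈ smoothLocus d G := by
  obtain ⟨N, hN, hNo, hxN⟩ := eventually_nhds_iff.1 h
  have h1 : SmoothOn d G ((smoothLocus d F ⊓ ⟨N, hNo⟩ : Opens X) : Set X) :=
    ((smoothOn_smoothLocus F).mono inter_subset_left).congr fun y hy => (hN y hy.2).symm
  exact h1.mem_smoothLocus ⟨hF, hxN⟩

theorem smoothLocus_mul {F G : X → ℂ} {x : X} (hF : x ∈ smoothLocus d F)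
    (hG : x ∈ smoothLocus d G) : x ∈ smoothLocus d (fun y => F y * G y) := by
  have h1 : SmoothOn d (fun y => F y * G y) ((smoothLocus d F ⊓ smoothLocus d G : Opens X) : Set X) :=
    SmoothOn.mul d ((smoothOn_smoothLocus F).mono inter_subset_left)
      ((smoothOn_smoothLocus G).mono inter_subset_right)
  exact h1.mem_smoothLocus ⟨hF, hG⟩

theorem SmoothOn.add {F G : X → ℂ} {U : Set X} (hF : SmoothOn d F U) (hG : SmoothOn d G U) :
    SmoothOn d (fun y => F y + G y) U := ContMDiffOn.add hF hG

theorem SmoothOn.sum {ι : Type*} {s : Finset ι} {F : ι → X → ℂ} {U : Set X}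
    (hF : ∀ i ∈ s, SmoothOn d (F i) U) : SmoothOn d (fun y => ∑ i ∈ s, F i y) U := by
  classical
  induction s using Finset.induction_on with
  | empty => simpa using (contMDiffOn_const : ContMDiffOn 𝓘(ℝ, Cn d) 𝓘(ℝ, ℂ) ∞ (fun _ => (0 : ℂ)) U)
  | insert i s his ih =>
    simp only [Finset.sum_insert his]
    exact (hF i (Finset.mem_insert_self _ _)).add
      (ih fun j hj => hF j (Finset.mem_insert_of_mem hj))

theorem smoothOn_const (c : ℂ) (U : Set X) : SmoothOn d (fun _ => c) U := contMDiffOn_const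

theorem smoothLocus_const (c : ℂ) (x : X) : x ∈ smoothLocus d (fun _ => c) :=
  SmoothOn.mem_smoothLocus (V := ⊤) contMDiffOn_const trivial

theorem smoothLocus_add {F G : X → ℂ} {x : X} (hF : x ∈ smoothLocus d F)
    (hG : x ∈ smoothLocus d G) : x ∈ smoothLocus d (fun y => F y + G y) := by
  have h1 : SmoothOn d (fun y => F y + G y) ((smoothLocus d F ⊓ smoothLocus d G : Opens X) : Set X) :=
    ((smoothOn_smoothLocus F).mono inter_subset_left).add
      ((smoothOn_smoothLocus G).mono inter_subset_right)
  exact h1.mem_smoothLocus ⟨hF, hG⟩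

/-- The value at `x` of the operator `P` applied to the germ of `F` at `x`; it is `0` unless `P` is
defined and `F` is smooth near `x`. -/
def LocOp.ev {W : Opens X} (P : LocOp d W) (F : X → ℂ) : X → ℂ :=
  (P.app (W ⊓ smoothLocus d F) inf_le_left ⟨Set.indicator ((W ⊓ smoothLocus d F : Opens X) : Set X) F,
    indicator_mem_smoothFun d (smoothOn_smoothLocus F) inter_subset_right⟩).1

namespace LocOp

variable {W : Opens X}

/-- Both values can be computed on a smaller open set on which F and s coincide, because P commutes
with restriction. This is what makes `ev` a function of the germ of F at x. -/
theorem ev_eq_app (P : LocOp d W) {V : Opens X} (hV : V ≤ W) (s : smoothFun d V) {F : X → ℂ} {x : X}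
    (hx : x ∈ V) (h : F =ᶠ[𝓝 x] s.1) : P.ev F x = (P.app V hV s).1 x := by
  obtain ⟨N, hN, hNo, hxN⟩ := eventually_nhds_iff.1 h
  set N' : Opens X := V ⊓ ⟨N, hNo⟩
  have h1 : SmoothOn d F N' := (s.2.1.mono inter_subset_left).congr fun y hy => hN y hy.2
  have hxN' : x ∈ N' := ⟨hx, hxN⟩
  have e1 : N' ≤ W ⊓ smoothLocus d F := le_inf (inf_le_left.trans hV) h1.le_smoothLocus
  have e2 : N' ≤ V := inf_le_left
  rw [ev, app_eq P inf_le_left e1 _ hxN', app_eq P hV e2 s hxN']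
  suffices e : (smoothSheaf d X).res e1 ⟨Set.indicator ((W ⊓ smoothLocus d F : Opens X) : Set X) F,
      indicator_mem_smoothFun d (smoothOn_smoothLocus F) inter_subset_right⟩ =
      (smoothSheaf d X).res e2 s by rw [e]
  refine smoothFun_ext (d := d) (X := X) (V := N') fun y hy => ?_
  refine (smoothSheaf_res_apply (d := d) e1 _ hy).trans
    (Eq.trans ?_ (smoothSheaf_res_apply (d := d) e2 s hy).symm)
  refine (Set.indicator_of_mem (s := ((W ⊓ smoothLocus d F : Opens X) : Set X)) (e1 hy) F).trans ?_
  exact hN y hy.2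

theorem ev_apply (P : LocOp d W) {V : Opens X} (hV : V ≤ W) (s : smoothFun d V) {x : X}
    (hx : x ∈ V) : P.ev s.1 x = (P.app V hV s).1 x :=
  P.ev_eq_app hV s hx Filter.EventuallyEq.rfl

theorem ev_of_notMem (P : LocOp d W) {F : X → ℂ} {x : X} (hx : ¬ (x ∈ W ∧ x ∈ smoothLocus d F)) :
    P.ev F x = 0 :=
  (P.app (W ⊓ smoothLocus d F) inf_le_left _).2.2 x hx

theorem ev_congr (P : LocOp d W) {F G : X → ℂ} {x : X} (h : F =ᶠ[𝓝 x] G) : P.ev F x = P.ev G x := by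
  by_cases hx : x ∈ W ∧ x ∈ smoothLocus d G
  · refine P.ev_eq_app (V := W ⊓ smoothLocus d G) inf_le_left _ hx (h.trans ?_)
    filter_upwards [(W ⊓ smoothLocus d G).2.mem_nhds hx] with y hy
    exact (Set.indicator_of_mem (s := ((W ⊓ smoothLocus d G : Opens X) : Set X)) hy G).symm
  · rw [P.ev_of_notMem hx, P.ev_of_notMem]
    exact fun h' => hx ⟨h'.1, smoothLocus_congr h h'.2⟩

/-- Evaluation on a function that is smooth on `V`. -/
theorem ev_of_smoothOn (P : LocOp d W) {V : Opens X} (hV : V ≤ W) {F : X → ℂ} (hF : SmoothOn d F V)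
    {x : X} (hx : x ∈ V) : P.ev F x = (P.app V hV ⟨Set.indicator (V : Set X) F,
      indicator_mem_smoothFun d hF le_rfl⟩).1 x := by
  refine P.ev_eq_app hV _ hx ?_
  filter_upwards [V.2.mem_nhds hx] with y hy
  exact (Set.indicator_of_mem (s := (V : Set X)) hy F).symm

theorem smoothOn_ev (P : LocOp d W) {V : Opens X} (hV : V ≤ W) {F : X → ℂ} (hF : SmoothOn d F V) :
    SmoothOn d (P.ev F) V :=
  ((P.app V hV ⟨Set.indicator (V : Set X) F,
    indicator_mem_smoothFun d hF le_rfl⟩).2.1).congr fun _ hx => P.ev_of_smoothOn hV hF hx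

theorem mem_smoothLocus_ev (P : LocOp d W) {F : X → ℂ} {x : X} (hx : x ∈ W)
    (hF : x ∈ smoothLocus d F) : x ∈ smoothLocus d (P.ev F) :=
  (P.smoothOn_ev (V := W ⊓ smoothLocus d F) inf_le_left
    ((smoothOn_smoothLocus F).mono inter_subset_right)).mem_smoothLocus ⟨hx, hF⟩

theorem ev_restr (P : LocOp d W) {V : Opens X} (h : V ≤ W) (F : X → ℂ) {x : X} (hx : x ∈ V) :
    ev (HomOn.restr h P) F x = P.ev F x := by
  by_cases hF : x ∈ smoothLocus d F
  · rw [ev_of_smoothOn (HomOn.restr h P) (V := V ⊓ smoothLocus d F) inf_le_left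
      ((smoothOn_smoothLocus F).mono inter_subset_right) ⟨hx, hF⟩,
      ev_of_smoothOn P (V := V ⊓ smoothLocus d F) (inf_le_left.trans h)
      ((smoothOn_smoothLocus F).mono inter_subset_right) ⟨hx, hF⟩]
    rfl
  · rw [ev_of_notMem _ fun h => hF h.2, ev_of_notMem _ fun h => hF h.2]

@[simp] theorem add_ev (P Q : LocOp d W) (F : X → ℂ) (x : X) :
    ev (P + Q) F x = P.ev F x + Q.ev F x := rfl

@[simp] theorem sub_ev (P Q : LocOp d W) (F : X → ℂ) (x : X) :
    ev (P - Q) F x = P.ev F x - Q.ev F x := rfl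

@[simp] theorem neg_ev (P : LocOp d W) (F : X → ℂ) (x : X) : ev (-P) F x = -P.ev F x := rfl

@[simp] theorem zero_ev (F : X → ℂ) (x : X) : ev (0 : LocOp d W) F x = 0 := rfl

@[simp] theorem smul_ev (c : ℂ) (P : LocOp d W) (F : X → ℂ) (x : X) :
    ev (c • P) F x = c * P.ev F x := rfl

/-- Smoothness of F at x cannot be dropped: `Q.ev F` takes the default value 0 where F is not
smooth, and may happen to be smooth there, so that in general the two sides would differ. -/
theorem comp_ev (P Q : LocOp d W) {F : X → ℂ} {x : X} (hF : x ∈ smoothLocus d F) :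
    ev (P.comp Q) F x = P.ev (Q.ev F) x := by
  by_cases hx : x ∈ W
  · exact (P.ev_eq_app (V := W ⊓ smoothLocus d F) inf_le_left
      (Q.app (W ⊓ smoothLocus d F) inf_le_left _) ⟨hx, hF⟩ Filter.EventuallyEq.rfl).symm
  · rw [ev_of_notMem _ fun h => hx h.1, ev_of_notMem _ fun h => hx h.1]

theorem one_ev {F : X → ℂ} {x : X} (hx : x ∈ W) (hF : x ∈ smoothLocus d F) :
    ev (HomOn.one (smoothSheaf d X) W) F x = F x :=
  Set.indicator_of_mem (s := ((W ⊓ smoothLocus d F : Opens X) : Set X)) ⟨hx, hF⟩ F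

theorem mulOp_ev {f F : X → ℂ} (hf : SmoothOn d f W) {x : X} (hx : x ∈ W)
    (hF : x ∈ smoothLocus d F) : ev (mulOp d f W) F x = f x * F x := by
  refine (mulOp_app hf inf_le_left _ x).trans ?_
  congr 1
  exact Set.indicator_of_mem (s := ((W ⊓ smoothLocus d F : Opens X) : Set X)) ⟨hx, hF⟩ F

theorem coordDeriv_ev [IsManifold 𝓘(ℂ, Cn d) ω X] (a : Chart d X) (j : Fin d)
    (hW : (W : Set X) ⊆ a.1.source) {F : X → ℂ} {x : X} (hx : x ∈ W) (hF : x ∈ smoothLocus d F) :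
    ev (coordDeriv d a j W hW) F x = wirtinger d a j F x := by
  set V : Opens X := W ⊓ smoothLocus d F
  have hxV : x ∈ V := ⟨hx, hF⟩
  change Set.indicator (V : Set X) (wirtinger d a j (Set.indicator (V : Set X) F)) x = _
  rw [Set.indicator_of_mem (s := (V : Set X)) hxV, wirtinger_indicator d a j F (hW hx) hxV]

theorem ev_add (P : LocOp d W) {F G : X → ℂ} {x : X} (hF : x ∈ smoothLocus d F)
    (hG : x ∈ smoothLocus d G) : P.ev (fun y => F y + G y) x = P.ev F x + P.ev G x := by
  by_cases hx : x ∈ W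
  · set V : Opens X := W ⊓ (smoothLocus d F ⊓ smoothLocus d G)
    have hxV : x ∈ V := ⟨hx, hF, hG⟩
    have h1 : SmoothOn d F V := (smoothOn_smoothLocus F).mono fun y hy => hy.2.1
    have h2 : SmoothOn d G V := (smoothOn_smoothLocus G).mono fun y hy => hy.2.2
    rw [P.ev_of_smoothOn inf_le_left h1 hxV, P.ev_of_smoothOn inf_le_left h2 hxV,
      P.ev_of_smoothOn inf_le_left (h1.add h2) hxV]
    have e : (⟨Set.indicator (V : Set X) (fun y => F y + G y),
        indicator_mem_smoothFun d (h1.add h2) le_rfl⟩ : smoothFun d V) =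
        ⟨Set.indicator (V : Set X) F, indicator_mem_smoothFun d h1 le_rfl⟩ +
        ⟨Set.indicator (V : Set X) G, indicator_mem_smoothFun d h2 le_rfl⟩ :=
      Subtype.ext (Set.indicator_add _ _ _)
    rw [e]
    exact congrFun (congrArg Subtype.val (map_add (P.app V inf_le_left) _ _)) x
  · simp [ev_of_notMem P fun h => hx h.1]

theorem ev_const_mul (P : LocOp d W) (c : ℂ) {F : X → ℂ} {x : X} (hF : x ∈ smoothLocus d F) :
    P.ev (fun y => c * F y) x = c * P.ev F x := by
  by_cases hx : x ∈ W
  · set V : Opens X := W ⊓ smoothLocus d F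
    have hxV : x ∈ V := ⟨hx, hF⟩
    have h1 : SmoothOn d F V := (smoothOn_smoothLocus F).mono fun y hy => hy.2
    rw [P.ev_of_smoothOn inf_le_left h1 hxV,
      P.ev_of_smoothOn inf_le_left ((smoothOn_const c _).mul d h1) hxV]
    have e : (⟨Set.indicator (V : Set X) (fun y => c * F y),
        indicator_mem_smoothFun d ((smoothOn_const c _).mul d h1) le_rfl⟩ : smoothFun d V) =
        c • ⟨Set.indicator (V : Set X) F, indicator_mem_smoothFun d h1 le_rfl⟩ :=
      Subtype.ext (Set.indicator_const_smul (V : Set X) c F)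
    rw [e]
    exact congrFun (congrArg Subtype.val (map_smul (P.app V inf_le_left) c _)) x
  · simp [ev_of_notMem P fun h => hx h.1]

theorem ev_zero (P : LocOp d W) (x : X) : P.ev (fun _ => 0) x = 0 := by
  have h := P.ev_const_mul 0 (smoothLocus_const (d := d) 0 x)
  simpa using h

theorem ev_eq_zero (P : LocOp d W) {F : X → ℂ} {x : X} (h : ∀ᶠ y in 𝓝 x, F y = 0) :
    P.ev F x = 0 :=
  (P.ev_congr (G := fun _ => 0) h).trans (P.ev_zero x)

theorem ev_neg (P : LocOp d W) {F : X → ℂ} {x : X} (hF : x ∈ smoothLocus d F) :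
    P.ev (fun y => -F y) x = -P.ev F x := by
  have h := P.ev_const_mul (-1) hF
  simpa using h

/-- Operators are determined by their values on germs of smooth functions. -/
theorem ext_ev {P Q : LocOp d W}
    (h : ∀ x ∈ W, ∀ F : X → ℂ, x ∈ smoothLocus d F → P.ev F x = Q.ev F x) : P = Q :=
  HomOn.ext fun V hV s => smoothFun_ext fun x hx => by
    rw [← P.ev_apply hV s hx, ← Q.ev_apply hV s hx]
    exact h x (hV hx) s.1 (SmoothOn.mem_smoothLocus s.2.1 hx)

end LocOp

theorem IsHolDiffOp.ev_conj_mul [IsManifold 𝓘(ℂ, Cn d) ω X] {W : Opens X} {P : LocOp d W}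
    (hP : IsHolDiffOp d P) {f F : X → ℂ} {V : Opens X} (hf : HolOn d f V) {x : X} (hx : x ∈ V)
    (hF : x ∈ smoothLocus d F) :
    P.ev (fun y => conjFun f y * F y) x = conjFun f x * P.ev F x := by
  by_cases hxW : x ∈ W
  · set N : Opens X := W ⊓ (V ⊓ smoothLocus d F)
    have hxN : x ∈ N := ⟨hxW, hx, hF⟩
    have h1 : HolOn d f N := hf.mono fun y hy => hy.2.1
    have h2 : SmoothOn d F N := (smoothOn_smoothLocus F).mono fun y hy => hy.2.2
    have h3 : SmoothOn d (fun y => conjFun f y * F y) N := SmoothOn.mul d (h1.smoothOn d).conj h2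
    rw [P.ev_of_smoothOn inf_le_left h2 hxN, P.ev_of_smoothOn inf_le_left h3 hxN]
    refine hP.conj_mul f N inf_le_left h1 _ _ (fun y hy => ?_) x hxN
    change Set.indicator (N : Set X) (fun y => conjFun f y * F y) y =
      conjFun f y * Set.indicator (N : Set X) F y
    rw [Set.indicator_of_mem (s := (N : Set X)) hy, Set.indicator_of_mem (s := (N : Set X)) hy]
  · rw [P.ev_of_notMem fun h => hxW h.1, P.ev_of_notMem fun h => hxW h.1, mul_zero]

theorem TwDiffOp.act_app [IsManifold 𝓘(ℂ, Cn d) ω X] {A : HolLineBundle d X} {U : Opens X}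
    (R : TwDiffOp A U) {V : Opens X} (hV : V ≤ U) (s : A.absSec V) (i : A.ι) {x : X} (hx : x ∈ V)
    (hi : x ∈ A.dom i) : (R.act.app V hV s).1 i x = (R.op i).ev (s.1 i) x :=
  ((R.op i).ev_apply (inf_le_inf_right _ hV) ⟨s.1 i, s.2.1 i⟩ (x := x) ⟨hx, hi⟩).symm

end GermEvaluation

/-! ### Calculus of the holomorphic partial derivatives -/

section Wirtinger

/-- The complex linear part of a real linear form. -/
def linPart {E : Type*} [NormedAddCommGroup E] [NormedSpace ℂ E] (A : E →L[ℝ] ℂ) (v : E) : ℂ :=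
  (1 / 2) * (A v - Complex.I * A (Complex.I • v))

theorem linPart_add {E : Type*} [NormedAddCommGroup E] [NormedSpace ℂ E] (A : E →L[ℝ] ℂ) (v w : E) :
    linPart A (v + w) = linPart A v + linPart A w := by
  simp only [linPart, smul_add, map_add]
  ring

/-- `linPart` is the projection of a real linear form onto the forms that commute with
multiplication by i. With c split into real and imaginary parts this is a computation from real
linearity and i² = -1. -/
theorem linPart_smul {E : Type*} [NormedAddCommGroup E] [NormedSpace ℂ E] (A : E →L[ℝ] ℂ) (c : ℂ)
    (v : E) : linPart A (c • v) = c * linPart A v := by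
  have h : ∀ (c : ℂ) (w : E), c • w = (c.re : ℝ) • w + (c.im : ℝ) • (Complex.I • w) := by
    intro c w
    conv_lhs => rw [← Complex.re_add_im c]
    rw [add_smul, mul_smul]
    rfl
  have h2 : Complex.I • (Complex.I • v) = -v := by rw [smul_smul, Complex.I_mul_I, neg_one_smul]
  have hc := Complex.re_add_im c
  simp only [linPart]
  rw [smul_comm Complex.I c v, h c v, h c (Complex.I • v), h2]
  simp only [map_add, map_smul, map_neg, Complex.real_smul]
  -- The first four occurrences of c sit inside real and imaginary parts; the fifth is the complex
  -- scalar on the right-hand side.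
  nth_rewrite 5 [← hc]
  linear_combination (1 / 2) * (c.im * A (Complex.I • v)) * Complex.I_mul_I

theorem linPart_sum_single {d : ℕ} (A : Cn d →L[ℝ] ℂ) (v : Cn d) :
    linPart A v = ∑ i, v i * linPart A (Pi.single i 1) := by
  conv_lhs => rw [pi_eq_sum_univ' v]
  have h : ∀ s : Finset (Fin d), linPart A (∑ i ∈ s, v i • Pi.single i (1 : ℂ)) =
      ∑ i ∈ s, v i * linPart A (Pi.single i 1) := by
    classical
    intro s
    induction s using Finset.induction_on with
    | empty => simp [linPart]
    | insert i s his ih => rw [Finset.sum_insert his, Finset.sum_insert his, linPart_add, ih, linPart_smul]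
  exact h Finset.univ

variable {d : ℕ} {X : Type*} [TopologicalSpace X] [ChartedSpace (Cn d) X]

theorem wirtinger_eq_linPart (a : Chart d X) (j : Fin d) (f : X → ℂ) (x : X) :
    wirtinger d a j f x = linPart (fderiv ℝ (f ∘ a.1.symm) (a.1 x)) (Pi.single j 1) := by
  rw [wirtinger, linPart, ← Pi.single_smul, smul_eq_mul, mul_one]

theorem wirtinger_congr (a : Chart d X) (j : Fin d) {f g : X → ℂ} {x : X} (hx : x ∈ a.1.source)
    (h : f =ᶠ[𝓝 x] g) : wirtinger d a j f x = wirtinger d a j g x := by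
  have h1 : f ∘ a.1.symm =ᶠ[𝓝 (a.1 x)] g ∘ a.1.symm := by
    have h2 := a.1.continuousAt_symm (a.1.map_source hx)
    rw [ContinuousAt, a.1.left_inv hx] at h2
    exact h2.eventually h
  simp only [wirtinger, h1.fderiv_eq]

variable [IsManifold 𝓘(ℂ, Cn d) ω X]

theorem Chart.contDiffAt (a : Chart d X) {f : X → ℂ} {x : X} (hx : x ∈ a.1.source)
    (hf : x ∈ smoothLocus d f) : ContDiffAt ℝ ∞ (f ∘ a.1.symm) (a.1 x) := by
  refine (a.contDiffOn_symm d (smoothOn_smoothLocus f)).contDiffAt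
    ((a.isOpen_preimage d _).mem_nhds ⟨a.1.map_source hx, ?_⟩)
  simpa [a.1.left_inv hx] using hf

theorem Chart.differentiableAt' (a : Chart d X) {f : X → ℂ} {x : X} (hx : x ∈ a.1.source)
    (hf : x ∈ smoothLocus d f) : DifferentiableAt ℝ (f ∘ a.1.symm) (a.1 x) :=
  (a.contDiffAt hx hf).differentiableAt (by simp)

/-- The coordinate vector field on the whole domain of a chart. -/
def Chart.deriv (a : Chart d X) (j : Fin d) : LocOp d (⟨a.1.source, a.1.open_source⟩ : Opens X) :=
  coordDeriv d a j _ Subset.rfl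

theorem Chart.deriv_ev (a : Chart d X) (j : Fin d) {f : X → ℂ} {x : X} (hx : x ∈ a.1.source)
    (hf : x ∈ smoothLocus d f) : (a.deriv j).ev f x = wirtinger d a j f x :=
  LocOp.coordDeriv_ev a j _ hx hf

theorem wirtinger_mem_smoothLocus (a : Chart d X) (j : Fin d) {f : X → ℂ} {x : X}
    (hx : x ∈ a.1.source) (hf : x ∈ smoothLocus d f) :
    x ∈ smoothLocus d (wirtinger d a j f) := by
  refine smoothLocus_congr ?_ ((a.deriv j).mem_smoothLocus_ev hx hf)
  filter_upwards [a.1.open_source.mem_nhds hx, (smoothLocus d f).2.mem_nhds hf] with y hy hfy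
  exact a.deriv_ev j hy hfy

theorem wirtinger_mul (a : Chart d X) (j : Fin d) {f g : X → ℂ} {x : X} (hx : x ∈ a.1.source)
    (hf : x ∈ smoothLocus d f) (hg : x ∈ smoothLocus d g) :
    wirtinger d a j (fun y => f y * g y) x =
      wirtinger d a j f x * g x + f x * wirtinger d a j g x := by
  have h1 := (a.differentiableAt' hx hf).hasFDerivAt.mul (a.differentiableAt' hx hg).hasFDerivAt
  have h2 : (fun y => f y * g y) ∘ a.1.symm = (f ∘ a.1.symm) * (g ∘ a.1.symm) := rfl
  simp only [wirtinger, h2, h1.fderiv, _root_.add_apply, _root_.smul_apply, smul_eq_mul,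
    Function.comp_apply, a.1.left_inv hx]
  ring

/-- Both sides are the same combination of second real derivatives in the directions 1 and i of the
two coordinates, up to exchanging the two arguments; the second Fréchet derivative is symmetric. -/
theorem wirtinger_comm (a : Chart d X) (i j : Fin d) {f : X → ℂ} {x : X} (hx : x ∈ a.1.source)
    (hf : x ∈ smoothLocus d f) :
    wirtinger d a i (wirtinger d a j f) x = wirtinger d a j (wirtinger d a i f) x := by
  set F := f ∘ a.1.symm with hF
  set v := a.1 x
  have hc : ContDiffAt ℝ ∞ F v := a.contDiffAt hx hf
  have hd : DifferentiableAt ℝ (fderiv ℝ F) v :=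
    (hc.fderiv_right (m := ∞) (by simp)).differentiableAt (by simp)
  have hsymm : ∀ u w, fderiv ℝ (fderiv ℝ F) v u w = fderiv ℝ (fderiv ℝ F) v w u :=
    hc.isSymmSndFDerivAt (by simpa using (WithTop.coe_le_coe.2 le_top : ((2 : ℕ∞) : WithTop ℕ∞) ≤ ∞))
  have hw : ∀ j : Fin d, HasFDerivAt (wirtinger d a j f ∘ a.1.symm)
      ((1 / 2 : ℂ) • ((fderiv ℝ (fderiv ℝ F) v).flip (Pi.single j 1) -
        Complex.I • (fderiv ℝ (fderiv ℝ F) v).flip (Pi.single j Complex.I))) v := by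
    intro j
    have h1 : ∀ u : Cn d, HasFDerivAt (fun w => fderiv ℝ F w u)
        ((fderiv ℝ (fderiv ℝ F) v).flip u) v := fun u => by
      refine (hd.hasFDerivAt.clm_apply (hasFDerivAt_const u v)).congr_fderiv ?_
      ext w
      simp
    have h2 : HasFDerivAt (fun w => (1 / 2 : ℂ) * (fderiv ℝ F w (Pi.single j 1) -
        Complex.I * fderiv ℝ F w (Pi.single j Complex.I))) _ v :=
      ((h1 (Pi.single j 1)).sub ((h1 (Pi.single j Complex.I)).const_mul Complex.I)).const_mul (1 / 2)
    refine h2.congr_of_eventuallyEq ?_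
    filter_upwards [a.1.open_target.mem_nhds (a.1.map_source hx)] with w hw
    simp only [Function.comp_apply, wirtinger, a.1.right_inv hw]
    rfl
  rw [wirtinger, wirtinger, (hw j).fderiv, (hw i).fderiv]
  simp only [_root_.smul_apply, _root_.sub_apply, ContinuousLinearMap.flip_apply, smul_eq_mul]
  rw [hsymm (Pi.single i 1) (Pi.single j 1), hsymm (Pi.single i 1) (Pi.single j Complex.I),
    hsymm (Pi.single i Complex.I) (Pi.single j 1),
    hsymm (Pi.single i Complex.I) (Pi.single j Complex.I)]
  ring

theorem HolOn.contDiffAt_symm {f : X → ℂ} {V : Opens X} (hf : HolOn d f V) (a : Chart d X) {x : X}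
    (hx : x ∈ a.1.source) (hxV : x ∈ V) : ContDiffAt ℂ ω (f ∘ a.1.symm) (a.1 x) := by
  have h3 : ContMDiffOn 𝓘(ℂ, Cn d) 𝓘(ℂ, ℂ) ω (f ∘ a.1.symm) (a.1.target ∩ a.1.symm ⁻¹' V) :=
    hf.comp ((contMDiffOn_symm_of_mem_maximalAtlas a.2).mono Set.inter_subset_left)
      (fun y hy => hy.2)
  refine h3.contDiffOn.contDiffAt ((a.isOpen_preimage d V).mem_nhds
    ⟨a.1.map_source hx, ?_⟩)
  simpa [a.1.left_inv hx] using hxV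

/-- The derivative of a holomorphic function commutes with i, so both halves of the defining average
equal the complex partial derivative. -/
theorem wirtinger_of_hol (a : Chart d X) (j : Fin d) {f : X → ℂ} {x : X}
    (hf : DifferentiableAt ℂ (f ∘ a.1.symm) (a.1 x)) :
    wirtinger d a j f x = fderiv ℂ (f ∘ a.1.symm) (a.1 x) (Pi.single j 1) := by
  have h1 : fderiv ℝ (f ∘ a.1.symm) (a.1 x) =
      (fderiv ℂ (f ∘ a.1.symm) (a.1 x)).restrictScalars ℝ :=
    (hf.hasFDerivAt.restrictScalars ℝ).fderiv
  rw [wirtinger_eq_linPart, h1, linPart]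
  simp only [ContinuousLinearMap.coe_restrictScalars', map_smul, smul_eq_mul]
  linear_combination (-1 / 2) * fderiv ℂ (f ∘ a.1.symm) (a.1 x) (Pi.single j 1) * Complex.I_mul_I

theorem HolOn.wirtinger {f : X → ℂ} {V : Opens X} (hf : HolOn d f V) (a : Chart d X) (j : Fin d)
    (hV : (V : Set X) ⊆ a.1.source) : HolOn d (wirtinger d a j f) V := by
  intro x hx
  have h1 := (hf.contDiffAt_symm a (hV hx) hx)
  have h2 : ContDiffAt ℂ ω (fun w => fderiv ℂ (f ∘ a.1.symm) w (Pi.single j 1)) (a.1 x) :=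
    (h1.fderiv_right (m := ω) (by simp)).clm_apply contDiffAt_const
  have h3 := contMDiffAt_of_mem_maximalAtlas a.2 (hV hx)
  have h4 := (h2.contMDiffAt.comp x h3).congr_of_eventuallyEq
    (f₁ := DPush.wirtinger d a j f) (by
      filter_upwards [V.2.mem_nhds hx] with y hy
      exact wirtinger_of_hol a j ((hf.contDiffAt_symm a (hV hy) hy).differentiableAt (by simp)))
  exact h4.contMDiffWithinAt

theorem Chart.coord_hol (a : Chart d X) (i : Fin d) : HolOn d (fun y => a.1 y i) a.1.source := by
  have h1 : ContDiff ℂ ω (fun v : Cn d => v i) := contDiff_apply ℂ ℂ i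
  exact h1.contMDiff.comp_contMDiffOn (contMDiffOn_of_mem_maximalAtlas a.2)

/-- The chain rule for a change of holomorphic coordinates. -/
theorem wirtinger_change (a b : Chart d X) (j : Fin d) {f : X → ℂ} {x : X} (ha : x ∈ a.1.source)
    (hb : x ∈ b.1.source) (hf : x ∈ smoothLocus d f) :
    wirtinger d b j f x = ∑ i, wirtinger d b j (fun y => a.1 y i) x * wirtinger d a i f x := by
  have hT : DifferentiableAt ℂ (a.1 ∘ b.1.symm) (b.1 x) := HolLineBundle.trans_differentiableAt hb ha
  have hTx : (a.1 ∘ b.1.symm) (b.1 x) = a.1 x := by simp [b.1.left_inv hb]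
  have h1 : f ∘ b.1.symm =ᶠ[𝓝 (b.1 x)] (f ∘ a.1.symm) ∘ (a.1 ∘ b.1.symm) := by
    filter_upwards [(b.1.symm ≫ₕ a.1).open_source.mem_nhds (HolLineBundle.trans_mem hb ha)] with y hy
    have hy2 : b.1.symm y ∈ a.1.source := by simpa using hy.2
    simp [a.1.left_inv hy2]
  have h2 : DifferentiableAt ℝ (f ∘ a.1.symm) ((a.1 ∘ b.1.symm) (b.1 x)) := by
    rw [hTx]; exact a.differentiableAt' ha hf
  have h3 : HasFDerivAt (f ∘ b.1.symm) ((fderiv ℝ (f ∘ a.1.symm) (a.1 x)).comp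
      ((fderiv ℂ (a.1 ∘ b.1.symm) (b.1 x)).restrictScalars ℝ)) (b.1 x) := by
    have := h2.hasFDerivAt.comp (b.1 x) (hT.hasFDerivAt.restrictScalars ℝ)
    rw [hTx] at this
    exact this.congr_of_eventuallyEq h1
  have h4 : ∀ i, wirtinger d b j (fun y => a.1 y i) x =
      fderiv ℂ (a.1 ∘ b.1.symm) (b.1 x) (Pi.single j 1) i := by
    intro i
    have e : (fun y => a.1 y i) ∘ b.1.symm = fun w => (a.1 ∘ b.1.symm) w i := rfl
    have e2 := (hasFDerivAt_pi'.1 hT.hasFDerivAt) i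
    rw [wirtinger_of_hol b j (by rw [e]; exact e2.differentiableAt), e, e2.fderiv]
    rfl
  rw [wirtinger_eq_linPart, h3.fderiv]
  -- The derivative of the coordinate change is complex linear, so it passes through the projection
  -- onto the complex linear part.
  have h5 : linPart ((fderiv ℝ (f ∘ a.1.symm) (a.1 x)).comp
      ((fderiv ℂ (a.1 ∘ b.1.symm) (b.1 x)).restrictScalars ℝ)) (Pi.single j 1) =
      linPart (fderiv ℝ (f ∘ a.1.symm) (a.1 x))
        (fderiv ℂ (a.1 ∘ b.1.symm) (b.1 x) (Pi.single j 1)) := by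
    simp only [linPart, ContinuousLinearMap.comp_apply, ContinuousLinearMap.coe_restrictScalars',
      map_smul]
  rw [h5, linPart_sum_single]
  exact Finset.sum_congr rfl fun i _ => by rw [h4 i, wirtinger_eq_linPart]

theorem wirtinger_const (a : Chart d X) (j : Fin d) (c : ℂ) (x : X) :
    wirtinger d a j (fun _ => c) x = 0 := by
  have : (fun _ : X => c) ∘ a.1.symm = fun _ => c := rfl
  simp [wirtinger, this]

end Wirtinger

/-! ### Test functions and integration in charts -/

section TestFunctions

variable {d : ℕ} {X : Type*} [TopologicalSpace X] [ChartedSpace (Cn d) X]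

variable (d) in
/-- `f` is a smooth function on `X` with compact support contained in `N`. -/
structure IsTest (f : X → ℂ) (N : Set X) : Prop where
  smooth : SmoothOn d f univ
  cpt : HasCompactSupport f
  sub : tsupport f ⊆ N

namespace IsTest
variable {f g : X → ℂ} {N : Set X}

theorem mem_smoothLocus (h : IsTest d f N) (x : X) : x ∈ smoothLocus d f :=
  SmoothOn.mem_smoothLocus (V := ⊤) (by simpa using h.smooth) trivial

theorem mono {N' : Set X} (h : IsTest d f N) (hN : N ⊆ N') : IsTest d f N' :=
  ⟨h.smooth, h.cpt, h.sub.trans hN⟩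

theorem eventually_zero {x : X} (hx : x ∉ tsupport f) : ∀ᶠ y in 𝓝 x, f y = 0 :=
  notMem_tsupport_iff_eventuallyEq.1 hx

theorem apply_zero (h : IsTest d f N) {x : X} (hx : x ∉ N) : f x = 0 :=
  image_eq_zero_of_notMem_tsupport fun h' => hx (h.sub h')

theorem ev_zero (h : IsTest d f N) {W : Opens X} (P : LocOp d W) {x : X} (hx : x ∉ N) :
    P.ev f x = 0 :=
  P.ev_eq_zero (eventually_zero fun h' => hx (h.sub h'))

/-- At points of K smoothness comes from the open set N. Off K the function vanishes on a whole
neighbourhood, since compact sets in a Hausdorff space are closed. -/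
theorem of_smoothOn [T2Space X] {N : Opens X} (hf : SmoothOn d f N) {K : Set X} (hK : IsCompact K)
    (hKN : K ⊆ N) (h0 : ∀ x ∉ K, f x = 0) : IsTest d f N := by
  have hsupp : tsupport f ⊆ K :=
    closure_minimal (fun _ hx => by_contra fun h => hx (h0 _ h)) hK.isClosed
  refine ⟨fun x _ => ?_, hK.of_isClosed_subset (isClosed_tsupport f) hsupp, hsupp.trans hKN⟩
  by_cases hx : x ∈ K
  · exact ((hf x (hKN hx)).contMDiffAt (N.2.mem_nhds (hKN hx))).contMDiffWithinAt
  · have h1 : f =ᶠ[𝓝 x] fun _ => 0 := by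
      filter_upwards [hK.isClosed.isOpen_compl.mem_nhds hx] with y hy using h0 y hy
    exact ((contMDiffAt_const (c := (0 : ℂ))).congr_of_eventuallyEq h1).contMDiffWithinAt

theorem mul_right [T2Space X] {N : Opens X} (hf : IsTest d f N) (hg : SmoothOn d g N) :
    IsTest d (fun y => f y * g y) N :=
  of_smoothOn (SmoothOn.mul d (hf.smooth.mono (subset_univ _)) hg) hf.cpt hf.sub fun x hx => by
    rw [image_eq_zero_of_notMem_tsupport hx, zero_mul]

theorem mul_left [T2Space X] {N : Opens X} (hf : SmoothOn d f N) (hg : IsTest d g N) :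
    IsTest d (fun y => f y * g y) N := by
  simpa only [mul_comm] using hg.mul_right hf

theorem ev [T2Space X] {N W : Opens X} (hf : IsTest d f N) (P : LocOp d W) (hN : N ≤ W) :
    IsTest d (P.ev f) N :=
  of_smoothOn (P.smoothOn_ev hN (hf.smooth.mono (subset_univ _))) hf.cpt hf.sub fun _ hx =>
    P.ev_eq_zero (eventually_zero hx)

theorem add (hf : IsTest d f N) (hg : IsTest d g N) : IsTest d (fun y => f y + g y) N :=
  ⟨hf.smooth.add hg.smooth, hf.cpt.add hg.cpt, (tsupport_add f g).trans (union_subset hf.sub hg.sub)⟩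

theorem const_mul (c : ℂ) (hf : IsTest d f N) : IsTest d (fun y => c * f y) N :=
  ⟨SmoothOn.mul d (smoothOn_const c _) hf.smooth, hf.cpt.mul_left,
    (tsupport_mul_subset_right).trans hf.sub⟩

end IsTest

/-- The integral of a function over the domain of the chart `a`, for Lebesgue measure in the
coordinates of `a`. -/
def cint (a : Chart d X) (F : X → ℂ) : ℂ := ∫ v in a.1.target, F (a.1.symm v)

/-- A function in the coordinates of a chart, extended by zero. -/
def inChart (a : Chart d X) (F : X → ℂ) : Cn d → ℂ :=
  Set.indicator a.1.target (F ∘ a.1.symm)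

theorem cint_eq (a : Chart d X) (F : X → ℂ) : cint a F = ∫ v, inChart a F v :=
  (integral_indicator a.1.open_target.measurableSet).symm

theorem cint_congr (a : Chart d X) {F G : X → ℂ} (h : ∀ x ∈ a.1.source, F x = G x) :
    cint a F = cint a G :=
  setIntegral_congr_fun a.1.open_target.measurableSet fun _ hv => h _ (a.1.map_target hv)

theorem inChart_cpt (a : Chart d X) {F : X → ℂ} (hF : IsTest d F a.1.source) :
    HasCompactSupport (inChart a F) := by
  have hK : IsCompact (a.1 '' tsupport F) := hF.cpt.isCompact.image_of_continuousOn
    (a.1.continuousOn.mono hF.sub)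
  refine HasCompactSupport.intro hK fun v hv => ?_
  by_cases h : v ∈ a.1.target
  · rw [inChart, Set.indicator_of_mem h]
    refine image_eq_zero_of_notMem_tsupport (f := F) fun h' => hv ⟨_, h', a.1.right_inv h⟩
  · exact Set.indicator_of_notMem h _

variable [IsManifold 𝓘(ℂ, Cn d) ω X]

/-- Extension by zero stays smooth because the image of the support is compact, hence closed in ℂ^d,
and lies inside the open target of the chart. -/
theorem inChart_contDiff (a : Chart d X) {F : X → ℂ} (hF : IsTest d F a.1.source) :
    ContDiff ℝ ∞ (inChart a F) := by
  have hK : IsCompact (a.1 '' tsupport F) := hF.cpt.isCompact.image_of_continuousOn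
    (a.1.continuousOn.mono hF.sub)
  refine contDiff_iff_contDiffAt.2 fun v => ?_
  by_cases h : v ∈ a.1.target
  · have h1 := a.contDiffAt (a.1.map_target h) (hF.mem_smoothLocus (a.1.symm v))
    rw [a.1.right_inv h] at h1
    refine h1.congr_of_eventuallyEq ?_
    filter_upwards [a.1.open_target.mem_nhds h] with w hw using Set.indicator_of_mem hw _
  · refine (contDiffAt_const (c := (0 : ℂ))).congr_of_eventuallyEq ?_
    have hv : v ∉ a.1 '' tsupport F := by
      rintro ⟨x, hx, rfl⟩
      exact h (a.1.map_source (hF.sub hx))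
    filter_upwards [hK.isClosed.isOpen_compl.mem_nhds hv] with w hw
    by_cases hw' : w ∈ a.1.target
    · rw [inChart, Set.indicator_of_mem hw']
      exact image_eq_zero_of_notMem_tsupport (f := F) fun h' => hw ⟨_, h', a.1.right_inv hw'⟩
    · exact Set.indicator_of_notMem hw' _

theorem inChart_integrable (a : Chart d X) {F : X → ℂ} (hF : IsTest d F a.1.source) :
    Integrable (inChart a F) :=
  (inChart_contDiff a hF).continuous.integrable_of_hasCompactSupport (inChart_cpt a hF)

theorem cint_add (a : Chart d X) {F G : X → ℂ} (hF : IsTest d F a.1.source)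
    (hG : IsTest d G a.1.source) : cint a (fun y => F y + G y) = cint a F + cint a G := by
  rw [cint_eq, cint_eq, cint_eq, ← integral_add (inChart_integrable a hF) (inChart_integrable a hG)]
  congr 1
  exact Set.indicator_add _ _ _

theorem cint_const_mul (a : Chart d X) (c : ℂ) (F : X → ℂ) :
    cint a (fun y => c * F y) = c * cint a F :=
  integral_const_mul c _

theorem cint_sum (a : Chart d X) {ι : Type*} (s : Finset ι) {F : ι → X → ℂ}
    (hF : ∀ i ∈ s, IsTest d (F i) a.1.source) :
    cint a (fun y => ∑ i ∈ s, F i y) = ∑ i ∈ s, cint a (F i) := by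
  simp only [cint_eq]
  rw [← integral_finsetSum s fun i hi => inChart_integrable a (hF i hi)]
  congr 1
  funext v
  by_cases hv : v ∈ a.1.target <;> simp [inChart, hv]

/-- The integral over ℂ^d of a directional derivative of a compactly supported function is zero, and
∂/∂z_j is a combination of two real directional derivatives. This is the only analytic input to the
adjointness of transposes. -/
theorem cint_wirtinger (a : Chart d X) (j : Fin d) {F : X → ℂ} (hF : IsTest d F a.1.source) :
    cint a (wirtinger d a j F) = 0 := by
  set G := inChart a F with hG
  have hc := inChart_contDiff a hF
  have hcs := inChart_cpt a hF
  have hfd : Continuous (fderiv ℝ G) := hc.continuous_fderiv (by simp)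
  have hi : ∀ u : Cn d, Integrable (fun v => fderiv ℝ G v u) := fun u =>
    (hfd.clm_apply continuous_const).integrable_of_hasCompactSupport (hcs.fderiv_apply ℝ u)
  have h0 : ∀ u : Cn d, ∫ v, fderiv ℝ G v u = 0 := by
    intro u
    -- Integration by parts against the constant function 1.
    have h := integral_mul_fderiv_eq_neg_fderiv_mul_of_integrable (μ := (volume : Measure (Cn d)))
      (f := fun _ : Cn d => (1 : ℂ)) (g := G) (v := u) (by simp) (by simpa using hi u)
      (by simpa using inChart_integrable a hF) (fun x _ => differentiableAt_const _)
      (fun x _ => hc.differentiable (by simp) x)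
    simpa using h
  have h1 : cint a (wirtinger d a j F) = ∫ v in a.1.target, (1 / 2 : ℂ) * (fderiv ℝ G v (Pi.single j 1) -
      Complex.I * fderiv ℝ G v (Pi.single j Complex.I)) := by
    refine setIntegral_congr_fun a.1.open_target.measurableSet fun v hv => ?_
    have e : F ∘ a.1.symm =ᶠ[𝓝 v] G := by
      filter_upwards [a.1.open_target.mem_nhds hv] with w hw using (Set.indicator_of_mem hw _).symm
    simp only [wirtinger, a.1.right_inv hv, e.fderiv_eq]
  -- The support of G lies in the target of the chart, so the integral over the target is an
  -- integral over all of ℂ^d.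
  have h2 : ∀ v ∉ a.1.target, (1 / 2 : ℂ) * (fderiv ℝ G v (Pi.single j 1) -
      Complex.I * fderiv ℝ G v (Pi.single j Complex.I)) = 0 := by
    intro v hv
    have hvs : v ∉ tsupport G := by
      have hK : IsCompact (a.1 '' tsupport F) := hF.cpt.isCompact.image_of_continuousOn
        (a.1.continuousOn.mono hF.sub)
      have : tsupport G ⊆ a.1 '' tsupport F := closure_minimal (fun w hw => by
        by_contra hw'
        refine hw ?_
        by_cases h : w ∈ a.1.target
        · rw [hG, inChart, Set.indicator_of_mem h]
          exact image_eq_zero_of_notMem_tsupport (f := F) fun h' => hw' ⟨_, h', a.1.right_inv h⟩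
        · exact Set.indicator_of_notMem h _) hK.isClosed
      intro h
      obtain ⟨x, hx, rfl⟩ := this h
      exact hv (a.1.map_source (hF.sub hx))
    have : fderiv ℝ G v = 0 := image_eq_zero_of_notMem_tsupport
      fun h => hvs (tsupport_fderiv_subset ℝ h)
    simp [this]
  rw [h1, setIntegral_eq_integral_of_forall_compl_eq_zero h2, integral_const_mul,
    integral_sub (hi _) ((hi _).const_mul _), integral_const_mul, h0, h0]
  simp

/-- The real determinant of a complex linear map is the norm, from ℂ to ℝ, of its complex
determinant. This is the source of all the factors |J|² below. -/
theorem abs_det_restrictScalars (L : Cn d →L[ℂ] Cn d) :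
    |(L.restrictScalars ℝ).det| = ‖L.det‖ ^ 2 := by
  have h : (L.restrictScalars ℝ).det = Algebra.norm ℝ L.det :=
    LinearMap.det_restrictScalars (R := ℝ) (S := ℂ) (f := (L : Cn d →ₗ[ℂ] Cn d))
  rw [h, Algebra.norm_complex_apply, Complex.normSq_eq_norm_sq, abs_of_nonneg (by positivity)]

/-- The change of variables formula for a change of holomorphic coordinates. -/
theorem cint_change (a b : Chart d X) {F : X → ℂ}
    (hF : ∀ x, ¬ (x ∈ a.1.source ∧ x ∈ b.1.source) → F x = 0) :
    cint a F = cint b (fun y => (‖HolLineBundle.jac b a y‖ ^ 2 : ℝ) * F y) := by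
  set O : Set (Cn d) := (b.1.symm ≫ₕ a.1).source with hO
  have hOo : IsOpen O := (b.1.symm ≫ₕ a.1).open_source
  have hmem : ∀ v, v ∈ O ↔ v ∈ b.1.target ∧ b.1.symm v ∈ a.1.source := by
    intro v; simp [hO]
  set T : Cn d → Cn d := a.1 ∘ b.1.symm with hT
  have hd : ∀ v ∈ O, HasFDerivWithinAt T ((fderiv ℂ T v).restrictScalars ℝ) O v := fun v hv =>
    ((((HolLineBundle.trans_contDiffOn b a).contDiffAt (hOo.mem_nhds hv)).differentiableAt
      (by simp)).hasFDerivAt.restrictScalars ℝ).hasFDerivWithinAt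
  have hinj : InjOn T O := by
    intro v hv w hw h
    have h1 := a.1.injOn ((hmem v).1 hv).2 ((hmem w).1 hw).2 h
    exact b.1.symm.injOn ((hmem v).1 hv).1 ((hmem w).1 hw).1 h1
  have himg : T '' O = {v | v ∈ a.1.target ∧ a.1.symm v ∈ b.1.source} := by
    ext w
    constructor
    · rintro ⟨v, hv, rfl⟩
      obtain ⟨h1, h2⟩ := (hmem v).1 hv
      refine ⟨a.1.map_source h2, ?_⟩
      simpa [hT, a.1.left_inv h2] using b.1.map_target h1
    · rintro ⟨h1, h2⟩
      refine ⟨b.1 (a.1.symm w), (hmem _).2 ⟨b.1.map_source h2, ?_⟩, ?_⟩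
      · rw [b.1.left_inv h2]; exact a.1.map_target h1
      · simp [hT, b.1.left_inv h2, a.1.right_inv h1]
  have key := integral_image_eq_integral_abs_det_fderiv_smul volume hOo.measurableSet hd hinj
    (fun v => F (a.1.symm v))
  -- F vanishes off the overlap of the two charts, so both integrals may be restricted to the
  -- overlap, where T relates the coordinates.
  have e1 : cint a F = ∫ v in T '' O, F (a.1.symm v) := by
    rw [himg]
    refine (setIntegral_eq_of_subset_of_forall_sdiff_eq_zero a.1.open_target.measurableSet
      (fun v hv => hv.1) fun v hv => hF _ fun h => hv.2 ⟨hv.1, h.2⟩)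
  have e2 : cint b (fun y => (‖HolLineBundle.jac b a y‖ ^ 2 : ℝ) * F y) =
      ∫ v in O, (‖HolLineBundle.jac b a (b.1.symm v)‖ ^ 2 : ℝ) * F (b.1.symm v) := by
    refine (setIntegral_eq_of_subset_of_forall_sdiff_eq_zero b.1.open_target.measurableSet
      (fun v hv => ((hmem v).1 hv).1) fun v hv => ?_)
    beta_reduce
    rw [hF _ fun h => hv.2 ((hmem v).2 ⟨hv.1, h.1⟩), mul_zero]
  rw [e1, e2, key]
  refine setIntegral_congr_fun hOo.measurableSet fun v hv => ?_
  obtain ⟨h1, h2⟩ := (hmem v).1 hv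
  simp only [hT, Function.comp_apply, a.1.left_inv h2]
  rw [abs_det_restrictScalars, HolLineBundle.jac, b.1.right_inv h1, Complex.real_smul]

/-- The fundamental lemma of the calculus of variations in a chart. -/
theorem eq_zero_of_cint [T2Space X] (a : Chart d X) {N : Opens X} (hN : (N : Set X) ⊆ a.1.source)
    {H : X → ℂ} (hH : SmoothOn d H N) (h : ∀ f, IsTest d f N → cint a (fun y => f y * H y) = 0) :
    ∀ x ∈ N, H x = 0 := by
  set U : Set (Cn d) := a.1.target ∩ a.1.symm ⁻¹' N with hU
  have hUo : IsOpen U := a.isOpen_preimage d N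
  have hc : ContinuousOn (H ∘ a.1.symm) U := (a.contDiffOn_symm d hH).continuousOn
  have hae := hUo.ae_eq_zero_of_integral_contDiff_smul_eq_zero (μ := (volume : Measure (Cn d)))
    (f := H ∘ a.1.symm) (hc.locallyIntegrableOn hUo.measurableSet) ?_
  · have h1 : EqOn (H ∘ a.1.symm) (fun _ => 0) U := by
      refine Measure.eqOn_open_of_ae_eq (μ := (volume : Measure (Cn d))) ?_ hUo hc continuousOn_const
      exact (ae_restrict_iff' hUo.measurableSet).2 hae
    intro x hx
    have h2 := h1 (x := a.1 x) ⟨a.1.map_source (hN hx), by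
      simpa [a.1.left_inv (hN hx)] using hx⟩
    simpa [a.1.left_inv (hN hx)] using h2
  · intro g hg hgc hgs
    have hR : IsManifold 𝓘(ℝ, Cn d) ∞ X := isManifold_real d
    -- The fundamental lemma on ℂ^d tests with real bump functions g in the coordinates. The
    -- corresponding test function on X is g in the chart, extended by zero.
    set f : X → ℂ := Set.indicator (N : Set X) fun x => ((g (a.1 x) : ℝ) : ℂ) with hf
    have hfs : SmoothOn d f N := by
      refine smoothOn_indicator d (U := N) ?_ Subset.rfl
      have h1 : ContDiff ℝ ∞ fun v : Cn d => ((g v : ℝ) : ℂ) := Complex.ofRealCLM.contDiff.comp hg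
      exact h1.contMDiff.comp_contMDiffOn ((contMDiffOn_of_mem_maximalAtlas a.mem_real).mono hN)
    have hK : IsCompact (a.1.symm '' tsupport g) := hgc.isCompact.image_of_continuousOn
      (a.1.continuousOn_symm.mono fun v hv => (hgs hv).1)
    have hft : IsTest d f N := IsTest.of_smoothOn hfs hK (by
      rintro _ ⟨v, hv, rfl⟩
      exact (hgs hv).2) fun x hx => by
        by_cases hxN : x ∈ N
        · rw [hf, Set.indicator_of_mem (s := (N : Set X)) hxN]
          rw [image_eq_zero_of_notMem_tsupport (f := g) fun h' => hx ⟨_, h', a.1.left_inv (hN hxN)⟩]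
          simp
        · exact Set.indicator_of_notMem (s := (N : Set X)) hxN _
    refine Eq.trans ?_ (h f hft)
    rw [cint, ← setIntegral_eq_integral_of_forall_compl_eq_zero (s := a.1.target)]
    · refine setIntegral_congr_fun a.1.open_target.measurableSet fun v hv => ?_
      simp only [Function.comp_apply, Complex.real_smul]
      by_cases hvN : a.1.symm v ∈ N
      · rw [hf, Set.indicator_of_mem (s := (N : Set X)) hvN, a.1.right_inv hv]
      · rw [hf, Set.indicator_of_notMem (s := (N : Set X)) hvN,
          image_eq_zero_of_notMem_tsupport (f := g) fun h' => hvN (hgs h').2]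
        simp
    · intro v hv
      rw [image_eq_zero_of_notMem_tsupport (f := g) fun h' => hv (hgs h').1, zero_smul]

end TestFunctions

/-! ### Formal transposes: existence, adjointness, change of coordinates -/

section Transposes

variable {d : ℕ} {X : Type*} [TopologicalSpace X] [ChartedSpace (Cn d) X]
  [IsManifold 𝓘(ℂ, Cn d) ω X]

namespace IsTranspose
variable {a b : Chart d X} {W : Opens X} {P P' : LocOp d W}

theorem restr (h : IsTranspose d a P P') :
    ∀ {V : Opens X} (hV : V ≤ W), IsTranspose d a (HomOn.restr hV P) (HomOn.restr hV P') := by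
  induction h with
  | mul f hf =>
    intro V h
    rw [mulOp_restr (hf.smoothOn d) h]
    exact .mul f (hf.mono h)
  | deriv j hW =>
    intro V h
    exact .deriv j (Set.Subset.trans h hW)
  | add _ _ ih1 ih2 => exact fun h => .add (ih1 h) (ih2 h)
  | comp _ _ ih1 ih2 => exact fun h => .comp (ih1 h) (ih2 h)
  | @locally W P P' N hN hx _ ih =>
    intro V h
    exact .locally (fun x => V ⊓ N x) (fun _ _ => inf_le_left) (fun x hxV => ⟨hxV, hx x (h hxV)⟩)
      fun x hxV => ih x (h hxV) (inf_le_right : V ⊓ N x ≤ N x)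

theorem _root_.DPush.IsHolDiffOp.neg {P : LocOp d W} (h : IsHolDiffOp d P) : IsHolDiffOp d (-P) := by
  simpa using h.smul (-1)

theorem isHol (h : IsTranspose d a P P') : IsHolDiffOp d P ∧ IsHolDiffOp d P' := by
  induction h with
  | mul f hf => exact ⟨.mul f hf, .mul f hf⟩
  | deriv j hW => exact ⟨.deriv a j hW, (IsHolDiffOp.deriv a j hW).neg⟩
  | add _ _ ih1 ih2 => exact ⟨ih1.1.add ih2.1, ih1.2.add ih2.2⟩
  | comp _ _ ih1 ih2 => exact ⟨ih1.1.comp ih2.1, ih2.2.comp ih1.2⟩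
  | locally N hN hx _ ih =>
    exact ⟨.locally N hN hx fun x h => (ih x h).1, .locally N hN hx fun x h => (ih x h).2⟩

theorem neg (h : IsTranspose d a P P') : IsTranspose d a (-P) (-P') := by
  have h1 := (IsTranspose.mul (a := a) (W := W) (fun _ => (-1 : ℂ)) contMDiffOn_const).comp h
  rw [mulOp_const_comp] at h1
  -- Transposition reverses products, so the scalar -1 stands to the right of P'; linearity of P'
  -- brings it to the front.
  have h2 : P'.comp (mulOp d (fun _ => (-1 : ℂ)) W) = -P' :=
    LocOp.ext_ev fun x hx F hF => by
      rw [LocOp.comp_ev _ _ hF, LocOp.neg_ev, ← P'.ev_neg hF]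
      refine P'.ev_congr ?_
      filter_upwards [W.2.mem_nhds hx, (smoothLocus d F).2.mem_nhds hF] with y hy hFy
      rw [LocOp.mulOp_ev (smoothOn_const _ _) hy hFy, neg_one_mul]
  rwa [h2, neg_one_smul] at h1

theorem symm (h : IsTranspose d a P P') : IsTranspose d a P' P := by
  induction h with
  | mul f hf => exact .mul f hf
  | deriv j hW => simpa using (IsTranspose.deriv (a := a) j hW).neg
  | add _ _ ih1 ih2 => exact ih1.add ih2
  | comp _ _ ih1 ih2 => exact ih2.comp ih1
  | locally N hN hx _ ih => exact .locally N hN hx ih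

theorem zero : IsTranspose d a (0 : LocOp d W) 0 := by
  have h1 := IsTranspose.mul (a := a) (W := W) (fun _ => (0 : ℂ)) contMDiffOn_const
  have h2 : mulOp d (fun _ => (0 : ℂ)) W = 0 := LocOp.ext_ev fun x hx F hF => by
    rw [LocOp.mulOp_ev (smoothOn_const _ _) hx hF, zero_mul, LocOp.zero_ev]
  rwa [h2] at h1

theorem sum {ι : Type*} (s : Finset ι) {Q Q' : ι → LocOp d W}
    (h : ∀ i ∈ s, IsTranspose d a (Q i) (Q' i)) : IsTranspose d a (∑ i ∈ s, Q i) (∑ i ∈ s, Q' i) := by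
  classical
  induction s using Finset.induction_on with
  | empty => simpa using zero
  | insert i s his ih =>
    rw [Finset.sum_insert his, Finset.sum_insert his]
    exact (h i (Finset.mem_insert_self _ _)).add (ih fun j hj => h j (Finset.mem_insert_of_mem hj))

end IsTranspose

theorem LocOp.sum_ev {W : Opens X} {ι : Type*} (s : Finset ι) (Q : ι → LocOp d W) (F : X → ℂ) (x : X) :
    LocOp.ev (∑ i ∈ s, Q i) F x = ∑ i ∈ s, (Q i).ev F x := by
  classical
  induction s using Finset.induction_on with
  | empty => simp
  | insert i s his ih => rw [Finset.sum_insert his, Finset.sum_insert his, LocOp.add_ev, ih]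

/-- A coordinate vector field in the coordinates of another chart. -/
theorem coordDeriv_change (a b : Chart d X) (j : Fin d) {W : Opens X} (hb : (W : Set X) ⊆ b.1.source)
    (ha : (W : Set X) ⊆ a.1.source) : coordDeriv d b j W hb =
      ∑ i, (mulOp d (wirtinger d b j fun y => a.1 y i) W).comp (coordDeriv d a i W ha) := by
  refine LocOp.ext_ev fun x hx F hF => ?_
  rw [LocOp.coordDeriv_ev b j hb hx hF, LocOp.sum_ev, wirtinger_change a b j (ha hx) (hb hx) hF]
  refine Finset.sum_congr rfl fun i _ => ?_
  rw [LocOp.comp_ev _ _ hF, LocOp.mulOp_ev _ hx (LocOp.mem_smoothLocus_ev _ hx hF),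
    LocOp.coordDeriv_ev a i ha hx hF]
  exact HolOn.smoothOn d (HolOn.wirtinger ((a.coord_hol i).mono ha) b j hb)

/-- Every holomorphic differential operator has, locally, a formal transpose. -/
theorem IsHolDiffOp.exists_transpose (a : Chart d X) {W : Opens X} {P : LocOp d W}
    (hP : IsHolDiffOp d P) : ∀ x ∈ W, x ∈ a.1.source → ∃ (N : Opens X) (hN : N ≤ W)
      (P' : LocOp d N), x ∈ N ∧ IsTranspose d a (HomOn.restr hN P) P' := by
  induction hP with
  | @mul W f hf =>
    intro x hx _
    exact ⟨W, le_rfl, mulOp d f W, hx, .mul f hf⟩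
  | @deriv W b j hW =>
    intro x hx hxa
    have h1 : W ⊓ ⟨a.1.source, a.1.open_source⟩ ≤ W := inf_le_left
    have h2 : ((W ⊓ ⟨a.1.source, a.1.open_source⟩ : Opens X) : Set X) ⊆ a.1.source := inter_subset_right
    -- In the chart a the field is ∑ c_i ∂/∂a_i with c_i the derivatives of the coordinates of a, so
    -- its transpose is ∑ (-∂/∂a_i) ∘ c_i, with the coefficients applied first.
    refine ⟨W ⊓ ⟨a.1.source, a.1.open_source⟩, h1,
      ∑ i, HomOn.comp (-coordDeriv d a i _ h2) (mulOp d (wirtinger d b j fun y => a.1 y i) _),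
      ⟨hx, hxa⟩, ?_⟩
    change IsTranspose d a (coordDeriv d b j _ (Set.Subset.trans h1 hW)) _
    rw [coordDeriv_change a b j (Set.Subset.trans h1 hW) h2]
    refine .sum _ fun i _ => .comp (.mul _ ?_) (.deriv i h2)
    exact HolOn.wirtinger ((a.coord_hol i).mono h2) b j (Set.Subset.trans h1 hW)
  | add _ _ ih1 ih2 =>
    intro x hx hxa
    obtain ⟨N, hN, P', hxN, h⟩ := ih1 x hx hxa
    obtain ⟨M, hM, Q', hxM, h'⟩ := ih2 x hx hxa
    exact ⟨N ⊓ M, inf_le_left.trans hN, _, ⟨hxN, hxM⟩, (h.restr inf_le_left).add (h'.restr inf_le_right)⟩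
  | comp _ _ ih1 ih2 =>
    intro x hx hxa
    obtain ⟨N, hN, P', hxN, h⟩ := ih1 x hx hxa
    obtain ⟨M, hM, Q', hxM, h'⟩ := ih2 x hx hxa
    exact ⟨N ⊓ M, inf_le_left.trans hN, _, ⟨hxN, hxM⟩, (h.restr inf_le_left).comp (h'.restr inf_le_right)⟩
  | locally M hM hxM _ ih =>
    intro x hx hxa
    obtain ⟨N, hN, P', hxN, h⟩ := ih x hx x (hxM x hx) hxa
    exact ⟨N, hN.trans (hM x hx), P', hxN, h⟩

variable [T2Space X]

/-- Formal transposes are adjoint to each other for the integral in the chart. -/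
theorem IsTranspose.pairing {a : Chart d X} {W : Opens X} {P P' : LocOp d W}
    (h : IsTranspose d a P P') : ∀ x ∈ W, x ∈ a.1.source → ∃ N : Opens X, x ∈ N ∧ N ≤ W ∧
      (N : Set X) ⊆ a.1.source ∧ ∀ N' ≤ N, ∀ f g : X → ℂ, SmoothOn d f N' → SmoothOn d g N' →
      (IsTest d f N' ∨ IsTest d g N') →
      cint a (fun y => P.ev f y * g y) = cint a (fun y => f y * P'.ev g y) := by
  -- As soon as one factor is a test function, the product has compact support in N'. This gives the
  -- integrability that additivity of the integral needs, and it lets integrands be compared on N'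
  -- only.
  have prod_test : ∀ {N' W' : Opens X} {f g : X → ℂ} (Q : LocOp d W'), N' ≤ W' → SmoothOn d f N' →
      SmoothOn d g N' → (IsTest d f N' ∨ IsTest d g N') →
      IsTest d (fun y => Q.ev f y * g y) N' := by
    rintro N' W' f g Q hW hf hg (h | h)
    · exact (h.ev Q hW).mul_right hg
    · exact IsTest.mul_left (Q.smoothOn_ev hW hf) h
  have prod_test' : ∀ {N' W' : Opens X} {f g : X → ℂ} (Q : LocOp d W'), N' ≤ W' → SmoothOn d f N' →
      SmoothOn d g N' → (IsTest d f N' ∨ IsTest d g N') →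
      IsTest d (fun y => f y * Q.ev g y) N' := by
    rintro N' W' f g Q hW hf hg (h | h)
    · exact h.mul_right (Q.smoothOn_ev hW hg)
    · exact IsTest.mul_left hf (h.ev Q hW)
  induction h with
  | @mul W m hm =>
    intro x hx hxa
    refine ⟨W ⊓ ⟨a.1.source, a.1.open_source⟩, ⟨hx, hxa⟩, inf_le_left, inter_subset_right,
      fun N' hN' f g hf hg hfg => cint_congr a fun y _ => ?_⟩
    have hW := hN'.trans inf_le_left
    by_cases hy : y ∈ N'
    · rw [LocOp.mulOp_ev (hm.smoothOn d) (hW hy) (hf.mem_smoothLocus hy),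
        LocOp.mulOp_ev (hm.smoothOn d) (hW hy) (hg.mem_smoothLocus hy)]
      ring
    · exact ((prod_test _ hW hf hg hfg).apply_zero hy).trans
        ((prod_test' _ hW hf hg hfg).apply_zero hy).symm
  | @deriv W j hW =>
    intro x hx hxa
    refine ⟨W, hx, le_rfl, hW, fun N' hN' f g hf hg hfg => ?_⟩
    have h1 := (prod_test (coordDeriv d a j W hW) hN' hf hg hfg).mono (Set.Subset.trans hN' hW)
    have h2 := (prod_test' (-coordDeriv d a j W hW) hN' hf hg hfg).mono (Set.Subset.trans hN' hW)
    have h3 : IsTest d (fun y => f y * g y) N' := by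
      rcases hfg with h | h
      · exact h.mul_right hg
      · exact IsTest.mul_left hf h
    -- The integral of ∂_j(f g) vanishes; by the Leibniz rule this is integration by parts.
    have h4 := cint_wirtinger a j (h3.mono (Set.Subset.trans hN' hW))
    have h5 : cint a (wirtinger d a j fun y => f y * g y) =
        cint a (fun y => (coordDeriv d a j W hW).ev f y * g y +
          (-1) * (f y * (-coordDeriv d a j W hW).ev g y)) := by
      refine cint_congr a fun y hya => ?_
      by_cases hy : y ∈ N'
      · rw [LocOp.neg_ev, LocOp.coordDeriv_ev _ _ _ (hN' hy) (hf.mem_smoothLocus hy),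
          LocOp.coordDeriv_ev _ _ _ (hN' hy) (hg.mem_smoothLocus hy),
          wirtinger_mul a j hya (hf.mem_smoothLocus hy) (hg.mem_smoothLocus hy)]
        ring
      · have e1 := (prod_test (coordDeriv d a j W hW) hN' hf hg hfg).apply_zero hy
        have e2 := (prod_test' (-coordDeriv d a j W hW) hN' hf hg hfg).apply_zero hy
        rw [e1, e2, wirtinger_congr a j hya (IsTest.eventually_zero fun h' => hy (h3.sub h')),
          wirtinger_const]
        simp
    rw [h5, cint_add a h1 (h2.const_mul _), cint_const_mul] at h4
    linear_combination h4
  | @add W P P' Q Q' _ _ ih1 ih2 =>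
    intro x hx hxa
    obtain ⟨N, hxN, hNW, hNa, h1⟩ := ih1 x hx hxa
    obtain ⟨M, hxM, hMW, hMa, h2⟩ := ih2 x hx hxa
    refine ⟨N ⊓ M, ⟨hxN, hxM⟩, inf_le_left.trans hNW, Set.Subset.trans inter_subset_left hNa,
      fun N' hN' f g hf hg hfg => ?_⟩
    have hW := (hN'.trans inf_le_left).trans hNW
    have hsub : (N' : Set X) ⊆ a.1.source := Set.Subset.trans (hN'.trans inf_le_left) hNa
    have e1 : cint a (fun y => (P + Q).ev f y * g y) =
        cint a (fun y => P.ev f y * g y + Q.ev f y * g y) :=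
      cint_congr a fun y _ => add_mul _ _ _
    have e2 : cint a (fun y => f y * (P' + Q').ev g y) =
        cint a (fun y => f y * P'.ev g y + f y * Q'.ev g y) :=
      cint_congr a fun y _ => mul_add _ _ _
    rw [e1, e2, cint_add a ((prod_test P hW hf hg hfg).mono hsub) ((prod_test Q hW hf hg hfg).mono hsub),
      cint_add a ((prod_test' P' hW hf hg hfg).mono hsub) ((prod_test' Q' hW hf hg hfg).mono hsub),
      h1 N' (hN'.trans inf_le_left) f g hf hg hfg, h2 N' (hN'.trans inf_le_right) f g hf hg hfg]
  | @comp W P P' Q Q' _ _ ih1 ih2 =>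
    intro x hx hxa
    obtain ⟨N, hxN, hNW, hNa, h1⟩ := ih1 x hx hxa
    obtain ⟨M, hxM, hMW, hMa, h2⟩ := ih2 x hx hxa
    refine ⟨N ⊓ M, ⟨hxN, hxM⟩, inf_le_left.trans hNW, Set.Subset.trans inter_subset_left hNa,
      fun N' hN' f g hf hg hfg => ?_⟩
    have hW := (hN'.trans inf_le_left).trans hNW
    have hQf := Q.smoothOn_ev hW hf
    have hPg := P'.smoothOn_ev hW hg
    -- Operators do not enlarge supports, so whichever factor is a test function remains one after Q
    -- or P' has been applied.
    have hfg1 : IsTest d (Q.ev f) N' ∨ IsTest d g N' := hfg.imp_left fun h => h.ev Q hW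
    have hfg2 : IsTest d f N' ∨ IsTest d (P'.ev g) N' := hfg.imp_right fun h => h.ev P' hW
    have e1 : cint a (fun y => LocOp.ev (P.comp Q) f y * g y) = cint a (fun y => P.ev (Q.ev f) y * g y) := by
      refine cint_congr a fun y _ => ?_
      by_cases hy : y ∈ N'
      · rw [LocOp.comp_ev _ _ (hf.mem_smoothLocus hy)]
      · exact ((prod_test _ hW hf hg hfg).apply_zero hy).trans
          ((prod_test _ hW hQf hg hfg1).apply_zero hy).symm
    have e2 : cint a (fun y => f y * LocOp.ev (Q'.comp P') g y) = cint a (fun y => f y * Q'.ev (P'.ev g) y) := by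
      refine cint_congr a fun y _ => ?_
      by_cases hy : y ∈ N'
      · rw [LocOp.comp_ev _ _ (hg.mem_smoothLocus hy)]
      · exact ((prod_test' _ hW hf hg hfg).apply_zero hy).trans
          ((prod_test' _ hW hf hPg hfg2).apply_zero hy).symm
    rw [e1, e2, h1 N' (hN'.trans inf_le_left) _ g hQf hg hfg1,
      h2 N' (hN'.trans inf_le_right) f _ hf hPg hfg2]
  | @locally W P P' M hM hxM _ ih =>
    intro x hx hxa
    obtain ⟨N, hxN, hNM, hNa, h1⟩ := ih x hx x (hxM x hx) hxa
    refine ⟨N, hxN, hNM.trans (hM x hx), hNa, fun N' hN' f g hf hg hfg => ?_⟩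
    have hMx := hN'.trans hNM
    have hW := hMx.trans (hM x hx)
    have e := h1 N' hN' f g hf hg hfg
    have e1 : cint a (fun y => P.ev f y * g y) =
        cint a (fun y => LocOp.ev (HomOn.restr (hM x hx) P) f y * g y) := by
      refine cint_congr a fun y _ => ?_
      by_cases hy : y ∈ N'
      · rw [P.ev_restr _ _ (hMx hy)]
      · exact ((prod_test _ hW hf hg hfg).apply_zero hy).trans
          ((prod_test _ hMx hf hg hfg).apply_zero hy).symm
    have e2 : cint a (fun y => f y * P'.ev g y) =
        cint a (fun y => f y * LocOp.ev (HomOn.restr (hM x hx) P') g y) := by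
      refine cint_congr a fun y _ => ?_
      by_cases hy : y ∈ N'
      · rw [P'.ev_restr _ _ (hMx hy)]
      · exact ((prod_test' _ hW hf hg hfg).apply_zero hy).trans
          ((prod_test' _ hMx hf hg hfg).apply_zero hy).symm
    rw [e1, e2, e]

/-- Behaviour of the formal transpose under a change of coordinates. -/
theorem IsTranspose.change {a b : Chart d X} {W : Opens X} {P P₁ P₂ : LocOp d W}
    (h₁ : IsTranspose d a P P₁) (h₂ : IsTranspose d b P P₂) {x : X} (hx : x ∈ W)
    (hxa : x ∈ a.1.source) (hxb : x ∈ b.1.source) {g : X → ℂ} (hg : x ∈ smoothLocus d g) :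
    P₁.ev g x = (HolLineBundle.jac b a x)⁻¹ * P₂.ev (fun y => HolLineBundle.jac b a y * g y) x := by
  obtain ⟨N, hxN, hNW, hNa, h1⟩ := h₁.pairing x hx hxa
  obtain ⟨M, hxM, hMW, hMb, h2⟩ := h₂.pairing x hx hxb
  set O : Opens X := N ⊓ (M ⊓ smoothLocus d g) with hO
  have hON : O ≤ N := inf_le_left
  have hOM : O ≤ M := inf_le_right.trans inf_le_left
  have hOW : O ≤ W := hON.trans hNW
  have hxO : x ∈ O := ⟨hxN, hxM, hg⟩
  have hgO : SmoothOn d g O := (smoothOn_smoothLocus g).mono fun y hy => hy.2.2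
  set J : X → ℂ := HolLineBundle.jac b a with hJ
  have hJhol : HolOn d J O := ((HolLineBundle.canonical d X).hol b a).mono
    fun y hy => ⟨hMb (hOM hy), hNa (hON hy)⟩
  have hJ0 : ∀ y ∈ O, J y ≠ 0 := fun y hy =>
    (HolLineBundle.canonical d X).ne_zero b a y (hMb (hOM hy)) (hNa (hON hy))
  have hJg : SmoothOn d (fun y => J y * g y) O := (hJhol.smoothOn d).mul d hgO
  have hrhs : SmoothOn d (fun y => (J y)⁻¹ * P₂.ev (fun y => J y * g y) y) O :=
    ((hJhol.inv hJ0).smoothOn d).mul d (P₂.smoothOn_ev hOW hJg)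
  -- The two sides are compared by pairing with test functions f in the chart a. With J = jac b a,
  -- adjointness and the change of variables give ∫_a f P₁g = ∫_a (P f) g = ∫_b |J|² (P f) g = ∫_b f
  -- P₂(conj J · J g).
  have key := eq_zero_of_cint a (N := O) (Set.Subset.trans hON hNa)
    (H := fun y => P₁.ev g y + (-1) * ((J y)⁻¹ * P₂.ev (fun y => J y * g y) y))
    ((P₁.smoothOn_ev hOW hgO).add ((smoothOn_const _ _).mul d hrhs)) (fun f hf => ?_) x hxO
  · linear_combination key
  · have hfs : SmoothOn d f O := hf.smooth.mono (subset_univ _)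
    have t1 : IsTest d (fun y => f y * P₁.ev g y) O := hf.mul_right (P₁.smoothOn_ev hOW hgO)
    have t2 : IsTest d (fun y => f y * ((J y)⁻¹ * P₂.ev (fun y => J y * g y) y)) O :=
      hf.mul_right hrhs
    have hsub : (O : Set X) ⊆ a.1.source := Set.Subset.trans hON hNa
    have e0 : cint a (fun y => f y * (P₁.ev g y + (-1) * ((J y)⁻¹ * P₂.ev (fun y => J y * g y) y))) =
        cint a (fun y => f y * P₁.ev g y) +
          (-1) * cint a (fun y => f y * ((J y)⁻¹ * P₂.ev (fun y => J y * g y) y)) := by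
      rw [← cint_const_mul, ← cint_add a (t1.mono hsub) ((t2.const_mul _).mono hsub)]
      exact cint_congr a fun y _ => by ring
    have van : ∀ {F : X → ℂ}, IsTest d F O → ∀ y, ¬ (y ∈ a.1.source ∧ y ∈ b.1.source) → F y = 0 :=
      fun hF y hy => hF.apply_zero fun hyO => hy ⟨hsub hyO, hMb (hOM hyO)⟩
    have t3 : IsTest d (fun y => P.ev f y * g y) O := (hf.ev P hOW).mul_right hgO
    have hcJ : SmoothOn d (conjFun J) O := (hJhol.smoothOn d).conj
    have e1 : cint a (fun y => f y * P₁.ev g y) =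
        cint b (fun y => f y * P₂.ev (fun y => conjFun J y * (J y * g y)) y) := by
      rw [← h1 O hON f g hfs hgO (.inl hf), cint_change a b (van t3),
        ← h2 O hOM f _ hfs (hcJ.mul d hJg) (.inl hf)]
      refine cint_congr b fun y _ => ?_
      rw [← hJ, conjFun, ← Complex.normSq_eq_norm_sq, ← Complex.mul_conj]
      ring
    -- The same integral is reached from the right-hand side: P₂ commutes with conj J, and |J|² J⁻¹
    -- = conj J.
    have e2 : cint a (fun y => f y * ((J y)⁻¹ * P₂.ev (fun y => J y * g y) y)) =
        cint b (fun y => f y * P₂.ev (fun y => conjFun J y * (J y * g y)) y) := by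
      rw [cint_change a b (van t2)]
      refine cint_congr b fun y _ => ?_
      by_cases hy : y ∈ O
      · rw [h₂.isHol.2.ev_conj_mul hJhol hy (hJg.mem_smoothLocus hy), ← hJ, conjFun,
          ← Complex.normSq_eq_norm_sq, ← Complex.mul_conj]
        have := hJ0 y hy
        field_simp
      · simp [hf.apply_zero hy]
    rw [e0, e1, e2]
    ring

/-- The relation is generated by rules and is not visibly a function; adjointness makes it one. This
is the change of coordinates with both charts equal, where the Jacobian is 1. -/
theorem IsTranspose.unique {a : Chart d X} {W : Opens X} {P P₁ P₂ : LocOp d W}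
    (h₁ : IsTranspose d a P P₁) (h₂ : IsTranspose d a P P₂) {x : X} (hx : x ∈ W)
    (hxa : x ∈ a.1.source) {g : X → ℂ} (hg : x ∈ smoothLocus d g) : P₁.ev g x = P₂.ev g x := by
  rw [h₁.change h₂ hx hxa hxa hg, HolLineBundle.jac_self a hxa, inv_one, one_mul]
  refine P₂.ev_congr ?_
  filter_upwards [a.1.open_source.mem_nhds hxa] with y hy
  rw [HolLineBundle.jac_self a hy, one_mul]

end Transposes

/-! ### Charts in which the submersion is a projection -/

section AdaptedCharts

/-- Concatenation of tuples as a linear equivalence. -/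
def appendCLE (n k : ℕ) : (Cn n × Cn k) ≃L[ℂ] Cn (n + k) :=
  LinearEquiv.toContinuousLinearEquiv
    { Fin.appendEquiv n k with
      map_add' := fun x y => by
        ext i
        refine Fin.addCases (fun i => ?_) (fun i => ?_) i <;> simp [Fin.appendEquiv]
      map_smul' := fun c x => by
        ext i
        refine Fin.addCases (fun i => ?_) (fun i => ?_) i <;> simp [Fin.appendEquiv] }

variable {n k : ℕ} {Y Z : Type*} [TopologicalSpace Y] [ChartedSpace (Cn n) Y]
  [TopologicalSpace Z] [ChartedSpace (Cn (n + k)) Z]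
  [IsManifold 𝓘(ℂ, Cn (n + k)) ω Z] [IsManifold 𝓘(ℂ, Cn n) ω Y]

/-- A submersion has local charts φ, ψ in which it is the projection ℂ^n × F → ℂ^n. Identifying F
with ℂ^k and applying the transition from ψ to b to the first factor produces base coordinates that
are exactly those of the prescribed chart b. -/
theorem exists_adaptedChart {p : C(Z, Y)}
    (hp : Manifold.IsSubmersion 𝓘(ℂ, Cn (n + k)) 𝓘(ℂ, Cn n) ω p) (z : Z) (b : Chart n Y)
    (hb : p z ∈ b.1.source) :
    ∃ t : AdaptedChart (n := n) (k := k) p, t.b = b ∧ z ∈ t.a.1.source := by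
  obtain ⟨F, _, _, hF⟩ := hp.isSubmersionAt z
  set φ := hF.domChart
  set ψ := hF.codChart
  set A := hF.equiv
  have hφ : φ ∈ IsManifold.maximalAtlas 𝓘(ℂ, Cn (n + k)) ω Z := hF.domChart_mem_maximalAtlas
  have hψ : ψ ∈ IsManifold.maximalAtlas 𝓘(ℂ, Cn n) ω Y := hF.codChart_mem_maximalAtlas
  have hw : ∀ z' ∈ φ.source, (A (φ z')).1 = ψ (p z') := by
    intro z' hz'
    have h1 := hF.writtenInCharts
    have h2 := h1 (x := φ z') (by
      simp only [OpenPartialHomeomorph.extend, modelWithCornersSelf_partialEquiv, PartialEquiv.trans_refl]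
      exact φ.map_source hz')
    refine h2.symm.trans ?_
    change ψ (p (φ.symm (φ z'))) = _
    rw [φ.left_inv hz']
  have : FiniteDimensional ℂ F :=
    Module.Finite.of_surjective (LinearMap.snd ℂ (Cn n) F ∘ₗ A.toLinearEquiv.toLinearMap)
      (fun x => ⟨A.symm (0, x), by simp⟩)
  -- The definition of a submersion only provides some complement F; comparing dimensions in ℂ^(n+k)
  -- ≅ ℂ^n × F shows that it has dimension k.
  have hrank : Module.finrank ℂ F = Module.finrank ℂ (Cn k) := by
    have h1 := A.toLinearEquiv.finrank_eq
    rw [Module.finrank_prod] at h1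
    simp only [Module.finrank_fintype_fun_eq_card, Fintype.card_fin] at h1 ⊢
    omega
  set e : F ≃L[ℂ] Cn k := ContinuousLinearEquiv.ofFinrankEq hrank
  set T : OpenPartialHomeomorph (Cn n) (Cn n) := ψ.symm ≫ₕ b.1 with hT
  have hTd : ContDiffOn ℂ ω T T.source := HolLineBundle.trans_contDiffOn ⟨ψ, hψ⟩ b
  have hTd' : ContDiffOn ℂ ω T.symm T.target := by
    have h := HolLineBundle.trans_contDiffOn b ⟨ψ, hψ⟩
    exact h
  set G := T.prod (OpenPartialHomeomorph.refl (Cn k)) with hG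
  set B : Cn (n + k) ≃L[ℂ] Cn n × Cn k := A.trans ((ContinuousLinearEquiv.refl ℂ (Cn n)).prodCongr e)
  set a' : OpenPartialHomeomorph Z (Cn (n + k)) :=
    ((φ.transHomeomorph B.toHomeomorph) ≫ₕ G).transHomeomorph (appendCLE n k).toHomeomorph
  have hsrc : ∀ z', z' ∈ a'.source ↔ z' ∈ φ.source ∧ p z' ∈ b.1.source := by
    intro z'
    have h0 : z' ∈ a'.source ↔ z' ∈ φ.source ∧ (A (φ z')).1 ∈ ψ.target ∧
        ψ.symm (A (φ z')).1 ∈ b.1.source := by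
      simp [a', G, T, B]
    rw [h0]
    refine and_congr_right fun hz' => ?_
    have hpz : p z' ∈ ψ.source := hF.source_subset_preimage_source hz'
    rw [hw z' hz', ψ.left_inv hpz]
    exact and_iff_right (ψ.map_source hpz)
  have hval : ∀ z' ∈ φ.source, a' z' = Fin.append (b.1 (p z')) (e (A (φ z')).2) := by
    intro z' hz'
    have hpz : p z' ∈ ψ.source := hF.source_subset_preimage_source hz'
    have h0 : a' z' = Fin.append (b.1 (ψ.symm (A (φ z')).1)) (e (A (φ z')).2) := rfl
    rw [h0, hw z' hz', ψ.left_inv hpz]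
  have ha' : a' ∈ IsManifold.maximalAtlas 𝓘(ℂ, Cn (n + k)) ω Z := by
    refine OpenPartialHomeomorph.mem_maximalAtlas_of_contMDiffOn a' ?_ ?_
    · have h1 : ContDiffOn ℂ ω (fun v => appendCLE n k (G (B v))) (B ⁻¹' G.source) :=
        (appendCLE n k).contDiff.comp_contDiffOn
          (ContDiffOn.comp (hTd.prodMap contDiffOn_id) B.contDiff.contDiffOn fun v hv => hv)
      refine h1.contMDiffOn.comp ((contMDiffOn_of_mem_maximalAtlas hφ).mono ?_) ?_
      · exact fun z' hz' => ((hsrc z').1 hz').1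
      · intro z' hz'
        exact hz'.2
    · have h1 : ContDiffOn ℂ ω (fun v => B.symm (G.symm ((appendCLE n k).symm v)))
          ((appendCLE n k).symm ⁻¹' G.target) :=
        B.symm.contDiff.comp_contDiffOn
          (ContDiffOn.comp (hTd'.prodMap contDiffOn_id) (appendCLE n k).symm.contDiff.contDiffOn
            fun v hv => hv)
      refine (contMDiffOn_symm_of_mem_maximalAtlas hφ).comp (h1.contMDiffOn.mono ?_) ?_
      · intro v hv
        exact hv.1
      · intro v hv
        exact hv.2
  refine ⟨⟨⟨a', ha'⟩, b, fun z' hz' => ((hsrc z').1 hz').2, fun z' hz' j => ?_⟩, rfl,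
    (hsrc z).2 ⟨hF.mem_domChart_source, hb⟩⟩
  change a' z' _ = _
  rw [hval z' ((hsrc z').1 hz').1, Fin.append_left]

theorem contMDiff_real {p : Z → Y} (hp : ContMDiff 𝓘(ℂ, Cn (n + k)) 𝓘(ℂ, Cn n) ω p) :
    ContMDiff 𝓘(ℝ, Cn (n + k)) 𝓘(ℝ, Cn n) ∞ p := by
  intro x
  have h1 := hp x
  rw [contMDiffAt_iff] at h1 ⊢
  refine ⟨h1.1, ?_⟩
  have h2 : ContDiffWithinAt ℝ ω _ _ _ := h1.2.restrict_scalars ℝ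
  exact h2.of_le le_top

theorem SmoothOn.comp_map {p : Z → Y} (hp : ContMDiff 𝓘(ℂ, Cn (n + k)) 𝓘(ℂ, Cn n) ω p) {f : Y → ℂ}
    {B : Set Y} (hf : SmoothOn n f B) : SmoothOn (n + k) (f ∘ p) (p ⁻¹' B) :=
  ContMDiffOn.comp hf (contMDiff_real hp).contMDiffOn fun _ h => h

theorem smoothLocus_comp {p : C(Z, Y)} (hp : ContMDiff 𝓘(ℂ, Cn (n + k)) 𝓘(ℂ, Cn n) ω p) {f : Y → ℂ}
    {z : Z} (hf : p z ∈ smoothLocus n f) : z ∈ smoothLocus (n + k) (f ∘ p) :=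
  SmoothOn.mem_smoothLocus (V := Opens.comap p (smoothLocus n f))
    ((smoothOn_smoothLocus f).comp_map hp) hf

namespace AdaptedChart
variable {p : C(Z, Y)} (t : AdaptedChart (n := n) (k := k) p)

/-- The projection to the base coordinates. -/
def baseCLM (n k : ℕ) : Cn (n + k) →L[ℂ] Cn n :=
  (ContinuousLinearMap.fst ℂ (Cn n) (Cn k)).comp (appendCLE n k).symm.toContinuousLinearMap

theorem baseCLM_apply (v : Cn (n + k)) (j : Fin n) : baseCLM n k v j = v (Fin.castAdd k j) := rfl

theorem base_eq {z : Z} (hz : z ∈ t.a.1.source) : baseCLM n k (t.a.1 z) = t.b.1 (p z) :=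
  funext fun j => t.proj z hz j

/-- In adapted coordinates f ∘ p is f composed with a linear projection. Hence base derivatives of f
∘ p are those of f, and fiber derivatives vanish. -/
theorem fderiv_pullback (f : Y → ℂ) {z : Z} (hz : z ∈ t.a.1.source) (hf : p z ∈ smoothLocus n f) :
    fderiv ℝ ((f ∘ p) ∘ t.a.1.symm) (t.a.1 z) =
      (fderiv ℝ (f ∘ t.b.1.symm) (t.b.1 (p z))).comp ((baseCLM n k).restrictScalars ℝ) := by
  have h1 : (f ∘ p) ∘ t.a.1.symm =ᶠ[𝓝 (t.a.1 z)]
      (f ∘ t.b.1.symm) ∘ ((baseCLM n k).restrictScalars ℝ) := by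
    filter_upwards [t.a.1.open_target.mem_nhds (t.a.1.map_source hz)] with v hv
    have h2 := t.a.1.map_target hv
    have h3 := t.base_eq h2
    rw [t.a.1.right_inv hv] at h3
    simp only [Function.comp_apply, ContinuousLinearMap.coe_restrictScalars', h3,
      t.b.1.left_inv (t.mapsTo _ h2)]
  have h4 := t.b.differentiableAt' (t.mapsTo z hz) hf
  rw [← t.base_eq hz] at h4 ⊢
  rw [h1.fderiv_eq]
  exact (h4.hasFDerivAt.comp _ ((baseCLM n k).restrictScalars ℝ).hasFDerivAt).fderiv

theorem wirtinger_base (f : Y → ℂ) {z : Z} (hz : z ∈ t.a.1.source) (hf : p z ∈ smoothLocus n f)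
    (j : Fin n) : wirtinger (n + k) t.a (Fin.castAdd k j) (f ∘ p) z = wirtinger n t.b j f (p z) := by
  rw [wirtinger_eq_linPart, wirtinger_eq_linPart, t.fderiv_pullback f hz hf]
  have h : baseCLM n k (Pi.single (Fin.castAdd k j) 1) = Pi.single j 1 := by
    ext i
    rw [baseCLM_apply]
    by_cases h : i = j <;> simp [h]
  simp only [linPart, ContinuousLinearMap.comp_apply, ContinuousLinearMap.coe_restrictScalars',
    map_smul, h]

theorem wirtinger_fiber (f : Y → ℂ) {z : Z} (hz : z ∈ t.a.1.source) (hf : p z ∈ smoothLocus n f)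
    (j : Fin k) : wirtinger (n + k) t.a (Fin.natAdd n j) (f ∘ p) z = 0 := by
  rw [wirtinger_eq_linPart, t.fderiv_pullback f hz hf]
  have h : baseCLM n k (Pi.single (Fin.natAdd n j) 1) = 0 := by
    ext i
    rw [baseCLM_apply]
    have : Fin.castAdd k i ≠ Fin.natAdd n j := by
      intro h
      have := congrArg Fin.val h
      simp at this
      omega
    simp [this]
  simp [linPart, h]

end AdaptedChart

end AdaptedCharts

/-! ### Iterated derivatives and exponentials as joint eigenfunctions -/

section IteratedDerivatives

variable {d : ℕ} {X : Type*} [TopologicalSpace X] [ChartedSpace (Cn d) X]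

/-- Iterated partial derivatives in the chart `a`, indexed by words. -/
def iterD (a : Chart d X) : List (Fin d) → (X → ℂ) → X → ℂ
  | [], f => f
  | j :: w, f => wirtinger d a j (iterD a w f)

variable [IsManifold 𝓘(ℂ, Cn d) ω X]

theorem iterD_mem_smoothLocus (a : Chart d X) (w : List (Fin d)) {f : X → ℂ} {x : X}
    (hx : x ∈ a.1.source) (hf : x ∈ smoothLocus d f) : x ∈ smoothLocus d (iterD a w f) := by
  induction w with
  | nil => exact hf
  | cons j w ih => exact wirtinger_mem_smoothLocus a j hx ih

theorem iterD_congr (a : Chart d X) (w : List (Fin d)) {f g : X → ℂ} {x : X} (hx : x ∈ a.1.source)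
    (h : f =ᶠ[𝓝 x] g) : iterD a w f =ᶠ[𝓝 x] iterD a w g := by
  induction w with
  | nil => exact h
  | cons j w ih =>
    filter_upwards [ih.eventuallyEq_nhds, a.1.open_source.mem_nhds hx] with y hy hys
    exact wirtinger_congr a j hys hy

/-- Partial derivatives commute, so a word only matters up to permutation and stands for a
multi-index. -/
theorem iterD_perm (a : Chart d X) {w w' : List (Fin d)} (h : w.Perm w') :
    ∀ {f : X → ℂ} {x : X}, x ∈ a.1.source → x ∈ smoothLocus d f → iterD a w f x = iterD a w' f x := by
  induction h with
  | nil => exact fun _ _ => rfl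
  | cons j _ ih =>
    intro f x hx hf
    refine wirtinger_congr a j hx ?_
    filter_upwards [a.1.open_source.mem_nhds hx, (smoothLocus d f).2.mem_nhds hf] with y hy hyf
    exact ih hy hyf
  | swap i j w =>
    intro f x hx hf
    exact wirtinger_comm a j i hx (iterD_mem_smoothLocus a w hx hf)
  | trans _ _ ih1 ih2 =>
    intro f x hx hf
    exact (ih1 hx hf).trans (ih2 hx hf)

/-- The iterated partial derivative as an operator. -/
def iterOp (a : Chart d X) (W : Opens X) (hW : (W : Set X) ⊆ a.1.source) : List (Fin d) → LocOp d W
  | [] => HomOn.one _ W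
  | j :: w => (coordDeriv d a j W hW).comp (iterOp a W hW w)

theorem iterOp_isHol (a : Chart d X) {W : Opens X} (hW : (W : Set X) ⊆ a.1.source)
    (w : List (Fin d)) : IsHolDiffOp d (iterOp a W hW w) := by
  induction w with
  | nil => exact isHolDiffOp_one W
  | cons j w ih => exact (IsHolDiffOp.deriv a j hW).comp ih

theorem iterOp_ev (a : Chart d X) {W : Opens X} (hW : (W : Set X) ⊆ a.1.source) (w : List (Fin d)) :
    ∀ {f : X → ℂ} {x : X}, x ∈ W → x ∈ smoothLocus d f →
      (iterOp a W hW w).ev f x = iterD a w f x := by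
  induction w with
  | nil => exact fun hx hf => LocOp.one_ev hx hf
  | cons j w ih =>
    intro f x hx hf
    refine (LocOp.comp_ev _ _ hf).trans ?_
    rw [LocOp.coordDeriv_ev a j hW hx (LocOp.mem_smoothLocus_ev _ hx hf)]
    refine wirtinger_congr a j (hW hx) ?_
    filter_upwards [W.2.mem_nhds hx, (smoothLocus d f).2.mem_nhds hf] with y hy hyf using ih hy hyf

/-- The iterated derivative is put in the second slot of the relation: the pairing then moves it
from a test function to Q acting on the other factor. -/
theorem iterD_isTranspose (a : Chart d X) {W : Opens X} (hW : (W : Set X) ⊆ a.1.source)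
    (w : List (Fin d)) : ∃ Q : LocOp d W, IsTranspose d a Q (iterOp a W hW w) := by
  induction w with
  | nil =>
    have h : (mulOp d (fun _ => 1) W : LocOp d W) = HomOn.one _ W :=
      LocOp.ext_ev fun x hx F hF => by
        rw [LocOp.mulOp_ev (smoothOn_const _ _) hx hF, LocOp.one_ev hx hF, one_mul]
    have h1 := IsTranspose.mul (a := a) (W := W) (fun _ => (1 : ℂ)) contMDiffOn_const
    rw [h] at h1
    exact ⟨_, h1⟩
  | cons j w ih =>
    obtain ⟨Q, hQ⟩ := ih
    exact ⟨_, hQ.comp ((IsTranspose.deriv (a := a) j hW).symm)⟩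

/-- The exponential function with frequency `l` in the coordinates of `a`. -/
def chartExp (a : Chart d X) (l : Fin d → ℂ) (x : X) : ℂ := Complex.exp (∑ j, l j * a.1 x j)

theorem chartExp_hol (a : Chart d X) (l : Fin d → ℂ) : HolOn d (chartExp a l) a.1.source := by
  have h1 : ContDiff ℂ ω (fun v : Cn d => Complex.exp (∑ j, l j * v j)) :=
    Complex.contDiff_exp.comp (ContDiff.sum fun j _ => contDiff_const.mul (contDiff_apply ℂ ℂ j))
  exact h1.contMDiff.comp_contMDiffOn (contMDiffOn_of_mem_maximalAtlas a.2)

theorem chartExp_mem_smoothLocus (a : Chart d X) (l : Fin d → ℂ) {x : X} (hx : x ∈ a.1.source) :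
    x ∈ smoothLocus d (chartExp a l) :=
  SmoothOn.mem_smoothLocus (V := ⟨a.1.source, a.1.open_source⟩) ((chartExp_hol a l).smoothOn d) hx

theorem chartExp_ne_zero (a : Chart d X) (l : Fin d → ℂ) (x : X) : chartExp a l x ≠ 0 :=
  Complex.exp_ne_zero _

theorem wirtinger_chartExp (a : Chart d X) (l : Fin d → ℂ) (j : Fin d) {x : X} (hx : x ∈ a.1.source) :
    wirtinger d a j (chartExp a l) x = l j * chartExp a l x := by
  have h1 : HasFDerivAt (fun v : Cn d => ∑ j, l j * v j)
      (∑ j, l j • ContinuousLinearMap.proj (R := ℂ) (φ := fun _ : Fin d => ℂ) j) (a.1 x) := by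
    refine HasFDerivAt.fun_sum fun j _ => ?_
    exact (hasFDerivAt_apply (𝕜 := ℂ) j (a.1 x)).const_mul (l j)
  have h2 := h1.cexp
  have h3 : chartExp a l ∘ a.1.symm =ᶠ[𝓝 (a.1 x)] fun v => Complex.exp (∑ j, l j * v j) := by
    filter_upwards [a.1.open_target.mem_nhds (a.1.map_source hx)] with v hv
    simp only [Function.comp_apply, chartExp, a.1.right_inv hv]
  have h4 := h2.congr_of_eventuallyEq h3
  rw [wirtinger_of_hol a j h4.differentiableAt, h4.fderiv]
  simp [chartExp, Pi.single_apply, mul_comm]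

/-- Exponentials are joint eigenfunctions of the partial derivatives, with a monomial in the
frequencies as eigenvalue. Varying l therefore recovers the symbol of an operator with constant or
frozen coefficients. -/
theorem iterD_chartExp (a : Chart d X) (l : Fin d → ℂ) (w : List (Fin d)) :
    ∀ {x : X}, x ∈ a.1.source → iterD a w (chartExp a l) x = (w.map l).prod * chartExp a l x := by
  induction w with
  | nil => intro x _; simp [iterD]
  | cons j w ih =>
    intro x hx
    have h1 : iterD a w (chartExp a l) =ᶠ[𝓝 x] fun y => (w.map l).prod * chartExp a l y := by
      filter_upwards [a.1.open_source.mem_nhds hx] with y hy using ih hy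
    have h2 := wirtinger_mul a j hx (smoothLocus_const (d := d) (w.map l).prod x)
      (chartExp_mem_smoothLocus a l hx)
    change wirtinger d a j (iterD a w (chartExp a l)) x = _
    rw [wirtinger_congr a j hx h1, h2, wirtinger_const, wirtinger_chartExp a l j hx]
    simp
    ring

end IteratedDerivatives

/-! ### Symbols as polynomials -/

section Symbols

/-- The polynomial `∑ c_e X^{w_e}` of a list of coefficients and words. -/
def symbolPoly {m : ℕ} (L : List (ℂ × List (Fin m))) : MvPolynomial (Fin m) ℂ :=
  (L.map fun e => MvPolynomial.monomial (Multiset.toFinsupp (e.2 : Multiset (Fin m))) e.1).sum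

theorem eval_symbolPoly {m : ℕ} (L : List (ℂ × List (Fin m))) (l : Fin m → ℂ) :
    MvPolynomial.eval l (symbolPoly L) = (L.map fun e => e.1 * (e.2.map l).prod).sum := by
  induction L with
  | nil => simp [symbolPoly]
  | cons e L ih =>
    have h : symbolPoly (e :: L) = MvPolynomial.monomial
      (Multiset.toFinsupp (e.2 : Multiset (Fin m))) e.1 + symbolPoly L := by simp [symbolPoly]
    rw [h, map_add, ih, List.map_cons, List.sum_cons, MvPolynomial.eval_monomial]
    congr 2
    rw [Finsupp.prod, Multiset.toFinsupp_support]
    simp only [Multiset.toFinsupp_apply]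
    rw [← Finset.prod_multiset_map_count]
    simp

/-- A linear functional on polynomials with prescribed values on monomials. -/
def monomialFunctional {m : ℕ} (T : List (Fin m) → ℂ) : MvPolynomial (Fin m) ℂ →ₗ[ℂ] ℂ :=
  (MvPolynomial.basisMonomials (Fin m) ℂ).constr ℂ fun s => T (Finsupp.toMultiset s).toList

/-- The sum ∑ c_e T(w_e) depends only on the symbol polynomial when T is invariant under
permutations. In particular it vanishes when the symbol does, even if the words in the list are
repeated or permuted. -/
theorem monomialFunctional_symbolPoly {m : ℕ} {T : List (Fin m) → ℂ}
    (hT : ∀ w w' : List (Fin m), w.Perm w' → T w = T w') (L : List (ℂ × List (Fin m))) :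
    monomialFunctional T (symbolPoly L) = (L.map fun e => e.1 * T e.2).sum := by
  induction L with
  | nil => simp [symbolPoly]
  | cons e L ih =>
    have h : symbolPoly (e :: L) = MvPolynomial.monomial
      (Multiset.toFinsupp (e.2 : Multiset (Fin m))) e.1 + symbolPoly L := by simp [symbolPoly]
    have h2 : MvPolynomial.monomial (Multiset.toFinsupp (e.2 : Multiset (Fin m))) e.1 =
        e.1 • MvPolynomial.basisMonomials (Fin m) ℂ (Multiset.toFinsupp (e.2 : Multiset (Fin m))) := by
      rw [MvPolynomial.coe_basisMonomials, MvPolynomial.smul_monomial, smul_eq_mul, mul_one]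
    rw [h, map_add, ih, List.map_cons, List.sum_cons, h2, map_smul, monomialFunctional,
      Module.Basis.constr_basis, smul_eq_mul]
    congr 2
    refine hT _ _ ?_
    rw [← Multiset.coe_eq_coe, Multiset.coe_toList, Multiset.toFinsupp_toMultiset]

end Symbols

/-! ### The ideal 𝒟_Z·Θ_{Z/Y} and normal forms modulo it -/

section VerticalIdeal

variable {n k : ℕ} {Y Z : Type*} [TopologicalSpace Y] [ChartedSpace (Cn n) Y]
  [TopologicalSpace Z] [ChartedSpace (Cn (n + k)) Z]
  [IsManifold 𝓘(ℂ, Cn (n + k)) ω Z] {p : C(Z, Y)}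

theorem IsVertical.restr {V : Opens Z} {ξ : LocOp (n + k) V} (h : IsVertical (n := n) p ξ)
    {V' : Opens Z} (hV : V' ≤ V) : IsVertical (n := n) p (HomOn.restr hV ξ) where
  isHol := h.isHol.restr hV
  leibniz N hN f g q hq z := h.leibniz N (hN.trans hV) f g q hq z
  kills N hN B f q hNB hq := h.kills N (hN.trans hV) B f q hNB hq

namespace InVertIdeal

theorem isHol {V : Opens Z} {P : LocOp (n + k) V} (h : InVertIdeal (n := n) p P) :
    IsHolDiffOp (n + k) P := by
  induction h with
  | comp hP hξ => exact hP.comp hξ.isHol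
  | add _ _ ih1 ih2 => exact ih1.add ih2
  | locally N hN hz _ ih => exact .locally N hN hz ih

theorem restr {V : Opens Z} {P : LocOp (n + k) V} (h : InVertIdeal (n := n) p P) :
    ∀ {V' : Opens Z} (hV : V' ≤ V), InVertIdeal (n := n) p (HomOn.restr hV P) := by
  induction h with
  | comp hP hξ => exact fun hV => .comp (hP.restr hV) (hξ.restr hV)
  | add _ _ ih1 ih2 => exact fun hV => .add (ih1 hV) (ih2 hV)
  | @locally V P N hN hz _ ih =>
    intro V' hV
    exact .locally (fun z => V' ⊓ N z) (fun _ _ => inf_le_left) (fun z h => ⟨h, hz z (hV h)⟩)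
      fun z h => ih z (hV h) (inf_le_right : V' ⊓ N z ≤ N z)

theorem comp_left {V : Opens Z} {P : LocOp (n + k) V} (h : InVertIdeal (n := n) p P) :
    ∀ {Q : LocOp (n + k) V}, IsHolDiffOp (n + k) Q → InVertIdeal (n := n) p (HomOn.comp Q P) := by
  induction h with
  | @comp V P ξ hP hξ =>
    intro Q hQ
    have h1 : InVertIdeal (n := n) p (HomOn.comp (HomOn.comp Q P) ξ) := .comp (hQ.comp hP) hξ
    exact h1
  | add _ _ ih1 ih2 =>
    intro Q hQ
    rw [HomOn.comp_add]
    exact .add (ih1 hQ) (ih2 hQ)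
  | @locally V P N hN hz _ ih =>
    intro Q hQ
    exact .locally N hN hz fun z h => ih z h (hQ.restr (hN z h))

theorem neg {V : Opens Z} {P : LocOp (n + k) V} (h : InVertIdeal (n := n) p P) :
    InVertIdeal (n := n) p (-P) := by
  simpa using h.smul (-1)

variable [IsManifold 𝓘(ℂ, Cn n) ω Y]

/-- Elements of the vertical ideal kill functions that are pulled back from the base. -/
theorem ev_comp {V : Opens Z} {P : LocOp (n + k) V} (h : InVertIdeal (n := n) p P)
    (hp : ContMDiff 𝓘(ℂ, Cn (n + k)) 𝓘(ℂ, Cn n) ω p) :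
    ∀ {f : Y → ℂ} {z : Z}, p z ∈ smoothLocus n f → P.ev (f ∘ p) z = 0 := by
  induction h with
  | @comp V P ξ hP hξ =>
    intro f z hf
    rw [LocOp.comp_ev _ _ (smoothLocus_comp hp hf)]
    by_cases hz : z ∈ V
    · refine P.ev_eq_zero ?_
      set B := smoothLocus n f
      set V' : Opens Z := V ⊓ Opens.comap p B
      have hs : SmoothOn (n + k) (f ∘ p) V' :=
        ((smoothOn_smoothLocus f).comp_map hp).mono fun y hy => hy.2
      filter_upwards [V'.2.mem_nhds ⟨hz, hf⟩] with y hy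
      rw [ξ.ev_of_smoothOn inf_le_left hs hy]
      have h0 := hξ.kills V' inf_le_left B ⟨Set.indicator (B : Set Y) f,
        indicator_mem_smoothFun n (smoothOn_smoothLocus f) Subset.rfl⟩
        ⟨Set.indicator (V' : Set Z) (f ∘ p), indicator_mem_smoothFun (n + k) hs le_rfl⟩
        inf_le_right (fun z hz => by
          change Set.indicator (V' : Set Z) (f ∘ p) z = Set.indicator (B : Set Y) f (p z)
          rw [Set.indicator_of_mem (s := (V' : Set Z)) hz, Set.indicator_of_mem (s := (B : Set Y)) hz.2]
          rfl)
      rw [h0]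
      rfl
    · exact P.ev_of_notMem fun h => hz h.1
  | add _ _ ih1 ih2 =>
    intro f z hf
    rw [LocOp.add_ev, ih1 hf, ih2 hf, add_zero]
  | @locally V P N hN hz _ ih =>
    intro f z hf
    by_cases hzV : z ∈ V
    · rw [← P.ev_restr (hN z hzV) _ (hz z hzV), ih z hzV hf]
    · exact P.ev_of_notMem fun h => hzV h.1

end InVertIdeal

variable [IsManifold 𝓘(ℂ, Cn n) ω Y]

namespace AdaptedChart

variable (t : AdaptedChart (n := n) (k := k) p)

theorem fiberDeriv_isVertical (hp : ContMDiff 𝓘(ℂ, Cn (n + k)) 𝓘(ℂ, Cn n) ω p) (j : Fin k)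
    {V : Opens Z} (hV : (V : Set Z) ⊆ t.a.1.source) :
    IsVertical (n := n) p (coordDeriv (n + k) t.a (Fin.natAdd n j) V hV) where
  isHol := .deriv _ _ hV
  leibniz V' h f g q hq z := by
    by_cases hz : z ∈ V'
    · have hf := SmoothOn.mem_smoothLocus f.2.1 hz
      have hg := SmoothOn.mem_smoothLocus g.2.1 hz
      have hqs := SmoothOn.mem_smoothLocus q.2.1 hz
      rw [← LocOp.ev_apply _ h q hz, ← LocOp.ev_apply _ h f hz, ← LocOp.ev_apply _ h g hz,
        LocOp.coordDeriv_ev _ _ hV (h hz) hf, LocOp.coordDeriv_ev _ _ hV (h hz) hg,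
        LocOp.coordDeriv_ev _ _ hV (h hz) hqs, ← wirtinger_mul t.a _ (hV (h hz)) hf hg]
      exact wirtinger_congr _ _ (hV (h hz)) (Filter.Eventually.of_forall hq)
    · have v : ∀ u : smoothFun (n + k) V',
          ((coordDeriv (n + k) t.a (Fin.natAdd n j) V hV).app V' h u).1 z = 0 := fun u =>
        (HomOn.app (F := smoothSheaf (n + k) Z) (G := smoothSheaf (n + k) Z)
          (coordDeriv (n + k) t.a (Fin.natAdd n j) V hV) V' h u : smoothFun (n + k) V').2.2 z hz
      refine (v q).trans ?_
      have h1 := v f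
      have h2 := f.2.2 z hz
      simp only [h1, h2, zero_mul, add_zero]
  kills V' h B f q hB hq := by
    refine smoothFun_ext fun z hz => ?_
    have hf : p z ∈ smoothLocus n f.1 := SmoothOn.mem_smoothLocus f.2.1 (hB hz)
    rw [← LocOp.ev_apply _ h q hz]
    have e : q.1 =ᶠ[𝓝 z] f.1 ∘ p := by
      filter_upwards [V'.2.mem_nhds hz] with y hy using hq y hy
    rw [LocOp.ev_congr _ e, LocOp.coordDeriv_ev _ _ hV (h hz) (smoothLocus_comp hp hf),
      t.wirtinger_fiber _ (hV (h hz)) hf]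
    rfl

/-- Derivatives along the base, as operators on `Z`. -/
abbrev baseOp (W : Opens Z) (hW : (W : Set Z) ⊆ t.a.1.source) (w : List (Fin n)) : LocOp (n + k) W :=
  iterOp t.a W hW (w.map (Fin.castAdd k))

theorem iterD_base (w : List (Fin n)) {f : Y → ℂ} :
    ∀ {z : Z}, z ∈ t.a.1.source → p z ∈ smoothLocus n f →
      iterD t.a (w.map (Fin.castAdd k)) (f ∘ p) z = iterD t.b w f (p z) := by
  induction w with
  | nil => exact fun _ _ => rfl
  | cons j w ih =>
    intro z hz hf
    have e : iterD t.a (w.map (Fin.castAdd k)) (f ∘ p) =ᶠ[𝓝 z] iterD t.b w f ∘ p := by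
      filter_upwards [t.a.1.open_source.mem_nhds hz,
        (Opens.comap p (smoothLocus n f)).2.mem_nhds hf] with y hy hyf using ih hy hyf
    refine (wirtinger_congr t.a _ hz e).trans ?_
    exact t.wirtinger_base _ hz (iterD_mem_smoothLocus t.b w (t.mapsTo z hz) hf) j

/-- The operator `∑ c_e ∂^{w_e}` with derivatives along the base. -/
def listOp (W : Opens Z) (hW : (W : Set Z) ⊆ t.a.1.source) (L : List ((Z → ℂ) × List (Fin n))) :
    LocOp (n + k) W :=
  (L.map fun e => HomOn.comp (mulOp (n + k) e.1 W) (t.baseOp W hW e.2)).sum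

theorem listOp_cons (W : Opens Z) (hW : (W : Set Z) ⊆ t.a.1.source) (e : (Z → ℂ) × List (Fin n))
    (L : List ((Z → ℂ) × List (Fin n))) : t.listOp W hW (e :: L) =
      HomOn.comp (mulOp (n + k) e.1 W) (t.baseOp W hW e.2) + t.listOp W hW L := by
  simp [listOp]

theorem listOp_append (W : Opens Z) (hW : (W : Set Z) ⊆ t.a.1.source)
    (L L' : List ((Z → ℂ) × List (Fin n))) :
    t.listOp W hW (L ++ L') = t.listOp W hW L + t.listOp W hW L' := by
  simp [listOp]

theorem listOp_ev (W : Opens Z) (hW : (W : Set Z) ⊆ t.a.1.source) (L : List ((Z → ℂ) × List (Fin n)))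
    (hL : ∀ e ∈ L, HolOn (n + k) e.1 W) {f : Z → ℂ} {z : Z} (hz : z ∈ W)
    (hf : z ∈ smoothLocus (n + k) f) : (t.listOp W hW L).ev f z =
      (L.map fun e => e.1 z * iterD t.a (e.2.map (Fin.castAdd k)) f z).sum := by
  induction L with
  | nil => simp [listOp]
  | cons e L ih =>
    rw [listOp_cons, LocOp.add_ev, ih fun e' he' => hL e' (List.mem_cons_of_mem _ he'),
      LocOp.comp_ev _ _ hf, LocOp.mulOp_ev ((hL e List.mem_cons_self).smoothOn _) hz
        (LocOp.mem_smoothLocus_ev _ hz hf), iterOp_ev _ _ _ hz hf, List.map_cons, List.sum_cons]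

theorem listOp_restr {W V : Opens Z} (hW : (W : Set Z) ⊆ t.a.1.source) (h : V ≤ W)
    (L : List ((Z → ℂ) × List (Fin n))) (hL : ∀ e ∈ L, HolOn (n + k) e.1 W) :
    HomOn.restr h (t.listOp W hW L) = t.listOp V (Set.Subset.trans h hW) L :=
  LocOp.ext_ev fun z hz F hF => by
    rw [LocOp.ev_restr _ _ _ hz, listOp_ev _ _ _ _ hL (h hz) hF,
      listOp_ev _ _ _ _ (fun e he => (hL e he).mono h) hz hF]

/-- Near `z`, the operator `P` is congruent to a combination of derivatives along the base. -/
def HasNormalForm {W : Opens Z} (P : LocOp (n + k) W) (z : Z) : Prop :=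
  ∃ (N : Opens Z) (hN : N ≤ W) (hNa : (N : Set Z) ⊆ t.a.1.source) (L : List ((Z → ℂ) × List (Fin n))),
    z ∈ N ∧ (∀ e ∈ L, HolOn (n + k) e.1 N) ∧
      InVertIdeal (n := n) p (HomOn.restr hN P - t.listOp N hNa L)

namespace HasNormalForm
variable {t}
variable {W : Opens Z} {P Q : LocOp (n + k) W} {z : Z}

theorem of_restr {V : Opens Z} (h : V ≤ W) (hP : t.HasNormalForm (HomOn.restr h P) z) :
    t.HasNormalForm P z := by
  obtain ⟨N, hN, hNa, L, hz, hL, hI⟩ := hP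
  exact ⟨N, hN.trans h, hNa, L, hz, hL, hI⟩

theorem restr (hP : t.HasNormalForm P z) {V : Opens Z} (h : V ≤ W) (hz : z ∈ V) :
    t.HasNormalForm (HomOn.restr h P) z := by
  obtain ⟨N, hN, hNa, L, hzN, hL, hI⟩ := hP
  refine ⟨N ⊓ V, inf_le_right, Set.Subset.trans inter_subset_left hNa, L, ⟨hzN, hz⟩,
    fun e he => (hL e he).mono inter_subset_left, ?_⟩
  have h1 := hI.restr (inf_le_left : N ⊓ V ≤ N)
  rw [map_sub, t.listOp_restr hNa inf_le_left L hL] at h1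
  exact h1

theorem add (hP : t.HasNormalForm P z) (hQ : t.HasNormalForm Q z) : t.HasNormalForm (P + Q) z := by
  obtain ⟨N, hN, hNa, L, hzN, hL, hI⟩ := hP
  obtain ⟨M, hM, hMa, L', hzM, hL', hI'⟩ := hQ
  refine ⟨N ⊓ M, inf_le_left.trans hN, Set.Subset.trans inter_subset_left hNa, L ++ L', ⟨hzN, hzM⟩,
    fun e he => ?_, ?_⟩
  · rcases List.mem_append.1 he with h | h
    · exact (hL e h).mono inter_subset_left
    · exact (hL' e h).mono inter_subset_right
  · have h1 := hI.restr (inf_le_left : N ⊓ M ≤ N)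
    have h2 := hI'.restr (inf_le_right : N ⊓ M ≤ M)
    rw [map_sub, t.listOp_restr hNa inf_le_left L hL] at h1
    rw [map_sub, t.listOp_restr hMa inf_le_right L' hL'] at h2
    rw [map_add, t.listOp_append]
    exact h1.add_sub h2

theorem sum {ι : Type*} (s : Finset ι) {Q : ι → LocOp (n + k) W} (hz : z ∈ W)
    (hza : z ∈ t.a.1.source) (h : ∀ i ∈ s, t.HasNormalForm (Q i) z) :
    t.HasNormalForm (∑ i ∈ s, Q i) z := by
  classical
  induction s using Finset.induction_on with
  | empty =>
    refine ⟨W ⊓ ⟨t.a.1.source, t.a.1.open_source⟩, inf_le_left, inter_subset_right, [], ⟨hz, hza⟩,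
      by simp, ?_⟩
    rw [Finset.sum_empty, map_zero]
    exact .of_eq (by simp [listOp])
  | insert i s his ih =>
    rw [Finset.sum_insert his]
    exact (h i (Finset.mem_insert_self _ _)).add (ih fun j hj => h j (Finset.mem_insert_of_mem hj))

/-- Normal forms are preserved by operators that preserve the operators `c ∂^w`. -/
theorem comp_of_step (hP : t.HasNormalForm P z) {R : LocOp (n + k) W} (hR : IsHolDiffOp (n + k) R)
    (hstep : ∀ (N : Opens Z) (hN : N ≤ W) (hNa : (N : Set Z) ⊆ t.a.1.source)
      (e : (Z → ℂ) × List (Fin n)), HolOn (n + k) e.1 N →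
      ∃ L' : List ((Z → ℂ) × List (Fin n)), (∀ e ∈ L', HolOn (n + k) e.1 N) ∧
        InVertIdeal (n := n) p (HomOn.comp (HomOn.restr hN R)
          (HomOn.comp (mulOp (n + k) e.1 N) (t.baseOp N hNa e.2)) - t.listOp N hNa L')) :
    t.HasNormalForm (HomOn.comp R P) z := by
  obtain ⟨N, hN, hNa, L, hzN, hL, hI⟩ := hP
  have key : ∃ L' : List ((Z → ℂ) × List (Fin n)), (∀ e ∈ L', HolOn (n + k) e.1 N) ∧
      InVertIdeal (n := n) p (HomOn.comp (HomOn.restr hN R) (t.listOp N hNa L) -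
        t.listOp N hNa L') := by
    clear hI
    induction L with
    | nil =>
      refine ⟨[], by simp, .of_eq ?_⟩
      simp [listOp, HomOn.comp_zero]
    | cons e L ih =>
      obtain ⟨L', hL', h'⟩ := ih fun e' he' => hL e' (List.mem_cons_of_mem _ he')
      obtain ⟨L'', hL'', h''⟩ := hstep N hN hNa e (hL e List.mem_cons_self)
      refine ⟨L'' ++ L', fun e' he' => ?_, ?_⟩
      · rcases List.mem_append.1 he' with h | h
        · exact hL'' e' h
        · exact hL' e' h
      · rw [t.listOp_cons, t.listOp_append, HomOn.comp_add]
        exact h''.add_sub h'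
  obtain ⟨L', hL', h'⟩ := key
  refine ⟨N, hN, hNa, L', hzN, hL', ?_⟩
  have h1 := hI.comp_left (hR.restr hN)
  have h2 : HomOn.comp (HomOn.restr hN R) (HomOn.restr hN P - t.listOp N hNa L) =
      HomOn.restr hN (HomOn.comp R P) - HomOn.comp (HomOn.restr hN R) (t.listOp N hNa L) := by
    rw [sub_eq_add_neg, HomOn.comp_add, ← neg_one_smul ℂ (t.listOp N hNa L), HomOn.comp_smul,
      neg_one_smul, ← sub_eq_add_neg]
    rfl
  rw [h2] at h1
  have h3 := h1.add h'
  rwa [sub_add_sub_cancel] at h3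

theorem mul (hP : t.HasNormalForm P z) {f : Z → ℂ} (hf : HolOn (n + k) f W) :
    t.HasNormalForm (HomOn.comp (mulOp (n + k) f W) P) z := by
  refine hP.comp_of_step (.mul f hf) fun N hN hNa e he => ?_
  have hfN : HolOn (n + k) f N := hf.mono hN
  have hfe : HolOn (n + k) (fun y => f y * e.1 y) N := hfN.mul he
  refine ⟨[(fun y => f y * e.1 y, e.2)], by simpa using hfe, .of_eq ?_⟩
  refine LocOp.ext_ev fun x hx F hF => ?_
  have h1 := LocOp.mem_smoothLocus_ev (t.baseOp N hNa e.2) hx hF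
  rw [t.listOp_cons, LocOp.add_ev, LocOp.comp_ev _ _ hF, LocOp.comp_ev _ _ hF,
    mulOp_restr (hf.smoothOn _) hN, LocOp.mulOp_ev (hfe.smoothOn _) hx h1,
    LocOp.mulOp_ev (hfN.smoothOn _) hx (LocOp.mem_smoothLocus_ev _ hx hF), LocOp.comp_ev _ _ hF,
    LocOp.mulOp_ev (he.smoothOn _) hx h1]
  simp [listOp, mul_assoc]

/-- Leibniz gives ∂_i ∘ c∂^w = (∂_i c)∂^w + c ∂_i∂^w. For a base direction both terms are of the
required form; for a fiber direction the second one is c∂^w∂_i, which ends in a vertical field and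
lies in the ideal. -/
theorem deriv (hp : ContMDiff 𝓘(ℂ, Cn (n + k)) 𝓘(ℂ, Cn n) ω p) (hP : t.HasNormalForm P z)
    (hW : (W : Set Z) ⊆ t.a.1.source) (i : Fin (n + k)) :
    t.HasNormalForm (HomOn.comp (coordDeriv (n + k) t.a i W hW) P) z := by
  refine hP.comp_of_step (.deriv t.a i hW) fun N hN hNa e he => ?_
  have hde : HolOn (n + k) (wirtinger (n + k) t.a i e.1) N := he.wirtinger t.a i hNa
  have hres : HomOn.restr hN (coordDeriv (n + k) t.a i W hW) = coordDeriv (n + k) t.a i N hNa := rfl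
  have hev : ∀ x ∈ N, ∀ F : Z → ℂ, x ∈ smoothLocus (n + k) F →
      LocOp.ev (HomOn.comp (coordDeriv (n + k) t.a i N hNa)
        (HomOn.comp (mulOp (n + k) e.1 N) (t.baseOp N hNa e.2))) F x =
      wirtinger (n + k) t.a i e.1 x * iterD t.a (e.2.map (Fin.castAdd k)) F x +
        e.1 x * wirtinger (n + k) t.a i (iterD t.a (e.2.map (Fin.castAdd k)) F) x := by
    intro x hx F hF
    have h1 := iterD_mem_smoothLocus t.a (e.2.map (Fin.castAdd k)) (hNa hx) hF
    rw [LocOp.comp_ev _ _ hF, LocOp.coordDeriv_ev _ _ hNa hx (LocOp.mem_smoothLocus_ev _ hx hF),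
      ← wirtinger_mul t.a i (hNa hx) ((he.smoothOn _).mem_smoothLocus hx) h1]
    refine wirtinger_congr _ _ (hNa hx) ?_
    filter_upwards [N.2.mem_nhds hx, (smoothLocus (n + k) F).2.mem_nhds hF] with y hy hyF
    rw [LocOp.comp_ev _ _ hyF, LocOp.mulOp_ev (he.smoothOn _) hy (LocOp.mem_smoothLocus_ev _ hy hyF),
      iterOp_ev _ _ _ hy hyF]
  rw [hres]
  have hcases : (∃ j, i = Fin.castAdd k j) ∨ ∃ j, i = Fin.natAdd n j :=
    Fin.addCases (fun j => .inl ⟨j, rfl⟩) (fun j => .inr ⟨j, rfl⟩) i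
  obtain ⟨j, hi⟩ | ⟨j, hi⟩ := hcases
  · refine ⟨[(wirtinger (n + k) t.a i e.1, e.2), (e.1, j :: e.2)], ?_, .of_eq ?_⟩
    · simpa using ⟨hde, he⟩
    · refine LocOp.ext_ev fun x hx F hF => ?_
      rw [hev x hx F hF, t.listOp_ev N hNa _ (by simpa using ⟨hde, he⟩) hx hF]
      simp [iterD, hi]
  · refine ⟨[(wirtinger (n + k) t.a i e.1, e.2)], by simpa using hde, ?_⟩
    have hv := t.fiberDeriv_isVertical hp j hNa
    -- The ideal is a left ideal, so the vertical field must be the rightmost factor.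
    have h1 := InVertIdeal.comp ((IsHolDiffOp.mul e.1 he).comp
      (iterOp_isHol t.a hNa (e.2.map (Fin.castAdd k)))) hv
    convert h1 using 1
    refine LocOp.ext_ev fun x hx F hF => ?_
    have h2 := LocOp.mem_smoothLocus_ev (coordDeriv (n + k) t.a (Fin.natAdd n j) N hNa) hx hF
    rw [LocOp.sub_ev, hev x hx F hF, t.listOp_ev N hNa _ (by simpa using hde) hx hF,
      LocOp.comp_ev _ _ hF, LocOp.comp_ev _ _ h2, LocOp.mulOp_ev (he.smoothOn _) hx
        (LocOp.mem_smoothLocus_ev _ hx h2), iterOp_ev _ _ _ hx h2]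
    have e1 : iterD t.a (e.2.map (Fin.castAdd k))
        (LocOp.ev (coordDeriv (n + k) t.a (Fin.natAdd n j) N hNa) F) x =
        iterD t.a (e.2.map (Fin.castAdd k)) (wirtinger (n + k) t.a i F) x := by
      refine (iterD_congr t.a _ (hNa hx) ?_).self_of_nhds
      filter_upwards [N.2.mem_nhds hx, (smoothLocus (n + k) F).2.mem_nhds hF] with y hy hyF
      rw [LocOp.coordDeriv_ev _ _ hNa hy hyF, hi]
    have e2 : ∀ w : List (Fin (n + k)), wirtinger (n + k) t.a i (iterD t.a w F) x =
        iterD t.a w (wirtinger (n + k) t.a i F) x := by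
      intro w
      -- The last letter of a word acts first; moving i from the front to the end of the word is a
      -- permutation.
      have h3 : iterD t.a (w ++ [i]) F = iterD t.a w (wirtinger (n + k) t.a i F) := by
        induction w with
        | nil => rfl
        | cons j w ih => exact congrArg (wirtinger (n + k) t.a j) ih
      rw [← h3]
      exact iterD_perm t.a (w := i :: w) (by simpa using (List.perm_append_comm (l₁ := [i]) (l₂ := w)))
        (hNa hx) hF
    rw [e1, e2]
    simp

end HasNormalForm

/-- Every holomorphic differential operator has a normal form in an adapted chart. -/
theorem hasNormalForm (hp : ContMDiff 𝓘(ℂ, Cn (n + k)) 𝓘(ℂ, Cn n) ω p) {W : Opens Z}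
    {Q : LocOp (n + k) W} (hQ : IsHolDiffOp (n + k) Q) :
    ∀ {P : LocOp (n + k) W}, (∀ z ∈ W, z ∈ t.a.1.source → t.HasNormalForm P z) →
      ∀ z ∈ W, z ∈ t.a.1.source → t.HasNormalForm (HomOn.comp Q P) z := by
  -- The induction is on Q for all P at once. Normal forms of two factors cannot simply be
  -- multiplied, since a left ideal is not stable under multiplication from the right; instead the
  -- normal form of the inner factor is fed into the outer one.
  induction hQ with
  | mul f hf => exact fun hP z hz hza => (hP z hz hza).mul hf
  | @deriv W b j hW =>
    intro P hP z hz hza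
    have h2 : ((W ⊓ ⟨t.a.1.source, t.a.1.open_source⟩ : Opens Z) : Set Z) ⊆ t.a.1.source :=
      inter_subset_right
    refine HasNormalForm.of_restr (V := W ⊓ ⟨t.a.1.source, t.a.1.open_source⟩) inf_le_left ?_
    have hz' : z ∈ W ⊓ ⟨t.a.1.source, t.a.1.open_source⟩ := ⟨hz, hza⟩
    have hP' := (hP z hz hza).restr inf_le_left hz'
    have hb := Set.Subset.trans (inf_le_left : W ⊓ ⟨t.a.1.source, t.a.1.open_source⟩ ≤ W) hW
    change t.HasNormalForm (HomOn.comp (coordDeriv (n + k) b j _ hb) (HomOn.restr inf_le_left P)) z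
    rw [coordDeriv_change t.a b j hb h2]
    have e : HomOn.comp (∑ i, HomOn.comp (mulOp (n + k) (wirtinger (n + k) b j fun y => t.a.1 y i) _)
        (coordDeriv (n + k) t.a i _ h2)) (HomOn.restr inf_le_left P) =
        ∑ i, HomOn.comp (mulOp (n + k) (wirtinger (n + k) b j fun y => t.a.1 y i) _)
          (HomOn.comp (coordDeriv (n + k) t.a i _ h2) (HomOn.restr inf_le_left P)) := by
      refine LocOp.ext_ev fun x hx F hF => ?_
      have hF' := LocOp.mem_smoothLocus_ev (HomOn.restr inf_le_left P) hx hF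
      rw [LocOp.comp_ev _ _ hF, LocOp.sum_ev, LocOp.sum_ev]
      refine Finset.sum_congr rfl fun i _ => ?_
      rw [LocOp.comp_ev _ _ hF', LocOp.comp_ev _ _ hF]
      refine LocOp.ev_congr _ ?_
      filter_upwards [(smoothLocus (n + k) F).2.mem_nhds hF] with y hyF
      rw [LocOp.comp_ev _ _ hyF]
    rw [e]
    refine HasNormalForm.sum _ hz' hza fun i _ => (hP'.deriv hp h2 i).mul ?_
    exact HolOn.wirtinger ((t.a.coord_hol i).mono h2) b j hb
  | @add W Q Q' _ _ ih1 ih2 =>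
    intro P hP z hz hza
    rw [HomOn.add_comp]
    exact (ih1 hP z hz hza).add (ih2 hP z hz hza)
  | comp _ _ ih1 ih2 => exact fun hP z hz hza => ih1 (ih2 hP) z hz hza
  | @locally W Q N hN hxN _ ih =>
    intro P hP z hz hza
    refine HasNormalForm.of_restr (hN z hz) (ih z hz (P := HomOn.restr (hN z hz) P) ?_ z (hxN z hz) hza)
    exact fun y hy hya => (hP y (hN z hz hy) hya).restr (hN z hz) hy

theorem hasNormalForm_of_isHol (hp : ContMDiff 𝓘(ℂ, Cn (n + k)) 𝓘(ℂ, Cn n) ω p) {W : Opens Z}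
    {P : LocOp (n + k) W} (hP : IsHolDiffOp (n + k) P) {z : Z} (hz : z ∈ W) (hza : z ∈ t.a.1.source) :
    t.HasNormalForm P z := by
  refine t.hasNormalForm hp hP (P := HomOn.one _ W) (fun y hy hya => ?_) z hz hza
  have h1 : HolOn (n + k) (fun _ => (1 : ℂ))
      ((W ⊓ ⟨t.a.1.source, t.a.1.open_source⟩ : Opens Z) : Set Z) :=
    contMDiffOn_const
  refine ⟨W ⊓ ⟨t.a.1.source, t.a.1.open_source⟩, inf_le_left, inter_subset_right, [(fun _ => 1, [])],
    ⟨hy, hya⟩, by simpa using h1, .of_eq ?_⟩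
  refine LocOp.ext_ev fun x hx F hF => ?_
  rw [t.listOp_ev _ _ _ (by simpa using h1) hx hF, LocOp.ev_restr _ _ _ hx, LocOp.one_ev hx.1 hF]
  simp [iterD]

/-- Value of a normal form on functions that are pulled back from the base. -/
theorem ev_of_normalForm (hp : ContMDiff 𝓘(ℂ, Cn (n + k)) 𝓘(ℂ, Cn n) ω p) {W N : Opens Z}
    {P : LocOp (n + k) W} (hN : N ≤ W) (hNa : (N : Set Z) ⊆ t.a.1.source)
    {L : List ((Z → ℂ) × List (Fin n))} (hL : ∀ e ∈ L, HolOn (n + k) e.1 N)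
    (hI : InVertIdeal (n := n) p (HomOn.restr hN P - t.listOp N hNa L)) {f : Y → ℂ} {z : Z}
    (hz : z ∈ N) (hf : p z ∈ smoothLocus n f) :
    P.ev (f ∘ p) z = (L.map fun e => e.1 z * iterD t.b e.2 f (p z)).sum := by
  have h1 := hI.ev_comp hp hf
  rw [LocOp.sub_ev, LocOp.ev_restr _ _ _ hz, sub_eq_zero,
    t.listOp_ev N hNa L hL hz (smoothLocus_comp hp hf)] at h1
  rw [h1]
  congr 1
  refine List.map_congr_left fun e _ => ?_
  rw [t.iterD_base _ (hNa hz) hf]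

/-- The symbol of an operator in normal form is determined by its values on exponentials. -/
theorem eval_symbol (hp : ContMDiff 𝓘(ℂ, Cn (n + k)) 𝓘(ℂ, Cn n) ω p) {W N : Opens Z}
    {P : LocOp (n + k) W} (hN : N ≤ W) (hNa : (N : Set Z) ⊆ t.a.1.source)
    {L : List ((Z → ℂ) × List (Fin n))} (hL : ∀ e ∈ L, HolOn (n + k) e.1 N)
    (hI : InVertIdeal (n := n) p (HomOn.restr hN P - t.listOp N hNa L)) {z : Z} (hz : z ∈ N)
    (l : Fin n → ℂ) : P.ev (chartExp t.b l ∘ p) z =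
      MvPolynomial.eval l (symbolPoly (L.map fun e => (e.1 z, e.2))) * chartExp t.b l (p z) := by
  have hb := t.mapsTo z (hNa hz)
  rw [t.ev_of_normalForm hp hN hNa hL hI hz (chartExp_mem_smoothLocus t.b l hb), eval_symbolPoly,
    List.map_map, ← List.sum_map_mul_right]
  congr 1
  refine List.map_congr_left fun e _ => ?_
  rw [iterD_chartExp t.b l _ hb, Function.comp_apply, mul_assoc]

end AdaptedChart

/-- A holomorphic differential operator that kills all functions pulled back from the base lies in
the vertical ideal. -/
theorem inVertIdeal_of_ev (hp : Manifold.IsSubmersion 𝓘(ℂ, Cn (n + k)) 𝓘(ℂ, Cn n) ω p) {V : Opens Z}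
    {P : LocOp (n + k) V} (hP : IsHolDiffOp (n + k) P)
    (h : ∀ z ∈ V, ∀ f : Y → ℂ, p z ∈ smoothLocus n f → P.ev (f ∘ p) z = 0) :
    InVertIdeal (n := n) p P := by
  have key : ∀ z ∈ V, ∃ N : Opens Z, z ∈ N ∧ ∃ hN : N ≤ V, InVertIdeal (n := n) p (HomOn.restr hN P) := by
    intro z hz
    obtain ⟨t, -, hzt⟩ := exists_adaptedChart hp z
      ⟨chartAt (Cn n) (p z), IsManifold.chart_mem_maximalAtlas _⟩ (mem_chart_source _ _)
    obtain ⟨N, hN, hNa, L, hzN, hL, hI⟩ := t.hasNormalForm_of_isHol hp.contMDiff hP hz hzt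
    refine ⟨N, hzN, hN, ?_⟩
    have h0 : t.listOp N hNa L = 0 := by
      refine LocOp.ext_ev fun x hx F hF => ?_
      -- At each point x the operator kills all exponentials of the base coordinates, so its symbol
      -- is a polynomial that vanishes at every l.
      have hq : symbolPoly (L.map fun e => (e.1 x, e.2)) = 0 := by
        refine MvPolynomial.funext fun l => ?_
        have hb := t.mapsTo x (hNa hx)
        have h1 := t.eval_symbol hp.contMDiff hN hNa hL hI hx l
        rw [h x (hN hx) _ (chartExp_mem_smoothLocus t.b l hb)] at h1
        rw [map_zero]
        exact (mul_eq_zero.1 h1.symm).resolve_right (chartExp_ne_zero _ _ _)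
      -- F itself need not come from Y. Its derivatives at x define a permutation-invariant function
      -- of words, so their combination vanishes together with the symbol.
      have h2 := monomialFunctional_symbolPoly
        (T := fun w => iterD t.a (w.map (Fin.castAdd k)) F x)
        (fun w w' hww => iterD_perm t.a (hww.map _) (hNa hx) hF) (L.map fun e => (e.1 x, e.2))
      rw [hq, map_zero, List.map_map] at h2
      rw [t.listOp_ev N hNa L hL hx hF, LocOp.zero_ev]
      exact h2.symm
    rwa [h0, sub_zero] at hI
  choose! N hzN hN hI using key
  exact .locally N hN hzN hI

end VerticalIdeal

/-! ### Transposes at the level of germs -/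

section TransposeGerm

variable {d : ℕ} {X : Type*} [TopologicalSpace X] [T2Space X] [ChartedSpace (Cn d) X]
  [IsManifold 𝓘(ℂ, Cn d) ω X]

theorem jac_hol (a b : Chart d X) :
    HolOn d (HolLineBundle.jac a b) (a.1.source ∩ b.1.source) :=
  (HolLineBundle.canonical d X).hol a b

theorem jac_mem_smoothLocus (a b : Chart d X) {x : X} (ha : x ∈ a.1.source) (hb : x ∈ b.1.source) :
    x ∈ smoothLocus d (HolLineBundle.jac a b) :=
  SmoothOn.mem_smoothLocus (V := ⟨a.1.source, a.1.open_source⟩ ⊓ ⟨b.1.source, b.1.open_source⟩)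
    ((jac_hol a b).smoothOn d) ⟨ha, hb⟩

theorem jac_ne_zero (a b : Chart d X) {x : X} (ha : x ∈ a.1.source) (hb : x ∈ b.1.source) :
    HolLineBundle.jac a b x ≠ 0 :=
  (HolLineBundle.canonical d X).ne_zero a b x ha hb

theorem jac_inv (a b : Chart d X) {x : X} (ha : x ∈ a.1.source) (hb : x ∈ b.1.source) :
    (HolLineBundle.jac a b x)⁻¹ = HolLineBundle.jac b a x := by
  have h := HolLineBundle.jac_mul a b a ha hb ha
  rw [HolLineBundle.jac_self a ha] at h
  exact inv_eq_of_mul_eq_one_right h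

open Classical in
/-- The value at `x` of the formal transpose of `S` in the chart `a`, applied to `f`. -/
def trEv (a : Chart d X) {W : Opens X} (S : LocOp d W) (f : X → ℂ) (x : X) : ℂ :=
  if h : ∃ (N : Opens X) (hN : N ≤ W) (S' : LocOp d N),
      x ∈ N ∧ x ∈ a.1.source ∧ IsTranspose d a (HomOn.restr hN S) S' then
    h.choose_spec.choose_spec.choose.ev f x
  else 0

variable {a : Chart d X} {W : Opens X} {S : LocOp d W}

/-- Any two local transposes agree on germs by uniqueness, so the choice made in the definition is
immaterial. -/
theorem trEv_eq {N : Opens X} (hN : N ≤ W) {S' : LocOp d N} (h : IsTranspose d a (HomOn.restr hN S) S')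
    {x : X} (hx : x ∈ N) (hxa : x ∈ a.1.source) {f : X → ℂ} (hf : x ∈ smoothLocus d f) :
    trEv a S f x = S'.ev f x := by
  have H : ∃ (N : Opens X) (hN : N ≤ W) (S' : LocOp d N),
      x ∈ N ∧ x ∈ a.1.source ∧ IsTranspose d a (HomOn.restr hN S) S' := ⟨N, hN, S', hx, hxa, h⟩
  rw [trEv, dif_pos H]
  obtain ⟨hxM, -, hM⟩ := H.choose_spec.choose_spec.choose_spec
  set M := H.choose
  have h1 := hM.restr (inf_le_right : N ⊓ M ≤ M)
  have h2 := h.restr (inf_le_left : N ⊓ M ≤ N)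
  have h3 := IsTranspose.unique h1 h2 (x := x) ⟨hx, hxM⟩ hxa hf
  have hx' : x ∈ N ⊓ M := ⟨hx, hxM⟩
  rwa [LocOp.ev_restr _ _ _ hx', LocOp.ev_restr _ _ _ hx'] at h3

theorem exists_trEv (a : Chart d X) (hS : IsHolDiffOp d S) {x : X} (hx : x ∈ W) (hxa : x ∈ a.1.source) :
    ∃ (N : Opens X) (hN : N ≤ W) (S' : LocOp d N), x ∈ N ∧ (N : Set X) ⊆ a.1.source ∧
      IsTranspose d a (HomOn.restr hN S) S' ∧
      ∀ y ∈ N, ∀ f : X → ℂ, y ∈ smoothLocus d f → trEv a S f y = S'.ev f y := by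
  obtain ⟨N, hN, S', hxN, h⟩ := hS.exists_transpose a x hx hxa
  have hle : N ⊓ ⟨a.1.source, a.1.open_source⟩ ≤ N := inf_le_left
  refine ⟨N ⊓ ⟨a.1.source, a.1.open_source⟩, hle.trans hN, HomOn.restr hle S', ⟨hxN, hxa⟩,
    inter_subset_right, h.restr hle, fun y hy f hf => ?_⟩
  exact trEv_eq (hle.trans hN) (h.restr hle) hy hy.2 hf

theorem trEv_congr (hS : IsHolDiffOp d S) {x : X} (hx : x ∈ W) (hxa : x ∈ a.1.source) {f g : X → ℂ}
    (h : f =ᶠ[𝓝 x] g) (hf : x ∈ smoothLocus d f) : trEv a S f x = trEv a S g x := by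
  obtain ⟨N, hN, S', hxN, -, -, h1⟩ := exists_trEv a hS hx hxa
  rw [h1 x hxN f hf, h1 x hxN g (smoothLocus_congr h hf), S'.ev_congr h]

theorem trEv_mem_smoothLocus (hS : IsHolDiffOp d S) {x : X} (hx : x ∈ W) (hxa : x ∈ a.1.source)
    {f : X → ℂ} (hf : x ∈ smoothLocus d f) : x ∈ smoothLocus d (trEv a S f) := by
  obtain ⟨N, hN, S', hxN, -, -, h1⟩ := exists_trEv a hS hx hxa
  refine smoothLocus_congr (F := S'.ev f) ?_ (S'.mem_smoothLocus_ev hxN hf)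
  filter_upwards [N.2.mem_nhds hxN, (smoothLocus d f).2.mem_nhds hf] with y hy hyf
  exact (h1 y hy f hyf).symm

/-- Transposes in different charts of operators that are conjugate to each other. -/
theorem trEv_twist (a b : Chart d X) {W' : Opens X} {S' : LocOp d W'} (hS' : IsHolDiffOp d S')
    {V : Opens X} (hV : V ≤ W) (hV' : V ≤ W') {g : X → ℂ} (hg : HolOn d g V) (hg0 : ∀ x ∈ V, g x ≠ 0)
    (h : HomOn.restr hV S = (mulOp d g V).comp ((HomOn.restr hV' S').comp (mulOp d (fun x => (g x)⁻¹) V)))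
    {x : X} (hx : x ∈ V) (hxa : x ∈ a.1.source) (hxb : x ∈ b.1.source) {f : X → ℂ}
    (hf : x ∈ smoothLocus d f) : trEv a S f x = (HolLineBundle.jac b a x * g x)⁻¹ *
      trEv b S' (fun y => HolLineBundle.jac b a y * g y * f y) x := by
  have hVS : IsHolDiffOp d (HomOn.restr hV' S') := hS'.restr hV'
  obtain ⟨N, hN, T, hxN, -, hT, -⟩ := exists_trEv a hVS hx hxa
  obtain ⟨M, hM, T', hxM, -, hT', -⟩ := exists_trEv b hVS hx hxb
  set O := N ⊓ M
  have hxO : x ∈ O := ⟨hxN, hxM⟩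
  have hO : O ≤ V := inf_le_left.trans hN
  have h1 := hT.restr (inf_le_left : O ≤ N)
  have h2 := hT'.restr (inf_le_right : O ≤ M)
  have hgO : HolOn d g O := hg.mono hO
  have hgi : HolOn d (fun x => (g x)⁻¹) O := hgO.inv fun y hy => hg0 y (hO hy)
  have hgx : x ∈ smoothLocus d g := (hgO.smoothOn d).mem_smoothLocus hxO
  -- Transposition reverses the conjugation: the transpose of g S' g⁻¹ is g⁻¹ S'ᵗ g.
  have h3 : IsTranspose d a (HomOn.restr (hO.trans hV) S)
      (HomOn.comp (HomOn.comp (mulOp d (fun x => (g x)⁻¹) O) (HomOn.restr inf_le_left T)) (mulOp d g O)) := by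
    have e := congrArg (HomOn.restr hO) h
    change HomOn.restr (hO.trans hV) S = (HomOn.restr hO (mulOp d g V)).comp
      ((HomOn.restr (inf_le_left : O ≤ N) (HomOn.restr hN (HomOn.restr hV' S'))).comp
        (HomOn.restr hO (mulOp d (fun x => (g x)⁻¹) V))) at e
    rw [mulOp_restr (hg.smoothOn d), mulOp_restr ((hg.inv hg0).smoothOn d)] at e
    rw [e]
    exact (IsTranspose.mul g hgO).comp (h1.comp (IsTranspose.mul _ hgi))
  have hgf := smoothLocus_mul hgx hf
  have hgf' := LocOp.mem_smoothLocus_ev (mulOp d g O) hxO hf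
  have hj := jac_mem_smoothLocus b a hxb hxa
  rw [trEv_eq (hO.trans hV) h3 hxO hxa hf, LocOp.comp_ev _ _ hf, LocOp.comp_ev _ _ hgf',
    LocOp.mulOp_ev (hgi.smoothOn d) hxO (LocOp.mem_smoothLocus_ev _ hxO hgf')]
  have e1 : (mulOp d g O).ev f =ᶠ[𝓝 x] fun y => g y * f y := by
    filter_upwards [O.2.mem_nhds hxO, (smoothLocus d f).2.mem_nhds hf] with y hy hyf
    exact LocOp.mulOp_ev (hgO.smoothOn d) hy hyf
  rw [LocOp.ev_congr _ e1, h1.change h2 hxO hxa hxb hgf,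
    trEv_eq (S := S') (hO.trans hV') h2 hxO hxb (smoothLocus_mul (smoothLocus_mul hj hgx) hf), mul_inv]
  simp only [mul_assoc]
  ring

end TransposeGerm

/-! ### Lifting operators from the base -/

section Lifts

variable {n k : ℕ} {Y Z : Type*} [TopologicalSpace Y] [ChartedSpace (Cn n) Y]
  [TopologicalSpace Z] [ChartedSpace (Cn (n + k)) Z]
  [IsManifold 𝓘(ℂ, Cn (n + k)) ω Z] [IsManifold 𝓘(ℂ, Cn n) ω Y] {p : C(Z, Y)}

theorem IsLift.ev (hp : ContMDiff 𝓘(ℂ, Cn (n + k)) 𝓘(ℂ, Cn n) ω p) {B : Opens Y} {V : Opens Z}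
    {S : LocOp n B} {T : LocOp (n + k) V} (h : IsLift p S T) (hV : V ≤ Opens.comap p B) {z : Z}
    (hz : z ∈ V) {f : Y → ℂ} (hf : p z ∈ smoothLocus n f) : T.ev (f ∘ p) z = S.ev f (p z) := by
  set B' := B ⊓ smoothLocus n f
  set V' : Opens Z := V ⊓ Opens.comap p B'
  have hs : SmoothOn (n + k) (f ∘ p) V' :=
    ((smoothOn_smoothLocus f).comp_map hp).mono fun y hy => hy.2.2
  have hf' : SmoothOn n f B' := (smoothOn_smoothLocus f).mono inter_subset_right
  have hz' : z ∈ V' := ⟨hz, hV hz, hf⟩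
  have hpz : p z ∈ B' := hz'.2
  rw [T.ev_of_smoothOn inf_le_left hs hz', S.ev_of_smoothOn inf_le_left hf' hpz]
  refine h B' inf_le_left V' inf_le_left inf_le_right _ _ (fun y hy => ?_) z hz'
  have hy2 : p y ∈ B' := hy.2
  exact (Set.indicator_of_mem (s := (V' : Set Z)) hy _).trans
    (Set.indicator_of_mem (s := (B' : Set Y)) hy2 _).symm

theorem IsLift.of_ev {B : Opens Y} {V : Opens Z}
    {S : LocOp n B} {T : LocOp (n + k) V}
    (h : ∀ z ∈ V, ∀ f : Y → ℂ, p z ∈ smoothLocus n f → T.ev (f ∘ p) z = S.ev f (p z)) :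
    IsLift p S T := by
  intro B' hB V' hV hVB f q hq z hz
  have hpz : p z ∈ B' := hVB hz
  rw [← T.ev_apply hV q hz, ← S.ev_apply hB f hpz,
    ← h z (hV hz) f.1 (SmoothOn.mem_smoothLocus f.2.1 hpz)]
  refine T.ev_congr ?_
  filter_upwards [V'.2.mem_nhds hz] with y hy using hq y hy

/-- Differential operators on the base lift locally. -/
theorem exists_lift_ev (hs : Manifold.IsSubmersion 𝓘(ℂ, Cn (n + k)) 𝓘(ℂ, Cn n) ω p) {B : Opens Y}
    {S : LocOp n B} (hS : IsHolDiffOp n S) : ∀ z, p z ∈ B → ∃ (V : Opens Z) (T : LocOp (n + k) V),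
      z ∈ V ∧ V ≤ Opens.comap p B ∧ IsHolDiffOp (n + k) T ∧
      ∀ y ∈ V, ∀ f : Y → ℂ, p y ∈ smoothLocus n f → T.ev (f ∘ p) y = S.ev f (p y) := by
  have hp := hs.contMDiff
  induction hS with
  | @mul B g hg =>
    intro z hz
    have hgp : HolOn (n + k) (g ∘ p) (Opens.comap p B) := hg.comp hp.contMDiffOn fun _ h => h
    refine ⟨Opens.comap p B, mulOp (n + k) (g ∘ p) _, hz, le_rfl, .mul _ hgp, fun y hy f hf => ?_⟩
    rw [LocOp.mulOp_ev (hgp.smoothOn _) hy (smoothLocus_comp hp hf), LocOp.mulOp_ev (hg.smoothOn _) hy hf]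
    rfl
  | @deriv B b j hB =>
    intro z hz
    -- The adapted chart is taken over b itself, so that its j-th base field lifts the j-th field of
    -- b.
    obtain ⟨t, rfl, hzt⟩ := exists_adaptedChart hs z b (hB hz)
    refine ⟨Opens.comap p B ⊓ ⟨t.a.1.source, t.a.1.open_source⟩,
      coordDeriv (n + k) t.a (Fin.castAdd k j) _ inter_subset_right, ⟨hz, hzt⟩, inf_le_left,
      .deriv _ _ _, fun y hy f hf => ?_⟩
    have hyB : p y ∈ B := hy.1
    rw [LocOp.coordDeriv_ev _ _ _ hy (smoothLocus_comp hp hf), LocOp.coordDeriv_ev _ _ _ hyB hf,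
      t.wirtinger_base f hy.2 hf]
  | @add B P Q _ _ ih1 ih2 =>
    intro z hz
    obtain ⟨V, T, hzV, hV, hT, h⟩ := ih1 z hz
    obtain ⟨V', T', hzV', hV', hT', h'⟩ := ih2 z hz
    refine ⟨V ⊓ V', HomOn.restr inf_le_left T + HomOn.restr inf_le_right T', ⟨hzV, hzV'⟩,
      inf_le_left.trans hV, (hT.restr _).add (hT'.restr _), fun y hy f hf => ?_⟩
    rw [LocOp.add_ev, LocOp.add_ev, LocOp.ev_restr _ _ _ hy, LocOp.ev_restr _ _ _ hy, h y hy.1 f hf,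
      h' y hy.2 f hf]
  | @comp B P Q _ _ ih1 ih2 =>
    intro z hz
    obtain ⟨V, T, hzV, hV, hT, h⟩ := ih1 z hz
    obtain ⟨V', T', hzV', hV', hT', h'⟩ := ih2 z hz
    refine ⟨V ⊓ V', HomOn.comp (HomOn.restr inf_le_left T) (HomOn.restr inf_le_right T'), ⟨hzV, hzV'⟩,
      inf_le_left.trans hV, (hT.restr _).comp (hT'.restr _), fun y hy f hf => ?_⟩
    have hyB : p y ∈ B := hV hy.1
    rw [LocOp.comp_ev _ _ (smoothLocus_comp hp hf), LocOp.comp_ev _ _ hf, LocOp.ev_restr _ _ _ hy,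
      ← h y hy.1 _ (Q.mem_smoothLocus_ev hyB hf)]
    refine T.ev_congr ?_
    filter_upwards [(V ⊓ V').2.mem_nhds hy, (Opens.comap p (smoothLocus n f)).2.mem_nhds hf] with x hx hxf
    rw [LocOp.ev_restr _ _ _ hx, h' x hx.2 f hxf]
    rfl
  | @locally B P N hN hx _ ih =>
    intro z hz
    obtain ⟨V, T, hzV, hV, hT, h⟩ := ih (p z) hz z (hx _ hz)
    refine ⟨V, T, hzV, hV.trans (Opens.comap_mono p (hN _ hz)), hT, fun y hy f hf => ?_⟩
    have hyN : p y ∈ N (p z) := hV hy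
    rw [h y hy f hf, LocOp.ev_restr _ _ _ hyN]

end Lifts

/-! ### Sections of 𝒟_{Z→Y} as operators from functions on Y to functions on Z -/

section GermsOfFamilies

variable {n k : ℕ} {Y Z : Type*} [TopologicalSpace Y] [ChartedSpace (Cn n) Y]
  [TopologicalSpace Z] [ChartedSpace (Cn (n + k)) Z]
  [IsManifold 𝓘(ℂ, Cn (n + k)) ω Z] [IsManifold 𝓘(ℂ, Cn n) ω Y] {p : C(Z, Y)}

/-- `P` represents on `V₀` the section of `𝒟_{Z→Y}` given by `x`. -/
def Represents (p : C(Z, Y)) (x : ∀ V : Opens Z, LocOp (n + k) V) {V₀ : Opens Z} (P : LocOp (n + k) V₀) :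
    Prop :=
  IsHolDiffOp (n + k) P ∧ ∀ (V : Opens Z) (h : V ≤ V₀), InVertIdeal (n := n) p (x V - HomOn.restr h P)

open Classical in
/-- The action of a section of `𝒟_{Z→Y}` on functions on `Y`. -/
def famEv (p : C(Z, Y)) (x : ∀ V : Opens Z, LocOp (n + k) V) (f : Y → ℂ) (z : Z) : ℂ :=
  if h : ∃ (V₀ : Opens Z) (P : LocOp (n + k) V₀), z ∈ V₀ ∧ Represents (n := n) p x P then
    h.choose_spec.choose.ev (f ∘ p) z
  else 0

variable {x y : ∀ V : Opens Z, LocOp (n + k) V}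

theorem InVertIdeal.ev_eq {V V' : Opens Z} {P : LocOp (n + k) V} {P' : LocOp (n + k) V'}
    (hp : ContMDiff 𝓘(ℂ, Cn (n + k)) 𝓘(ℂ, Cn n) ω p) {N : Opens Z} (h : N ≤ V) (h' : N ≤ V')
    (hI : InVertIdeal (n := n) p (HomOn.restr h P - HomOn.restr h' P')) {z : Z} (hz : z ∈ N) {f : Y → ℂ}
    (hf : p z ∈ smoothLocus n f) : P.ev (f ∘ p) z = P'.ev (f ∘ p) z := by
  have h1 := hI.ev_comp hp hf
  rwa [LocOp.sub_ev, sub_eq_zero, LocOp.ev_restr _ _ _ hz, LocOp.ev_restr _ _ _ hz] at h1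

theorem InVertIdeal.sub_trans {V : Opens Z} {P Q R : LocOp (n + k) V}
    (h : InVertIdeal (n := n) p (P - Q)) (h' : InVertIdeal (n := n) p (Q - R)) :
    InVertIdeal (n := n) p (P - R) := by
  simpa using h.add h'

theorem InVertIdeal.sub_symm {V : Opens Z} {P Q : LocOp (n + k) V}
    (h : InVertIdeal (n := n) p (P - Q)) : InVertIdeal (n := n) p (Q - P) := by
  simpa using h.neg

/-- Two representatives differ near z by an element of the vertical ideal, which kills f ∘ p; so the
value does not depend on the representative. -/
theorem famEv_eq (hp : ContMDiff 𝓘(ℂ, Cn (n + k)) 𝓘(ℂ, Cn n) ω p) {V₀ : Opens Z} {P : LocOp (n + k) V₀}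
    (h : Represents (n := n) p x P) {z : Z} (hz : z ∈ V₀) {f : Y → ℂ} (hf : p z ∈ smoothLocus n f) :
    famEv p x f z = P.ev (f ∘ p) z := by
  have H : ∃ (V₀ : Opens Z) (P : LocOp (n + k) V₀), z ∈ V₀ ∧ Represents (n := n) p x P :=
    ⟨V₀, P, hz, h⟩
  rw [famEv, dif_pos H]
  obtain ⟨hzM, -, hM⟩ := H.choose_spec.choose_spec
  set M := H.choose
  exact InVertIdeal.ev_eq hp (N := V₀ ⊓ M) inf_le_right inf_le_left
    ((hM _ inf_le_right).sub_symm.sub_trans (h.2 _ inf_le_left)) ⟨hz, hzM⟩ hf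

theorem isRepresentedAt_iff {z : Z} : IsRepresentedAt (n := n) p x z ↔
    ∃ (V₀ : Opens Z) (P : LocOp (n + k) V₀), z ∈ V₀ ∧ Represents (n := n) p x P := Iff.rfl

theorem Represents.of_ev (hs : Manifold.IsSubmersion 𝓘(ℂ, Cn (n + k)) 𝓘(ℂ, Cn n) ω p) {V V₀ : Opens Z}
    {P : LocOp (n + k) V} (h : Represents (n := n) p x P) {Q : LocOp (n + k) V₀}
    (hQ : IsHolDiffOp (n + k) Q) (hV : V₀ ≤ V)
    (h' : ∀ z ∈ V₀, ∀ f : Y → ℂ, p z ∈ smoothLocus n f → P.ev (f ∘ p) z = Q.ev (f ∘ p) z) :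
    Represents (n := n) p x Q := by
  refine ⟨hQ, fun N hN => (h.2 N (hN.trans hV)).sub_trans ?_⟩
  refine inVertIdeal_of_ev hs ((h.1.restr _).add ((hQ.restr hN).neg) |> fun h => by rwa [← sub_eq_add_neg] at h)
    fun z hz f hf => ?_
  rw [LocOp.sub_ev, LocOp.ev_restr _ _ _ hz, LocOp.ev_restr _ _ _ hz, h' z (hN hz) f hf, sub_self]

theorem Represents.restr {V₀ : Opens Z} {P : LocOp (n + k) V₀} (h : Represents (n := n) p x P)
    {V : Opens Z} (hV : V ≤ V₀) : Represents (n := n) p x (HomOn.restr hV P) :=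
  ⟨h.1.restr hV, fun N hN => h.2 N (hN.trans hV)⟩

/-- Operators with equal action on pulled back functions are congruent modulo the ideal. This
faithfulness lets identities in the quotient be checked on functions. -/
theorem agreeAt_of_famEv (hs : Manifold.IsSubmersion 𝓘(ℂ, Cn (n + k)) 𝓘(ℂ, Cn n) ω p) {z : Z}
    (hx : IsRepresentedAt (n := n) p x z) (hy : IsRepresentedAt (n := n) p y z) {W : Opens Z} (hz : z ∈ W)
    (h : ∀ z' ∈ W, ∀ f : Y → ℂ, p z' ∈ smoothLocus n f → famEv p x f z' = famEv p y f z') :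
    AgreeAt (n := n) p x y z := by
  obtain ⟨V, P, hzV, hP⟩ := isRepresentedAt_iff.1 hx
  obtain ⟨V', P', hzV', hP'⟩ := isRepresentedAt_iff.1 hy
  have h1 : W ⊓ (V ⊓ V') ≤ V := inf_le_right.trans inf_le_left
  have h2 : W ⊓ (V ⊓ V') ≤ V' := inf_le_right.trans inf_le_right
  have h3 : Represents (n := n) p x (HomOn.restr h2 P') :=
    hP.of_ev hs (hP'.1.restr h2) h1 fun y' hy' f hf => by
      rw [LocOp.ev_restr _ _ _ hy', ← famEv_eq hs.contMDiff hP hy'.2.1 hf,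
        ← famEv_eq hs.contMDiff hP' hy'.2.2 hf, h y' hy'.1 f hf]
  exact ⟨W ⊓ (V ⊓ V'), ⟨hz, hzV, hzV'⟩, fun N hN =>
    (h3.2 N hN).sub_trans (hP'.2 N (hN.trans h2)).sub_symm⟩

theorem famEv_eq_of_agreeAt (hp : ContMDiff 𝓘(ℂ, Cn (n + k)) 𝓘(ℂ, Cn n) ω p) {z : Z}
    (h : AgreeAt (n := n) p x y z) (hy : IsRepresentedAt (n := n) p y z) {f : Y → ℂ}
    (hf : p z ∈ smoothLocus n f) : famEv p x f z = famEv p y f z := by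
  obtain ⟨V, P, hzV, hP⟩ := isRepresentedAt_iff.1 hy
  obtain ⟨W, hzW, hW⟩ := h
  have h1 : Represents (n := n) p x (HomOn.restr (inf_le_right : W ⊓ V ≤ V) P) :=
    ⟨hP.1.restr _, fun N hN => (hW N (hN.trans inf_le_left)).sub_trans (hP.2 N (hN.trans inf_le_right))⟩
  rw [famEv_eq hp h1 ⟨hzW, hzV⟩ hf, famEv_eq hp hP hzV hf, LocOp.ev_restr _ _ _ (⟨hzW, hzV⟩ : z ∈ W ⊓ V)]

/-- `P` represents on `V₀` the functional `H` on functions on `Y`. -/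
def EvRep (p : C(Z, Y)) (H : (Y → ℂ) → Z → ℂ) {V₀ : Opens Z} (P : LocOp (n + k) V₀) : Prop :=
  IsHolDiffOp (n + k) P ∧ ∀ z ∈ V₀, ∀ f : Y → ℂ, p z ∈ smoothLocus n f → P.ev (f ∘ p) z = H f z

theorem EvRep.restr {H : (Y → ℂ) → Z → ℂ} {V₀ : Opens Z} {P : LocOp (n + k) V₀}
    (h : EvRep (n := n) p H P) {V : Opens Z} (hV : V ≤ V₀) : EvRep (n := n) p H (HomOn.restr hV P) :=
  ⟨h.1.restr hV, fun z hz f hf => by rw [LocOp.ev_restr _ _ _ hz, h.2 z (hV hz) f hf]⟩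

open Classical in
/-- A family of operators with prescribed action on functions on `Y`. -/
def famOf (p : C(Z, Y)) (H : (Y → ℂ) → Z → ℂ) (V : Opens Z) : LocOp (n + k) V :=
  if h : ∃ Q : LocOp (n + k) V, EvRep (n := n) p H Q then h.choose else 0

/-- Operators with the same action are congruent, so they may be chosen independently on every open
set and still form a family of local representatives. -/
theorem represents_famOf (hs : Manifold.IsSubmersion 𝓘(ℂ, Cn (n + k)) 𝓘(ℂ, Cn n) ω p)
    {H : (Y → ℂ) → Z → ℂ} {V₀ : Opens Z} {P : LocOp (n + k) V₀} (h : EvRep (n := n) p H P) :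
    Represents (n := n) p (famOf p H) P := by
  refine ⟨h.1, fun V hV => ?_⟩
  have hE : ∃ Q : LocOp (n + k) V, EvRep (n := n) p H Q := ⟨_, h.restr hV⟩
  rw [famOf, dif_pos hE]
  have h1 := hE.choose_spec
  refine inVertIdeal_of_ev hs ((h1.1).add ((h.1.restr hV).neg) |> fun h => by rwa [← sub_eq_add_neg] at h)
    fun z hz f hf => ?_
  rw [LocOp.sub_ev, h1.2 z hz f hf, (h.restr hV).2 z hz f hf, sub_self]

end GermsOfFamilies

/-! ### The action of sections of the transfer sheaf on functions -/

section Hats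

variable {n k : ℕ} {Y Z : Type*} [TopologicalSpace Y] [T2Space Y] [ChartedSpace (Cn n) Y]
  [TopologicalSpace Z] [T2Space Z] [ChartedSpace (Cn (n + k)) Z]
  [IsManifold 𝓘(ℂ, Cn (n + k)) ω Z] [IsManifold 𝓘(ℂ, Cn n) ω Y] {p : C(Z, Y)}
  (hs : Manifold.IsSubmersion 𝓘(ℂ, Cn (n + k)) 𝓘(ℂ, Cn n) ω p) (L : HolLineBundle n Y)

/-- The transition function of `K_Y⁻¹ ⊗ L`. -/
def baseFactor (L : HolLineBundle n Y) (i i' : L.ι) (b b' : Chart n Y) (y : Y) : ℂ :=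
  (HolLineBundle.jac b b' y)⁻¹ * L.g i i' y

variable {L} in
theorem baseFactor_mem_smoothLocus {i i' : L.ι} {b b' : Chart n Y} {y : Y} (hi : y ∈ L.dom i)
    (hi' : y ∈ L.dom i') (hb : y ∈ b.1.source) (hb' : y ∈ b'.1.source) :
    y ∈ smoothLocus n (baseFactor L i i' b b') := by
  have h1 : HolOn n (fun y => (HolLineBundle.jac b b' y)⁻¹)
      ((⟨b.1.source, b.1.open_source⟩ ⊓ ⟨b'.1.source, b'.1.open_source⟩ : Opens Y) : Set Y) :=
    HolOn.inv (jac_hol b b') fun x hx => jac_ne_zero b b' hx.1 hx.2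
  exact smoothLocus_mul ((h1.smoothOn n).mem_smoothLocus ⟨hb, hb'⟩)
    (((L.hol i i').smoothOn n).mem_smoothLocus ⟨hi, hi'⟩)

theorem changeTriv_sub (τ τ' : (twistM p hs.contMDiff L).ι) {V : Opens Z} (P Q : LocOp (n + k) V) :
    changeTriv p hs.contMDiff L τ τ' (P - Q) =
      changeTriv p hs.contMDiff L τ τ' P - changeTriv p hs.contMDiff L τ τ' Q := by
  rw [sub_eq_add_neg, changeTriv_add, ← neg_one_smul ℂ Q, changeTriv_smul, neg_one_smul, ← sub_eq_add_neg]

variable {L}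

/-- The right factor is pulled back from Y and can be absorbed into the function; only the left
factor remains a function on Z. -/
theorem changeTriv_ev {τ τ' : (twistM p hs.contMDiff L).ι} {V : Opens Z}
    (hV : V ≤ (twistM p hs.contMDiff L).dom τ ⊓ (twistM p hs.contMDiff L).dom τ') (P : LocOp (n + k) V)
    {z : Z} (hz : z ∈ V) {f : Y → ℂ} (hf : p z ∈ smoothLocus n f) :
    (changeTriv p hs.contMDiff L τ τ' P).ev (f ∘ p) z = leftFactor p hs.contMDiff L τ τ' z *
      P.ev ((fun y => baseFactor L τ.1 τ'.1 τ.2.2 τ'.2.2 y * f y) ∘ p) z := by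
  have hl := HolOn.smoothOn _ ((leftFactor_hol p hs.contMDiff L τ τ').mono hV)
  have hr := HolOn.smoothOn _ ((rightFactor_hol p hs.contMDiff L τ τ').mono hV)
  have hfp := smoothLocus_comp hs.contMDiff hf
  have h1 := LocOp.mem_smoothLocus_ev (mulOp (n + k) (rightFactor p hs.contMDiff L τ τ') V) hz hfp
  rw [changeTriv, LocOp.comp_ev _ _ hfp,
    LocOp.mulOp_ev hl hz (smoothLocus_congr ?_ (P.mem_smoothLocus_ev hz h1)), LocOp.comp_ev _ _ hfp]
  · congr 1
    refine P.ev_congr ?_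
    filter_upwards [V.2.mem_nhds hz, (Opens.comap p (smoothLocus n f)).2.mem_nhds hf] with y hy hyf
    exact LocOp.mulOp_ev hr hy (smoothLocus_comp hs.contMDiff hyf)
  · filter_upwards [(Opens.comap p (smoothLocus n f)).2.mem_nhds hf] with y hyf
    exact (LocOp.comp_ev _ _ (smoothLocus_comp hs.contMDiff hyf)).symm

theorem changeTriv_isHol {τ τ' : (twistM p hs.contMDiff L).ι} {V : Opens Z}
    (hV : V ≤ (twistM p hs.contMDiff L).dom τ ⊓ (twistM p hs.contMDiff L).dom τ') {P : LocOp (n + k) V}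
    (hP : IsHolDiffOp (n + k) P) : IsHolDiffOp (n + k) (changeTriv p hs.contMDiff L τ τ' P) :=
  (IsHolDiffOp.mul _ ((leftFactor_hol p hs.contMDiff L τ τ').mono hV)).comp
    (hP.comp (IsHolDiffOp.mul _ ((rightFactor_hol p hs.contMDiff L τ τ').mono hV)))

theorem baseFactor_mul_mem_smoothLocus {τ τ' : (twistM p hs.contMDiff L).ι} {z : Z}
    (hz : z ∈ (twistM p hs.contMDiff L).dom τ) (hz' : z ∈ (twistM p hs.contMDiff L).dom τ') {f : Y → ℂ}
    (hf : p z ∈ smoothLocus n f) :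
    p z ∈ smoothLocus n (fun y => baseFactor L τ.1 τ'.1 τ.2.2 τ'.2.2 y * f y) :=
  smoothLocus_mul (baseFactor_mem_smoothLocus hz.1 hz'.1 hz.2.2 hz'.2.2) hf

/-- Right multiplication by a general function would leave the left ideal. The factor used here
comes from Y, so the new operator still kills pulled back functions. -/
theorem changeTriv_inVertIdeal {τ τ' : (twistM p hs.contMDiff L).ι} {V : Opens Z}
    (hV : V ≤ (twistM p hs.contMDiff L).dom τ ⊓ (twistM p hs.contMDiff L).dom τ') {P : LocOp (n + k) V}
    (hP : InVertIdeal (n := n) p P) : InVertIdeal (n := n) p (changeTriv p hs.contMDiff L τ τ' P) := by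
  refine inVertIdeal_of_ev hs (changeTriv_isHol hs hV hP.isHol) fun z hz f hf => ?_
  rw [changeTriv_ev hs hV P hz hf, hP.ev_comp hs.contMDiff
    (baseFactor_mul_mem_smoothLocus hs (hV hz).1 (hV hz).2 hf), mul_zero]

theorem Represents.changeTriv {τ τ' : (twistM p hs.contMDiff L).ι} {V : Opens Z}
    (hV : V ≤ (twistM p hs.contMDiff L).dom τ ⊓ (twistM p hs.contMDiff L).dom τ')
    {x : ∀ V : Opens Z, LocOp (n + k) V} {P : LocOp (n + k) V} (h : Represents (n := n) p x P) :
    Represents (n := n) p (fun V => changeTriv p hs.contMDiff L τ τ' (x V))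
      (DPush.changeTriv p hs.contMDiff L τ τ' P) := by
  refine ⟨changeTriv_isHol hs hV h.1, fun N hN => ?_⟩
  have h1 := changeTriv_inVertIdeal hs (τ := τ) (τ' := τ') (hN.trans hV) (h.2 N hN)
  rw [changeTriv_sub hs] at h1
  have h2 : HomOn.restr hN (DPush.changeTriv p hs.contMDiff L τ τ' P) =
      DPush.changeTriv p hs.contMDiff L τ τ' (HomOn.restr hN P) := by
    have h3 := mulOp_restr (HolOn.smoothOn _ ((leftFactor_hol p hs.contMDiff L τ τ').mono hV)) hN
    have h4 := mulOp_restr (HolOn.smoothOn _ ((rightFactor_hol p hs.contMDiff L τ τ').mono hV)) hN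
    rw [DPush.changeTriv, DPush.changeTriv, ← h3, ← h4]
    rfl
  rw [h2]
  exact h1

variable {U : Opens Y}

/-- The action of a section of the transfer sheaf on functions on `Y`, in the trivialization `τ`. -/
def hat (ξ : (transferSheaf p hs.contMDiff L).sec U) (τ : (twistM p hs.contMDiff L).ι) (f : Y → ℂ) : Z → ℂ :=
  famEv p ((Submodule.Quotient.mk_surjective _ ξ).choose.1 τ) f

/-- Equality in the quotient is equality of actions. Hence `hat` does not depend on the chosen
family, and a section is determined by its `hat`. -/
theorem transferMk_eq_iff (x y : transferFamilies p hs.contMDiff L U) :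
    transferMk p hs.contMDiff L x = transferMk p hs.contMDiff L y ↔
      ∀ (τ : (twistM p hs.contMDiff L).ι) (z : Z), p z ∈ U → z ∈ (twistM p hs.contMDiff L).dom τ →
        ∀ f : Y → ℂ, p z ∈ smoothLocus n f → famEv p (x.1 τ) f z = famEv p (y.1 τ) f z := by
  have h0 : transferMk p hs.contMDiff L x = transferMk p hs.contMDiff L y ↔
      ∀ (τ : (twistM p hs.contMDiff L).ι) (z : Z), p z ∈ U → z ∈ (twistM p hs.contMDiff L).dom τ →
        AgreeAt (n := n) p (fun V => x.1 τ V - y.1 τ V) (fun _ => 0) z :=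
    Submodule.Quotient.eq _
  rw [h0]
  constructor
  · intro h τ z hz hτ f hf
    obtain ⟨V, hzV, hV⟩ := h τ z hz hτ
    refine famEv_eq_of_agreeAt hs.contMDiff ⟨V, hzV, fun N hN => ?_⟩ (y.2.1 τ z hz hτ) hf
    simpa using hV N hN
  · intro h τ z hz hτ
    have h1 : AgreeAt (n := n) p (x.1 τ) (y.1 τ) z :=
      agreeAt_of_famEv hs (x.2.1 τ z hz hτ) (y.2.1 τ z hz hτ)
        (W := Opens.comap p U ⊓ (twistM p hs.contMDiff L).dom τ) ⟨hz, hτ⟩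
        fun z' hz' f hf => h τ z' hz'.1 hz'.2 f hf
    obtain ⟨V, hzV, hV⟩ := h1
    exact ⟨V, hzV, fun N hN => by simpa using hV N hN⟩

theorem hat_mk (x : transferFamilies p hs.contMDiff L U) {τ : (twistM p hs.contMDiff L).ι} {z : Z}
    (hz : p z ∈ U) (hτ : z ∈ (twistM p hs.contMDiff L).dom τ) {f : Y → ℂ} (hf : p z ∈ smoothLocus n f) :
    hat hs (transferMk p hs.contMDiff L x) τ f z = famEv p (x.1 τ) f z :=
  (transferMk_eq_iff hs _ _).1
    (Submodule.Quotient.mk_surjective _ (transferMk p hs.contMDiff L x)).choose_spec τ z hz hτ f hf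

theorem hat_ext {ξ η : (transferSheaf p hs.contMDiff L).sec U}
    (h : ∀ (τ : (twistM p hs.contMDiff L).ι) (z : Z), p z ∈ U → z ∈ (twistM p hs.contMDiff L).dom τ →
        ∀ f : Y → ℂ, p z ∈ smoothLocus n f → hat hs ξ τ f z = hat hs η τ f z) : ξ = η := by
  obtain ⟨x, rfl⟩ := Submodule.Quotient.mk_surjective _ ξ
  obtain ⟨y, rfl⟩ := Submodule.Quotient.mk_surjective _ η
  refine (transferMk_eq_iff hs x y).2 fun τ z hz hτ f hf => ?_
  rw [← hat_mk hs x hz hτ hf, ← hat_mk hs y hz hτ hf]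
  exact h τ z hz hτ f hf

/-- Local representatives of a section. -/
theorem exists_evRep (ξ : (transferSheaf p hs.contMDiff L).sec U) {τ : (twistM p hs.contMDiff L).ι} {z : Z}
    (hz : p z ∈ U) (hτ : z ∈ (twistM p hs.contMDiff L).dom τ) :
    ∃ (V : Opens Z) (P : LocOp (n + k) V), z ∈ V ∧ V ≤ Opens.comap p U ⊓ (twistM p hs.contMDiff L).dom τ ∧
      EvRep (n := n) p (hat hs ξ τ) P := by
  obtain ⟨x, rfl⟩ := Submodule.Quotient.mk_surjective _ ξ
  obtain ⟨V, P, hzV, hP⟩ := isRepresentedAt_iff.1 (x.2.1 τ z hz hτ)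
  have h1 : V ⊓ (Opens.comap p U ⊓ (twistM p hs.contMDiff L).dom τ) ≤ V := inf_le_left
  refine ⟨_, HomOn.restr h1 P, ⟨hzV, hz, hτ⟩, inf_le_right, hP.1.restr h1, fun y hy f hf => ?_⟩
  rw [LocOp.ev_restr _ _ _ hy, ← famEv_eq hs.contMDiff hP hy.1 hf]
  exact (hat_mk hs x hy.2.1 hy.2.2 hf).symm

theorem hat_change (ξ : (transferSheaf p hs.contMDiff L).sec U) {τ τ' : (twistM p hs.contMDiff L).ι} {z : Z}
    (hz : p z ∈ U) (hτ : z ∈ (twistM p hs.contMDiff L).dom τ) (hτ' : z ∈ (twistM p hs.contMDiff L).dom τ')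
    {f : Y → ℂ} (hf : p z ∈ smoothLocus n f) :
    hat hs ξ τ f z = leftFactor p hs.contMDiff L τ τ' z *
      hat hs ξ τ' (fun y => baseFactor L τ.1 τ'.1 τ.2.2 τ'.2.2 y * f y) z := by
  obtain ⟨x, rfl⟩ := Submodule.Quotient.mk_surjective _ ξ
  have hf' := baseFactor_mul_mem_smoothLocus hs hτ hτ' hf
  refine (hat_mk hs x hz hτ hf).trans ?_
  refine Eq.trans ?_ (congrArg _ (hat_mk hs x hz hτ' hf')).symm
  obtain ⟨V, P, hzV, hP⟩ := isRepresentedAt_iff.1 (x.2.1 τ' z hz hτ')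
  have hle : V ⊓ ((twistM p hs.contMDiff L).dom τ ⊓ (twistM p hs.contMDiff L).dom τ') ≤ V := inf_le_left
  have hP' := (hP.restr hle).changeTriv hs (τ := τ) (τ' := τ') inf_le_right
  have hz' : z ∈ V ⊓ ((twistM p hs.contMDiff L).dom τ ⊓ (twistM p hs.contMDiff L).dom τ') := ⟨hzV, hτ, hτ'⟩
  rw [famEv_eq_of_agreeAt hs.contMDiff (x.2.2 τ τ' z hz hτ hτ') ⟨_, _, hz', hP'⟩ hf,
    famEv_eq hs.contMDiff hP' hz' hf, famEv_eq hs.contMDiff hP hzV hf', changeTriv_ev hs inf_le_right _ hz' hf,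
    LocOp.ev_restr _ _ _ hz']

/-- Sections of the transfer sheaf from their actions on functions. -/
theorem exists_hat_eq (H : (twistM p hs.contMDiff L).ι → (Y → ℂ) → Z → ℂ)
    (hrep : ∀ (τ : (twistM p hs.contMDiff L).ι) (z : Z), p z ∈ U → z ∈ (twistM p hs.contMDiff L).dom τ →
      ∃ (V : Opens Z) (P : LocOp (n + k) V), z ∈ V ∧ EvRep (n := n) p (H τ) P)
    (hch : ∀ (τ τ' : (twistM p hs.contMDiff L).ι) (z : Z), p z ∈ U → z ∈ (twistM p hs.contMDiff L).dom τ →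
      z ∈ (twistM p hs.contMDiff L).dom τ' → ∀ f : Y → ℂ, p z ∈ smoothLocus n f →
      H τ f z = leftFactor p hs.contMDiff L τ τ' z *
        H τ' (fun y => baseFactor L τ.1 τ'.1 τ.2.2 τ'.2.2 y * f y) z) :
    ∃ η : (transferSheaf p hs.contMDiff L).sec U, ∀ (τ : (twistM p hs.contMDiff L).ι) (z : Z), p z ∈ U →
      z ∈ (twistM p hs.contMDiff L).dom τ → ∀ f : Y → ℂ, p z ∈ smoothLocus n f → hat hs η τ f z = H τ f z := by
  have hF : ∀ (τ : (twistM p hs.contMDiff L).ι) (z : Z), p z ∈ U → z ∈ (twistM p hs.contMDiff L).dom τ →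
      ∀ f : Y → ℂ, p z ∈ smoothLocus n f → famEv (n := n) (k := k) p (fun V => famOf p (H τ) V) f z = H τ f z := by
    intro τ z hz hτ f hf
    obtain ⟨V, P, hzV, hP⟩ := hrep τ z hz hτ
    rw [famEv_eq hs.contMDiff (represents_famOf hs hP) hzV hf, hP.2 z hzV f hf]
  have hR : ∀ (τ : (twistM p hs.contMDiff L).ι) (z : Z), p z ∈ U → z ∈ (twistM p hs.contMDiff L).dom τ →
      IsRepresentedAt (n := n) (k := k) p (famOf p (H τ)) z := by
    intro τ z hz hτ
    obtain ⟨V, P, hzV, hP⟩ := hrep τ z hz hτ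
    exact ⟨V, P, hzV, represents_famOf hs hP⟩
  refine ⟨transferMk p hs.contMDiff L ⟨fun τ => famOf p (H τ), hR, fun τ τ' z hz hτ hτ' => ?_⟩,
    fun τ z hz hτ f hf => (hat_mk hs _ hz hτ hf).trans (hF τ z hz hτ f hf)⟩
  have hrep' : ∀ z ∈ (Opens.comap p U ⊓ ((twistM p hs.contMDiff L).dom τ ⊓ (twistM p hs.contMDiff L).dom τ')
      : Opens Z), ∃ (V : Opens Z) (P : LocOp (n + k) V), z ∈ V ∧
        V ≤ (twistM p hs.contMDiff L).dom τ ⊓ (twistM p hs.contMDiff L).dom τ' ∧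
        EvRep (n := n) p (H τ') P ∧ Represents (n := n) p (famOf p (H τ')) P := by
    intro z hz
    obtain ⟨V, P, hzV, hP⟩ := hrep τ' z hz.1 hz.2.2
    have hle : V ⊓ ((twistM p hs.contMDiff L).dom τ ⊓ (twistM p hs.contMDiff L).dom τ') ≤ V := inf_le_left
    exact ⟨_, HomOn.restr hle P, ⟨hzV, hz.2⟩, inf_le_right, hP.restr hle, (represents_famOf hs hP).restr hle⟩
  have hz' : z ∈ (Opens.comap p U ⊓ ((twistM p hs.contMDiff L).dom τ ⊓ (twistM p hs.contMDiff L).dom τ')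
      : Opens Z) := ⟨hz, hτ, hτ'⟩
  refine agreeAt_of_famEv hs (hR τ z hz hτ) ?_ hz' fun z' hz' f hf => ?_
  · obtain ⟨V, P, hzV, hV, -, hP⟩ := hrep' z hz'
    exact ⟨V, _, hzV, hP.changeTriv hs hV⟩
  · obtain ⟨V, P, hzV, hV, hPe, hP⟩ := hrep' z' hz'
    rw [hF τ z' hz'.1 hz'.2.1 f hf, famEv_eq hs.contMDiff (hP.changeTriv hs hV) hzV hf,
      changeTriv_ev hs hV P hzV hf, hPe.2 z' hzV _ (baseFactor_mul_mem_smoothLocus hs hz'.2.1 hz'.2.2 hf)]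
    exact hch τ τ' z' hz'.1 hz'.2.1 hz'.2.2 f hf

theorem hat_congr (ξ : (transferSheaf p hs.contMDiff L).sec U) {τ : (twistM p hs.contMDiff L).ι} {z : Z}
    (hz : p z ∈ U) (hτ : z ∈ (twistM p hs.contMDiff L).dom τ) {f g : Y → ℂ} (h : f =ᶠ[𝓝 (p z)] g)
    (hf : p z ∈ smoothLocus n f) : hat hs ξ τ f z = hat hs ξ τ g z := by
  obtain ⟨V, P, hzV, -, hP⟩ := exists_evRep hs ξ hz hτ
  rw [← hP.2 z hzV f hf, ← hP.2 z hzV g (smoothLocus_congr h hf)]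
  exact P.ev_congr (p.continuous.continuousAt.eventually h)

theorem hat_mem_smoothLocus (ξ : (transferSheaf p hs.contMDiff L).sec U) {τ : (twistM p hs.contMDiff L).ι}
    {z : Z} (hz : p z ∈ U) (hτ : z ∈ (twistM p hs.contMDiff L).dom τ) {f : Y → ℂ}
    (hf : p z ∈ smoothLocus n f) : z ∈ smoothLocus (n + k) (hat hs ξ τ f) := by
  obtain ⟨V, P, hzV, -, hP⟩ := exists_evRep hs ξ hz hτ
  refine smoothLocus_congr ?_ (P.mem_smoothLocus_ev hzV (smoothLocus_comp hs.contMDiff hf))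
  filter_upwards [V.2.mem_nhds hzV, (Opens.comap p (smoothLocus n f)).2.mem_nhds hf] with y hy hyf
  exact hP.2 y hy f hyf

theorem hat_fun_add (ξ : (transferSheaf p hs.contMDiff L).sec U) {τ : (twistM p hs.contMDiff L).ι} {z : Z}
    (hz : p z ∈ U) (hτ : z ∈ (twistM p hs.contMDiff L).dom τ) {f g : Y → ℂ}
    (hf : p z ∈ smoothLocus n f) (hg : p z ∈ smoothLocus n g) :
    hat hs ξ τ (fun y => f y + g y) z = hat hs ξ τ f z + hat hs ξ τ g z := by
  obtain ⟨V, P, hzV, -, hP⟩ := exists_evRep hs ξ hz hτ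
  rw [← hP.2 z hzV f hf, ← hP.2 z hzV g hg, ← hP.2 z hzV _ (smoothLocus_add hf hg)]
  exact P.ev_add (smoothLocus_comp hs.contMDiff hf) (smoothLocus_comp hs.contMDiff hg)

/-- Pull-backs of antiholomorphic functions are antiholomorphic on Z, and local representatives
commute with them. -/
theorem hat_conj_mul (ξ : (transferSheaf p hs.contMDiff L).sec U) {τ : (twistM p hs.contMDiff L).ι} {z : Z}
    (hz : p z ∈ U) (hτ : z ∈ (twistM p hs.contMDiff L).dom τ) {f g : Y → ℂ} {B : Opens Y} (hg : HolOn n g B)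
    (hzB : p z ∈ B) (hf : p z ∈ smoothLocus n f) :
    hat hs ξ τ (fun y => conjFun g y * f y) z = conjFun g (p z) * hat hs ξ τ f z := by
  obtain ⟨V, P, hzV, -, hP⟩ := exists_evRep hs ξ hz hτ
  have hgc : p z ∈ smoothLocus n (conjFun g) := ((hg.smoothOn n).conj).mem_smoothLocus hzB
  rw [← hP.2 z hzV f hf, ← hP.2 z hzV _ (smoothLocus_mul hgc hf)]
  have hgp : HolOn (n + k) (g ∘ p) (Opens.comap p B) := hg.comp hs.contMDiff.contMDiffOn fun _ h => h
  exact hP.1.ev_conj_mul hgp hzB (smoothLocus_comp hs.contMDiff hf)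

theorem Represents.add {x y : ∀ V : Opens Z, LocOp (n + k) V} {V V' : Opens Z} {P : LocOp (n + k) V}
    {P' : LocOp (n + k) V'} (hP : Represents (n := n) p x P) (hP' : Represents (n := n) p y P') :
    Represents (n := n) p (fun V => x V + y V)
      (HomOn.restr (inf_le_left : V ⊓ V' ≤ V) P + HomOn.restr (inf_le_right : V ⊓ V' ≤ V') P') := by
  refine ⟨(hP.1.restr _).add (hP'.1.restr _), fun N hN => ?_⟩
  rw [map_add]
  exact (hP.2 N (hN.trans inf_le_left)).add_sub (hP'.2 N (hN.trans inf_le_right))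

theorem hat_add (ξ η : (transferSheaf p hs.contMDiff L).sec U) {τ : (twistM p hs.contMDiff L).ι} {z : Z}
    (hz : p z ∈ U) (hτ : z ∈ (twistM p hs.contMDiff L).dom τ) {f : Y → ℂ} (hf : p z ∈ smoothLocus n f) :
    hat hs (ξ + η) τ f z = hat hs ξ τ f z + hat hs η τ f z := by
  obtain ⟨x, rfl⟩ := Submodule.Quotient.mk_surjective _ ξ
  obtain ⟨y, rfl⟩ := Submodule.Quotient.mk_surjective _ η
  change hat hs (transferMk p hs.contMDiff L (x + y)) τ f z =
    hat hs (transferMk p hs.contMDiff L x) τ f z + hat hs (transferMk p hs.contMDiff L y) τ f z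
  rw [hat_mk hs x hz hτ hf, hat_mk hs y hz hτ hf, hat_mk hs (x + y) hz hτ hf]
  change famEv p (fun V => x.1 τ V + y.1 τ V) f z = _
  obtain ⟨V, P, hzV, hP⟩ := isRepresentedAt_iff.1 (x.2.1 τ z hz hτ)
  obtain ⟨V', P', hzV', hP'⟩ := isRepresentedAt_iff.1 (y.2.1 τ z hz hτ)
  have hz' : z ∈ V ⊓ V' := ⟨hzV, hzV'⟩
  rw [famEv_eq hs.contMDiff (hP.add hP') hz' hf, famEv_eq hs.contMDiff hP hzV hf, famEv_eq hs.contMDiff hP' hzV' hf,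
    LocOp.add_ev, LocOp.ev_restr _ _ _ hz', LocOp.ev_restr _ _ _ hz']

theorem hat_smul (c : ℂ) (ξ : (transferSheaf p hs.contMDiff L).sec U) {τ : (twistM p hs.contMDiff L).ι} {z : Z}
    (hz : p z ∈ U) (hτ : z ∈ (twistM p hs.contMDiff L).dom τ) {f : Y → ℂ} (hf : p z ∈ smoothLocus n f) :
    hat hs (c • ξ) τ f z = c * hat hs ξ τ f z := by
  obtain ⟨x, rfl⟩ := Submodule.Quotient.mk_surjective _ ξ
  change hat hs (transferMk p hs.contMDiff L (c • x)) τ f z = c * hat hs (transferMk p hs.contMDiff L x) τ f z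
  rw [hat_mk hs x hz hτ hf, hat_mk hs (c • x) hz hτ hf]
  obtain ⟨V, P, hzV, hP⟩ := isRepresentedAt_iff.1 (x.2.1 τ z hz hτ)
  have h1 : Represents (n := n) p (fun V => c • x.1 τ V) (c • P) :=
    ⟨hP.1.smul c, fun N hN => (hP.2 N hN).smul_sub c⟩
  change famEv p (fun V => c • x.1 τ V) f z = _
  rw [famEv_eq hs.contMDiff h1 hzV hf, famEv_eq hs.contMDiff hP hzV hf, LocOp.smul_ev]

theorem hat_res {U' : Opens Y} (h : U' ≤ U) (ξ : (transferSheaf p hs.contMDiff L).sec U)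
    {τ : (twistM p hs.contMDiff L).ι} {z : Z} (hz : p z ∈ U') (hτ : z ∈ (twistM p hs.contMDiff L).dom τ)
    {f : Y → ℂ} (hf : p z ∈ smoothLocus n f) :
    hat hs ((transferSheaf p hs.contMDiff L).res h ξ) τ f z = hat hs ξ τ f z := by
  obtain ⟨x, rfl⟩ := Submodule.Quotient.mk_surjective _ ξ
  refine (hat_mk hs (Submodule.inclusion (transferFamilies_mono p hs.contMDiff L h) x) hz hτ hf).trans ?_
  exact (hat_mk hs x (h hz) hτ hf).symm

theorem hat_one {τ : (twistM p hs.contMDiff L).ι} {z : Z} (hτ : z ∈ (twistM p hs.contMDiff L).dom τ)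
    {f : Y → ℂ} (hf : p z ∈ smoothLocus n f) :
    hat hs (transferOne p hs.contMDiff L) τ f z = f (p z) := by
  refine (hat_mk (U := ⊤) hs _ (z := z) trivial hτ hf).trans ?_
  have h1 : Represents (n := n) p (fun V => HomOn.one (smoothSheaf (n + k) Z) V)
      (HomOn.one (smoothSheaf (n + k) Z) ⊤) := ⟨isHolDiffOp_one ⊤, fun V h => .of_eq rfl⟩
  refine (famEv_eq hs.contMDiff h1 (z := z) trivial hf).trans ?_
  exact LocOp.one_ev trivial (smoothLocus_comp hs.contMDiff hf)

end Hats

/-! ### The two module structures -/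

section Actions

variable {n k : ℕ} {Y Z : Type*} [TopologicalSpace Y] [T2Space Y] [ChartedSpace (Cn n) Y]
  [TopologicalSpace Z] [T2Space Z] [ChartedSpace (Cn (n + k)) Z]
  [IsManifold 𝓘(ℂ, Cn (n + k)) ω Z] [IsManifold 𝓘(ℂ, Cn n) ω Y] {p : C(Z, Y)}
  (hs : Manifold.IsSubmersion 𝓘(ℂ, Cn (n + k)) 𝓘(ℂ, Cn n) ω p) {L : HolLineBundle n Y} {U : Opens Y}

/-- Right multiplication by the lift of an operator on the base preserves the vertical ideal. -/
theorem InVertIdeal.comp_lift (hs : Manifold.IsSubmersion 𝓘(ℂ, Cn (n + k)) 𝓘(ℂ, Cn n) ω p) {B : Opens Y} {S : LocOp n B} {V : Opens Z} {I T : LocOp (n + k) V}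
    (hI : InVertIdeal (n := n) p I) (hT : IsHolDiffOp (n + k) T) (hV : V ≤ Opens.comap p B)
    (h : ∀ z ∈ V, ∀ f : Y → ℂ, p z ∈ smoothLocus n f → T.ev (f ∘ p) z = S.ev f (p z)) :
    InVertIdeal (n := n) p (HomOn.comp I T) := by
  refine inVertIdeal_of_ev hs (hI.isHol.comp hT) fun z hz f hf => ?_
  have hzB : p z ∈ B := hV hz
  rw [LocOp.comp_ev _ _ (smoothLocus_comp hs.contMDiff hf),
    ← hI.ev_comp hs.contMDiff (S.mem_smoothLocus_ev hzB hf)]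
  refine I.ev_congr ?_
  filter_upwards [V.2.mem_nhds hz, (Opens.comap p (smoothLocus n f)).2.mem_nhds hf] with y hy hyf
  exact h y hy f hyf

theorem HomOn.sub_comp {X : Type*} [TopologicalSpace X] {F G H : ModPresheaf X} {W : Opens X}
    (φ φ' : HomOn G H W) (ψ : HomOn F G W) : (φ - φ').comp ψ = φ.comp ψ - φ'.comp ψ := rfl

theorem LocOp.comp_sub {d : ℕ} {X : Type*} [TopologicalSpace X] [ChartedSpace (Cn d) X] {W : Opens X}
    (P Q Q' : LocOp d W) :
    HomOn.comp P (Q - Q') = HomOn.comp P Q - HomOn.comp P Q' := by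
  rw [sub_eq_add_neg, HomOn.comp_add, ← neg_one_smul ℂ Q', HomOn.comp_smul, neg_one_smul, ← sub_eq_add_neg]

theorem IsHolDiffOp.sub {d : ℕ} {X : Type*} [TopologicalSpace X] [ChartedSpace (Cn d) X]
    [IsManifold 𝓘(ℂ, Cn d) ω X] {W : Opens X} {P Q : LocOp d W} (hP : IsHolDiffOp d P)
    (hQ : IsHolDiffOp d Q) : IsHolDiffOp d (P - Q) := by
  rw [sub_eq_add_neg]
  exact hP.add hQ.neg

/-- The left action in terms of actions on functions. -/
theorem isLeftMul_iff (S : TwDiffOp L U) (ξ η : (transferSheaf p hs.contMDiff L).sec U) :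
    IsLeftMul p hs.contMDiff L S ξ η ↔
      ∀ (τ : (twistM p hs.contMDiff L).ι) (z : Z), p z ∈ U → z ∈ (twistM p hs.contMDiff L).dom τ →
        ∀ f : Y → ℂ, p z ∈ smoothLocus n f →
          hat hs η τ f z = hat hs ξ τ (trEv τ.2.2 (S.op τ.1) f) z := by
  constructor
  · rintro ⟨x, y, rfl, rfl, H⟩ τ z hz hτ f hf
    obtain ⟨B, hB, S', V₀, T, hzV, hVB, hBb, htr, hT, hlift, hI⟩ := H τ z hz hτ
    obtain ⟨V, P, hzV', hP⟩ := isRepresentedAt_iff.1 (x.2.1 τ z hz hτ)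
    have hl : ∀ z ∈ V₀, ∀ f : Y → ℂ, p z ∈ smoothLocus n f → T.ev (f ∘ p) z = S'.ev f (p z) :=
      fun z hz f hf => hlift.ev hs.contMDiff hVB hz hf
    have hzB : p z ∈ B := hVB hzV
    have hzb : p z ∈ τ.2.2.1.source := hBb hzB
    -- Replacing x by its representative P changes x ∘ T by an element of the ideal composed with T.
    -- Since T lifts an operator on the base, the ideal is stable under this right multiplication.
    have hrep : Represents (n := n) p (y.1 τ) (HomOn.comp (HomOn.restr (inf_le_right : V₀ ⊓ V ≤ V) P)
        (HomOn.restr (inf_le_left : V₀ ⊓ V ≤ V₀) T)) := by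
      refine ⟨(hP.1.restr _).comp (hT.restr _), fun N hN => (hI N (hN.trans inf_le_left)).sub_trans ?_⟩
      have h1 := (hP.2 N (hN.trans inf_le_right)).comp_lift (hs := hs) (S := S')
        (hT.restr (hN.trans inf_le_left)) ((hN.trans inf_le_left).trans hVB) fun z hz f hf => by
          rw [LocOp.ev_restr _ _ _ hz]
          exact hl z (hN hz).1 f hf
      rw [HomOn.sub_comp] at h1
      exact h1
    have hz' : z ∈ V₀ ⊓ V := ⟨hzV, hzV'⟩
    have htrf : p z ∈ smoothLocus n (trEv τ.2.2 (S.op τ.1) f) :=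
      trEv_mem_smoothLocus (S.isHol τ.1) ⟨hz, hτ.1⟩ hzb hf
    rw [hat_mk hs y hz hτ hf, hat_mk hs x hz hτ htrf, famEv_eq hs.contMDiff hrep hz' hf,
      famEv_eq hs.contMDiff hP hzV' htrf, LocOp.comp_ev _ _ (smoothLocus_comp hs.contMDiff hf),
      LocOp.ev_restr _ _ _ hz']
    refine P.ev_congr ?_
    filter_upwards [(V₀ ⊓ V).2.mem_nhds hz', (Opens.comap p (smoothLocus n f)).2.mem_nhds hf] with u hu huf
    have huB : p u ∈ B := hVB hu.1
    rw [LocOp.ev_restr _ _ _ hu, hl u hu.1 f huf]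
    exact (trEv_eq hB htr huB (hBb huB) huf).symm
  · intro H
    obtain ⟨x, rfl⟩ := Submodule.Quotient.mk_surjective _ ξ
    obtain ⟨y, rfl⟩ := Submodule.Quotient.mk_surjective _ η
    refine ⟨x, y, rfl, rfl, fun τ z hz hτ => ?_⟩
    obtain ⟨V, P, hzV, hP⟩ := isRepresentedAt_iff.1 (x.2.1 τ z hz hτ)
    obtain ⟨V', Q, hzV', hQ⟩ := isRepresentedAt_iff.1 (y.2.1 τ z hz hτ)
    obtain ⟨B, hB, S', hzB, hBb, htr, hev⟩ := exists_trEv τ.2.2 (S.isHol τ.1) (x := p z) ⟨hz, hτ.1⟩ hτ.2.2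
    obtain ⟨V₀, T, hzV₀, hVB, hT, hl⟩ := exists_lift_ev hs htr.isHol.2 z hzB
    set N₀ : Opens Z := (V₀ ⊓ (V ⊓ V')) ⊓ (Opens.comap p U ⊓ (twistM p hs.contMDiff L).dom τ) with hN₀
    have le0 : N₀ ≤ V₀ := inf_le_left.trans inf_le_left
    have le1 : N₀ ≤ V := inf_le_left.trans (inf_le_right.trans inf_le_left)
    have le2 : N₀ ≤ V' := inf_le_left.trans (inf_le_right.trans inf_le_right)
    refine ⟨B, hB, S', N₀, HomOn.restr le0 T, ⟨⟨hzV₀, hzV, hzV'⟩, hz, hτ⟩, le0.trans hVB, hBb, htr,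
      hT.restr _, IsLift.of_ev fun u hu f hf => ?_, fun N hN => ?_⟩
    · rw [LocOp.ev_restr _ _ _ hu]
      exact hl u (le0 hu) f hf
    · have h1 := (hP.2 N (hN.trans le1)).comp_lift (hs := hs) (S := S')
        (hT.restr (hN.trans le0)) ((hN.trans le0).trans hVB) fun z hz f hf => by
          rw [LocOp.ev_restr _ _ _ hz]
          exact hl z (le0 (hN hz)) f hf
      rw [HomOn.sub_comp] at h1
      refine (hQ.2 N (hN.trans le2)).sub_trans (InVertIdeal.sub_trans (InVertIdeal.sub_symm ?_) h1.sub_symm)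
      refine inVertIdeal_of_ev hs
        (((hP.1.restr _).comp (hT.restr _)).sub (hQ.1.restr _)) fun u hu f hf => ?_
      have hu' := hN hu
      have hub : p u ∈ τ.2.2.1.source := hBb (hVB (le0 hu'))
      have htrf : p u ∈ smoothLocus n (trEv τ.2.2 (S.op τ.1) f) :=
        trEv_mem_smoothLocus (S.isHol τ.1) ⟨hu'.2.1, hu'.2.2.1⟩ hub hf
      have h2 := H τ u hu'.2.1 hu'.2.2 f hf
      replace h2 := (hat_mk hs y hu'.2.1 hu'.2.2 hf).symm.trans (h2.trans (hat_mk hs x hu'.2.1 hu'.2.2 htrf))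
      rw [famEv_eq hs.contMDiff hQ (le2 hu') hf, famEv_eq hs.contMDiff hP (le1 hu') htrf] at h2
      rw [LocOp.sub_ev, LocOp.ev_restr _ _ _ hu, h2, LocOp.comp_ev _ _ (smoothLocus_comp hs.contMDiff hf),
        LocOp.ev_restr _ _ _ hu, sub_eq_zero]
      refine P.ev_congr ?_
      filter_upwards [N.2.mem_nhds hu, (Opens.comap p (smoothLocus n f)).2.mem_nhds hf] with v hv hvf
      rw [LocOp.ev_restr _ _ _ hv, hl v (le0 (hN hv)) f hvf]
      exact (hev (p v) (hVB (le0 (hN hv))) f hvf).symm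

/-- The right action in terms of actions on functions. -/
theorem isRightMul_iff (ξ η : (transferSheaf p hs.contMDiff L).sec U)
    (R : TwDiffOp (twistM p hs.contMDiff L) (Opens.comap p U)) :
    IsRightMul p hs.contMDiff L ξ R η ↔
      ∀ (τ : (twistM p hs.contMDiff L).ι) (z : Z), p z ∈ U → z ∈ (twistM p hs.contMDiff L).dom τ →
        ∀ f : Y → ℂ, p z ∈ smoothLocus n f →
          hat hs η τ f z = trEv τ.2.1 (R.op τ) (hat hs ξ τ f) z := by
  constructor
  · rintro ⟨x, y, rfl, rfl, H⟩ τ z hz hτ f hf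
    obtain ⟨V₀, hV₀, R', hzV, htr, hI⟩ := H τ z hz hτ
    obtain ⟨V, P, hzV', hP⟩ := isRepresentedAt_iff.1 (x.2.1 τ z hz hτ)
    have hza : z ∈ τ.2.1.1.source := hτ.2.1
    -- Here the multiplication is from the left, under which the ideal is stable for any operator.
    have hrep : Represents (n := n) p (y.1 τ) (HomOn.comp (HomOn.restr (inf_le_left : V₀ ⊓ V ≤ V₀) R')
        (HomOn.restr (inf_le_right : V₀ ⊓ V ≤ V) P)) := by
      refine ⟨(htr.isHol.2.restr _).comp (hP.1.restr _), fun N hN =>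
        (hI N (hN.trans inf_le_left)).sub_trans ?_⟩
      have h1 := (hP.2 N (hN.trans inf_le_right)).comp_left (htr.isHol.2.restr (hN.trans inf_le_left))
      rw [LocOp.comp_sub] at h1
      exact h1
    have hz' : z ∈ V₀ ⊓ V := ⟨hzV, hzV'⟩
    have hfp := smoothLocus_comp hs.contMDiff hf
    have hxf := hat_mem_smoothLocus hs (transferMk p hs.contMDiff L x) hz hτ hf
    refine (hat_mk hs y hz hτ hf).trans ?_
    refine Eq.trans ?_ (trEv_eq hV₀ htr hzV hza hxf).symm
    rw [famEv_eq hs.contMDiff hrep hz' hf, LocOp.comp_ev _ _ hfp, LocOp.ev_restr _ _ _ hz']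
    refine R'.ev_congr ?_
    filter_upwards [(V₀ ⊓ V).2.mem_nhds hz', (Opens.comap p (smoothLocus n f)).2.mem_nhds hf] with u hu huf
    have hu2 := hV₀ hu.1
    rw [hat_mk hs x hu2.1 hu2.2 huf, LocOp.ev_restr _ _ _ hu, famEv_eq hs.contMDiff hP hu.2 huf]
  · intro H
    obtain ⟨x, rfl⟩ := Submodule.Quotient.mk_surjective _ ξ
    obtain ⟨y, rfl⟩ := Submodule.Quotient.mk_surjective _ η
    refine ⟨x, y, rfl, rfl, fun τ z hz hτ => ?_⟩
    obtain ⟨V, P, hzV, hP⟩ := isRepresentedAt_iff.1 (x.2.1 τ z hz hτ)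
    obtain ⟨V', Q, hzV', hQ⟩ := isRepresentedAt_iff.1 (y.2.1 τ z hz hτ)
    obtain ⟨V₀, hV₀, R', hzV₀, hVa, htr, hev⟩ := exists_trEv τ.2.1 (R.isHol τ) (x := z) ⟨hz, hτ⟩ hτ.2.1
    set N₀ : Opens Z := V₀ ⊓ (V ⊓ V') with hN₀
    have le0 : N₀ ≤ V₀ := inf_le_left
    have le1 : N₀ ≤ V := inf_le_right.trans inf_le_left
    have le2 : N₀ ≤ V' := inf_le_right.trans inf_le_right
    refine ⟨N₀, le0.trans hV₀, HomOn.restr le0 R', ⟨hzV₀, hzV, hzV'⟩, htr.restr le0, fun N hN => ?_⟩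
    have h1 := (hP.2 N (hN.trans le1)).comp_left (htr.isHol.2.restr (hN.trans le0))
    rw [LocOp.comp_sub] at h1
    refine (hQ.2 N (hN.trans le2)).sub_trans (InVertIdeal.sub_trans (InVertIdeal.sub_symm ?_) h1.sub_symm)
    refine inVertIdeal_of_ev hs
      (((htr.isHol.2.restr _).comp (hP.1.restr _)).sub (hQ.1.restr _)) fun u hu f hf => ?_
    have hu' := hN hu
    have hu2 := hV₀ (le0 hu')
    have hxf := hat_mem_smoothLocus hs (transferMk p hs.contMDiff L x) hu2.1 hu2.2 hf
    have h2 := (hat_mk hs y hu2.1 hu2.2 hf).symm.trans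
      ((H τ u hu2.1 hu2.2 f hf).trans (hev u (le0 hu') _ hxf))
    rw [famEv_eq hs.contMDiff hQ (le2 hu') hf] at h2
    rw [LocOp.sub_ev, LocOp.ev_restr _ _ _ hu, h2, LocOp.comp_ev _ _ (smoothLocus_comp hs.contMDiff hf),
      LocOp.ev_restr _ _ _ hu, sub_eq_zero]
    refine R'.ev_congr ?_
    filter_upwards [N.2.mem_nhds hu, (Opens.comap p (smoothLocus n f)).2.mem_nhds hf] with v hv hvf
    have hv2 := hV₀ (le0 (hN hv))
    rw [hat_mk hs x hv2.1 hv2.2 hvf, LocOp.ev_restr _ _ _ hv, famEv_eq hs.contMDiff hP (le1 (hN hv)) hvf]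

theorem baseFactor_eq {i i' : L.ι} {b b' : Chart n Y} {y : Y} (hb : y ∈ b.1.source) (hb' : y ∈ b'.1.source) :
    baseFactor L i i' b b' y = HolLineBundle.jac b' b y * L.g i i' y := by
  rw [baseFactor, jac_inv b b' hb hb']

/-- The maps f ↦ ξ(Sᵗ f) define a section: locally they are given by P T, with P a representative of
ξ and T a lift of Sᵗ. The transposes of S in two trivializations are conjugate by the factor of
K_Y⁻¹ ⊗ L, which is what a change of trivialization requires. -/
theorem exists_isLeftMul (S : TwDiffOp L U) (ξ : (transferSheaf p hs.contMDiff L).sec U) :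
    ∃ η, IsLeftMul p hs.contMDiff L S ξ η := by
  obtain ⟨η, hη⟩ := exists_hat_eq hs (U := U) (L := L)
    (fun τ f z => hat hs ξ τ (trEv τ.2.2 (S.op τ.1) f) z)
    (fun τ z hz hτ => by
      obtain ⟨V, P, hzV, hVU, hP⟩ := exists_evRep hs ξ hz hτ
      obtain ⟨B, hB, S', hzB, hBb, htr, hev⟩ := exists_trEv τ.2.2 (S.isHol τ.1) (x := p z) ⟨hz, hτ.1⟩ hτ.2.2
      obtain ⟨V₀, T, hzV₀, hVB, hT, hl⟩ := exists_lift_ev hs htr.isHol.2 z hzB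
      refine ⟨V₀ ⊓ V, HomOn.comp (HomOn.restr inf_le_right P) (HomOn.restr inf_le_left T), ⟨hzV₀, hzV⟩,
        (hP.1.restr _).comp (hT.restr _), fun u hu f hf => ?_⟩
      have hub : p u ∈ B := hVB hu.1
      have hu2 := hVU hu.2
      have htrf : p u ∈ smoothLocus n (trEv τ.2.2 (S.op τ.1) f) :=
        trEv_mem_smoothLocus (S.isHol τ.1) ⟨hu2.1, hu2.2.1⟩ (hBb hub) hf
      rw [LocOp.comp_ev _ _ (smoothLocus_comp hs.contMDiff hf), LocOp.ev_restr _ _ _ hu]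
      refine (P.ev_congr ?_).trans (hP.2 u hu.2 _ htrf)
      filter_upwards [(V₀ ⊓ V).2.mem_nhds hu, (Opens.comap p (smoothLocus n f)).2.mem_nhds hf] with v hv hvf
      rw [LocOp.ev_restr _ _ _ hv, hl v hv.1 f hvf]
      exact (hev (p v) (hVB hv.1) f hvf).symm)
    (fun τ τ' z hz hτ hτ' f hf => by
      have h1 := trEv_mem_smoothLocus (S.isHol τ.1) (x := p z) ⟨hz, hτ.1⟩ hτ.2.2 hf
      rw [hat_change hs ξ hz hτ hτ' h1]
      congr 1
      refine hat_congr hs ξ hz hτ' ?_ (baseFactor_mul_mem_smoothLocus hs hτ hτ' h1)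
      set V : Opens Y := (U ⊓ L.dom τ.1) ⊓ (U ⊓ L.dom τ'.1)
      have hzV : p z ∈ V := ⟨⟨hz, hτ.1⟩, hz, hτ'.1⟩
      filter_upwards [V.2.mem_nhds hzV, τ.2.2.1.open_source.mem_nhds hτ.2.2,
        τ'.2.2.1.open_source.mem_nhds hτ'.2.2, (smoothLocus n f).2.mem_nhds hf] with y hy hyb hyb' hyf
      have hg : HolOn n (L.g τ.1 τ'.1) V := (L.hol _ _).mono fun x hx => ⟨hx.1.2, hx.2.2⟩
      -- The product of the Jacobian and g is the base factor itself, so it cancels against the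
      -- factor in front.
      rw [trEv_twist τ.2.2 τ'.2.2 (S.isHol τ'.1) (V := V) inf_le_left inf_le_right hg
        (fun x hx => L.ne_zero _ _ _ hx.1.2 hx.2.2) (S.glue _ _ _ _ _) hy hyb hyb' hyf]
      have h2 := L.ne_zero τ.1 τ'.1 y hy.1.2 hy.2.2
      have h3 := jac_ne_zero τ'.2.2 τ.2.2 hyb' hyb
      refine (congrArg₂ (· * ·) (baseFactor_eq hyb hyb') rfl).trans ?_
      rw [← mul_assoc, mul_inv_cancel₀ (mul_ne_zero h3 h2), one_mul]
      refine trEv_congr (S.isHol τ'.1) hy.2 hyb' ?_ (smoothLocus_mul (smoothLocus_mul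
        (jac_mem_smoothLocus _ _ hyb' hyb) ((hg.smoothOn n).mem_smoothLocus hy)) hyf)
      filter_upwards [τ.2.2.1.open_source.mem_nhds hyb, τ'.2.2.1.open_source.mem_nhds hyb'] with u hu hu'
      exact congrArg (· * f u) (baseFactor_eq hu hu').symm)
  exact ⟨η, (isLeftMul_iff hs S ξ η).2 hη⟩

/-- Written with the inverse Jacobian, the factor of K_Z ⊗ M⁻¹ is exactly the one by which
transposes of the components of R are conjugated. -/
theorem leftFactor_eq {τ τ' : (twistM p hs.contMDiff L).ι} {z : Z}
    (hτ : z ∈ (twistM p hs.contMDiff L).dom τ) (hτ' : z ∈ (twistM p hs.contMDiff L).dom τ') :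
    leftFactor p hs.contMDiff L τ τ' z =
      (HolLineBundle.jac τ'.2.1 τ.2.1 z * (twistM p hs.contMDiff L).g τ τ' z)⁻¹ := by
  rw [mul_inv, jac_inv τ'.2.1 τ.2.1 hτ'.2.1 hτ.2.1]
  rfl

/-- The maps f ↦ Rᵗ(ξ f) are locally given by Rᵗ P. In the change of trivialization, the left factor
of ξ cancels inside the transpose and reappears outside. -/
theorem exists_isRightMul (ξ : (transferSheaf p hs.contMDiff L).sec U)
    (R : TwDiffOp (twistM p hs.contMDiff L) (Opens.comap p U)) :
    ∃ η, IsRightMul p hs.contMDiff L ξ R η := by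
  obtain ⟨η, hη⟩ := exists_hat_eq hs (U := U) (L := L)
    (fun τ f z => trEv τ.2.1 (R.op τ) (hat hs ξ τ f) z)
    (fun τ z hz hτ => by
      obtain ⟨V, P, hzV, hVU, hP⟩ := exists_evRep hs ξ hz hτ
      obtain ⟨V₀, hV₀, R', hzV₀, hVa, htr, hev⟩ := exists_trEv τ.2.1 (R.isHol τ) (x := z) ⟨hz, hτ⟩ hτ.2.1
      refine ⟨V₀ ⊓ V, HomOn.comp (HomOn.restr inf_le_left R') (HomOn.restr inf_le_right P), ⟨hzV₀, hzV⟩,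
        (htr.isHol.2.restr _).comp (hP.1.restr _), fun u hu f hf => ?_⟩
      have hu2 := hVU hu.2
      rw [LocOp.comp_ev _ _ (smoothLocus_comp hs.contMDiff hf), LocOp.ev_restr _ _ _ hu]
      refine (R'.ev_congr ?_).trans (hev u hu.1 _ (hat_mem_smoothLocus hs ξ hu2.1 hu2.2 hf)).symm
      filter_upwards [(V₀ ⊓ V).2.mem_nhds hu, (Opens.comap p (smoothLocus n f)).2.mem_nhds hf] with v hv hvf
      rw [LocOp.ev_restr _ _ _ hv, hP.2 v hv.2 f hvf])
    (fun τ τ' z hz hτ hτ' f hf => by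
      set V : Opens Z := (Opens.comap p U ⊓ (twistM p hs.contMDiff L).dom τ) ⊓
        (Opens.comap p U ⊓ (twistM p hs.contMDiff L).dom τ')
      have hzV : z ∈ V := ⟨⟨hz, hτ⟩, hz, hτ'⟩
      have hg : HolOn (n + k) ((twistM p hs.contMDiff L).g τ τ') V :=
        ((twistM p hs.contMDiff L).hol _ _).mono fun x hx => ⟨hx.1.2, hx.2.2⟩
      have hxf := hat_mem_smoothLocus hs ξ hz hτ hf
      have hj := jac_mem_smoothLocus τ'.2.1 τ.2.1 hτ'.2.1 hτ.2.1
      rw [trEv_twist τ.2.1 τ'.2.1 (R.isHol τ') (V := V) inf_le_left inf_le_right hg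
        (fun x hx => (twistM p hs.contMDiff L).ne_zero _ _ _ hx.1.2 hx.2.2) (R.glue _ _ _ _ _) hzV
        hτ.2.1 hτ'.2.1 hxf, leftFactor_eq hs hτ hτ']
      congr 1
      refine trEv_congr (R.isHol τ') ⟨hz, hτ'⟩ hτ'.2.1 ?_ (smoothLocus_mul (smoothLocus_mul hj
        (HolOn.smoothOn _ hg |>.mem_smoothLocus hzV)) hxf)
      filter_upwards [V.2.mem_nhds hzV, (Opens.comap p (smoothLocus n f)).2.mem_nhds hf] with u hu huf
      rw [hat_change hs ξ hu.1.1 hu.1.2 hu.2.2 huf, leftFactor_eq hs hu.1.2 hu.2.2, ← mul_assoc,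
        mul_inv_cancel₀, one_mul]
      exact mul_ne_zero (jac_ne_zero _ _ hu.2.2.2.1 hu.1.2.2.1)
        ((twistM p hs.contMDiff L).ne_zero _ _ _ hu.1.2 hu.2.2))
  exact ⟨η, (isRightMul_iff hs ξ η R).2 hη⟩

theorem existsUnique_isLeftMul (S : TwDiffOp L U) (ξ : (transferSheaf p hs.contMDiff L).sec U) :
    ∃! η, IsLeftMul p hs.contMDiff L S ξ η := by
  obtain ⟨η, hη⟩ := exists_isLeftMul hs S ξ
  refine ⟨η, hη, fun η' hη' => hat_ext hs fun τ z hz hτ f hf => ?_⟩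
  rw [(isLeftMul_iff hs S ξ η).1 hη τ z hz hτ f hf, (isLeftMul_iff hs S ξ η').1 hη' τ z hz hτ f hf]

theorem existsUnique_isRightMul (ξ : (transferSheaf p hs.contMDiff L).sec U)
    (R : TwDiffOp (twistM p hs.contMDiff L) (Opens.comap p U)) :
    ∃! η, IsRightMul p hs.contMDiff L ξ R η := by
  obtain ⟨η, hη⟩ := exists_isRightMul hs ξ R
  refine ⟨η, hη, fun η' hη' => hat_ext hs fun τ z hz hτ f hf => ?_⟩
  rw [(isRightMul_iff hs ξ η R).1 hη τ z hz hτ f hf, (isRightMul_iff hs ξ η' R).1 hη' τ z hz hτ f hf]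

end Actions

/-! ### Partitions of unity and tubes around fibers -/

section Partitions

variable {d : ℕ} {X : Type*} [TopologicalSpace X] [T2Space X] [SecondCountableTopology X]
  [ChartedSpace (Cn d) X] [IsManifold 𝓘(ℂ, Cn d) ω X]

/-- Finite smooth partitions of unity near a compact set, with compact supports. -/
theorem exists_partition {K : Set X} (hK : IsCompact K) (N : X → Opens X) (hN : ∀ x ∈ K, x ∈ N x) :
    ∃ (s : Finset X) (χ : X → X → ℂ) (O : Opens X), (∀ x ∈ s, x ∈ K) ∧ (∀ x ∈ s, IsTest d (χ x) (N x)) ∧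
      K ⊆ O ∧ ∀ y ∈ O, ∑ x ∈ s, χ x y = 1 := by
  have : LocallyCompactSpace X := ChartedSpace.locallyCompactSpace (Cn d) X
  have : IsManifold 𝓘(ℝ, Cn d) ∞ X := isManifold_real d
  have h1 : ∀ x ∈ K, ∃ C : Set X, IsCompact C ∧ x ∈ interior C ∧ C ⊆ N x := fun x hx =>
    exists_compact_subset (N x).2 (hN x hx)
  choose! C hC hxC hCN using h1
  obtain ⟨s, hsK, hs⟩ := hK.elim_nhds_subcover (fun x => interior (C x))
    fun x hx => isOpen_interior.mem_nhds (hxC x hx)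
  -- The intermediate compact set makes the sum equal to 1 on a neighbourhood of K and not only on
  -- K.
  obtain ⟨K', hK', hKK', hK's⟩ := exists_compact_between hK
    (isOpen_biUnion fun x (_ : x ∈ s) => isOpen_interior (s := C x)) hs
  obtain ⟨f, hf⟩ := SmoothPartitionOfUnity.exists_isSubordinate 𝓘(ℝ, Cn d) hK'.isClosed
    (fun x : s => interior (C x.1)) (fun x => isOpen_interior) (by
      intro y hy
      obtain ⟨x, hx, hyx⟩ := mem_iUnion₂.1 (hK's hy)
      exact mem_iUnion.2 ⟨⟨x, hx⟩, hyx⟩)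
  classical
  refine ⟨s, fun x y => if hx : x ∈ s then ((f ⟨x, hx⟩ y : ℝ) : ℂ) else 0, ⟨interior K', isOpen_interior⟩,
    hsK, fun x hx => ?_, hKK', fun y hy => ?_⟩
  · simp only [hx, dite_true]
    have h2 : tsupport (fun y => ((f ⟨x, hx⟩ y : ℝ) : ℂ)) ⊆ tsupport (f ⟨x, hx⟩) :=
      closure_mono fun y hy => by simpa using hy
    have h3 := h2.trans ((hf ⟨x, hx⟩).trans interior_subset)
    refine ⟨?_, (hC x (hsK x hx)).of_isClosed_subset (isClosed_tsupport _) h3, h3.trans (hCN x (hsK x hx))⟩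
    have h4 : ContDiff ℝ ∞ (fun r : ℝ => (r : ℂ)) := Complex.ofRealCLM.contDiff
    exact h4.contMDiff.comp_contMDiffOn (f ⟨x, hx⟩).contMDiff.contMDiffOn
  · have h2 := f.sum_eq_one (interior_subset hy)
    rw [finsum_eq_sum_of_fintype] at h2
    rw [← Finset.sum_coe_sort s]
    simp only [Finset.coe_mem, dite_true, Subtype.coe_eta]
    exact_mod_cast h2

/-- Neighbourhoods of a fiber of a closed map contain preimages of neighbourhoods. -/
theorem exists_tube {Y Z : Type*} [TopologicalSpace Y] [TopologicalSpace Z] {p : C(Z, Y)} (hp : IsClosedMap p)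
    {y : Y} {O : Opens Z} (h : ∀ z, p z = y → z ∈ O) : ∃ B : Opens Y, y ∈ B ∧ Opens.comap p B ≤ O := by
  refine ⟨⟨(p '' (O : Set Z)ᶜ)ᶜ, (hp _ O.2.isClosed_compl).isOpen_compl⟩, ?_, fun z hz => ?_⟩
  · rintro ⟨z, hz, rfl⟩
    exact hz (h z rfl)
  · by_contra hzO
    exact hz ⟨z, hzO, rfl⟩

end Partitions

/-! ### Fiber coordinates and their change of variables -/

section Slices

variable {n k : ℕ} {Y Z : Type*} [TopologicalSpace Y] [ChartedSpace (Cn n) Y]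
  [TopologicalSpace Z] [ChartedSpace (Cn (n + k)) Z]
  [IsManifold 𝓘(ℂ, Cn (n + k)) ω Z] [IsManifold 𝓘(ℂ, Cn n) ω Y] {p : C(Z, Y)}

/-- The determinant of a block triangular map of `ℂ^n × ℂ^k`. -/
theorem det_block (A : Cn (n + k) →L[ℂ] Cn (n + k)) (B : Cn n →L[ℂ] Cn n) (D : Cn k →L[ℂ] Cn k)
    (hB : ∀ v : Cn (n + k), ∀ i : Fin n, A v (Fin.castAdd k i) = B (fun j => v (Fin.castAdd k j)) i)
    (hD : ∀ x : Cn k, ∀ i : Fin k, A (Fin.append 0 x) (Fin.natAdd n i) = D x i) : A.det = B.det * D.det := by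
  have hdet : ∀ {m : ℕ} (T : Cn m →L[ℂ] Cn m), T.det = (LinearMap.toMatrix' (T : Cn m →ₗ[ℂ] Cn m)).det :=
    fun T => (LinearMap.det_toMatrix' _).symm
  rw [hdet A, hdet B, hdet D, ← Matrix.det_submatrix_equiv_self finSumFinEquiv,
    ← Matrix.fromBlocks_toBlocks ((LinearMap.toMatrix' (A : Cn (n + k) →ₗ[ℂ] Cn (n + k))).submatrix
      finSumFinEquiv finSumFinEquiv)]
  -- The base component depends on the base variables only, so the block from fiber to base
  -- directions is zero.
  have e12 : ((LinearMap.toMatrix' (A : Cn (n + k) →ₗ[ℂ] Cn (n + k))).submatrix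
      finSumFinEquiv finSumFinEquiv).toBlocks₁₂ = 0 := by
    ext i j
    simp only [Matrix.toBlocks₁₂, Matrix.of_apply, Matrix.submatrix_apply, LinearMap.toMatrix'_apply,
      finSumFinEquiv_apply_left, finSumFinEquiv_apply_right, Matrix.zero_apply]
    refine (hB _ i).trans ?_
    have h0 : (fun j' : Fin n => (Pi.single (Fin.natAdd n j) (1 : ℂ) : Cn (n + k)) (Fin.castAdd k j')) = 0 := by
      ext j'
      simp only [Pi.single_apply, Fin.ext_iff, Fin.val_castAdd, Fin.val_natAdd, Pi.zero_apply, ite_eq_right_iff]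
      omega
    refine (congrFun (congrArg B h0) i).trans ?_
    rw [map_zero]
    rfl
  have e11 : ((LinearMap.toMatrix' (A : Cn (n + k) →ₗ[ℂ] Cn (n + k))).submatrix
      finSumFinEquiv finSumFinEquiv).toBlocks₁₁ = LinearMap.toMatrix' (B : Cn n →ₗ[ℂ] Cn n) := by
    ext i j
    simp only [Matrix.toBlocks₁₁, Matrix.of_apply, Matrix.submatrix_apply, LinearMap.toMatrix'_apply,
      finSumFinEquiv_apply_left]
    refine (hB _ i).trans ?_
    refine congrFun (congrArg B ?_) i
    ext j'
    simp [Pi.single_apply, Fin.ext_iff]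
  have e22 : ((LinearMap.toMatrix' (A : Cn (n + k) →ₗ[ℂ] Cn (n + k))).submatrix
      finSumFinEquiv finSumFinEquiv).toBlocks₂₂ = LinearMap.toMatrix' (D : Cn k →ₗ[ℂ] Cn k) := by
    ext i j
    simp only [Matrix.toBlocks₂₂, Matrix.of_apply, Matrix.submatrix_apply, LinearMap.toMatrix'_apply,
      finSumFinEquiv_apply_right]
    refine Eq.trans ?_ (hD _ i)
    refine congrFun (congrArg A ?_) _
    ext j'
    refine Fin.addCases (fun l => ?_) (fun l => ?_) j'
    · simp [Pi.single_apply, Fin.ext_iff]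
      omega
    · simp [Pi.single_apply, Fin.ext_iff]
  rw [e12, e11, e22, Matrix.det_fromBlocks_zero₁₂]

namespace AdaptedChart

variable (s t : AdaptedChart (n := n) (k := k) p) {y : Y}

/-- The coordinates of the part of the fiber over `y` in the domain of the chart. -/
def slice (y : Y) : Set (Cn k) := {x | Fin.append (s.b.1 y) x ∈ s.a.1.target}

variable {s}

theorem fiberParam_mem {x : Cn k} (hx : x ∈ s.slice y) : s.fiberParam y x ∈ s.a.1.source :=
  s.a.1.map_target hx

theorem coord_fiberParam {x : Cn k} (hx : x ∈ s.slice y) : s.a.1 (s.fiberParam y x) = Fin.append (s.b.1 y) x :=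
  s.a.1.right_inv hx

theorem proj_fiberParam (hy : y ∈ s.b.1.source) {x : Cn k} (hx : x ∈ s.slice y) : p (s.fiberParam y x) = y := by
  refine s.b.1.injOn (s.mapsTo _ (fiberParam_mem hx)) hy ?_
  rw [← s.base_eq (fiberParam_mem hx), coord_fiberParam hx]
  ext j
  rw [baseCLM_apply, Fin.append_left]

variable (s)

/-- The fiber coordinates of a point. -/
def fiberCoord (z : Z) : Cn k := fun j => s.a.1 z (Fin.natAdd n j)

theorem append_fiberCoord {z : Z} (hz : z ∈ s.a.1.source) :
    Fin.append (s.b.1 (p z)) (s.fiberCoord z) = s.a.1 z := by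
  ext j
  refine Fin.addCases (fun l => ?_) (fun l => ?_) j
  · rw [Fin.append_left, s.proj z hz l]
  · rw [Fin.append_right]
    rfl

theorem fiberCoord_mem_slice {z : Z} (hz : z ∈ s.a.1.source) : s.fiberCoord z ∈ s.slice (p z) := by
  have h : Fin.append (s.b.1 (p z)) (s.fiberCoord z) ∈ s.a.1.target := by
    rw [s.append_fiberCoord hz]
    exact s.a.1.map_source hz
  exact h

theorem fiberParam_fiberCoord {z : Z} (hz : z ∈ s.a.1.source) : s.fiberParam (p z) (s.fiberCoord z) = z := by
  rw [fiberParam, s.append_fiberCoord hz, s.a.1.left_inv hz]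

theorem fiberCoord_fiberParam {x : Cn k} (hx : x ∈ s.slice y) : s.fiberCoord (s.fiberParam y x) = x := by
  ext j
  rw [fiberCoord, coord_fiberParam hx, Fin.append_right]

theorem isOpen_slice_preimage (y : Y) (O : Opens Z) : IsOpen {x | x ∈ s.slice y ∧ s.fiberParam y x ∈ O} := by
  have hc : Continuous fun x : Cn k => Fin.append (s.b.1 y) x :=
    (appendCLE n k).continuous.comp (Continuous.prodMk continuous_const continuous_id)
  exact (s.a.isOpen_preimage (n + k) O).preimage hc

/-- The derivative of the change of fiber coordinates. -/
theorem hasFDerivAt_fiberCoord {x : Cn k} (hy : y ∈ s.b.1.source) (hx : x ∈ s.slice y)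
    (ht : s.fiberParam y x ∈ t.a.1.source) : ∃ D : Cn k →L[ℂ] Cn k,
      HasFDerivAt (fun x => t.fiberCoord (s.fiberParam y x)) D x ∧
      HolLineBundle.jac s.a t.a (s.fiberParam y x) = HolLineBundle.jac s.b t.b y * D.det := by
  set z := s.fiberParam y x with hz
  have hzs : z ∈ s.a.1.source := fiberParam_mem hx
  have hpz : p z = y := proj_fiberParam hy hx
  have hyt : y ∈ t.b.1.source := hpz ▸ t.mapsTo z ht
  have hA := (HolLineBundle.trans_differentiableAt hzs ht).hasFDerivAt
  set A := fderiv ℂ (t.a.1 ∘ s.a.1.symm) (s.a.1 z) with hAdef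
  have hsz : s.a.1 z = Fin.append (s.b.1 y) x := coord_fiberParam hx
  have hι : HasFDerivAt (fun x : Cn k => Fin.append (s.b.1 y) x)
      (((appendCLE n k : (Cn n × Cn k) →L[ℂ] Cn (n + k))).comp (ContinuousLinearMap.inr ℂ (Cn n) (Cn k))) x := by
    have h1 : HasFDerivAt (fun x : Cn k => ((s.b.1 y, x) : Cn n × Cn k))
        (ContinuousLinearMap.inr ℂ (Cn n) (Cn k)) x := hasFDerivAt_prodMk_right _ _
    exact (appendCLE n k : (Cn n × Cn k) →L[ℂ] Cn (n + k)).hasFDerivAt.comp x h1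
  set π : Cn (n + k) →L[ℂ] Cn k :=
    (ContinuousLinearMap.snd ℂ (Cn n) (Cn k)).comp (appendCLE n k).symm.toContinuousLinearMap with hπ
  rw [hsz] at hA
  refine ⟨π.comp (A.comp (((appendCLE n k : (Cn n × Cn k) →L[ℂ] Cn (n + k))).comp
    (ContinuousLinearMap.inr ℂ (Cn n) (Cn k)))), π.hasFDerivAt.comp x (hA.comp x hι), ?_⟩
  have hB := (HolLineBundle.trans_differentiableAt (hpz ▸ s.mapsTo z hzs : y ∈ s.b.1.source) hyt).hasFDerivAt
  -- p is a projection in both charts, so the base part of the transition is the transition of the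
  -- base charts after projecting. Comparing the two derivatives of this function shows that A is
  -- block triangular.
  refine det_block A _ _ (fun v i => ?_) (fun x i => rfl)
  have e : (fun w => baseCLM n k ((t.a.1 ∘ s.a.1.symm) w)) =ᶠ[𝓝 (Fin.append (s.b.1 y) x)]
      fun w => (t.b.1 ∘ s.b.1.symm) (baseCLM n k w) := by
    rw [← hsz]
    filter_upwards [(s.a.1.symm ≫ₕ t.a.1).open_source.mem_nhds (HolLineBundle.trans_mem hzs ht)] with w hw
    have hw1 : w ∈ s.a.1.target := hw.1
    have hw2 : s.a.1.symm w ∈ t.a.1.source := hw.2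
    have h1 := s.base_eq (s.a.1.map_target hw1)
    rw [s.a.1.right_inv hw1] at h1
    rw [Function.comp_apply, t.base_eq hw2, Function.comp_apply, h1,
      s.b.1.left_inv (s.mapsTo _ (s.a.1.map_target hw1))]
  have hbase : baseCLM n k (Fin.append (s.b.1 y) x) = s.b.1 y := by
    ext j
    rw [baseCLM_apply, Fin.append_left]
  have h1 := (baseCLM n k).hasFDerivAt.comp (Fin.append (s.b.1 y) x) hA
  have h2 : HasFDerivAt (fun w => (t.b.1 ∘ s.b.1.symm) (baseCLM n k w))
      ((fderiv ℂ (t.b.1 ∘ s.b.1.symm) (s.b.1 y)).comp (baseCLM n k)) (Fin.append (s.b.1 y) x) := by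
    rw [← hbase] at hB
    have h3 := hB.comp (Fin.append (s.b.1 y) x) (baseCLM n k).hasFDerivAt
    rw [hbase] at h3
    exact h3
  have h3 := h1.unique (h2.congr_of_eventuallyEq e)
  exact congrFun (DFunLike.congr_fun h3 v) i

/-- Change of variables between the fiber coordinates of two adapted charts. -/
theorem slice_change (hy : y ∈ s.b.1.source) {E : Set Z}
    (hE : MeasurableSet {x | x ∈ s.slice y ∧ s.fiberParam y x ∈ t.a.1.source ∩ E}) {F G : Z → ℂ}
    (hFG : ∀ z, p z = y → z ∈ s.a.1.source → z ∈ t.a.1.source →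
      F z = (‖HolLineBundle.jac s.a t.a z * (HolLineBundle.jac s.b t.b y)⁻¹‖ ^ 2 : ℝ) * G z) :
    (∫ x in {x | x ∈ t.slice y ∧ p (t.fiberParam y x) = y ∧ t.fiberParam y x ∈ s.a.1.source ∩ E},
        G (t.fiberParam y x) =
      ∫ x in {x | x ∈ s.slice y ∧ s.fiberParam y x ∈ t.a.1.source ∩ E}, F (s.fiberParam y x)) ∧
    (IntegrableOn (fun x => F (s.fiberParam y x)) {x | x ∈ s.slice y ∧ s.fiberParam y x ∈ t.a.1.source ∩ E} →
      IntegrableOn (fun x => G (t.fiberParam y x))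
        {x | x ∈ t.slice y ∧ p (t.fiberParam y x) = y ∧ t.fiberParam y x ∈ s.a.1.source ∩ E}) := by
  set D := {x | x ∈ s.slice y ∧ s.fiberParam y x ∈ t.a.1.source ∩ E} with hD
  set φ : Cn k → Cn k := fun x => t.fiberCoord (s.fiberParam y x) with hφ
  have hpy : ∀ x ∈ D, p (s.fiberParam y x) = y := fun x hx => proj_fiberParam hy hx.1
  have hback : ∀ x ∈ D, t.fiberParam y (φ x) = s.fiberParam y x := fun x hx => by
    have h := t.fiberParam_fiberCoord hx.2.1
    rwa [hpy x hx] at h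
  -- Over `s` the condition p = y is automatic, because y lies in its base chart. This is not
  -- assumed for the base chart of `t`, where the fiber parametrization could use a meaningless
  -- coordinate value, so the condition remains in the set.
  have himg : φ '' D = {x | x ∈ t.slice y ∧ p (t.fiberParam y x) = y ∧ t.fiberParam y x ∈ s.a.1.source ∩ E} := by
    ext x'
    constructor
    · rintro ⟨x, hx, rfl⟩
      refine ⟨?_, ?_⟩
      · have h := t.fiberCoord_mem_slice hx.2.1
        rwa [hpy x hx] at h
      · rw [hback x hx]
        exact ⟨hpy x hx, fiberParam_mem hx.1, hx.2.2⟩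
    · rintro ⟨h1, h2, h3, h4⟩
      have h5 := s.fiberParam_fiberCoord h3
      have h6 := s.fiberCoord_mem_slice h3
      rw [h2] at h5 h6
      refine ⟨s.fiberCoord (t.fiberParam y x'), ⟨h6, ?_⟩, ?_⟩
      · rw [h5]
        exact ⟨fiberParam_mem h1, h4⟩
      · change t.fiberCoord (s.fiberParam y _) = x'
        rw [h5, t.fiberCoord_fiberParam h1]
  have hinj : InjOn φ D := fun x hx x' hx' h => by
    have h1 := hback x hx
    rw [h, hback x' hx'] at h1
    rw [← s.fiberCoord_fiberParam hx.1, ← h1, s.fiberCoord_fiberParam hx'.1]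
  have hder : ∀ x ∈ D, ∃ T : Cn k →L[ℂ] Cn k, HasFDerivAt φ T x ∧
      HolLineBundle.jac s.a t.a (s.fiberParam y x) = HolLineBundle.jac s.b t.b y * T.det :=
    fun x hx => s.hasFDerivAt_fiberCoord t hy hx.1 hx.2.1
  choose! T hT hdet using hder
  have hT' : ∀ x ∈ D, HasFDerivWithinAt φ ((T x).restrictScalars ℝ) D x := fun x hx =>
    ((hT x hx).restrictScalars ℝ).hasFDerivWithinAt
  have hval : ∀ x ∈ D, |((T x).restrictScalars ℝ).det| • G (t.fiberParam y (φ x)) = F (s.fiberParam y x) := by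
    intro x hx
    have hyt : y ∈ t.b.1.source := hpy x hx ▸ t.mapsTo _ hx.2.1
    have hj : HolLineBundle.jac s.b t.b y ≠ 0 := (HolLineBundle.canonical n Y).ne_zero s.b t.b y hy hyt
    rw [abs_det_restrictScalars, hback x hx, hFG _ (hpy x hx) (fiberParam_mem hx.1) hx.2.1, hdet x hx,
      mul_comm (HolLineBundle.jac s.b t.b y), mul_assoc, mul_inv_cancel₀ hj, mul_one, Complex.real_smul]
  rw [← himg]
  refine ⟨?_, fun hF => ?_⟩
  · rw [integral_image_eq_integral_abs_det_fderiv_smul volume hE hT' hinj]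
    exact setIntegral_congr_fun hE hval
  · rw [integrableOn_image_iff_integrableOn_abs_det_fderiv_smul volume hE hT' hinj]
    exact hF.congr_fun (fun x hx => (hval x hx).symm) hE

end AdaptedChart

end Slices

/-! ### Integrals over slices: integrability, smooth dependence, Fubini -/

section SliceIntegrals

variable {n k : ℕ} {Y Z : Type*} [TopologicalSpace Y] [T2Space Y] [ChartedSpace (Cn n) Y]
  [TopologicalSpace Z] [T2Space Z] [ChartedSpace (Cn (n + k)) Z]
  [IsManifold 𝓘(ℂ, Cn (n + k)) ω Z] [IsManifold 𝓘(ℂ, Cn n) ω Y] {p : C(Z, Y)}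

theorem append_measurePreserving (n k : ℕ) :
    MeasurePreserving (fun q : Cn n × Cn k => Fin.append q.1 q.2) := by
  have h1 := volume_measurePreserving_sumPiEquivProdPi_symm (fun _ : Fin n ⊕ Fin k => ℂ)
  have h2 := volume_measurePreserving_piCongrLeft (fun _ : Fin (n + k) => ℂ) finSumFinEquiv
  have e : ∀ (w : Fin n ⊕ Fin k → ℂ) (x : Fin n ⊕ Fin k),
      (MeasurableEquiv.piCongrLeft (fun _ : Fin (n + k) => ℂ) finSumFinEquiv) w (finSumFinEquiv x) = w x :=
    fun w x => Equiv.piCongrLeft_apply_apply (fun _ : Fin (n + k) => ℂ) finSumFinEquiv w x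
  have hfun : (fun q : Cn n × Cn k => (Fin.append q.1 q.2 : Cn (n + k))) =
      (MeasurableEquiv.piCongrLeft (fun _ : Fin (n + k) => ℂ) finSumFinEquiv) ∘
        (MeasurableEquiv.sumPiEquivProdPi (fun _ : Fin n ⊕ Fin k => ℂ)).symm := by
    funext q
    ext i
    revert i
    refine Fin.addCases (fun j => ?_) (fun j => ?_)
    · rw [Fin.append_left]
      exact (e ((MeasurableEquiv.sumPiEquivProdPi (fun _ : Fin n ⊕ Fin k => ℂ)).symm q) (Sum.inl j)).symm
    · rw [Fin.append_right]
      exact (e ((MeasurableEquiv.sumPiEquivProdPi (fun _ : Fin n ⊕ Fin k => ℂ)).symm q) (Sum.inr j)).symm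
  rw [hfun]
  exact h2.comp h1

theorem append_integral {F : Cn (n + k) → ℂ} (hF : Integrable F) :
    ∫ u : Cn n, ∫ x : Cn k, F (Fin.append u x) = ∫ v, F v := by
  have hm := append_measurePreserving n k
  have hemb : MeasurableEmbedding (fun q : Cn n × Cn k => Fin.append q.1 q.2) :=
    (appendCLE n k).toHomeomorph.measurableEmbedding
  rw [← hm.integral_comp hemb F]
  exact (integral_prod _ ((hm.integrable_comp_emb hemb).2 hF)).symm

/-- The partial integral is the value at 0 of a convolution of the constant 1 with a family of
functions whose supports lie in one compact set; such convolutions depend smoothly on the parameter.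
-/
theorem contDiff_integral_append {F : Cn (n + k) → ℂ} (hF : ContDiff ℝ ∞ F) (hK : HasCompactSupport F) :
    ContDiff ℝ ∞ fun u : Cn n => ∫ x : Cn k, F (Fin.append u x) := by
  -- The sign compensates for the convolution at 0, which evaluates g at -t.
  set g : Cn n → Cn k → ℂ := fun u x => F (Fin.append u (-x)) with hg
  have hgc : ContDiff ℝ ∞ (fun q : Cn n × Cn k => F (Fin.append q.1 (-q.2))) := by
    have h1 : ContDiff ℂ ∞ (fun q : Cn n × Cn k => appendCLE n k (q.1, -q.2)) :=
      (appendCLE n k).contDiff.comp (contDiff_fst.prodMk contDiff_snd.neg)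
    exact hF.comp (h1.restrict_scalars ℝ)
  have hk : IsCompact ((fun v : Cn (n + k) => -((appendCLE n k).symm v).2) '' tsupport F) :=
    hK.isCompact.image (by fun_prop)
  have h := contDiffOn_convolution_right_with_param (𝕜 := ℝ) (n := (⊤ : ℕ∞)) (μ := (volume : Measure (Cn k)))
    (ContinuousLinearMap.mul ℝ ℂ) (f := fun _ => (1 : ℂ)) (g := g) isOpen_univ hk
    (fun u x _ hx => by
      by_contra h0
      refine hx ⟨Fin.append u (-x), subset_tsupport _ h0, ?_⟩
      have : (appendCLE n k).symm (Fin.append u (-x)) = (u, -x) := (appendCLE n k).symm_apply_apply (u, -x)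
      simp [this])
    (locallyIntegrable_const 1) hgc.contDiffOn
  rw [univ_prod_univ, contDiffOn_univ] at h
  have h2 := h.comp (contDiff_id.prodMk (contDiff_const (c := (0 : Cn k))))
  convert h2 using 1
  funext u
  simp [convolution, hg]

namespace AdaptedChart

variable (s : AdaptedChart (n := n) (k := k) p) {y : Y}

/-- Integral of a function over the part of a fiber in an adapted chart. -/
def sliceInt (F : Z → ℂ) (y : Y) : ℂ := ∫ x in s.slice y, F (s.fiberParam y x)

theorem isOpen_slice (y : Y) : IsOpen (s.slice y) := by
  have h := s.isOpen_slice_preimage y ⊤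
  convert h using 1
  ext x
  exact ⟨fun h => ⟨h, trivial⟩, fun h => h.1⟩

theorem inChart_append (F : Z → ℂ) (y : Y) : (fun x => inChart s.a F (Fin.append (s.b.1 y) x)) =
    Set.indicator (s.slice y) fun x => F (s.fiberParam y x) := by
  funext x
  by_cases hx : x ∈ s.slice y
  · rw [Set.indicator_of_mem hx]
    exact Set.indicator_of_mem (s := s.a.1.target) hx _
  · rw [Set.indicator_of_notMem hx]
    exact Set.indicator_of_notMem (s := s.a.1.target) hx _

theorem sliceInt_eq (F : Z → ℂ) (y : Y) : s.sliceInt F y = ∫ x, inChart s.a F (Fin.append (s.b.1 y) x) := by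
  rw [inChart_append, integral_indicator (s.isOpen_slice y).measurableSet]
  rfl

-- A slice is embedded as a closed subset of ℂ^(n+k), so the restriction of a continuous function
-- with compact support is again of this kind.
variable {s} in
theorem integrableOn_slice {F : Z → ℂ} (hF : IsTest (n + k) F s.a.1.source) (y : Y) :
    IntegrableOn (fun x => F (s.fiberParam y x)) (s.slice y) := by
  rw [← integrable_indicator_iff (s.isOpen_slice y).measurableSet, ← inChart_append]
  have hc := (inChart_contDiff s.a hF).continuous
  have hemb : Topology.IsClosedEmbedding fun x : Cn k => Fin.append (s.b.1 y) x := by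
    have h1 : Topology.IsClosedEmbedding fun x : Cn k => ((s.b.1 y, x) : Cn n × Cn k) :=
      Topology.IsClosedEmbedding.of_continuous_injective_isClosedMap (by fun_prop)
        (fun x x' h => (Prod.ext_iff.1 h).2) (fun C hC => by
          have : (fun x : Cn k => ((s.b.1 y, x) : Cn n × Cn k)) '' C = {s.b.1 y} ×ˢ C := by
            ext q
            constructor
            · rintro ⟨x, hx, rfl⟩
              exact ⟨rfl, hx⟩
            · rintro ⟨h1, h2⟩
              exact ⟨q.2, h2, Prod.ext h1.symm rfl⟩
          rw [this]
          exact isClosed_singleton.prod hC)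
    exact (appendCLE n k).toHomeomorph.isClosedEmbedding.comp h1
  exact (hc.comp hemb.continuous).integrable_of_hasCompactSupport
    ((inChart_cpt s.a hF).comp_isClosedEmbedding hemb)

variable {s} in
theorem sliceInt_smooth {F : Z → ℂ} (hF : IsTest (n + k) F s.a.1.source) :
    SmoothOn n (s.sliceInt F) s.b.1.source := by
  have : IsManifold 𝓘(ℝ, Cn n) ∞ Y := isManifold_real n
  have h1 := contDiff_integral_append (inChart_contDiff s.a hF) (inChart_cpt s.a hF)
  have h2 : SmoothOn n ((fun u : Cn n => ∫ x : Cn k, inChart s.a F (Fin.append u x)) ∘ s.b.1) s.b.1.source :=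
    h1.contMDiff.comp_contMDiffOn (contMDiffOn_of_mem_maximalAtlas s.b.mem_real)
  exact h2.congr fun y _ => s.sliceInt_eq F y

variable {s} in
/-- Fubini's theorem in an adapted chart. -/
theorem cint_sliceInt {F : Z → ℂ} (hF : IsTest (n + k) F s.a.1.source) :
    cint s.b (s.sliceInt F) = cint s.a F := by
  rw [cint_eq s.a, ← append_integral (inChart_integrable s.a hF)]
  refine (setIntegral_congr_fun (g := fun u => ∫ x : Cn k, inChart s.a F (Fin.append u x))
    s.b.1.open_target.measurableSet fun u hu => ?_).trans (setIntegral_eq_integral_of_forall_compl_eq_zero ?_)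
  · exact (s.sliceInt_eq F _).trans (by rw [s.b.1.right_inv hu])
  -- Over u outside the base chart the inner integrand is identically zero: p maps the domain of the
  -- chart of Z into that of the base chart.
  · intro u hu
    have h0 : ∀ x : Cn k, inChart s.a F (Fin.append u x) = 0 := by
      intro x
      refine Set.indicator_of_notMem (fun hx => hu ?_) _
      have h1 := s.base_eq (s.a.1.map_target hx)
      rw [s.a.1.right_inv hx] at h1
      have h2 : baseCLM n k (Fin.append u x) = u := by
        ext j
        rw [baseCLM_apply, Fin.append_left]
      rw [← h2, h1]
      exact s.b.1.map_source (s.mapsTo _ (s.a.1.map_target hx))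
    exact (integral_congr_ae (.of_forall h0)).trans (integral_zero _ _)

end AdaptedChart

end SliceIntegrals

/-! ### Sections of |A|² -/

section AbsSections

variable {d : ℕ} {X : Type*} [TopologicalSpace X] [ChartedSpace (Cn d) X] {A : HolLineBundle d X}
  {U : Opens X}

/-- Multiplication of sections of `|A|²` by smooth functions. -/
def mulSec (χ : X → ℂ) (hχ : SmoothOn d χ U) (s : A.absSec U) : A.absSec U :=
  ⟨fun i x => χ x * s.1 i x, fun i =>
    ⟨SmoothOn.mul d (hχ.mono fun _ h => h.1) (s.2.1 i).1, fun x hx => by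
      beta_reduce
      rw [(s.2.1 i).2 x hx, mul_zero]⟩,
    fun i j x hx hi hj => by
      beta_reduce
      rw [s.2.2 i j x hx hi hj]
      ring⟩

theorem HolLineBundle.g_self (A : HolLineBundle d X) {i : A.ι} {x : X} (hx : x ∈ A.dom i) : A.g i i x = 1 := by
  have h := A.cocycle i i i x hx hx hx
  exact mul_right_cancel₀ (A.ne_zero i i x hx hx) (h.trans (one_mul _).symm)

end AbsSections

/-! ### Independence of fiber integrals of the system of charts -/

section FiberIntegrals

variable {n k : ℕ} {Y Z : Type*} [TopologicalSpace Y] [T2Space Y] [ChartedSpace (Cn n) Y]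
  [TopologicalSpace Z] [T2Space Z] [ChartedSpace (Cn (n + k)) Z]
  [IsManifold 𝓘(ℂ, Cn (n + k)) ω Z] [IsManifold 𝓘(ℂ, Cn n) ω Y] {p : C(Z, Y)}
  {hp : ContMDiff 𝓘(ℂ, Cn (n + k)) 𝓘(ℂ, Cn n) ω p} {L : HolLineBundle n Y} {V : Opens Y}

/-- The part of the fiber over `y` that is in the domain of the chart `t j`, but not in the domains of
the earlier charts. -/
def fiberPiece {N : ℕ} (t : Fin N → AdaptedChart (n := n) (k := k) p) (j : Fin N) (y : Y) : Set (Cn k) :=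
  {x | x ∈ (t j).slice y ∧ p ((t j).fiberParam y x) = y ∧ ∀ l < j, (t j).fiberParam y x ∉ (t l).a.1.source}

theorem measurableSet_slice_sdiff {N : ℕ} (s : AdaptedChart (n := n) (k := k) p)
    (t : Fin N → AdaptedChart (n := n) (k := k) p) (j : Fin N) (y : Y) :
    MeasurableSet {x | x ∈ s.slice y ∧ ∀ l < j, s.fiberParam y x ∉ (t l).a.1.source} := by
  have h : {x | x ∈ s.slice y ∧ ∀ l < j, s.fiberParam y x ∉ (t l).a.1.source} = s.slice y ∩
      ⋂ l, ⋂ (_ : l < j), {x | x ∈ s.slice y ∧ s.fiberParam y x ∈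
        (⟨(t l).a.1.source, (t l).a.1.open_source⟩ : Opens Z)}ᶜ := by
    ext x
    simp only [Set.mem_ofPred_eq, mem_inter_iff, mem_iInter, mem_compl_iff, not_and]
    exact ⟨fun h => ⟨h.1, fun l hl _ => h.2 l hl⟩, fun h => ⟨h.1, fun l hl => h.2 l hl h.1⟩⟩
  rw [h]
  refine (s.isOpen_slice y).measurableSet.inter (MeasurableSet.iInter fun l => MeasurableSet.iInter fun _ => ?_)
  exact (s.isOpen_slice_preimage y _).measurableSet.compl

/-- If y lies outside the base chart, its coordinate is a default value and the condition p = y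
makes the piece empty. Otherwise that condition is automatic and the piece is an open set minus
finitely many open sets. -/
theorem measurableSet_fiberPiece {N : ℕ} (t : Fin N → AdaptedChart (n := n) (k := k) p) (j : Fin N) (y : Y) :
    MeasurableSet (fiberPiece t j y) := by
  by_cases hy : y ∈ (t j).b.1.source
  · convert measurableSet_slice_sdiff (t j) t j y using 1
    ext x
    exact ⟨fun h => ⟨h.1, h.2.2⟩, fun h => ⟨h.1, AdaptedChart.proj_fiberParam hy h.1, h.2⟩⟩
  · convert MeasurableSet.empty
    refine eq_empty_of_forall_notMem fun x hx => hy ?_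
    rw [← hx.2.1]
    exact (t j).mapsTo _ (AdaptedChart.fiberParam_mem hx.1)

theorem absSec_change (h : (twistM p hp L).absSec (Opens.comap p V)) (s t : AdaptedChart (n := n) (k := k) p)
    {i : L.ι} {z : Z} (hz : p z ∈ V) (hi : p z ∈ L.dom i) (hs : z ∈ s.a.1.source) (ht : z ∈ t.a.1.source) :
    h.1 (i, (s.a, s.b)) z =
      (‖HolLineBundle.jac s.a t.a z * (HolLineBundle.jac s.b t.b (p z))⁻¹‖ ^ 2 : ℝ) * h.1 (i, (t.a, t.b)) z := by
  have h1 := h.2.2 (i, (s.a, s.b)) (i, (t.a, t.b)) z hz ⟨hi, hs, s.mapsTo z hs⟩ ⟨hi, ht, t.mapsTo z ht⟩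
  have h2 : (twistM p hp L).g (i, (s.a, s.b)) (i, (t.a, t.b)) z =
      L.g i i (p z) * (HolLineBundle.jac s.a t.a z * (HolLineBundle.jac s.b t.b (p z))⁻¹) := rfl
  rw [h2, L.g_self hi, one_mul] at h1
  exact h1

/-- The section `h` is concentrated, over `y`, in the domain of the adapted chart `s`. -/
structure Concentrated (h : (twistM p hp L).absSec (Opens.comap p V)) (s : AdaptedChart (n := n) (k := k) p)
    (i : L.ι) (y : Y) : Prop where
  mem : y ∈ s.b.1.source
  vanish : ∀ t : AdaptedChart (n := n) (k := k) p, ∀ z, p z = y → z ∉ s.a.1.source → h.1 (i, (t.a, t.b)) z = 0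
  int : IntegrableOn (fun x => h.1 (i, (s.a, s.b)) (s.fiberParam y x)) (s.slice y)

/-- Each piece of the fiber is transported to the coordinates of the single chart s by change of
variables; the Jacobian is the transition function of |K_{Z/Y}|². The transported pieces partition
the slice of s, so any covering system gives the same integral. -/
theorem Concentrated.pieces {h : (twistM p hp L).absSec (Opens.comap p V)}
    {s : AdaptedChart (n := n) (k := k) p} {i : L.ι} {y : Y} (hc : Concentrated h s i y) (hy : y ∈ V)
    (hi : y ∈ L.dom i) {N : ℕ} (t : Fin N → AdaptedChart (n := n) (k := k) p) :
    (∀ j, IntegrableOn (fun x => h.1 (i, ((t j).a, (t j).b)) ((t j).fiberParam y x)) (fiberPiece t j y)) ∧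
    ((∀ z, p z = y → ∃ j, z ∈ (t j).a.1.source) →
      fiberIntegralWith p hp L t h.1 i y = s.sliceInt (h.1 (i, (s.a, s.b))) y) := by
  set E : Fin N → Set Z := fun j => {z | ∀ l < j, z ∉ (t l).a.1.source} with hE
  set D : Fin N → Set (Cn k) := fun j => {x | x ∈ s.slice y ∧ s.fiberParam y x ∈ (t j).a.1.source ∩ E j} with hD
  have hDm : ∀ j, MeasurableSet (D j) := by
    intro j
    convert ((s.isOpen_slice_preimage y ⟨(t j).a.1.source, (t j).a.1.open_source⟩).measurableSet).inter
      (measurableSet_slice_sdiff s t j y) using 1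
    ext x
    exact ⟨fun h => ⟨⟨h.1, h.2.1⟩, h.1, h.2.2⟩, fun h => ⟨h.1.1, h.1.2, h.2.2⟩⟩
  have hch := fun j => s.slice_change (t j) hc.mem (E := E j) (hDm j) (F := h.1 (i, (s.a, s.b)))
    (G := h.1 (i, ((t j).a, (t j).b))) fun z hz hzs hzt => by
      have h1 := absSec_change h s (t j) (i := i) (z := z) (by rwa [hz]) (by rwa [hz]) hzs hzt
      rwa [hz] at h1
  have hsub : ∀ j, {x | x ∈ (t j).slice y ∧ p ((t j).fiberParam y x) = y ∧
      (t j).fiberParam y x ∈ s.a.1.source ∩ E j} ⊆ fiberPiece t j y :=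
    fun j x hx => ⟨hx.1, hx.2.1, hx.2.2.2⟩
  have hzero : ∀ j, ∀ x ∈ fiberPiece t j y \ {x | x ∈ (t j).slice y ∧ p ((t j).fiberParam y x) = y ∧
      (t j).fiberParam y x ∈ s.a.1.source ∩ E j}, h.1 (i, ((t j).a, (t j).b)) ((t j).fiberParam y x) = 0 :=
    fun j x hx => hc.vanish (t j) _ hx.1.2.1 fun hxs => hx.2 ⟨hx.1.1, hx.1.2.1, hxs, hx.1.2.2⟩
  have hDint : ∀ j, IntegrableOn (fun x => h.1 (i, (s.a, s.b)) (s.fiberParam y x)) (D j) :=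
    fun j => hc.int.mono_set fun x hx => hx.1
  refine ⟨fun j => ((hch j).2 (hDint j)).of_forall_sdiff_eq_zero (measurableSet_fiberPiece t j y) (hzero j),
    fun hcov => ?_⟩
  have h1 : ∀ j, ∫ x in fiberPiece t j y, h.1 (i, ((t j).a, (t j).b)) ((t j).fiberParam y x) =
      ∫ x in D j, h.1 (i, (s.a, s.b)) (s.fiberParam y x) := fun j => by
    rw [setIntegral_eq_of_subset_of_forall_sdiff_eq_zero (measurableSet_fiberPiece t j y) (hsub j) (hzero j)]
    exact (hch j).1
  have hdisj : Pairwise (Function.onFun Disjoint D) := by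
    intro j l hjl
    refine Set.disjoint_left.2 fun x hx hx' => ?_
    rcases lt_or_gt_of_ne hjl with hlt | hlt
    · exact hx'.2.2 j hlt hx.2.1
    · exact hx.2.2 l hlt hx'.2.1
  have hun : ⋃ j, D j = s.slice y := by
    refine Subset.antisymm (iUnion_subset fun j x hx => hx.1) fun x hx => ?_
    -- A point of the slice belongs to the piece of the first chart that contains it.
    obtain ⟨m, hm, hmin⟩ := (wellFounded_lt (α := Fin N)).has_min {j | s.fiberParam y x ∈ (t j).a.1.source}
      (hcov _ (AdaptedChart.proj_fiberParam hc.mem hx))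
    exact mem_iUnion.2 ⟨m, hx, hm, fun l hl hl' => hmin l hl' hl⟩
  refine (Finset.sum_congr rfl fun j _ => h1 j).trans ?_
  rw [← integral_iUnion_fintype hDm hdisj hDint, hun]
  rfl

end FiberIntegrals

/-! ### Fiber integration of smooth sections -/

section FiberIntegration

variable {n k : ℕ} {Y Z : Type*} [TopologicalSpace Y] [T2Space Y] [SecondCountableTopology Y]
  [ChartedSpace (Cn n) Y] [TopologicalSpace Z] [T2Space Z] [SecondCountableTopology Z]
  [ChartedSpace (Cn (n + k)) Z]
  [IsManifold 𝓘(ℂ, Cn (n + k)) ω Z] [IsManifold 𝓘(ℂ, Cn n) ω Y] {p : C(Z, Y)}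
  {L : HolLineBundle n Y} {V : Opens Y}

theorem AdaptedChart.sliceInt_add (s : AdaptedChart (n := n) (k := k) p) {F G : Z → ℂ}
    (hF : IsTest (n + k) F s.a.1.source) (hG : IsTest (n + k) G s.a.1.source) (y : Y) :
    s.sliceInt (fun z => F z + G z) y = s.sliceInt F y + s.sliceInt G y :=
  integral_add (integrableOn_slice hF y) (integrableOn_slice hG y)

/-- The system of charts chosen in the definition depends on y only, not on the density or on the
trivialization of L. Hence two fiber integrals at y can be compared integrand by integrand. -/
theorem fiberIntegral_eq_mul {hp : ContMDiff 𝓘(ℂ, Cn (n + k)) 𝓘(ℂ, Cn n) ω p}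
    {h h' : (twistM p hp L).ι → Z → ℂ} {i i' : L.ι} {y : Y} (c : ℂ)
    (hh : ∀ (t : AdaptedChart (n := n) (k := k) p) (z : Z), p z = y → z ∈ t.a.1.source →
      h (i, (t.a, t.b)) z = c * h' (i', (t.a, t.b)) z) :
    fiberIntegral p hp L h i y = c * fiberIntegral p hp L h' i' y := by
  unfold fiberIntegral
  split_ifs with H
  · rw [fiberIntegralWith, fiberIntegralWith, Finset.mul_sum]
    refine Finset.sum_congr rfl fun j _ => ?_
    rw [← integral_const_mul]
    refine setIntegral_congr_fun (measurableSet_fiberPiece H.choose_spec.choose j y) fun x hx => ?_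
    exact hh _ _ hx.2.1 (AdaptedChart.fiberParam_mem hx.1)
  · rw [mul_zero]

/-- A partition of unity near a fiber, subordinate to adapted charts over a given chart of the base. -/
structure FiberPartition (p : C(Z, Y)) (b : Chart n Y) (N : Opens Y) where
  σ : Finset Z
  s : Z → AdaptedChart (n := n) (k := k) p
  χ : Z → Z → ℂ
  B : Opens Y
  le : B ≤ N
  base : ∀ l ∈ σ, (s l).b = b
  test : ∀ l ∈ σ, IsTest (n + k) (χ l) ((⟨(s l).a.1.source, (s l).a.1.open_source⟩ ⊓ Opens.comap p N : Opens Z))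
  sum_eq : ∀ z, p z ∈ B → ∑ l ∈ σ, χ l z = 1

/-- The fiber is compact because p is proper, so finitely many adapted charts suffice. Since p is
closed, the neighbourhood of the fiber where the functions sum to 1 contains a full preimage. -/
theorem exists_fiberPartition (hs : Manifold.IsSubmersion 𝓘(ℂ, Cn (n + k)) 𝓘(ℂ, Cn n) ω p) (hpr : IsProperMap p)
    (b : Chart n Y) {N : Opens Y} {y : Y} (hyN : y ∈ N) (hyb : y ∈ b.1.source) :
    ∃ P : FiberPartition (n := n) (k := k) p b N, y ∈ P.B := by
  classical
  -- Away from the fiber any adapted chart serves; it only makes the choice a function on all of Z.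
  have h1 : ∀ z : Z, ∃ t : AdaptedChart (n := n) (k := k) p, p z = y → t.b = b ∧ z ∈ t.a.1.source := by
    intro z
    by_cases hz : p z = y
    · obtain ⟨t, ht⟩ := exists_adaptedChart hs z b (hz ▸ hyb)
      exact ⟨t, fun _ => ht⟩
    · obtain ⟨b', hb'⟩ := (HolLineBundle.canonical n Y).cover (p z)
      obtain ⟨t, ht⟩ := exists_adaptedChart hs z b' hb'
      exact ⟨t, fun h => absurd h hz⟩
  choose t ht using h1
  have hK : IsCompact (p ⁻¹' {y}) := hpr.isCompact_preimage isCompact_singleton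
  obtain ⟨σ, χ, O, hσ, hχ, hO, hsum⟩ := exists_partition (d := n + k) hK
    (fun z => (⟨(t z).a.1.source, (t z).a.1.open_source⟩ ⊓ Opens.comap p N : Opens Z))
    (fun z hz => ⟨(ht z hz).2, by
      change p z ∈ N
      rw [show p z = y from hz]
      exact hyN⟩)
  obtain ⟨B, hyB, hB⟩ := exists_tube hpr.isClosedMap (y := y) (O := O) fun z hz => hO hz
  exact ⟨⟨σ, t, χ, B ⊓ N, inf_le_right, fun l hl => (ht l (hσ l hl)).1, hχ,
    fun z hz => hsum z (hB hz.1)⟩, hyB, hyN⟩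

namespace FiberPartition

variable {hp : ContMDiff 𝓘(ℂ, Cn (n + k)) 𝓘(ℂ, Cn n) ω p} {b : Chart n Y} {N : Opens Y}
  (P : FiberPartition (n := n) (k := k) p b N)

theorem smooth {l : Z} (hl : l ∈ P.σ) (U : Set Z) : SmoothOn (n + k) (P.χ l) U :=
  (P.test l hl).smooth.mono (subset_univ U)

/-- The part of a density in one of the charts. -/
def part (l : Z) (i : L.ι) (h : (twistM p hp L).ι → Z → ℂ) (z : Z) : ℂ :=
  P.χ l z * h (i, ((P.s l).a, (P.s l).b)) z

theorem part_isTest {i : L.ι} (hN : N ≤ V ⊓ L.dom i) (h : (twistM p hp L).absSec (Opens.comap p V)) {l : Z}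
    (hl : l ∈ P.σ) : IsTest (n + k) (P.part l i h.1) (P.s l).a.1.source := by
  have h1 : SmoothOn (n + k) (h.1 (i, ((P.s l).a, (P.s l).b)))
      ((⟨(P.s l).a.1.source, (P.s l).a.1.open_source⟩ ⊓ Opens.comap p N : Opens Z) : Set Z) :=
    (h.2.1 (i, ((P.s l).a, (P.s l).b))).1.mono fun z hz =>
      ⟨(hN hz.2).1, (hN hz.2).2, hz.1, (P.s l).mapsTo z hz.1⟩
  exact ((P.test l hl).mul_right h1).mono fun z hz => hz.1

theorem base_source {l : Z} (hl : l ∈ P.σ) : (P.s l).b.1.source = b.1.source := by rw [P.base l hl]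

theorem concentrated {i : L.ι} (hN : N ≤ V ⊓ L.dom i) (h : (twistM p hp L).absSec (Opens.comap p V)) {l : Z}
    (hl : l ∈ P.σ) {y : Y} (hb : y ∈ b.1.source) :
    Concentrated (mulSec (P.χ l) (P.smooth hl _) h) (P.s l) i y where
  mem := by rwa [P.base_source hl]
  vanish t z hz hzs := by
    change P.χ l z * _ = 0
    rw [(P.test l hl).apply_zero fun h => hzs h.1, zero_mul]
  int := AdaptedChart.integrableOn_slice (P.part_isTest hN h hl) y

theorem exists_cover {y : Y} (hy : y ∈ P.B) : ∃ (N : ℕ) (t : Fin N → AdaptedChart (n := n) (k := k) p),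
    ∀ z, p z = y → ∃ j, z ∈ (t j).a.1.source := by
  refine ⟨P.σ.card, fun j => P.s (P.σ.equivFin.symm j), fun z hz => ?_⟩
  by_contra hno
  push Not at hno
  have h0 : ∀ l ∈ P.σ, P.χ l z = 0 := fun l hl => (P.test l hl).apply_zero fun hzl => by
    have h1 := hno (P.σ.equivFin ⟨l, hl⟩)
    rw [Equiv.symm_apply_apply] at h1
    exact h1 hzl.1
  have h1 := P.sum_eq z (hz ▸ hy)
  rw [Finset.sum_eq_zero h0] at h1
  exact zero_ne_one h1

/-- The density is split by the partition of unity into parts concentrated in single charts. For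
each part, the integral with the arbitrary chosen system equals a slice integral. -/
theorem fiberIntegral_eq {i : L.ι} (hN : N ≤ V ⊓ L.dom i) (h : (twistM p hp L).absSec (Opens.comap p V))
    {y : Y} (hy : y ∈ P.B) (hb : y ∈ b.1.source) :
    fiberIntegral p hp L h.1 i y = ∑ l ∈ P.σ, (P.s l).sliceInt (P.part l i h.1) y := by
  have H := P.exists_cover hy
  have hyV : y ∈ V ⊓ L.dom i := hN (P.le hy)
  rw [fiberIntegral, dif_pos H]
  set t := H.choose_spec.choose with ht
  have hpc := fun l (hl : l ∈ P.σ) => (P.concentrated hN h hl hb).pieces hyV.1 hyV.2 t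
  have h2 : ∀ l ∈ P.σ, (P.s l).sliceInt (P.part l i h.1) y =
      ∑ j, ∫ x in fiberPiece t j y, P.χ l ((t j).fiberParam y x) *
        h.1 (i, ((t j).a, (t j).b)) ((t j).fiberParam y x) :=
    fun l hl => ((hpc l hl).2 H.choose_spec.choose_spec).symm
  rw [Finset.sum_congr rfl h2, Finset.sum_comm]
  refine Finset.sum_congr rfl fun j _ => ?_
  refine Eq.trans ?_ (integral_finsetSum P.σ (f := fun l x => P.χ l ((t j).fiberParam y x) *
    h.1 (i, ((t j).a, (t j).b)) ((t j).fiberParam y x)) fun l hl => (hpc l hl).1 j)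
  refine setIntegral_congr_fun (measurableSet_fiberPiece t j y) fun x hx => ?_
  have h3 := P.sum_eq _ (hx.2.1.symm ▸ hy)
  exact ((one_mul _).symm.trans (congrArg (· * _) h3.symm)).trans (Finset.sum_mul ..)

end FiberPartition

variable (hs : Manifold.IsSubmersion 𝓘(ℂ, Cn (n + k)) 𝓘(ℂ, Cn n) ω p)

/-- Near a given point the chosen systems of charts vary without control, but the value is a fixed
finite sum of slice integrals over one base chart, each smooth in y. -/
theorem fiberIntegral_smooth (hpr : IsProperMap p) (h : (twistM p hs.contMDiff L).absSec (Opens.comap p V)) (i : L.ι) :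
    SmoothOn n (fiberIntegral p hs.contMDiff L h.1 i) (V ⊓ L.dom i : Opens Y) := by
  intro y hy
  obtain ⟨b, hb⟩ := (HolLineBundle.canonical n Y).cover y
  obtain ⟨P, hyP⟩ := exists_fiberPartition hs hpr b hy hb
  have h1 : SmoothOn n (fun y => ∑ l ∈ P.σ, (P.s l).sliceInt (P.part l i h.1) y) b.1.source :=
    SmoothOn.sum fun l hl => by
      rw [← P.base_source hl]
      exact AdaptedChart.sliceInt_smooth (P.part_isTest le_rfl h hl)
  have h2 : SmoothOn n (fiberIntegral p hs.contMDiff L h.1 i) ((P.B : Set Y) ∩ b.1.source) :=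
    (h1.mono inter_subset_right).congr fun y hy => P.fiberIntegral_eq le_rfl h hy.1 hy.2
  exact (h2.contMDiffAt ((P.B.2.inter b.1.open_source).mem_nhds ⟨hyP, hb⟩)).contMDiffWithinAt

/-- Additivity of integrals needs integrability, which is available after passing to the compactly
supported parts of a partition of unity. -/
theorem fiberIntegral_add (hpr : IsProperMap p) (h h' : (twistM p hs.contMDiff L).absSec (Opens.comap p V)) {i : L.ι} {y : Y}
    (hy : y ∈ V ⊓ L.dom i) : fiberIntegral p hs.contMDiff L (h + h').1 i y =
      fiberIntegral p hs.contMDiff L h.1 i y + fiberIntegral p hs.contMDiff L h'.1 i y := by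
  obtain ⟨b, hb⟩ := (HolLineBundle.canonical n Y).cover y
  obtain ⟨P, hyP⟩ := exists_fiberPartition hs hpr b hy hb
  rw [P.fiberIntegral_eq le_rfl h hyP hb, P.fiberIntegral_eq le_rfl h' hyP hb,
    P.fiberIntegral_eq le_rfl (h + h') hyP hb, ← Finset.sum_add_distrib]
  refine Finset.sum_congr rfl fun l hl => ?_
  rw [← (P.s l).sliceInt_add (P.part_isTest le_rfl h hl) (P.part_isTest le_rfl h' hl)]
  congr 1
  funext z
  exact mul_add _ _ _

theorem twistM_g_same {i i' : L.ι} {a : Chart (n + k) Z} {b : Chart n Y} {z : Z} (ha : z ∈ a.1.source)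
    (hb : p z ∈ b.1.source) : (twistM p hs.contMDiff L).g (i, (a, b)) (i', (a, b)) z = L.g i i' (p z) := by
  change L.g i i' (p z) * (HolLineBundle.jac a a z * (HolLineBundle.jac b b (p z))⁻¹) = _
  rw [HolLineBundle.jac_self a ha, HolLineBundle.jac_self b hb, inv_one, mul_one, mul_one]

variable (hpr : IsProperMap p)

variable (L) in
/-- Fiber integrals over `V`, in a trivialization of `L`. -/
def pushFun (V : Opens Y) (h : (twistM p hs.contMDiff L).ι → Z → ℂ) (i : L.ι) : Y → ℂ :=
  Set.indicator ((V ⊓ L.dom i : Opens Y) : Set Y) (fiberIntegral p hs.contMDiff L h i)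

theorem pushFun_of_mem {h : (twistM p hs.contMDiff L).ι → Z → ℂ} {i : L.ι} {y : Y} (hy : y ∈ V ⊓ L.dom i) :
    pushFun L hs V h i y = fiberIntegral p hs.contMDiff L h i y :=
  Set.indicator_of_mem (s := ((V ⊓ L.dom i : Opens Y) : Set Y)) hy _

theorem pushFun_of_notMem {h : (twistM p hs.contMDiff L).ι → Z → ℂ} {i : L.ι} {y : Y} (hy : y ∉ V ⊓ L.dom i) :
    pushFun L hs V h i y = 0 :=
  Set.indicator_of_notMem (s := ((V ⊓ L.dom i : Opens Y) : Set Y)) hy _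

/-- Fiber integration of sections of `|M|²` over `p⁻¹V`. -/
def pushSec : (twistM p hs.contMDiff L).absSec (Opens.comap p V) →ₗ[ℂ] L.absSec V where
  toFun h := ⟨pushFun L hs V h.1,
    fun i => indicator_mem_smoothFun n (fiberIntegral_smooth hs hpr h i) le_rfl,
    fun i j y hy hi hj => by
      rw [pushFun_of_mem hs ⟨hy, hi⟩, pushFun_of_mem hs ⟨hy, hj⟩]
      refine fiberIntegral_eq_mul _ fun t z hz hzt => ?_
      subst hz
      have h1 := h.2.2 (i, (t.a, t.b)) (j, (t.a, t.b)) z hy ⟨hi, hzt, t.mapsTo z hzt⟩ ⟨hj, hzt, t.mapsTo z hzt⟩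
      rwa [twistM_g_same hs hzt (t.mapsTo z hzt)] at h1⟩
  map_add' h h' := Subtype.ext (funext fun i => funext fun y => by
    change pushFun L hs V (h + h').1 i y = pushFun L hs V h.1 i y + pushFun L hs V h'.1 i y
    by_cases hy : y ∈ V ⊓ L.dom i
    · rw [pushFun_of_mem hs hy, pushFun_of_mem hs hy, pushFun_of_mem hs hy]
      exact fiberIntegral_add hs hpr h h' hy
    · rw [pushFun_of_notMem hs hy, pushFun_of_notMem hs hy, pushFun_of_notMem hs hy, add_zero])
  map_smul' c h := Subtype.ext (funext fun i => funext fun y => by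
    change pushFun L hs V (c • h).1 i y = c * pushFun L hs V h.1 i y
    by_cases hy : y ∈ V ⊓ L.dom i
    · rw [pushFun_of_mem hs hy, pushFun_of_mem hs hy]
      exact fiberIntegral_eq_mul c fun t z _ _ => rfl
    · rw [pushFun_of_notMem hs hy, pushFun_of_notMem hs hy, mul_zero])

theorem pushSec_apply (h : (twistM p hs.contMDiff L).absSec (Opens.comap p V)) {i : L.ι} {y : Y}
    (hy : y ∈ V) (hi : y ∈ L.dom i) : (pushSec hs hpr h).1 i y = fiberIntegral p hs.contMDiff L h.1 i y :=
  pushFun_of_mem hs ⟨hy, hi⟩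

theorem pushSec_eq_mul {V' : Opens Y} (h : (twistM p hs.contMDiff L).absSec (Opens.comap p V))
    (h' : (twistM p hs.contMDiff L).absSec (Opens.comap p V')) {i i' : L.ι} {y : Y} (hy : y ∈ V) (hy' : y ∈ V')
    (hi : y ∈ L.dom i) (hi' : y ∈ L.dom i') (c : ℂ)
    (hh : ∀ (t : AdaptedChart (n := n) (k := k) p) (z : Z), p z = y → z ∈ t.a.1.source →
      h.1 (i, (t.a, t.b)) z = c * h'.1 (i', (t.a, t.b)) z) :
    (pushSec hs hpr h).1 i y = c * (pushSec hs hpr h').1 i' y := by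
  rw [pushSec_apply hs hpr h hy hi, pushSec_apply hs hpr h' hy' hi']
  exact fiberIntegral_eq_mul c hh

theorem pushSec_congr {V' : Opens Y} (h : (twistM p hs.contMDiff L).absSec (Opens.comap p V))
    (h' : (twistM p hs.contMDiff L).absSec (Opens.comap p V')) {i : L.ι} {y : Y} (hy : y ∈ V) (hy' : y ∈ V')
    (hi : y ∈ L.dom i) (hh : ∀ (t : AdaptedChart (n := n) (k := k) p) (z : Z), p z = y → z ∈ t.a.1.source →
      h.1 (i, (t.a, t.b)) z = h'.1 (i, (t.a, t.b)) z) :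
    (pushSec hs hpr h).1 i y = (pushSec hs hpr h').1 i y := by
  rw [pushSec_eq_mul hs hpr h h' hy hy' hi hi 1 fun t z hz hzt => (hh t z hz hzt).trans (one_mul _).symm, one_mul]

theorem pushSec_eq_zero (h : (twistM p hs.contMDiff L).absSec (Opens.comap p V)) {i : L.ι} {y : Y}
    (hh : ∀ τ z, p z = y → h.1 τ z = 0) : (pushSec hs hpr h).1 i y = 0 := by
  by_cases hy : y ∈ V ⊓ L.dom i
  · rw [pushSec_eq_mul hs hpr h h hy.1 hy.1 hy.2 hy.2 0 fun t z hz _ => (hh _ z hz).trans (zero_mul _).symm, zero_mul]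
  · exact ((pushSec hs hpr h).2.1 i).2 y hy

theorem pushSec_isTest (h : (twistM p hs.contMDiff L).absSec (Opens.comap p V)) {i : L.ι} {N : Opens Y}
    (hN : N ≤ V ⊓ L.dom i) {K : Set Y} (hK : IsCompact K) (hKN : K ⊆ N)
    (hh : ∀ τ z, p z ∉ K → h.1 τ z = 0) : IsTest n ((pushSec hs hpr h).1 i) N :=
  .of_smoothOn (((pushSec hs hpr h).2.1 i).1.mono hN) hK hKN fun _ hy =>
    pushSec_eq_zero hs hpr h fun τ z hz => hh τ z (hz ▸ hy)

/-- Fubini's theorem for densities concentrated in an adapted chart. -/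
theorem cint_pushSec (h : (twistM p hs.contMDiff L).absSec (Opens.comap p V)) (i : L.ι)
    (s : AdaptedChart (n := n) (k := k) p) {C : Set Z} (hC : IsCompact C)
    (hCs : C ⊆ (⟨s.a.1.source, s.a.1.open_source⟩ ⊓ Opens.comap p (V ⊓ L.dom i) : Opens Z))
    (hh : ∀ τ, ∀ z ∉ C, h.1 τ z = 0) :
    IsTest (n + k) (h.1 (i, (s.a, s.b))) s.a.1.source ∧
    cint s.b ((pushSec hs hpr h).1 i) = cint s.a (h.1 (i, (s.a, s.b))) := by
  have htest : IsTest (n + k) (h.1 (i, (s.a, s.b)))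
      (⟨s.a.1.source, s.a.1.open_source⟩ ⊓ Opens.comap p (V ⊓ L.dom i) : Opens Z) :=
    .of_smoothOn ((h.2.1 (i, (s.a, s.b))).1.mono fun z hz => ⟨hz.2.1, hz.2.2, hz.1, s.mapsTo z hz.1⟩) hC hCs (hh _)
  have htest' : IsTest (n + k) (h.1 (i, (s.a, s.b))) s.a.1.source := htest.mono fun z hz => hz.1
  refine ⟨htest', ?_⟩
  rw [← AdaptedChart.cint_sliceInt htest']
  refine cint_congr s.b fun y hy => ?_
  by_cases hyV : y ∈ V ⊓ L.dom i
  · have hc : Concentrated h s i y :=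
      ⟨hy, fun t z _ hzs => hh _ z fun hzC => hzs (hCs hzC).1, AdaptedChart.integrableOn_slice htest' y⟩
    obtain ⟨P, hyP⟩ := exists_fiberPartition hs hpr s.b hyV hy
    rw [pushSec_apply hs hpr h hyV.1 hyV.2, fiberIntegral]
    have H := P.exists_cover hyP
    rw [dif_pos H]
    exact (hc.pieces hyV.1 hyV.2 _).2 H.choose_spec.choose_spec
  -- Over other points the section is stored as 0, and the slice integral vanishes because C lies
  -- over V ⊓ L.dom i.
  · rw [((pushSec hs hpr h).2.1 i).2 y hyV]
    refine ((setIntegral_congr_fun (g := fun _ => (0 : ℂ)) (s.isOpen_slice y).measurableSet fun x hx => ?_).trans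
      (by simp)).symm
    refine htest.apply_zero fun hz => hyV ?_
    have h2 : p (s.fiberParam y x) ∈ V ⊓ L.dom i := hz.2
    rwa [AdaptedChart.proj_fiberParam hy hx] at h2

end FiberIntegration

/-! ### Coefficients of symbols -/

section SymbolCoefficients

variable {m : ℕ}

theorem coeff_symbolPoly (L : List (ℂ × List (Fin m))) (s : Fin m →₀ ℕ) :
    (symbolPoly L).coeff s =
      (L.map fun e => if Multiset.toFinsupp (e.2 : Multiset (Fin m)) = s then e.1 else 0).sum := by
  induction L with
  | nil => simp [symbolPoly]
  | cons e L ih =>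
    have h : symbolPoly (e :: L) = MvPolynomial.monomial
      (Multiset.toFinsupp (e.2 : Multiset (Fin m))) e.1 + symbolPoly L := by simp [symbolPoly]
    rw [h, MvPolynomial.coeff_add, ih, List.map_cons, List.sum_cons, MvPolynomial.coeff_monomial]

/-- This replaces lists of words, which vary from one representative to another, by a sum over a
finite set of exponents that can be enlarged freely. -/
theorem monomialFunctional_eq_sum (T : List (Fin m) → ℂ) (q : MvPolynomial (Fin m) ℂ)
    {S : Finset (Fin m →₀ ℕ)} (hS : ∀ s ∉ S, q.coeff s = 0) :
    monomialFunctional T q = ∑ s ∈ S, q.coeff s * T (Finsupp.toMultiset s).toList := by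
  have h1 : q.support ⊆ S := fun s hs => by_contra fun h => MvPolynomial.mem_support_iff.1 hs (hS s h)
  conv_lhs => rw [q.as_sum]
  rw [map_sum, ← Finset.sum_subset h1 fun s _ hs => by rw [MvPolynomial.notMem_support_iff.1 hs, zero_mul]]
  refine Finset.sum_congr rfl fun s _ => ?_
  have h2 : MvPolynomial.monomial s (q.coeff s) = q.coeff s • MvPolynomial.basisMonomials (Fin m) ℂ s := by
    rw [MvPolynomial.coe_basisMonomials, MvPolynomial.smul_monomial, smul_eq_mul, mul_one]
  rw [h2, map_smul, monomialFunctional, Module.Basis.constr_basis, smul_eq_mul]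

end SymbolCoefficients

/-! ### The expansion of a section in derivatives along the base -/

section Density

variable {n k : ℕ} {Y Z : Type*} [TopologicalSpace Y] [T2Space Y] [SecondCountableTopology Y]
  [ChartedSpace (Cn n) Y] [TopologicalSpace Z] [T2Space Z] [SecondCountableTopology Z]
  [ChartedSpace (Cn (n + k)) Z]
  [IsManifold 𝓘(ℂ, Cn (n + k)) ω Z] [IsManifold 𝓘(ℂ, Cn n) ω Y] {p : C(Z, Y)}
  (hs : Manifold.IsSubmersion 𝓘(ℂ, Cn (n + k)) 𝓘(ℂ, Cn n) ω p) {L : HolLineBundle n Y} {U : Opens Y}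

variable (n k Z) in
/-- A chart at a point. -/
def someChart (z : Z) : Chart (n + k) Z := ((HolLineBundle.canonical (n + k) Z).cover z).choose

theorem mem_someChart (z : Z) : z ∈ (someChart n k Z z).1.source :=
  ((HolLineBundle.canonical (n + k) Z).cover z).choose_spec

/-- The function `hat ξ (i, a, b) f`, which does not depend on the chart `a`. -/
def dens (ξ : (transferSheaf p hs.contMDiff L).sec U) (i : L.ι) (b : Chart n Y) (f : Y → ℂ) (z : Z) : ℂ :=
  hat hs ξ (i, (someChart n k Z z, b)) f z

/-- K_Z occurs both in K_Z and, inverted, in M⁻¹. The Jacobian between two charts of Z therefore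
cancels, and a change of chart of Z alone has no effect. -/
theorem hat_eq_dens (ξ : (transferSheaf p hs.contMDiff L).sec U) {i : L.ι} {a : Chart (n + k) Z} {b : Chart n Y}
    {z : Z} (hz : p z ∈ U) (hi : p z ∈ L.dom i) (ha : z ∈ a.1.source) (hb : p z ∈ b.1.source) {f : Y → ℂ}
    (hf : p z ∈ smoothLocus n f) : hat hs ξ (i, (a, b)) f z = dens hs ξ i b f z := by
  set a' := someChart n k Z z with ha'
  have haz : z ∈ a'.1.source := mem_someChart z
  have h1 := hat_change hs ξ (τ := (i, (a, b))) (τ' := (i, (a', b))) hz ⟨hi, ha, hb⟩ ⟨hi, haz, hb⟩ hf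
  refine h1.trans ?_
  have h2 : leftFactor p hs.contMDiff L (i, (a, b)) (i, (a', b)) z = 1 := by
    change HolLineBundle.jac a a' z * (L.g i i (p z) * (HolLineBundle.jac a a' z *
      (HolLineBundle.jac b b (p z))⁻¹))⁻¹ = 1
    rw [L.g_self hi, HolLineBundle.jac_self b hb, inv_one, mul_one, one_mul,
      mul_inv_cancel₀ (jac_ne_zero a a' ha haz)]
  rw [h2, one_mul]
  refine (hat_congr hs ξ (τ := (i, (a', b))) hz ⟨hi, haz, hb⟩ ?_ hf).symm
  filter_upwards [(L.dom i).2.mem_nhds hi, b.1.open_source.mem_nhds hb] with y hyi hyb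
  change f y = (HolLineBundle.jac b b y)⁻¹ * L.g i i y * f y
  rw [L.g_self hyi, HolLineBundle.jac_self b hyb, inv_one, one_mul, one_mul]

open Classical in
/-- The coefficients of the representatives of a section with respect to the derivatives along the base. -/
def symCoeff (ξ : (transferSheaf p hs.contMDiff L).sec U) (i : L.ι) (b : Chart n Y) (s : Fin n →₀ ℕ) (z : Z) : ℂ :=
  if H : ∃ q : MvPolynomial (Fin n) ℂ, ∀ l, dens hs ξ i b (chartExp b l) z =
    MvPolynomial.eval l q * chartExp b l (p z) then H.choose.coeff s else 0

/-- Exponentials have no zeros and a complex polynomial is determined by its values, so the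
polynomial is unique. This makes the coefficients globally defined functions, independent of local
representatives. -/
theorem symCoeff_eq {ξ : (transferSheaf p hs.contMDiff L).sec U} {i : L.ι} {b : Chart n Y} {z : Z}
    {q : MvPolynomial (Fin n) ℂ}
    (hq : ∀ l, dens hs ξ i b (chartExp b l) z = MvPolynomial.eval l q * chartExp b l (p z)) (s : Fin n →₀ ℕ) :
    symCoeff hs ξ i b s z = q.coeff s := by
  have H : ∃ q : MvPolynomial (Fin n) ℂ, ∀ l, dens hs ξ i b (chartExp b l) z =
    MvPolynomial.eval l q * chartExp b l (p z) := ⟨q, hq⟩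
  rw [symCoeff, dif_pos H]
  congr 1
  refine MvPolynomial.funext fun l => ?_
  exact mul_right_cancel₀ (chartExp_ne_zero b l (p z)) ((H.choose_spec l).symm.trans (hq l))

theorem HolOn.list_sum {d : ℕ} {X : Type*} [TopologicalSpace X] [ChartedSpace (Cn d) X] {ι : Type*}
    {O : Set X} (l : List ι) {F : ι → X → ℂ} (hF : ∀ e ∈ l, HolOn d (F e) O) :
    HolOn d (fun x => (l.map fun e => F e x).sum) O := by
  induction l with
  | nil => exact contMDiffOn_const
  | cons e l ih =>
    simp only [List.map_cons, List.sum_cons]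
    exact ContMDiffOn.add (hF e List.mem_cons_self) (ih fun e' he' => hF e' (List.mem_cons_of_mem _ he'))

/-- Local structure of the representatives, near a point of `Z`. -/
theorem dens_local (ξ : (transferSheaf p hs.contMDiff L).sec U) {i : L.ι} {b : Chart n Y} {z : Z}
    (hz : p z ∈ U) (hi : p z ∈ L.dom i) (hb : p z ∈ b.1.source) :
    ∃ (O : Opens Z) (S : Finset (Fin n →₀ ℕ)), z ∈ O ∧ (∀ s, HolOn (n + k) (symCoeff hs ξ i b s) O) ∧
      (∀ x ∈ O, ∀ s ∉ S, symCoeff hs ξ i b s x = 0) ∧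
      ∀ x ∈ O, ∀ f : Y → ℂ, p x ∈ smoothLocus n f → dens hs ξ i b f x =
        ∑ s ∈ S, symCoeff hs ξ i b s x * iterD b (Finsupp.toMultiset s).toList f (p x) := by
  classical
  obtain ⟨t, rfl, hzt⟩ := exists_adaptedChart hs z b hb
  obtain ⟨V, P, hzV, hV, hP⟩ := exists_evRep hs ξ (τ := (i, (t.a, t.b))) hz ⟨hi, hzt, hb⟩
  obtain ⟨N, hN, hNa, l, hzN, hl, hI⟩ := t.hasNormalForm_of_isHol hs.contMDiff hP.1 hzV hzt
  have hx : ∀ x ∈ N, p x ∈ U ∧ p x ∈ L.dom i ∧ p x ∈ t.b.1.source := fun x hx =>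
    ⟨(hV (hN hx)).1, (hV (hN hx)).2.1, (hV (hN hx)).2.2.2⟩
  have hd : ∀ x ∈ N, ∀ f : Y → ℂ, p x ∈ smoothLocus n f → dens hs ξ i t.b f x = P.ev (f ∘ p) x :=
    fun x hxN f hf => by
      rw [hP.2 x (hN hxN) f hf]
      exact (hat_eq_dens hs ξ (hx x hxN).1 (hx x hxN).2.1 (hNa hxN) (hx x hxN).2.2 hf).symm
  have hq : ∀ x ∈ N, ∀ m, dens hs ξ i t.b (chartExp t.b m) x =
      MvPolynomial.eval m (symbolPoly (l.map fun e => (e.1 x, e.2))) * chartExp t.b m (p x) :=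
    fun x hxN m => by
      rw [hd x hxN _ (chartExp_mem_smoothLocus t.b m (hx x hxN).2.2)]
      exact t.eval_symbol hs.contMDiff hN hNa hl hI hxN m
  -- Each coefficient is locally a sum of those coefficients in the list whose word has exponent s;
  -- this gives holomorphy and local finiteness.
  have hc : ∀ x ∈ N, ∀ s, symCoeff hs ξ i t.b s x = (l.map fun e =>
      if Multiset.toFinsupp (e.2 : Multiset (Fin n)) = s then e.1 x else 0).sum := fun x hxN s => by
    rw [symCoeff_eq hs (hq x hxN) s, coeff_symbolPoly, List.map_map]
    rfl
  have h0 : ∀ x ∈ N, ∀ s ∉ (l.map fun e => Multiset.toFinsupp (e.2 : Multiset (Fin n))).toFinset,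
      symCoeff hs ξ i t.b s x = 0 := fun x hxN s hsS => by
    rw [hc x hxN s]
    refine List.sum_eq_zero fun c hcm => ?_
    obtain ⟨e, he, rfl⟩ := List.mem_map.1 hcm
    refine if_neg fun h => hsS ?_
    rw [List.mem_toFinset]
    exact List.mem_map.2 ⟨e, he, h⟩
  refine ⟨N, _, hzN, fun s => ?_, h0, fun x hxN f hf => ?_⟩
  · refine (HolOn.list_sum l fun e he => ?_).congr fun x hxN => hc x hxN s
    split_ifs
    · exact hl e he
    · exact contMDiffOn_const
  · rw [hd x hxN f hf, t.ev_of_normalForm hs.contMDiff hN hNa hl hI hxN hf]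
    have h1 := monomialFunctional_symbolPoly (T := fun w => iterD t.b w f (p x))
      (fun w w' h => iterD_perm t.b h (hx x hxN).2.2 hf) (l.map fun e => (e.1 x, e.2))
    rw [List.map_map] at h1
    refine h1.symm.trans ?_
    rw [monomialFunctional_eq_sum _ _ fun s hsS => (symCoeff_eq hs (hq x hxN) s).symm.trans (h0 x hxN s hsS)]
    exact Finset.sum_congr rfl fun s _ => by rw [symCoeff_eq hs (hq x hxN) s]

/-- Local structure of the representatives over a neighbourhood of a point of `Y`. -/
theorem exists_expansion (hpr : IsProperMap p) (ξ : (transferSheaf p hs.contMDiff L).sec U) {i : L.ι}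
    {b : Chart n Y} {y : Y} (hy : y ∈ U) (hi : y ∈ L.dom i) (hb : y ∈ b.1.source) :
    ∃ (B : Opens Y) (S : Finset (Fin n →₀ ℕ)), y ∈ B ∧ B ≤ U ⊓ L.dom i ∧ (B : Set Y) ⊆ b.1.source ∧
      (∀ s, HolOn (n + k) (symCoeff hs ξ i b s) (Opens.comap p B)) ∧
      ∀ x, p x ∈ B → ∀ f : Y → ℂ, p x ∈ smoothLocus n f → dens hs ξ i b f x =
        ∑ s ∈ S, symCoeff hs ξ i b s x * iterD b (Finsupp.toMultiset s).toList f (p x) := by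
  classical
  have h1 : ∀ z : Z, ∃ (O : Opens Z) (S : Finset (Fin n →₀ ℕ)), p z = y → z ∈ O ∧
      (∀ s, HolOn (n + k) (symCoeff hs ξ i b s) O) ∧
      (∀ x ∈ O, ∀ s ∉ S, symCoeff hs ξ i b s x = 0) ∧
      ∀ x ∈ O, ∀ f : Y → ℂ, p x ∈ smoothLocus n f → dens hs ξ i b f x =
        ∑ s ∈ S, symCoeff hs ξ i b s x * iterD b (Finsupp.toMultiset s).toList f (p x) := by
    intro z
    by_cases hz : p z = y
    · subst hz
      obtain ⟨O, S, h⟩ := dens_local hs ξ hy hi hb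
      exact ⟨O, S, fun _ => h⟩
    · exact ⟨⊤, ∅, fun h => absurd h hz⟩
  choose O S h using h1
  have hK : IsCompact (p ⁻¹' {y}) := hpr.isCompact_preimage isCompact_singleton
  obtain ⟨σ, hσ, hcov⟩ := hK.elim_nhds_subcover (fun z => (O z : Set Z))
    fun z hz => (O z).2.mem_nhds (h z hz).1
  -- Compactness of the fiber bounds the exponents that occur, uniformly over a full preimage of a
  -- neighbourhood of y. The coefficients need no gluing since they are defined intrinsically.
  obtain ⟨B, hyB, hB⟩ := exists_tube hpr.isClosedMap (y := y) (O := ⨆ z ∈ σ, O z) fun z hz => by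
    obtain ⟨x, hx, hzx⟩ := mem_iUnion₂.1 (hcov hz)
    exact Opens.mem_iSup.2 ⟨x, Opens.mem_iSup.2 ⟨hx, hzx⟩⟩
  have hmem : ∀ x, p x ∈ B → ∃ z ∈ σ, x ∈ O z := fun x hx => by
    obtain ⟨z, hz⟩ := Opens.mem_iSup.1 (hB (show x ∈ Opens.comap p B from hx))
    obtain ⟨hzσ, hxz⟩ := Opens.mem_iSup.1 hz
    exact ⟨z, hzσ, hxz⟩
  refine ⟨B ⊓ ((U ⊓ L.dom i) ⊓ ⟨b.1.source, b.1.open_source⟩), σ.biUnion S, ⟨hyB, ⟨hy, hi⟩, hb⟩,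
    inf_le_right.trans inf_le_left, fun x hx => hx.2.2, fun s x hx => ?_, fun x hx f hf => ?_⟩
  · obtain ⟨z, hz, hxz⟩ := hmem x hx.1
    exact (((h z (hσ z hz)).2.1 s).contMDiffAt ((O z).2.mem_nhds hxz)).contMDiffWithinAt
  · obtain ⟨z, hz, hxz⟩ := hmem x hx.1
    rw [(h z (hσ z hz)).2.2.2 x hxz f hf]
    -- The exponents added by passing to the union have coefficient zero at x.
    refine Finset.sum_subset (Finset.subset_biUnion_of_mem S hz) fun s _ hs' => ?_
    rw [(h z (hσ z hz)).2.2.1 x hxz s hs', zero_mul]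

end Density

/-! ### The pairing that defines the homomorphism -/

section Pairing

variable {n k : ℕ} {Y Z : Type*} [TopologicalSpace Y] [T2Space Y] [SecondCountableTopology Y]
  [ChartedSpace (Cn n) Y] [TopologicalSpace Z] [T2Space Z] [SecondCountableTopology Z]
  [ChartedSpace (Cn (n + k)) Z]
  [IsManifold 𝓘(ℂ, Cn (n + k)) ω Z] [IsManifold 𝓘(ℂ, Cn n) ω Y] {p : C(Z, Y)}
  (hs : Manifold.IsSubmersion 𝓘(ℂ, Cn (n + k)) 𝓘(ℂ, Cn n) ω p) {L : HolLineBundle n Y} {U V : Opens Y}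

/-- The part of `U` on which `i` trivializes `L` and `b` is a chart. -/
def trivDom (U : Opens Y) (i : L.ι) (b : Chart n Y) : Opens Y := (U ⊓ L.dom i) ⊓ ⟨b.1.source, b.1.open_source⟩

theorem trivDom_mono (h : V ≤ U) (i : L.ι) (b : Chart n Y) : trivDom V i b ≤ trivDom U i b :=
  inf_le_inf_right _ (inf_le_inf_right _ h)

/-- `dens`, extended by zero. -/
def densFun (ξ : (transferSheaf p hs.contMDiff L).sec U) (i : L.ι) (b : Chart n Y) (f : Y → ℂ) : Z → ℂ :=
  Set.indicator (Opens.comap p (trivDom U i b) : Set Z) (dens hs ξ i b f)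

variable {i i' : L.ι} {b b' : Chart n Y} {f : Y → ℂ}

theorem densFun_of_mem (ξ : (transferSheaf p hs.contMDiff L).sec U) {z : Z} (hz : p z ∈ trivDom U i b) :
    densFun hs ξ i b f z = dens hs ξ i b f z :=
  Set.indicator_of_mem (s := (Opens.comap p (trivDom U i b) : Set Z)) hz _

theorem hat_zero_fun (ξ : (transferSheaf p hs.contMDiff L).sec U) {τ : (twistM p hs.contMDiff L).ι} {z : Z}
    (hz : p z ∈ U) (hτ : z ∈ (twistM p hs.contMDiff L).dom τ) : hat hs ξ τ (fun _ => 0) z = 0 := by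
  have h := hat_fun_add hs ξ hz hτ (smoothLocus_const (d := n) 0 (p z)) (smoothLocus_const (d := n) 0 (p z))
  simpa using h

theorem densFun_eq_zero (ξ : (transferSheaf p hs.contMDiff L).sec U) {z : Z} (h : ∀ᶠ y in 𝓝 (p z), f y = 0) :
    densFun hs ξ i b f z = 0 := by
  by_cases hz : p z ∈ trivDom U i b
  · rw [densFun_of_mem hs ξ hz]
    have h0 : (fun _ => (0 : ℂ)) =ᶠ[𝓝 (p z)] f := h.mono fun y hy => hy.symm
    have hτ : z ∈ (twistM p hs.contMDiff L).dom (i, (someChart n k Z z, b)) := ⟨hz.1.2, mem_someChart z, hz.2⟩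
    exact (hat_congr hs ξ hz.1.1 hτ h0 (smoothLocus_const 0 _)).symm.trans (hat_zero_fun hs ξ hz.1.1 hτ)
  · exact Set.indicator_of_notMem (s := (Opens.comap p (trivDom U i b) : Set Z)) hz _

theorem densFun_eq_hat (ξ : (transferSheaf p hs.contMDiff L).sec U) {a : Chart (n + k) Z} {z : Z}
    (hz : p z ∈ trivDom U i b) (ha : z ∈ a.1.source) (hf : p z ∈ smoothLocus n f) :
    densFun hs ξ i b f z = hat hs ξ (i, (a, b)) f z := by
  rw [densFun_of_mem hs ξ hz]
  exact (hat_eq_dens hs ξ hz.1.1 hz.1.2 ha hz.2 hf).symm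

/-- The support of f is a closed set inside the domain of the trivialization, so the extension by
zero is locally zero near every point outside the preimage of that domain. -/
theorem densFun_smooth (ξ : (transferSheaf p hs.contMDiff L).sec U) (hf : IsTest n f (trivDom U i b)) (W : Set Z) :
    SmoothOn (n + k) (densFun hs ξ i b f) W := by
  intro z _
  have h1 : z ∈ smoothLocus (n + k) (densFun hs ξ i b f) := by
    by_cases hz : p z ∈ trivDom U i b
    · refine smoothLocus_congr ?_ (hat_mem_smoothLocus hs ξ (τ := (i, (someChart n k Z z, b))) hz.1.1
        ⟨hz.1.2, mem_someChart z, hz.2⟩ (hf.mem_smoothLocus (p z)))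
      filter_upwards [(Opens.comap p (trivDom U i b)).2.mem_nhds hz,
        (someChart n k Z z).1.open_source.mem_nhds (mem_someChart z)] with x hx hxa
      exact (densFun_eq_hat hs ξ hx hxa (hf.mem_smoothLocus (p x))).symm
    · refine smoothLocus_congr (F := fun _ => 0) ?_ (smoothLocus_const 0 z)
      have h2 : p z ∉ tsupport f := fun h => hz (hf.sub h)
      filter_upwards [((isClosed_tsupport f).isOpen_compl.preimage p.continuous).mem_nhds h2] with x hx
      exact (densFun_eq_zero hs ξ (IsTest.eventually_zero hx)).symm
  exact (((smoothOn_smoothLocus _) z h1).contMDiffAt ((smoothLocus (n + k) _).2.mem_nhds h1)).contMDiffWithinAt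

/-- The pairing of `f` with `Φ(ξ)(h)`, in terms of which `Φ` is defined. -/
def pairing (ξ : (transferSheaf p hs.contMDiff L).sec U) (h : (twistM p hs.contMDiff L).absSec (Opens.comap p V))
    (i : L.ι) (b : Chart n Y) (f : Y → ℂ) : ℂ :=
  cint b (pushFun L hs V (fun τ z => densFun hs ξ i b f z * h.1 τ z) i)

theorem pushFun_eq_zero {h : (twistM p hs.contMDiff L).ι → Z → ℂ} {y : Y} (hh : ∀ τ z, p z = y → h τ z = 0) :
    pushFun L hs V h i y = 0 := by
  by_cases hy : y ∈ V ⊓ L.dom i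
  · rw [pushFun_of_mem hs hy, fiberIntegral_eq_mul (h' := h) (i' := i) 0 fun t z hz _ =>
      (hh _ z hz).trans (zero_mul _).symm, zero_mul]
  · exact pushFun_of_notMem hs hy

/-- The factor ρ of the test function is used up by the change of trivialization, at the price of ρ
in front; the factor conj ρ is antiholomorphic and comes out unchanged. Together they give |ρ|². -/
theorem dens_change (ξ : (transferSheaf p hs.contMDiff L).sec U) {z : Z} (hz : p z ∈ trivDom U i b)
    (hz' : p z ∈ trivDom U i' b') (hf : p z ∈ smoothLocus n f) :
    dens hs ξ i' b' (fun y => conjFun (baseFactor L i i' b b') y * (baseFactor L i i' b b' y * f y)) z =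
      (‖baseFactor L i i' b b' (p z)‖ ^ 2 : ℝ) * dens hs ξ i b f z := by
  set ρ := baseFactor L i i' b b' with hρ
  set a := someChart n k Z z
  have ha : z ∈ a.1.source := mem_someChart z
  have hτ : z ∈ (twistM p hs.contMDiff L).dom (i, (a, b)) := ⟨hz.1.2, ha, hz.2⟩
  have hτ' : z ∈ (twistM p hs.contMDiff L).dom (i', (a, b')) := ⟨hz'.1.2, ha, hz'.2⟩
  have h1 := hat_change hs ξ hz.1.1 hτ hτ' hf
  have h2 := factor_mul p hs.contMDiff L (i, (a, b)) (i', (a, b')) hτ hτ'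
  have h3 : rightFactor p hs.contMDiff L (i, (a, b)) (i', (a, b')) z = ρ (p z) := rfl
  rw [h3] at h2
  have hf' : p z ∈ smoothLocus n (fun y => ρ y * f y) := baseFactor_mul_mem_smoothLocus hs hτ hτ' hf
  have hhol : HolOn n ρ ((L.dom i ⊓ L.dom i') ⊓
      (⟨b.1.source, b.1.open_source⟩ ⊓ ⟨b'.1.source, b'.1.open_source⟩) : Opens Y) :=
    HolOn.mul (((jac_hol b b').inv fun x hx => jac_ne_zero b b' hx.1 hx.2).mono fun x hx => hx.2)
      ((L.hol i i').mono fun x hx => hx.1)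
  have h4 := hat_conj_mul hs ξ hz.1.1 hτ' hhol ⟨⟨hz.1.2, hz'.1.2⟩, hz.2, hz'.2⟩ hf'
  refine h4.trans ?_
  have h5 : dens hs ξ i b f z = leftFactor p hs.contMDiff L (i, (a, b)) (i', (a, b')) z *
      hat hs ξ (i', (a, b')) (fun y => ρ y * f y) z := h1
  rw [h5, ← Complex.normSq_eq_norm_sq, ← Complex.mul_conj, conjFun]
  linear_combination (-(starRingEnd ℂ) (ρ (p z)) * hat hs ξ (i', (a, b')) (fun y => ρ y * f y) z) * h2

/-- Changing variables on Y contributes |jac|², and h contributes |g|² from |L|². Their product is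
|ρ|², which is what `dens_change` produces from the new test function. So test functions transform
like sections of |K_Y|² ⊗ |L|⁻² and the pairing is intrinsic. -/
theorem pairing_change (hVU : V ≤ U) (ξ : (transferSheaf p hs.contMDiff L).sec U)
    (h : (twistM p hs.contMDiff L).absSec (Opens.comap p V))
    (hf : IsTest n f (trivDom V i b ⊓ trivDom V i' b' : Opens Y)) :
    pairing hs ξ h i b f = pairing hs ξ h i' b'
      (fun y => conjFun (baseFactor L i i' b b') y * (baseFactor L i i' b b' y * f y)) := by
  have hz : ∀ y, y ∉ trivDom V i b ⊓ trivDom V i' b' → ∀ (j : L.ι) (c : Chart n Y) (g : Y → ℂ → ℂ),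
      (∀ y, g y 0 = 0) → pushFun L hs V (fun τ z => densFun hs ξ j c (fun y => g y (f y)) z * h.1 τ z) j y = 0 := by
    intro y hy j c g hg
    refine pushFun_eq_zero hs fun τ z hzy => ?_
    rw [densFun_eq_zero hs ξ, zero_mul]
    rw [hzy]
    refine (IsTest.eventually_zero fun h' => hy (hf.sub h')).mono fun x hx => ?_
    rw [hx, hg]
  rw [pairing, pairing, cint_change b b' fun y hy => hz y (fun h' => hy ⟨h'.1.2, h'.2.2⟩) i b (fun _ c => c) fun _ => rfl]
  refine cint_congr b' fun y hyb' => ?_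
  by_cases hy : y ∈ trivDom V i b ⊓ trivDom V i' b'
  · rw [pushFun_of_mem hs hy.1.1, pushFun_of_mem hs hy.2.1]
    symm
    refine fiberIntegral_eq_mul _ fun t z hzy hzt => ?_
    subst hzy
    have hc := h.2.2 (i, (t.a, t.b)) (i', (t.a, t.b)) z hy.1.1.1 ⟨hy.1.1.2, hzt, t.mapsTo z hzt⟩
      ⟨hy.2.1.2, hzt, t.mapsTo z hzt⟩
    rw [twistM_g_same hs hzt (t.mapsTo z hzt)] at hc
    refine Eq.trans ?_ (congrArg (fun c => _ * (_ * c)) hc.symm)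
    rw [densFun_of_mem hs ξ (trivDom_mono hVU _ _ hy.1), densFun_of_mem hs ξ (trivDom_mono hVU _ _ hy.2),
      dens_change hs ξ (trivDom_mono hVU _ _ hy.1) (trivDom_mono hVU _ _ hy.2) (hf.mem_smoothLocus _),
      baseFactor_eq hy.1.2 hy.2.2, norm_mul, mul_pow]
    push_cast
    ring
  · rw [hz y hy i b (fun _ c => c) fun _ => rfl, mul_zero]
    exact (hz y hy i' b' (fun y c => conjFun (baseFactor L i i' b b') y * (baseFactor L i i' b b' y * c))
      fun _ => by simp).symm

/-- `u` represents `Φ(ξ)(h)` on `W`, in the trivialization `i` and in terms of the chart `b`. -/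
structure IsLocSol (ξ : (transferSheaf p hs.contMDiff L).sec U)
    (h : (twistM p hs.contMDiff L).absSec (Opens.comap p V)) (i : L.ι) (b : Chart n Y) (W : Opens Y)
    (u : Y → ℂ) : Prop where
  le : W ≤ trivDom V i b
  smooth : SmoothOn n u W
  pair : ∀ f, IsTest n f W → cint b (fun y => f y * u y) = pairing hs ξ h i b f

namespace IsLocSol

variable {hs} {ξ : (transferSheaf p hs.contMDiff L).sec U}
  {h : (twistM p hs.contMDiff L).absSec (Opens.comap p V)} {W W' : Opens Y} {u u' : Y → ℂ}

theorem mono (hu : IsLocSol hs ξ h i b W u) (hW : W' ≤ W) : IsLocSol hs ξ h i b W' u :=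
  ⟨hW.trans hu.le, hu.smooth.mono hW, fun f hf => hu.pair f (hf.mono hW)⟩

theorem congr (hu : IsLocSol hs ξ h i b W u) (huu : ∀ y ∈ W, u y = u' y) : IsLocSol hs ξ h i b W u' :=
  ⟨hu.le, hu.smooth.congr fun y hy => (huu y hy).symm, fun f hf => by
    rw [← hu.pair f hf]
    refine cint_congr b fun y _ => ?_
    by_cases hy : y ∈ W
    · rw [huu y hy]
    · rw [hf.apply_zero hy, zero_mul, zero_mul]⟩

/-- A smooth function is determined by its integrals against test functions. -/
theorem eqOn (hu : IsLocSol hs ξ h i b W u) (hu' : IsLocSol hs ξ h i b W' u') : ∀ y ∈ W ⊓ W', u y = u' y := by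
  have hN : ((W ⊓ W' : Opens Y) : Set Y) ⊆ b.1.source := fun y hy => (hu.le hy.1).2
  have hus : SmoothOn n u (W ⊓ W' : Opens Y) := hu.smooth.mono inter_subset_left
  have hus' : SmoothOn n u' (W ⊓ W' : Opens Y) := hu'.smooth.mono inter_subset_right
  have h1 := eq_zero_of_cint b hN (H := fun y => u y + (-1) * u' y)
    (hus.add (SmoothOn.mul n (smoothOn_const (-1) _) hus')) fun f hf => by
    have e : (fun y => f y * (u y + (-1) * u' y)) = fun y => f y * u y + (-1) * (f y * u' y) := by
      funext y
      ring
    rw [e, cint_add b ((hf.mul_right hus).mono hN) (((hf.mul_right hus').const_mul (-1)).mono hN), cint_const_mul,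
      hu.pair f (hf.mono inter_subset_left), hu'.pair f (hf.mono inter_subset_right)]
    ring
  intro y hy
  linear_combination h1 y hy

/-- The chart only affects test functions, so a solution changes by the transition function of |L|²
alone. This is why local solutions form a section of |L|². -/
theorem change (hVU : V ≤ U) (hu : IsLocSol hs ξ h i b W u) (i' : L.ι) (b' : Chart n Y) :
    IsLocSol hs ξ h i' b' (W ⊓ trivDom V i' b') fun y => (‖L.g i' i y‖ ^ 2 : ℝ) * u y where
  le := inf_le_right
  smooth := by
    have hg : SmoothOn n (fun y => conjFun (L.g i' i) y * L.g i' i y) (W ⊓ trivDom V i' b' : Opens Y) := by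
      have h1 : HolOn n (L.g i' i) (W ⊓ trivDom V i' b' : Opens Y) :=
        (L.hol i' i).mono fun y hy => ⟨hy.2.1.2, (hu.le hy.1).1.2⟩
      exact SmoothOn.mul n (h1.smoothOn n).conj (h1.smoothOn n)
    refine (SmoothOn.mul n hg (hu.smooth.mono inter_subset_left)).congr fun y _ => ?_
    rw [← Complex.normSq_eq_norm_sq, ← Complex.mul_conj, conjFun, mul_comm (L.g i' i y)]
  pair f hf := by
    have hW : ∀ y ∈ W ⊓ trivDom V i' b', y ∈ b.1.source ∧ y ∈ b'.1.source ∧ y ∈ L.dom i ∧ y ∈ L.dom i' :=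
      fun y hy => ⟨(hu.le hy.1).2, hy.2.2, (hu.le hy.1).1.2, hy.2.1.2⟩
    have hf' : IsTest n f (trivDom V i' b' ⊓ trivDom V i b : Opens Y) :=
      hf.mono fun y hy => ⟨hy.2, hu.le hy.1⟩
    rw [pairing_change hs hVU ξ h hf']
    set ρ := baseFactor L i' i b' b with hρ
    have hρs : SmoothOn n ρ (W ⊓ trivDom V i' b' : Opens Y) := fun y hy =>
      ((smoothOn_smoothLocus ρ y (baseFactor_mem_smoothLocus (hW y hy).2.2.2 (hW y hy).2.2.1 (hW y hy).2.1
        (hW y hy).1)).contMDiffAt ((smoothLocus n ρ).2.mem_nhds (baseFactor_mem_smoothLocus (hW y hy).2.2.2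
          (hW y hy).2.2.1 (hW y hy).2.1 (hW y hy).1))).contMDiffWithinAt
    have hF : IsTest n (fun y => conjFun ρ y * (ρ y * f y)) (W ⊓ trivDom V i' b' : Opens Y) :=
      IsTest.mul_left hρs.conj (IsTest.mul_left hρs hf)
    rw [← hu.pair _ (hF.mono inter_subset_left), cint_change b b' fun y hy => by
      rw [hF.apply_zero fun h' => hy ⟨(hW y h').1, (hW y h').2.1⟩, zero_mul]]
    refine cint_congr b' fun y _ => ?_
    by_cases hy : y ∈ W ⊓ trivDom V i' b'
    · have hj := jac_ne_zero b' b (hW y hy).2.1 (hW y hy).1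
      have h1 : L.g i' i y = HolLineBundle.jac b' b y * ρ y := by
        rw [hρ, baseFactor, ← mul_assoc, mul_inv_cancel₀ hj, one_mul]
      rw [h1, norm_mul, mul_pow, conjFun, Complex.ofReal_mul, ← Complex.normSq_eq_norm_sq (ρ y), ← Complex.mul_conj]
      ring
    · rw [hf.apply_zero hy]
      simp

end IsLocSol

end Pairing

/-! ### Existence and gluing of solutions -/

section Solutions

variable {n k : ℕ} {Y Z : Type*} [TopologicalSpace Y] [T2Space Y] [SecondCountableTopology Y]
  [ChartedSpace (Cn n) Y] [TopologicalSpace Z] [T2Space Z] [SecondCountableTopology Z]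
  [ChartedSpace (Cn (n + k)) Z]
  [IsManifold 𝓘(ℂ, Cn (n + k)) ω Z] [IsManifold 𝓘(ℂ, Cn n) ω Y] {p : C(Z, Y)}
  (hs : Manifold.IsSubmersion 𝓘(ℂ, Cn (n + k)) 𝓘(ℂ, Cn n) ω p)
  {L : HolLineBundle n Y} {U V : Opens Y} {i : L.ι} {b : Chart n Y} {f : Y → ℂ}

theorem absSheaf_res_apply {d : ℕ} {X : Type*} [TopologicalSpace X] [ChartedSpace (Cn d) X]
    {A : HolLineBundle d X} {U V : Opens X} (h : V ≤ U) (s : A.absSec U) (i : A.ι) {x : X} (hx : x ∈ V) :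
    (A.absSheaf.res h s).1 i x = s.1 i x :=
  Set.indicator_of_mem (s := (V : Set X)) hx _

theorem absSec_ext {d : ℕ} {X : Type*} [TopologicalSpace X] [ChartedSpace (Cn d) X]
    {A : HolLineBundle d X} {U : Opens X} {s t : A.absSec U}
    (h : ∀ i, ∀ x ∈ U, x ∈ A.dom i → s.1 i x = t.1 i x) : s = t := by
  refine Subtype.ext (funext fun i => funext fun x => ?_)
  by_cases hx : x ∈ U ⊓ A.dom i
  · exact h i x hx.1 hx.2
  · rw [(s.2.1 i).2 x hx, (t.2.1 i).2 x hx]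

theorem absSec_sum_apply {d : ℕ} {X : Type*} [TopologicalSpace X] [ChartedSpace (Cn d) X]
    {A : HolLineBundle d X} {U : Opens X} {ι : Type*} (S : Finset ι) (s : ι → A.absSec U) (i : A.ι) (x : X) :
    (∑ l ∈ S, s l).1 i x = ∑ l ∈ S, (s l).1 i x := by
  rw [Submodule.coe_sum, Finset.sum_apply, Finset.sum_apply]

/-- The section `D h`, for the density `D` associated with a test function. -/
def densSec (ξ : (transferSheaf p hs.contMDiff L).sec U) (hf : IsTest n f (trivDom U i b))
    (h : (twistM p hs.contMDiff L).absSec (Opens.comap p V)) : (twistM p hs.contMDiff L).absSec (Opens.comap p V) :=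
  mulSec (densFun hs ξ i b f) (densFun_smooth hs ξ hf _) h

theorem pairing_eq (hpr : IsProperMap p) (ξ : (transferSheaf p hs.contMDiff L).sec U) (hf : IsTest n f (trivDom U i b))
    (h : (twistM p hs.contMDiff L).absSec (Opens.comap p V)) :
    pairing hs ξ h i b f = cint b ((pushSec hs hpr (densSec hs ξ hf h)).1 i) := rfl

theorem densSec_isTest (hpr : IsProperMap p) (ξ : (transferSheaf p hs.contMDiff L).sec U) (hf : IsTest n f (trivDom U i b))
    (h : (twistM p hs.contMDiff L).absSec (Opens.comap p V)) {W : Opens Y} (hfW : IsTest n f W)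
    (hW : W ≤ trivDom V i b) : IsTest n ((pushSec hs hpr (densSec hs ξ hf h)).1 i) W := by
  refine pushSec_isTest hs hpr _ (hW.trans inf_le_left) hf.cpt hfW.sub fun τ z hz => ?_
  change densFun hs ξ i b f z * _ = 0
  rw [densFun_eq_zero hs ξ (IsTest.eventually_zero hz), zero_mul]

/-- Inserting ξ f = ∑ c_s · (∂^s f ∘ p) into the pairing and taking ∂^s f out of the fiber integral
leaves ∑ ∫ ∂^s f · p_!(c_s h); transposition moves the derivatives onto p_!(c_s h). The
neighbourhood W comes from the expansion and from the operators Q_s only, so it serves all V and h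
at once. -/
theorem exists_isLocSol (hpr : IsProperMap p) (ξ : (transferSheaf p hs.contMDiff L).sec U) {y : Y} (hy : y ∈ trivDom U i b) :
    ∃ W : Opens Y, y ∈ W ∧ W ≤ trivDom U i b ∧ ∀ (V : Opens Y), V ≤ U →
      ∀ h : (twistM p hs.contMDiff L).absSec (Opens.comap p V), ∃ u, IsLocSol hs ξ h i b (W ⊓ V) u := by
  obtain ⟨B, S, hyB, hBU, hBb, hc, hexp⟩ := exists_expansion hs hpr ξ hy.1.1 hy.1.2 hy.2
  have h1 : ∀ s : Fin n →₀ ℕ, ∃ (Q : LocOp n B) (N : Opens Y), y ∈ N ∧ N ≤ B ∧ ∀ N' ≤ N, ∀ f g : Y → ℂ,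
      SmoothOn n f N' → IsTest n g N' → cint b (fun y => g y * Q.ev f y) =
        cint b (fun y => (iterOp b B hBb (Finsupp.toMultiset s).toList).ev g y * f y) := by
    intro s
    obtain ⟨Q, hQ⟩ := iterD_isTranspose b hBb (Finsupp.toMultiset s).toList
    obtain ⟨N, hyN, hNB, -, hN⟩ := hQ.pairing y hyB (hBb hyB)
    refine ⟨Q, N, hyN, hNB, fun N' hN' f g hf hg => ?_⟩
    have h2 := hN N' hN' f g hf (hg.smooth.mono (subset_univ _)) (Or.inr hg)
    simp only [mul_comm] at h2 ⊢
    exact h2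
  choose Q N hyN hNB hN using h1
  have hWB : B ⊓ S.inf N ≤ B := inf_le_left
  have hWt : B ⊓ S.inf N ≤ trivDom U i b := fun x hx => ⟨hBU hx.1, hBb hx.1⟩
  refine ⟨B ⊓ S.inf N, ⟨hyB, ?_⟩, hWt, fun V hVU h => ?_⟩
  · rw [Opens.coe_finset_inf]
    simpa using fun s _ => hyN s
  set W : Opens Y := (B ⊓ S.inf N) ⊓ V with hW
  have hWV : W ≤ trivDom V i b := fun x hx => ⟨⟨hx.2, (hWt hx.1).1.2⟩, (hWt hx.1).2⟩
  have hcs : ∀ s, SmoothOn (n + k) (symCoeff hs ξ i b s) (Opens.comap p W) := fun s =>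
    ((hc s).smoothOn _).mono fun z hz => hz.1.1
  have hle : Opens.comap p W ≤ Opens.comap p V := fun z hz => hz.2
  set hr : (twistM p hs.contMDiff L).absSec (Opens.comap p W) := (twistM p hs.contMDiff L).absSheaf.res hle h
  set v : (Fin n →₀ ℕ) → L.absSec W := fun s => pushSec hs hpr (mulSec (symCoeff hs ξ i b s) (hcs s) hr) with hv
  have hvs : ∀ s, SmoothOn n ((v s).1 i) W := fun s => ((v s).2.1 i).1.mono fun x hx => ⟨hx, (hWV hx).1.2⟩
  have hQs : ∀ s, SmoothOn n ((Q s).ev ((v s).1 i)) W := fun s =>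
    (Q s).smoothOn_ev (inf_le_left.trans hWB) (hvs s)
  have hWb : (W : Set Y) ⊆ b.1.source := fun x hx => (hWV hx).2
  -- The solution is ∑ Q_s p_!(c_s h), where Q_s is an operator with transpose ∂^s.
  refine ⟨fun y => ∑ s ∈ S, (Q s).ev ((v s).1 i) y, hWV, SmoothOn.sum fun s _ => hQs s, fun f hf => ?_⟩
  have hft : IsTest n f (trivDom U i b) := hf.mono fun x hx => hWt hx.1
  have e1 : (fun y => f y * ∑ s ∈ S, (Q s).ev ((v s).1 i) y) = fun y => ∑ s ∈ S, f y * (Q s).ev ((v s).1 i) y :=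
    funext fun y => Finset.mul_sum ..
  rw [e1, cint_sum b S fun s _ => (hf.mul_right (hQs s)).mono hWb]
  have hWN : ∀ s ∈ S, W ≤ N s := fun s hsS => inf_le_left.trans (inf_le_right.trans (Finset.inf_le hsS))
  rw [Finset.sum_congr rfl fun s hsS => hN s W (hWN s hsS) _ f (hvs s) hf,
    ← cint_sum b S fun s _ => ((hf.ev _ (inf_le_left.trans hWB)).mul_right (hvs s)).mono hWb]
  refine cint_congr b fun y _ => ?_
  by_cases hy : y ∈ W
  · have e2 : pushFun L hs V (fun τ z => densFun hs ξ i b f z * h.1 τ z) i y =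
        (pushSec hs hpr (∑ s ∈ S, iterD b (Finsupp.toMultiset s).toList f y •
          mulSec (symCoeff hs ξ i b s) (hcs s) hr)).1 i y := by
      refine pushSec_congr hs hpr (densSec hs ξ hft h) _ hy.2 hy (hWV hy).1.2 fun t z hzy hzt => ?_
      have e3 : (∑ s ∈ S, iterD b (Finsupp.toMultiset s).toList f y •
          mulSec (symCoeff hs ξ i b s) (hcs s) hr).1 (i, (t.a, t.b)) z = ∑ s ∈ S,
            iterD b (Finsupp.toMultiset s).toList f y * (symCoeff hs ξ i b s z * hr.1 (i, (t.a, t.b)) z) :=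
        absSec_sum_apply S _ _ z
      rw [e3]
      have hzW : z ∈ Opens.comap p W := by
        change p z ∈ W
        rwa [hzy]
      have e4 : hr.1 (i, (t.a, t.b)) z = h.1 (i, (t.a, t.b)) z := absSheaf_res_apply hle h _ hzW
      change densFun hs ξ i b f z * h.1 (i, (t.a, t.b)) z = _
      rw [e4, densFun_of_mem hs ξ (hWt (show p z ∈ W from hzW).1), hexp z (hWB (show p z ∈ W from hzW).1) f
        (hf.mem_smoothLocus _), Finset.sum_mul, hzy]
      exact Finset.sum_congr rfl fun s _ => by ring
    rw [e2, map_sum, absSec_sum_apply]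
    refine Finset.sum_congr rfl fun s _ => ?_
    rw [map_smul, iterOp_ev b hBb _ (hWB hy.1) (hf.mem_smoothLocus y)]
    rfl
  · rw [pushFun_eq_zero hs fun τ z hz => by
      rw [densFun_eq_zero hs ξ (hz ▸ IsTest.eventually_zero fun h' => hy (hf.sub h')), zero_mul]]
    exact Finset.sum_eq_zero fun s _ => by rw [hf.ev_zero _ hy, zero_mul]

/-- Local solutions agree on overlaps by uniqueness, for different charts as well, and they exist
near every point. So their values assemble to one section. -/
theorem exists_sol (hpr : IsProperMap p) (hVU : V ≤ U) (ξ : (transferSheaf p hs.contMDiff L).sec U)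
    (h : (twistM p hs.contMDiff L).absSec (Opens.comap p V)) : ∃ u : L.absSec V, ∀ i b W u₀, IsLocSol hs ξ h i b W u₀ → ∀ y ∈ W, u.1 i y = u₀ y := by
  classical
  have hself : ∀ {i : L.ι} {y : Y} (c : ℂ), y ∈ L.dom i → (‖L.g i i y‖ ^ 2 : ℝ) * c = c := fun c hi => by
    rw [L.g_self hi]
    simp
  have key : ∀ (i : L.ι) (y : Y), ∃ c : ℂ, (∀ b W u₀, IsLocSol hs ξ h i b W u₀ → y ∈ W → u₀ y = c) ∧
      (y ∉ V ⊓ L.dom i → c = 0) := by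
    intro i y
    by_cases H : ∃ b W u₀, IsLocSol hs ξ h i b W u₀ ∧ y ∈ W
    · obtain ⟨b, W, u₀, hu, hy⟩ := H
      refine ⟨u₀ y, fun b' W' u₀' hu' hy' => ?_, fun hyV => absurd (hu.le hy).1 hyV⟩
      -- A solution for the chart b becomes one for b' with the same i; the factor |g_ii|² is 1.
      rw [← (hu.change hVU i b').eqOn hu' y ⟨⟨hy, hu'.le hy'⟩, hy'⟩, hself _ (hu.le hy).1.2]
    · exact ⟨0, fun b W u₀ hu hy => absurd ⟨b, W, u₀, hu, hy⟩ H, fun _ => rfl⟩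
  choose u hu hu0 using key
  have hloc : ∀ i, ∀ y ∈ V ⊓ L.dom i, ∃ b W u₀, IsLocSol hs ξ h i b W u₀ ∧ y ∈ W := fun i y hy => by
    obtain ⟨b, hb⟩ := (HolLineBundle.canonical n Y).cover y
    obtain ⟨W, hyW, -, hW⟩ := exists_isLocSol hs hpr ξ (i := i) (b := b) (y := y) ⟨⟨hVU hy.1, hy.2⟩, hb⟩
    obtain ⟨u₀, hu₀⟩ := hW V hVU h
    exact ⟨b, _, u₀, hu₀, hyW, hy.1⟩
  refine ⟨⟨u, fun i => ⟨fun y hy => ?_, hu0 i⟩, fun i j y hy hi hj => ?_⟩,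
    fun i b W u₀ hu₀ y hy => (hu i y b W u₀ hu₀ hy).symm⟩
  · obtain ⟨b, W, u₀, hu₀, hyW⟩ := hloc i y hy
    exact ((hu₀.smooth.congr fun x hx => (hu i x b W u₀ hu₀ hx).symm).contMDiffAt
      (W.2.mem_nhds hyW)).contMDiffWithinAt
  · obtain ⟨b, W, u₀, hu₀, hyW⟩ := hloc j y ⟨hy, hj⟩
    rw [← hu j y b W u₀ hu₀ hyW, ← hu i y b _ _ (hu₀.change hVU i b) ⟨hyW, ⟨hy, hi⟩, (hu₀.le hyW).2⟩]

variable (hpr : IsProperMap p) (hVU : V ≤ U) (ξ : (transferSheaf p hs.contMDiff L).sec U)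
  (h : (twistM p hs.contMDiff L).absSec (Opens.comap p V))

/-- The section `Φ(ξ)(h)`. -/
def sol : L.absSec V := (exists_sol hs hpr hVU ξ h).choose

theorem sol_isLocSol {W : Opens Y} {u₀ : Y → ℂ} (hu : IsLocSol hs ξ h i b W u₀) :
    IsLocSol hs ξ h i b W ((sol hs hpr hVU ξ h).1 i) :=
  hu.congr fun y hy => ((exists_sol hs hpr hVU ξ h).choose_spec i b W u₀ hu y hy).symm

/-- Identities for Φ reduce to identities between pairings: a section with the right integrals near
every point is the solution. -/
theorem eq_sol {u : L.absSec V} (hu : ∀ i, ∀ y ∈ V, y ∈ L.dom i → ∀ b : Chart n Y, y ∈ b.1.source →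
    ∃ W, y ∈ W ∧ IsLocSol hs ξ h i b W (u.1 i)) : u = sol hs hpr hVU ξ h := by
  refine absSec_ext fun i y hy hi => ?_
  obtain ⟨b, hb⟩ := (HolLineBundle.canonical n Y).cover y
  obtain ⟨W, hyW, hW⟩ := hu i y hy hi b hb
  exact ((exists_sol hs hpr hVU ξ h).choose_spec i b W _ hW y hyW).symm

theorem exists_sol_isLocSol {y : Y} (hy : y ∈ trivDom U i b) :
    ∃ W : Opens Y, y ∈ W ∧ W ≤ trivDom U i b ∧ ∀ (V : Opens Y) (hVU : V ≤ U)
      (h : (twistM p hs.contMDiff L).absSec (Opens.comap p V)),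
        IsLocSol hs ξ h i b (W ⊓ V) ((sol hs hpr hVU ξ h).1 i) := by
  obtain ⟨W, hyW, hWt, hW⟩ := exists_isLocSol hs hpr ξ hy
  refine ⟨W, hyW, hWt, fun V hVU h => ?_⟩
  obtain ⟨u₀, hu₀⟩ := hW V hVU h
  exact sol_isLocSol hs hpr hVU ξ h hu₀

end Solutions

/-! ### Algebraic rules for the pairing -/

section PairingRules

variable {n k : ℕ} {Y Z : Type*} [TopologicalSpace Y] [T2Space Y] [SecondCountableTopology Y]
  [ChartedSpace (Cn n) Y] [TopologicalSpace Z] [T2Space Z] [SecondCountableTopology Z]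
  [ChartedSpace (Cn (n + k)) Z]
  [IsManifold 𝓘(ℂ, Cn (n + k)) ω Z] [IsManifold 𝓘(ℂ, Cn n) ω Y] {p : C(Z, Y)}
  {hs : Manifold.IsSubmersion 𝓘(ℂ, Cn (n + k)) 𝓘(ℂ, Cn n) ω p}
  {L : HolLineBundle n Y} {U U' V V' W : Opens Y} {i : L.ι} {b : Chart n Y} {f f' : Y → ℂ}

theorem pairing_eq_mul (ξ : (transferSheaf p hs.contMDiff L).sec U) (ξ' : (transferSheaf p hs.contMDiff L).sec U')
    (h : (twistM p hs.contMDiff L).absSec (Opens.comap p V)) (h' : (twistM p hs.contMDiff L).absSec (Opens.comap p V'))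
    (hW : W ≤ trivDom V i b) (hW' : W ≤ trivDom V' i b) (hf : IsTest n f W) (hf' : IsTest n f' W) (c : ℂ)
    (hh : ∀ (t : AdaptedChart (n := n) (k := k) p) (z : Z), p z ∈ W → z ∈ t.a.1.source →
      densFun hs ξ i b f z * h.1 (i, (t.a, t.b)) z = c * (densFun hs ξ' i b f' z * h'.1 (i, (t.a, t.b)) z)) :
    pairing hs ξ h i b f = c * pairing hs ξ' h' i b f' := by
  rw [pairing, pairing, ← cint_const_mul]
  refine cint_congr b fun y _ => ?_
  by_cases hy : y ∈ W
  · rw [pushFun_of_mem hs (hW hy).1, pushFun_of_mem hs (hW' hy).1]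
    exact fiberIntegral_eq_mul c fun t z hz hzt => hh t z (hz ▸ hy) hzt
  · rw [pushFun_eq_zero hs fun τ z hz => by
        rw [densFun_eq_zero hs ξ (hz ▸ IsTest.eventually_zero fun h' => hy (hf.sub h')), zero_mul],
      pushFun_eq_zero hs fun τ z hz => by
        rw [densFun_eq_zero hs ξ' (hz ▸ IsTest.eventually_zero fun h' => hy (hf'.sub h')), zero_mul], mul_zero]

theorem pairing_congr (ξ : (transferSheaf p hs.contMDiff L).sec U) (ξ' : (transferSheaf p hs.contMDiff L).sec U')
    (h : (twistM p hs.contMDiff L).absSec (Opens.comap p V)) (h' : (twistM p hs.contMDiff L).absSec (Opens.comap p V'))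
    (hW : W ≤ trivDom V i b) (hW' : W ≤ trivDom V' i b) (hf : IsTest n f W) (hf' : IsTest n f' W)
    (hh : ∀ (t : AdaptedChart (n := n) (k := k) p) (z : Z), p z ∈ W → z ∈ t.a.1.source →
      densFun hs ξ i b f z * h.1 (i, (t.a, t.b)) z = densFun hs ξ' i b f' z * h'.1 (i, (t.a, t.b)) z) :
    pairing hs ξ h i b f = pairing hs ξ' h' i b f' := by
  rw [pairing_eq_mul ξ ξ' h h' hW hW' hf hf' 1 fun t z hz hzt => (hh t z hz hzt).trans (one_mul _).symm, one_mul]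

theorem pairing_eq_add (hpr : IsProperMap p) (hVU : V ≤ U) {ξ ξ' ξ'' : (transferSheaf p hs.contMDiff L).sec U}
    {h h' h'' : (twistM p hs.contMDiff L).absSec (Opens.comap p V)} (hf : IsTest n f (trivDom V i b))
    (hh : ∀ τ z, densFun hs ξ i b f z * h.1 τ z =
      densFun hs ξ' i b f z * h'.1 τ z + densFun hs ξ'' i b f z * h''.1 τ z) :
    pairing hs ξ h i b f = pairing hs ξ' h' i b f + pairing hs ξ'' h'' i b f := by
  have hfU : IsTest n f (trivDom U i b) := hf.mono (trivDom_mono hVU i b)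
  have e : densSec hs ξ hfU h = densSec hs ξ' hfU h' + densSec hs ξ'' hfU h'' :=
    Subtype.ext (funext fun τ => funext fun z => hh τ z)
  have hb : (trivDom V i b : Set Y) ⊆ b.1.source := fun y hy => hy.2
  rw [pairing_eq hs hpr ξ hfU h, pairing_eq hs hpr ξ' hfU h', pairing_eq hs hpr ξ'' hfU h'', e, map_add]
  exact cint_add b ((densSec_isTest hs hpr ξ' hfU h' hf le_rfl).mono hb)
    ((densSec_isTest hs hpr ξ'' hfU h'' hf le_rfl).mono hb)

theorem pairing_sum (hpr : IsProperMap p) (hVU : V ≤ U) (ξ : (transferSheaf p hs.contMDiff L).sec U) {ι : Type*}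
    (S : Finset ι) (h : ι → (twistM p hs.contMDiff L).absSec (Opens.comap p V)) (hf : IsTest n f (trivDom V i b)) :
    pairing hs ξ (∑ l ∈ S, h l) i b f = ∑ l ∈ S, pairing hs ξ (h l) i b f := by
  classical
  induction S using Finset.induction_on with
  | empty =>
    rw [Finset.sum_empty, Finset.sum_empty, pairing_eq_mul ξ ξ 0 0 le_rfl le_rfl hf hf 0 fun t z _ _ =>
      (mul_zero _).trans (zero_mul _).symm, zero_mul]
  | insert l S hl ih =>
    rw [Finset.sum_insert hl, Finset.sum_insert hl, ← ih]
    exact pairing_eq_add hpr hVU hf fun τ z => mul_add _ _ _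

theorem densFun_add (ξ ξ' : (transferSheaf p hs.contMDiff L).sec U) (hf : IsTest n f (trivDom U i b)) (z : Z) :
    densFun hs (ξ + ξ') i b f z = densFun hs ξ i b f z + densFun hs ξ' i b f z := by
  by_cases hz : p z ∈ trivDom U i b
  · rw [densFun_of_mem hs _ hz, densFun_of_mem hs _ hz, densFun_of_mem hs _ hz]
    exact hat_add hs ξ ξ' (τ := (i, (someChart n k Z z, b))) hz.1.1 ⟨hz.1.2, mem_someChart z, hz.2⟩ (hf.mem_smoothLocus _)
  · have h0 : ∀ᶠ y in 𝓝 (p z), f y = 0 := IsTest.eventually_zero fun h => hz (hf.sub h)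
    rw [densFun_eq_zero hs _ h0, densFun_eq_zero hs _ h0, densFun_eq_zero hs _ h0, add_zero]

theorem densFun_smul (c : ℂ) (ξ : (transferSheaf p hs.contMDiff L).sec U) (hf : IsTest n f (trivDom U i b)) (z : Z) :
    densFun hs (c • ξ) i b f z = c * densFun hs ξ i b f z := by
  by_cases hz : p z ∈ trivDom U i b
  · rw [densFun_of_mem hs _ hz, densFun_of_mem hs _ hz]
    exact hat_smul hs c ξ (τ := (i, (someChart n k Z z, b))) hz.1.1 ⟨hz.1.2, mem_someChart z, hz.2⟩ (hf.mem_smoothLocus _)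
  · have h0 : ∀ᶠ y in 𝓝 (p z), f y = 0 := IsTest.eventually_zero fun h => hz (hf.sub h)
    rw [densFun_eq_zero hs _ h0, densFun_eq_zero hs _ h0, mul_zero]

namespace IsLocSol

variable {ξ : (transferSheaf p hs.contMDiff L).sec U} {ξ' : (transferSheaf p hs.contMDiff L).sec U'}
  {ξ'' : (transferSheaf p hs.contMDiff L).sec U}
  {h : (twistM p hs.contMDiff L).absSec (Opens.comap p V)} {h' : (twistM p hs.contMDiff L).absSec (Opens.comap p V')}
  {h'' : (twistM p hs.contMDiff L).absSec (Opens.comap p V)} {u u' : Y → ℂ}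

theorem of_pairing (hu : IsLocSol hs ξ h i b W u) (hW : W ≤ trivDom V' i b)
    (hp : ∀ f, IsTest n f W → pairing hs ξ h i b f = pairing hs ξ' h' i b f) : IsLocSol hs ξ' h' i b W u :=
  ⟨hW, hu.smooth, fun f hf => (hu.pair f hf).trans (hp f hf)⟩

theorem add {h' : (twistM p hs.contMDiff L).absSec (Opens.comap p V)} {ξ' : (transferSheaf p hs.contMDiff L).sec U}
    (hu : IsLocSol hs ξ h i b W u) (hu' : IsLocSol hs ξ' h' i b W u')
    (hp : ∀ f, IsTest n f W → pairing hs ξ'' h'' i b f = pairing hs ξ h i b f + pairing hs ξ' h' i b f) :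
    IsLocSol hs ξ'' h'' i b W fun y => u y + u' y where
  le := hu.le
  smooth := hu.smooth.add hu'.smooth
  pair f hf := by
    have hb : (W : Set Y) ⊆ b.1.source := fun y hy => (hu.le hy).2
    rw [hp f hf, ← hu.pair f hf, ← hu'.pair f hf, ← cint_add b ((hf.mul_right hu.smooth).mono hb)
      ((hf.mul_right hu'.smooth).mono hb)]
    simp only [mul_add]

theorem const_mul (hu : IsLocSol hs ξ h i b W u) (c : ℂ)
    (hp : ∀ f, IsTest n f W → pairing hs ξ'' h'' i b f = c * pairing hs ξ h i b f) :
    IsLocSol hs ξ'' h'' i b W fun y => c * u y where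
  le := hu.le
  smooth := SmoothOn.mul n (smoothOn_const c _) hu.smooth
  pair f hf := by
    rw [hp f hf, ← hu.pair f hf, ← cint_const_mul]
    refine cint_congr b fun y _ => ?_
    ring

end IsLocSol

end PairingRules

/-! ### The homomorphism, its value on 1, and the left action -/

section Homomorphism

variable {n k : ℕ} {Y Z : Type*} [TopologicalSpace Y] [T2Space Y] [SecondCountableTopology Y]
  [ChartedSpace (Cn n) Y] [TopologicalSpace Z] [T2Space Z] [SecondCountableTopology Z]
  [ChartedSpace (Cn (n + k)) Z]
  [IsManifold 𝓘(ℂ, Cn (n + k)) ω Z] [IsManifold 𝓘(ℂ, Cn n) ω Y] {p : C(Z, Y)}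
  (hs : Manifold.IsSubmersion 𝓘(ℂ, Cn (n + k)) 𝓘(ℂ, Cn n) ω p) (hpr : IsProperMap p)
  {L : HolLineBundle n Y} {U V : Opens Y} (hVU : V ≤ U)

/-- The neighbourhood is chosen before h, so one W can be used for two sections and for their sum.
-/
theorem exists_sol_near (ξ : (transferSheaf p hs.contMDiff L).sec U) {i : L.ι} {b : Chart n Y} {y : Y}
    (hy : y ∈ V) (hi : y ∈ L.dom i) (hb : y ∈ b.1.source) :
    ∃ W : Opens Y, y ∈ W ∧ ∀ h : (twistM p hs.contMDiff L).absSec (Opens.comap p V),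
      IsLocSol hs ξ h i b W ((sol hs hpr hVU ξ h).1 i) := by
  obtain ⟨W, hyW, -, hW⟩ := exists_sol_isLocSol hs hpr ξ (i := i) (b := b) (y := y) ⟨⟨hVU hy, hi⟩, hb⟩
  exact ⟨W ⊓ V, ⟨hyW, hy⟩, fun h => hW V hVU h⟩

theorem sol_add_right (ξ : (transferSheaf p hs.contMDiff L).sec U)
    (h h' : (twistM p hs.contMDiff L).absSec (Opens.comap p V)) :
    sol hs hpr hVU ξ (h + h') = sol hs hpr hVU ξ h + sol hs hpr hVU ξ h' := by
  refine (eq_sol hs hpr hVU ξ _ fun i y hy hi b hb => ?_).symm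
  obtain ⟨W, hyW, hW⟩ := exists_sol_near hs hpr hVU ξ hy hi hb
  exact ⟨W, hyW, (hW h).add (hW h') fun f hf =>
    pairing_eq_add hpr hVU (hf.mono (hW h).le) fun τ z => mul_add _ _ _⟩

theorem sol_smul_right (ξ : (transferSheaf p hs.contMDiff L).sec U) (c : ℂ)
    (h : (twistM p hs.contMDiff L).absSec (Opens.comap p V)) :
    sol hs hpr hVU ξ (c • h) = c • sol hs hpr hVU ξ h := by
  refine (eq_sol hs hpr hVU ξ _ fun i y hy hi b hb => ?_).symm
  obtain ⟨W, hyW, hW⟩ := exists_sol_near hs hpr hVU ξ hy hi hb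
  exact ⟨W, hyW, (hW h).const_mul c fun f hf =>
    pairing_eq_mul ξ ξ _ _ (hW h).le (hW h).le hf hf c fun t z _ _ => mul_left_comm _ _ _⟩

theorem sol_add_left (ξ ξ' : (transferSheaf p hs.contMDiff L).sec U)
    (h : (twistM p hs.contMDiff L).absSec (Opens.comap p V)) :
    sol hs hpr hVU (ξ + ξ') h = sol hs hpr hVU ξ h + sol hs hpr hVU ξ' h := by
  refine (eq_sol hs hpr hVU _ h fun i y hy hi b hb => ?_).symm
  obtain ⟨W, hyW, hW⟩ := exists_sol_near hs hpr hVU ξ hy hi hb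
  obtain ⟨W', hyW', hW'⟩ := exists_sol_near hs hpr hVU ξ' hy hi hb
  refine ⟨W ⊓ W', ⟨hyW, hyW'⟩, ((hW h).mono inf_le_left).add ((hW' h).mono inf_le_right) fun f hf => ?_⟩
  have hf' : IsTest n f (trivDom V i b) := hf.mono (inf_le_left.trans (hW h).le)
  exact pairing_eq_add hpr hVU hf' fun τ z => by
    rw [densFun_add ξ ξ' (hf'.mono (trivDom_mono hVU i b)), add_mul]

theorem sol_smul_left (c : ℂ) (ξ : (transferSheaf p hs.contMDiff L).sec U)
    (h : (twistM p hs.contMDiff L).absSec (Opens.comap p V)) :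
    sol hs hpr hVU (c • ξ) h = c • sol hs hpr hVU ξ h := by
  refine (eq_sol hs hpr hVU _ h fun i y hy hi b hb => ?_).symm
  obtain ⟨W, hyW, hW⟩ := exists_sol_near hs hpr hVU ξ hy hi hb
  refine ⟨W, hyW, (hW h).const_mul c fun f hf => ?_⟩
  exact pairing_eq_mul _ ξ _ _ (hW h).le (hW h).le hf hf c fun t z _ _ => by
    rw [densFun_smul c ξ (hf.mono ((hW h).le.trans (trivDom_mono hVU i b))), mul_assoc]

theorem sol_res_right {V' : Opens Y} (h' : V' ≤ V) (ξ : (transferSheaf p hs.contMDiff L).sec U)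
    (h : (twistM p hs.contMDiff L).absSec (Opens.comap p V)) :
    L.absSheaf.res h' (sol hs hpr hVU ξ h) =
      sol hs hpr (h'.trans hVU) ξ ((twistM p hs.contMDiff L).absSheaf.res (Opens.comap_mono p h') h) := by
  refine eq_sol hs hpr _ ξ _ fun i y hy hi b hb => ?_
  obtain ⟨W, hyW, hW⟩ := exists_sol_near hs hpr hVU ξ (h' hy) hi hb
  have hle : W ⊓ V' ≤ trivDom V' i b := fun x hx => ⟨⟨hx.2, ((hW h).le hx.1).1.2⟩, ((hW h).le hx.1).2⟩
  refine ⟨W ⊓ V', ⟨hyW, hy⟩, ((((hW h).mono inf_le_left).congr fun x hx => ?_).of_pairing hle fun f hf => ?_)⟩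
  · exact (absSheaf_res_apply h' _ i hx.2).symm
  · refine pairing_congr ξ ξ h _ (inf_le_left.trans (hW h).le) hle hf hf fun t z hz hzt => ?_
    exact congrArg (_ * ·) (absSheaf_res_apply (Opens.comap_mono p h') h _ (show z ∈ Opens.comap p V' from hz.2)).symm

theorem sol_res_left {U' : Opens Y} (h' : U' ≤ U) (hV : V ≤ U') (ξ : (transferSheaf p hs.contMDiff L).sec U)
    (h : (twistM p hs.contMDiff L).absSec (Opens.comap p V)) :
    sol hs hpr (hV.trans h') ξ h = sol hs hpr hV ((transferSheaf p hs.contMDiff L).res h' ξ) h := by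
  refine eq_sol hs hpr _ _ _ fun i y hy hi b hb => ?_
  obtain ⟨W, hyW, hW⟩ := exists_sol_near hs hpr (hV.trans h') ξ hy hi hb
  refine ⟨W, hyW, (hW h).of_pairing (hW h).le fun f hf => ?_⟩
  refine pairing_congr _ _ h h (hW h).le (hW h).le hf hf fun t z hz hzt => congrArg (· * _) ?_
  have h1 := trivDom_mono hV i b ((hW h).le hz)
  rw [densFun_eq_hat hs ξ (trivDom_mono h' i b h1) hzt (hf.mem_smoothLocus _),
    densFun_eq_hat hs _ h1 hzt (hf.mem_smoothLocus _)]
  exact (hat_res hs h' ξ (τ := (i, (t.a, b))) h1.1.1 ⟨h1.1.2, hzt, h1.2⟩ (hf.mem_smoothLocus _)).symm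

/-- The homomorphism `Φ(ξ)` between sheaves of smooth sections. -/
def actSec (ξ : (transferSheaf p hs.contMDiff L).sec U) : (homSheaf p hs.contMDiff L).sec U :=
  HomOn.mk' (F := pushforward p (twistM p hs.contMDiff L).absSheaf) (G := L.absSheaf)
    (fun _ hV =>
      { toFun := fun h => sol hs hpr hV ξ h
        map_add' := fun h h' => sol_add_right hs hpr hV ξ h h'
        map_smul' := fun c h => sol_smul_right hs hpr hV ξ c h })
    (fun _ _ hV h' s => sol_res_right hs hpr hV h' ξ s)

variable (L) in
/-- The homomorphism `Φ` from the transfer sheaf to the sheaf of homomorphisms. -/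
def actHom : HomOn (transferSheaf p hs.contMDiff L) (homSheaf p hs.contMDiff L) ⊤ :=
  HomOn.mk'
    (fun _ _ =>
      { toFun := fun ξ => actSec hs hpr ξ
        map_add' := fun ξ ξ' => HomOn.ext fun _ hV h => sol_add_left hs hpr hV ξ ξ' h
        map_smul' := fun c ξ => HomOn.ext fun _ hV h => sol_smul_left hs hpr hV c ξ h })
    (fun _ _ _ h' ξ => HomOn.ext fun _ hV h => sol_res_left hs hpr h' hV ξ h)

/-- The unit section acts by f ↦ f ∘ p, which is constant on fibers; so p_!((f ∘ p) h) = f p_!(h),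
and p_!(h) solves the defining equation. -/
theorem actHom_one : IsFiberIntegration p hs.contMDiff L
    ((actHom hs hpr L).app ⊤ le_top (transferOne p hs.contMDiff L)) := by
  intro V h i y hy hi
  have h1 : pushSec hs hpr h = sol hs hpr le_top (transferOne p hs.contMDiff L) h := by
    refine eq_sol hs hpr _ _ _ fun i y hy hi b hb => ⟨trivDom V i b, ⟨⟨hy, hi⟩, hb⟩, le_rfl, ?_, fun f hf => ?_⟩
    · exact ((pushSec hs hpr h).2.1 i).1.mono fun x hx => hx.1
    · refine cint_congr b fun x _ => ?_
      by_cases hx : x ∈ trivDom V i b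
      · rw [pushFun_of_mem hs hx.1, pushSec_apply hs hpr h hx.1.1 hx.1.2]
        symm
        refine fiberIntegral_eq_mul (f x) fun t z hz hzt => congrArg (· * _) ?_
        subst hz
        have hx' : p z ∈ trivDom ⊤ i b := trivDom_mono le_top i b hx
        rw [densFun_eq_hat hs _ hx' hzt (hf.mem_smoothLocus _)]
        exact hat_one hs (τ := (i, (t.a, b))) ⟨hx.1.2, hzt, hx.2⟩ (hf.mem_smoothLocus _)
      · rw [hf.apply_zero hx, zero_mul, pushFun_eq_zero hs fun τ z hz => by
          rw [densFun_eq_zero hs _ (hz ▸ IsTest.eventually_zero fun h' => hx (hf.sub h')), zero_mul]]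
  refine (congrArg (fun s : L.absSec V => s.1 i y) h1.symm).trans ?_
  exact pushSec_apply hs hpr h hy hi

/-- `Φ` is compatible with the left actions. -/
theorem actHom_left (S : TwDiffOp L U) {ξ η : (transferSheaf p hs.contMDiff L).sec U}
    (hη : IsLeftMul p hs.contMDiff L S ξ η) :
    (actHom hs hpr L).app U le_top η = S.act.comp ((actHom hs hpr L).app U le_top ξ) := by
  rw [isLeftMul_iff hs] at hη
  refine HomOn.ext fun V hV h => ?_
  refine (eq_sol hs hpr hV η h (u := S.act.app V hV (sol hs hpr hV ξ h)) fun i y hy hi b hb => ?_).symm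
  obtain ⟨W, hyW, hW⟩ := exists_sol_near hs hpr hV ξ hy hi hb
  obtain ⟨N, hN, S', hyN, hNb, hS', hev⟩ := exists_trEv b (S.isHol i) (x := y) ⟨hV hy, hi⟩ hb
  obtain ⟨M, hyM, hMN, hMb, hM⟩ := hS'.pairing y hyN hb
  have hle := (hW h).le
  have hact : ∀ x ∈ W, (S.act.app V hV (sol hs hpr hV ξ h)).1 i x = (S.op i).ev ((sol hs hpr hV ξ h).1 i) x :=
    fun x hx => S.act_app hV _ i (hle hx).1.1 (hle hx).1.2
  have hsm : SmoothOn n ((sol hs hpr hV ξ h).1 i) (W ⊓ M : Opens Y) := (hW h).smooth.mono inter_subset_left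
  refine ⟨W ⊓ M, ⟨hyW, hyM⟩, inf_le_left.trans hle,
    (((S.act.app V hV (sol hs hpr hV ξ h)).2.1 i).1.mono fun x hx => (hle hx.1).1), fun f hf => ?_⟩
  have hfS : IsTest n (S'.ev f) (W ⊓ M : Opens Y) := hf.ev S' (inf_le_right.trans hMN)
  have e1 : cint b (fun x => f x * (S.act.app V hV (sol hs hpr hV ξ h)).1 i x) =
      cint b (fun x => LocOp.ev (HomOn.restr hN (S.op i)) ((sol hs hpr hV ξ h).1 i) x * f x) := by
    refine cint_congr b fun x _ => ?_
    by_cases hx : x ∈ W ⊓ M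
    · rw [hact x hx.1, LocOp.ev_restr _ _ _ (hMN hx.2), mul_comm]
    · rw [hf.apply_zero hx, zero_mul, mul_zero]
  -- S is moved onto the test function as its transpose; the pairing of Sᵗ f with ξ is that of f
  -- with η by the formula for the left action.
  rw [e1, hM _ inf_le_right _ f hsm (hf.smooth.mono (subset_univ _)) (Or.inr hf)]
  simp only [mul_comm (((sol hs hpr hV ξ h).1 i) _)]
  rw [(hW h).pair _ (hfS.mono inter_subset_left)]
  refine pairing_congr ξ η h h (inf_le_left.trans hle) (inf_le_left.trans hle) hfS hf fun t z hz hzt => congrArg (· * _) ?_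
  have h1 := trivDom_mono hV i b (hle hz.1)
  rw [densFun_eq_hat hs ξ h1 hzt (hfS.mem_smoothLocus _), densFun_eq_hat hs η h1 hzt (hf.mem_smoothLocus _)]
  refine Eq.trans ?_ (hη (i, (t.a, b)) z h1.1.1 ⟨h1.1.2, hzt, h1.2⟩ f (hf.mem_smoothLocus _)).symm
  refine hat_congr hs ξ (τ := (i, (t.a, b))) h1.1.1 ⟨h1.1.2, hzt, h1.2⟩ ?_ (hfS.mem_smoothLocus _)
  filter_upwards [N.2.mem_nhds (hMN hz.2)] with x hx
  exact (hev x hx f (hf.mem_smoothLocus x)).symm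

end Homomorphism

/-! ### Compatibility with the right action -/

section RightAction

variable {n k : ℕ} {Y Z : Type*} [TopologicalSpace Y] [T2Space Y] [SecondCountableTopology Y]
  [ChartedSpace (Cn n) Y] [TopologicalSpace Z] [T2Space Z] [SecondCountableTopology Z]
  [ChartedSpace (Cn (n + k)) Z]
  [IsManifold 𝓘(ℂ, Cn (n + k)) ω Z] [IsManifold 𝓘(ℂ, Cn n) ω Y] {p : C(Z, Y)}
  (hs : Manifold.IsSubmersion 𝓘(ℂ, Cn (n + k)) 𝓘(ℂ, Cn n) ω p) (hpr : IsProperMap p)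
  {L : HolLineBundle n Y} {U V : Opens Y} (hVU : V ≤ U) {i : L.ι} {b : Chart n Y} {f : Y → ℂ}

/-- The pairing with a density concentrated in an adapted chart. -/
theorem pairing_eq_cint (hpr : IsProperMap p) (hVU : V ≤ U) (ξ : (transferSheaf p hs.contMDiff L).sec U)
    (s : AdaptedChart (n := n) (k := k) p) (hf : IsTest n f (trivDom V i s.b))
    (h : (twistM p hs.contMDiff L).absSec (Opens.comap p V)) {C : Set Z} (hC : IsCompact C)
    (hCs : C ⊆ (⟨s.a.1.source, s.a.1.open_source⟩ ⊓ Opens.comap p (V ⊓ L.dom i) : Opens Z))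
    (hh : ∀ τ, ∀ z ∉ C, h.1 τ z = 0) :
    pairing hs ξ h i s.b f = cint s.a (fun z => densFun hs ξ i s.b f z * h.1 (i, (s.a, s.b)) z) := by
  have hf' := hf.mono (trivDom_mono hVU i s.b)
  rw [pairing_eq hs hpr ξ hf' h]
  refine (cint_pushSec hs hpr (densSec hs ξ hf' h) i s hC hCs fun τ z hz => ?_).2
  exact (congrArg (_ * ·) (hh τ z hz)).trans (mul_zero _)

/-- For h supported in an adapted chart over b, Fubini turns both pairings into integrals over that
chart of Z. There the claim is ∫ Rᵗ(ξ f) h = ∫ (ξ f) (R h), the adjointness of the transpose. -/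
theorem pairing_right_of_cpt (hpr : IsProperMap p) (hVU : V ≤ U) {ξ η : (transferSheaf p hs.contMDiff L).sec U}
    {R : TwDiffOp (twistM p hs.contMDiff L) (Opens.comap p U)} (hη : IsRightMul p hs.contMDiff L ξ R η)
    (s : AdaptedChart (n := n) (k := k) p) (hsb : s.b = b) (hf : IsTest n f (trivDom V i b)) {z : Z}
    (hz : p z ∈ V) (hi : p z ∈ L.dom i) (hzs : z ∈ s.a.1.source) :
    ∃ N : Opens Z, z ∈ N ∧ N ≤ Opens.comap p V ∧ ∀ h : (twistM p hs.contMDiff L).absSec (Opens.comap p V),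
      ∀ C ⊆ (N : Set Z), IsCompact C → (∀ τ, ∀ z ∉ C, h.1 τ z = 0) →
        pairing hs η h i b f = pairing hs ξ (R.act.app (Opens.comap p V) (Opens.comap_mono p hVU) h) i b f := by
  subst hsb
  rw [isRightMul_iff hs] at hη
  set τ : (twistM p hs.contMDiff L).ι := (i, (s.a, s.b)) with hτ
  obtain ⟨N, hN, R', hzN, hNa, hR', hev⟩ := exists_trEv s.a (R.isHol τ) (x := z)
    ⟨hVU hz, hi, hzs, s.mapsTo z hzs⟩ hzs
  obtain ⟨M, hzM, hMN, -, hM⟩ := hR'.pairing z hzN hzs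
  have hMs : M ⊓ Opens.comap p V ≤ (⟨s.a.1.source, s.a.1.open_source⟩ ⊓ Opens.comap p (V ⊓ L.dom i) : Opens Z) :=
    fun x hx => ⟨hNa (hMN hx.1), hx.2, (hN (hMN hx.1)).2.1⟩
  refine ⟨M ⊓ Opens.comap p V, ⟨hzM, hz⟩, inf_le_right, fun h C hCM hC hh => ?_⟩
  have hCs := hCM.trans hMs
  -- R is local, so R h vanishes off C as well and Fubini applies to both sides.
  have hRh : ∀ τ, ∀ x ∉ C, (R.act.app (Opens.comap p V) (Opens.comap_mono p hVU) h).1 τ x = 0 := by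
    intro τ' x hx
    by_cases hxd : x ∈ Opens.comap p V ⊓ (twistM p hs.contMDiff L).dom τ'
    · rw [R.act_app _ h τ' hxd.1 hxd.2]
      refine (R.op τ').ev_eq_zero ?_
      filter_upwards [hC.isClosed.isOpen_compl.mem_nhds hx] with x' hx' using hh τ' x' hx'
    · exact ((R.act.app (Opens.comap p V) (Opens.comap_mono p hVU) h).2.1 τ').2 x hxd
  rw [pairing_eq_cint hs hpr hVU η s hf h hC hCs hh, pairing_eq_cint hs hpr hVU ξ s hf _ hC hCs hRh]
  set D := densFun hs ξ i s.b f with hD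
  have hDs : SmoothOn (n + k) D univ := densFun_smooth hs ξ (hf.mono (trivDom_mono hVU i s.b)) _
  have htest : IsTest (n + k) (h.1 τ) (M ⊓ Opens.comap p V : Opens Z) :=
    .of_smoothOn ((h.2.1 τ).1.mono fun x hx => ⟨hx.2, (hN (hMN hx.1)).2⟩) hC hCM (hh τ)
  -- Here h is the test function; the density attached to f is smooth but not compactly supported in
  -- M, which the pairing permits.
  have key := hM (M ⊓ Opens.comap p V) inf_le_left (h.1 τ) D (htest.smooth.mono (subset_univ _))
    (hDs.mono (subset_univ _)) (Or.inl htest)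
  have e1 : cint s.a (fun x => densFun hs η i s.b f x * h.1 τ x) = cint s.a (fun x => h.1 τ x * R'.ev D x) := by
    refine cint_congr s.a fun x hxs => ?_
    by_cases hx : x ∈ M ⊓ Opens.comap p V
    · have hxd : p x ∈ trivDom U i s.b := ⟨(hN (hMN hx.1)).1 |> fun h => ⟨h, (hN (hMN hx.1)).2.1⟩, s.mapsTo x hxs⟩
      have hxτ : x ∈ (twistM p hs.contMDiff L).dom τ := (hN (hMN hx.1)).2
      rw [densFun_eq_hat hs η hxd hxs (hf.mem_smoothLocus _), hη τ x hxd.1.1 hxτ f (hf.mem_smoothLocus _),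
        hev x (hMN hx.1) _ (hat_mem_smoothLocus hs ξ hxd.1.1 hxτ (hf.mem_smoothLocus _)), mul_comm]
      refine congrArg (_ * ·) (R'.ev_congr ?_)
      filter_upwards [N.2.mem_nhds (hMN hx.1)] with x' hx'
      have hxd' : p x' ∈ trivDom U i s.b := ⟨⟨(hN hx').1, (hN hx').2.1⟩, (hN hx').2.2.2⟩
      exact (densFun_eq_hat hs ξ hxd' (hNa hx') (hf.mem_smoothLocus _)).symm
    · rw [htest.apply_zero hx, mul_zero, zero_mul]
  rw [e1, ← key]
  refine cint_congr s.a fun x hxs => ?_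
  by_cases hx : x ∈ M ⊓ Opens.comap p V
  · rw [R.act_app _ h τ hx.2 (hN (hMN hx.1)).2, LocOp.ev_restr _ _ _ (hMN hx.1), mul_comm]
  · rw [htest.ev_zero _ hx, zero_mul, hRh τ x fun hxC => hx (hCM hxC), mul_zero]

/-- The preimage of the support of f is compact by properness. A finite partition of unity on it
splits h into pieces small enough for the chart computation. -/
theorem pairing_right (hpr : IsProperMap p) (hVU : V ≤ U) {ξ η : (transferSheaf p hs.contMDiff L).sec U}
    {R : TwDiffOp (twistM p hs.contMDiff L) (Opens.comap p U)} (hη : IsRightMul p hs.contMDiff L ξ R η)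
    (h : (twistM p hs.contMDiff L).absSec (Opens.comap p V)) (hf : IsTest n f (trivDom V i b)) :
    pairing hs η h i b f = pairing hs ξ (R.act.app (Opens.comap p V) (Opens.comap_mono p hVU) h) i b f := by
  have hK : IsCompact (p ⁻¹' tsupport f) := hpr.isCompact_preimage hf.cpt
  have h1 : ∀ z : Z, ∃ N : Opens Z, p z ∈ tsupport f → z ∈ N ∧ N ≤ Opens.comap p V ∧
      ∀ h : (twistM p hs.contMDiff L).absSec (Opens.comap p V),
      ∀ C ⊆ (N : Set Z), IsCompact C → (∀ τ, ∀ z ∉ C, h.1 τ z = 0) →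
        pairing hs η h i b f = pairing hs ξ (R.act.app (Opens.comap p V) (Opens.comap_mono p hVU) h) i b f := by
    intro z
    by_cases hz : p z ∈ tsupport f
    · obtain ⟨s, hsb, hzs⟩ := exists_adaptedChart hs z b (hf.sub hz).2
      obtain ⟨N, hN⟩ := pairing_right_of_cpt hs hpr hVU hη s hsb hf (hf.sub hz).1.1 (hf.sub hz).1.2 hzs
      exact ⟨N, fun _ => hN⟩
    · exact ⟨⊤, fun h => absurd h hz⟩
  choose N hN using h1
  obtain ⟨σ, χ, O, hσ, hχ, hKO, hsum⟩ := exists_partition (d := n + k) hK N fun z hz => (hN z hz).1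
  classical
  set g : Z → (twistM p hs.contMDiff L).absSec (Opens.comap p V) := fun l =>
    if hl : l ∈ σ then mulSec (χ l) ((hχ l hl).smooth.mono (subset_univ _)) h else 0 with hg
  have hgl : ∀ l ∈ σ, ∀ τ z, (g l).1 τ z = χ l z * h.1 τ z := fun l hl τ z => by
    rw [hg]
    simp only [hl, dite_true]
    rfl
  have hgs : ∀ τ, ∀ z ∈ O, (∑ l ∈ σ, g l).1 τ z = h.1 τ z := fun τ z hz => by
    rw [absSec_sum_apply, Finset.sum_congr rfl fun l hl => hgl l hl τ z, ← Finset.sum_mul, hsum z hz, one_mul]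
  -- The pieces add up to h only on O, but the density attached to f vanishes elsewhere.
  have hDO : ∀ (ζ : (transferSheaf p hs.contMDiff L).sec U), ∀ z ∉ O, densFun hs ζ i b f z = 0 := fun ζ z hz =>
    densFun_eq_zero hs ζ (IsTest.eventually_zero fun h' => hz (hKO h'))
  have e1 : pairing hs η h i b f = pairing hs η (∑ l ∈ σ, g l) i b f := by
    refine pairing_congr η η h _ le_rfl le_rfl hf hf fun t z _ _ => ?_
    by_cases hz : z ∈ O
    · exact congrArg (_ * ·) (hgs _ z hz).symm
    · rw [hDO η z hz, zero_mul, zero_mul]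
  have e2 : pairing hs ξ (R.act.app (Opens.comap p V) (Opens.comap_mono p hVU) h) i b f =
      pairing hs ξ (R.act.app (Opens.comap p V) (Opens.comap_mono p hVU) (∑ l ∈ σ, g l)) i b f := by
    refine pairing_congr ξ ξ _ _ le_rfl le_rfl hf hf fun t z hzW hzt => ?_
    by_cases hz : z ∈ O
    · have hzd : z ∈ (twistM p hs.contMDiff L).dom (i, (t.a, t.b)) := ⟨hzW.1.2, hzt, t.mapsTo z hzt⟩
      refine congrArg (densFun hs ξ i b f z * ·) ?_
      refine (R.act_app _ h (i, (t.a, t.b)) hzW.1.1 hzd).trans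
        (Eq.trans ?_ (R.act_app _ (∑ l ∈ σ, g l) (i, (t.a, t.b)) hzW.1.1 hzd).symm)
      refine (R.op (i, (t.a, t.b))).ev_congr ?_
      filter_upwards [O.2.mem_nhds hz] with x hx using (hgs _ x hx).symm
    · rw [hDO ξ z hz, zero_mul, zero_mul]
  rw [e1, e2, pairing_sum hpr hVU η σ g hf]
  have e3 : R.act.app (Opens.comap p V) (Opens.comap_mono p hVU) (∑ l ∈ σ, g l) =
      ∑ l ∈ σ, R.act.app (Opens.comap p V) (Opens.comap_mono p hVU) (g l) := map_sum _ _ _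
  rw [e3]
  refine Eq.trans ?_ (pairing_sum hpr hVU ξ σ
    (fun l => R.act.app (Opens.comap p V) (Opens.comap_mono p hVU) (g l)) hf).symm
  refine Finset.sum_congr rfl fun l hl => ?_
  refine (hN l (hσ l hl)).2.2 (g l) (tsupport (χ l)) (hχ l hl).sub (hχ l hl).cpt fun τ z hz => ?_
  rw [hgl l hl, image_eq_zero_of_notMem_tsupport hz, zero_mul]

/-- `Φ` is compatible with the right actions. -/
theorem actHom_right {ξ η : (transferSheaf p hs.contMDiff L).sec U}
    {R : TwDiffOp (twistM p hs.contMDiff L) (Opens.comap p U)} (hη : IsRightMul p hs.contMDiff L ξ R η) :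
    (actHom hs hpr L).app U le_top η = HomOn.comp ((actHom hs hpr L).app U le_top ξ) (pushHom p R.act) := by
  refine HomOn.ext fun V hV h => ?_
  refine (eq_sol hs hpr hV η h (u := sol hs hpr hV ξ (R.act.app (Opens.comap p V) (Opens.comap_mono p hV) h))
    fun i y hy hi b hb => ?_).symm
  obtain ⟨W, hyW, hW⟩ := exists_sol_near hs hpr hV ξ hy hi hb
  refine ⟨W, hyW, (hW _).of_pairing (hW h).le fun f hf => ?_⟩
  exact (pairing_right hs hpr hV hη h (hf.mono (hW h).le)).symm

end RightAction

/-! ### Injectivity -/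

section Injectivity

variable {n k : ℕ} {Y Z : Type*} [TopologicalSpace Y] [T2Space Y] [SecondCountableTopology Y]
  [ChartedSpace (Cn n) Y] [TopologicalSpace Z] [T2Space Z] [SecondCountableTopology Z]
  [ChartedSpace (Cn (n + k)) Z]
  [IsManifold 𝓘(ℂ, Cn (n + k)) ω Z] [IsManifold 𝓘(ℂ, Cn n) ω Y] {p : C(Z, Y)}
  (hs : Manifold.IsSubmersion 𝓘(ℂ, Cn (n + k)) 𝓘(ℂ, Cn n) ω p) (hpr : IsProperMap p)
  {L : HolLineBundle n Y} {U : Opens Y}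

/-- Sections of `|A|²` with compact support in the domain of a trivialization. -/
theorem exists_absSec {d : ℕ} {X : Type*} [TopologicalSpace X] [T2Space X] [ChartedSpace (Cn d) X]
    (A : HolLineBundle d X) (U : Opens X) {i : A.ι} {g : X → ℂ} (hg : IsTest d g (U ⊓ A.dom i : Opens X)) :
    ∃ s : A.absSec U, s.1 i = g ∧ ∀ j, ∀ x ∉ tsupport g, s.1 j x = 0 := by
  have hsm : ∀ j, SmoothOn d (fun x => (‖A.g j i x‖ ^ 2 : ℝ) * g x) (U ⊓ A.dom j : Opens X) := by
    intro j x hx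
    by_cases hxg : x ∈ tsupport g
    · have h1 : HolOn d (A.g j i) (A.dom j ⊓ A.dom i : Opens X) := A.hol j i
      have h2 : SmoothOn d (fun x => (conjFun (A.g j i) x * A.g j i x) * g x) (A.dom j ⊓ A.dom i : Opens X) :=
        SmoothOn.mul d (SmoothOn.mul d (h1.smoothOn d).conj (h1.smoothOn d)) (hg.smooth.mono (subset_univ _))
      have h3 := (h2 x ⟨hx.2, (hg.sub hxg).2⟩).contMDiffAt ((A.dom j ⊓ A.dom i).2.mem_nhds ⟨hx.2, (hg.sub hxg).2⟩)
      refine (h3.congr_of_eventuallyEq (.of_forall fun y => ?_)).contMDiffWithinAt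
      beta_reduce
      rw [← Complex.normSq_eq_norm_sq, ← Complex.mul_conj, conjFun, mul_comm (A.g j i y)]
    · refine ((contMDiffAt_const (c := (0 : ℂ))).congr_of_eventuallyEq ?_).contMDiffWithinAt
      filter_upwards [IsTest.eventually_zero hxg] with y hy
      rw [hy, mul_zero]
  have hzero : ∀ x ∉ tsupport g, g x = 0 := fun x hx => image_eq_zero_of_notMem_tsupport hx
  set G : A.ι → X → ℂ := fun j =>
    Set.indicator ((U ⊓ A.dom j : Opens X) : Set X) (fun x => (‖A.g j i x‖ ^ 2 : ℝ) * g x) with hG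
  have hG1 : ∀ j, ∀ x ∈ U ⊓ A.dom j, G j x = (‖A.g j i x‖ ^ 2 : ℝ) * g x := fun j x hx =>
    Set.indicator_of_mem (s := ((U ⊓ A.dom j : Opens X) : Set X)) hx _
  have hG0 : ∀ j, ∀ x ∉ tsupport g, G j x = 0 := fun j x hx => by
    by_cases hxU : x ∈ U ⊓ A.dom j
    · rw [hG1 j x hxU, hzero x hx, mul_zero]
    · exact Set.indicator_of_notMem (s := ((U ⊓ A.dom j : Opens X) : Set X)) hxU _
  refine ⟨⟨G, fun j => indicator_mem_smoothFun d (hsm j) le_rfl, fun j l x hx hj hl => ?_⟩, funext fun x => ?_, hG0⟩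
  · rw [hG1 j x ⟨hx, hj⟩, hG1 l x ⟨hx, hl⟩]
    by_cases hxg : x ∈ tsupport g
    · rw [← A.cocycle j l i x hj hl (hg.sub hxg).2, norm_mul, mul_pow]
      push_cast
      ring
    · rw [hzero x hxg, mul_zero, mul_zero, mul_zero]
  · by_cases hxg : x ∈ tsupport g
    · refine (hG1 i x (hg.sub hxg)).trans ?_
      rw [A.g_self (hg.sub hxg).2]
      simp
    · exact (hG0 i x hxg).trans (hzero x hxg).symm

theorem exists_bump {d : ℕ} {X : Type*} [TopologicalSpace X] [T2Space X] [SecondCountableTopology X]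
    [ChartedSpace (Cn d) X] [IsManifold 𝓘(ℂ, Cn d) ω X] {W : Opens X} {x : X} (hx : x ∈ W) :
    ∃ χ : X → ℂ, IsTest d χ W ∧ ∀ᶠ y in 𝓝 x, χ y = 1 := by
  obtain ⟨s, χ, O, hs, hχ, hO, hsum⟩ := exists_partition (d := d) (isCompact_singleton (x := x)) (fun _ => W)
    fun y hy => by
      rw [show y = x from hy]
      exact hx
  have htest : ∀ s' ⊆ s, IsTest d (fun y => ∑ l ∈ s', χ l y) W := by
    classical
    intro s'
    induction s' using Finset.induction_on with
    | empty =>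
      intro _
      simp only [Finset.sum_empty]
      exact ⟨smoothOn_const 0 _, HasCompactSupport.zero, by simp [tsupport]⟩
    | insert l s' hl ih =>
      intro hss
      simp only [Finset.sum_insert hl]
      exact (hχ l (hss (Finset.mem_insert_self _ _))).add (ih fun j hj => hss (Finset.mem_insert_of_mem hj))
  refine ⟨_, htest s le_rfl, ?_⟩
  filter_upwards [O.2.mem_nhds (hO rfl)] with y hy using hsum y hy

/-- The sections h of |M|² supported in an adapted chart are arbitrary test functions there. If all
the integrals ∫_Z (ξ f) h vanish, then ξ f = 0 for every test function f, and germs of smooth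
functions extend to test functions. -/
theorem actHom_eq_zero {ξ : (transferSheaf p hs.contMDiff L).sec U}
    (h0 : (actHom hs hpr L).app U le_top ξ = 0) : ξ = 0 := by
  refine hat_ext hs fun τ z hz hτ f hf => ?_
  have hz0 : hat hs (0 : (transferSheaf p hs.contMDiff L).sec U) τ f z = 0 := by
    have h1 := hat_smul hs 0 (0 : (transferSheaf p hs.contMDiff L).sec U) hz hτ hf
    rwa [zero_smul, zero_mul] at h1
  rw [hz0]
  obtain ⟨i, a, b⟩ := τ
  have hyt : p z ∈ trivDom U i b := ⟨⟨hz, hτ.1⟩, hτ.2.2⟩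
  obtain ⟨W, hyW, hWt, hW⟩ := exists_sol_isLocSol hs hpr ξ hyt
  -- f is only smooth near p z; the bump function replaces it by a test function with the same germ.
  obtain ⟨χ, hχ, hχ1⟩ := exists_bump (d := n) (W := W ⊓ smoothLocus n f) (x := p z) ⟨hyW, hf⟩
  have hF : IsTest n (fun y => χ y * f y) W :=
    (hχ.mul_right ((smoothOn_smoothLocus f).mono inter_subset_right)).mono inter_subset_left
  have hFf : (fun y => χ y * f y) =ᶠ[𝓝 (p z)] f := by
    filter_upwards [hχ1] with y hy
    rw [hy, one_mul]
  rw [← hat_congr hs ξ hz hτ hFf (hF.mem_smoothLocus _), hat_eq_dens hs ξ hz hτ.1 hτ.2.1 hτ.2.2 (hF.mem_smoothLocus _)]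
  obtain ⟨s, hsb, hzs⟩ := exists_adaptedChart hs z b hτ.2.2
  subst hsb
  set D := densFun hs ξ i s.b (fun y => χ y * f y) with hD
  set N : Opens Z := ⟨s.a.1.source, s.a.1.open_source⟩ ⊓ Opens.comap p (U ⊓ L.dom i) with hN
  have hFU : IsTest n (fun y => χ y * f y) (trivDom U i s.b) := hF.mono hWt
  -- A test function g on N is the component, in this trivialization, of a global section of |M|²
  -- over p⁻¹(U) with the same support.
  have h2 := eq_zero_of_cint s.a (N := N) (fun x hx => hx.1) (densFun_smooth hs ξ hFU N) fun g hg => by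
    have hg' : IsTest (n + k) g (Opens.comap p U ⊓ (twistM p hs.contMDiff L).dom (i, (s.a, s.b)) : Opens Z) :=
      hg.mono fun x hx => ⟨hx.2.1, hx.2.2, hx.1, s.mapsTo x hx.1⟩
    obtain ⟨h, hh, hh0⟩ := exists_absSec (twistM p hs.contMDiff L) (Opens.comap p U) hg'
    have h3 := pairing_eq_cint hs hpr le_rfl ξ s hFU h hg.cpt hg.sub hh0
    have h4 := (hW U le_rfl h).pair _ (hF.mono fun y hy => ⟨hy, (hWt hy).1.1⟩)
    have h5 : sol hs hpr le_rfl ξ h = 0 :=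
      congrArg (fun φ => HomOn.app (F := pushforward p (twistM p hs.contMDiff L).absSheaf) (G := L.absSheaf)
        φ U le_rfl h) h0
    rw [h5, h3] at h4
    have h6 : cint s.b (fun y => χ y * f y * (0 : L.absSec U).1 i y) = 0 :=
      (cint_congr s.b (G := fun _ => 0) fun y _ => mul_zero _).trans (by simp [cint])
    rw [h6, hh] at h4
    rw [h4]
    exact cint_congr s.a fun x _ => mul_comm _ _
  have h7 := h2 z ⟨hzs, hz, hτ.1⟩
  exact (densFun_of_mem hs ξ hyt).symm.trans h7

theorem actHom_injective : Function.Injective ((actHom hs hpr L).app U le_top) :=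
  (injective_iff_map_eq_zero _).2 fun _ h0 => actHom_eq_zero hs hpr h0

end Injectivity

/-! ### Construction of twisted differential operators -/

section TwistedOperators

variable {d : ℕ} {X : Type*} [TopologicalSpace X] [ChartedSpace (Cn d) X] [IsManifold 𝓘(ℂ, Cn d) ω X]
  (A : HolLineBundle d X) {U : Opens X}

theorem HolLineBundle.holOn_g (i j : A.ι) {V : Opens X} (hi : V ≤ A.dom i) (hj : V ≤ A.dom j) :
    HolOn d (A.g i j) V :=
  (A.hol i j).mono fun _ hx => ⟨hi hx, hj hx⟩

theorem HolLineBundle.holOn_inv_g (i j : A.ι) {V : Opens X} (hi : V ≤ A.dom i) (hj : V ≤ A.dom j) :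
    HolOn d (fun x => (A.g i j x)⁻¹) V :=
  HolOn.inv (A.holOn_g i j hi hj) fun x hx => A.ne_zero i j x (hi hx) (hj hx)

theorem HolLineBundle.conj_ev (i j : A.ι) {V : Opens X} (hi : V ≤ A.dom i) (hj : V ≤ A.dom j) (P : LocOp d V)
    {x : X} (hx : x ∈ V) {F : X → ℂ} (hF : x ∈ smoothLocus d F) :
    LocOp.ev ((mulOp d (A.g i j) V).comp (P.comp (mulOp d (fun x => (A.g i j x)⁻¹) V))) F x =
      A.g i j x * P.ev (fun y => (A.g i j y)⁻¹ * F y) x := by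
  have h1 := (A.holOn_g i j hi hj).smoothOn d
  have h2 := (A.holOn_inv_g i j hi hj).smoothOn d
  rw [LocOp.comp_ev _ _ hF, LocOp.mulOp_ev h1 hx (LocOp.mem_smoothLocus_ev _ hx hF), LocOp.comp_ev _ _ hF]
  congr 1
  refine P.ev_congr ?_
  filter_upwards [V.2.mem_nhds hx, (smoothLocus d F).2.mem_nhds hF] with y hy hyF
  exact LocOp.mulOp_ev h2 hy hyF

/-- Multiplication by a holomorphic function, as a twisted differential operator. -/
def TwDiffOp.scalar (c : X → ℂ) (hc : HolOn d c U) : TwDiffOp A U where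
  op i := mulOp d c (U ⊓ A.dom i)
  isHol i := .mul c (hc.mono inter_subset_left)
  glue i j V hi hj := LocOp.ext_ev fun x hx F hF => by
    have hi' : V ≤ A.dom i := hi.trans inf_le_right
    have hj' : V ≤ A.dom j := hj.trans inf_le_right
    have hc' : ∀ l, SmoothOn d c (U ⊓ A.dom l : Opens X) := fun l => (hc.smoothOn d).mono inter_subset_left
    have h2 : x ∈ smoothLocus d fun y => (A.g i j y)⁻¹ * F y :=
      smoothLocus_mul (((A.holOn_inv_g i j hi' hj').smoothOn d).mem_smoothLocus hx) hF
    rw [A.conj_ev i j hi' hj' _ hx hF, LocOp.ev_restr _ _ _ hx, LocOp.ev_restr _ _ _ hx,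
      LocOp.mulOp_ev (hc' i) (hi hx) hF,
      LocOp.mulOp_ev (hc' j) (hj hx) h2]
    have := A.ne_zero i j x (hi' hx) (hj' hx)
    field_simp

/-- The twisted differential operator that is given by `Q` in the trivialization `i`. -/
def TwDiffOp.ofTriv (i : A.ι) (hU : U ≤ A.dom i) (Q : LocOp d U) (hQ : IsHolDiffOp d Q) : TwDiffOp A U where
  op j := (mulOp d (A.g j i) (U ⊓ A.dom j)).comp
    ((HomOn.restr inf_le_left Q).comp (mulOp d (fun x => (A.g j i x)⁻¹) (U ⊓ A.dom j)))
  isHol j := (IsHolDiffOp.mul _ (A.holOn_g j i inf_le_right (inf_le_left.trans hU))).comp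
    ((hQ.restr _).comp (.mul _ (A.holOn_inv_g j i inf_le_right (inf_le_left.trans hU))))
  glue j l V hj hl := LocOp.ext_ev fun x hx F hF => by
    have hj' : V ≤ A.dom j := hj.trans inf_le_right
    have hl' : V ≤ A.dom l := hl.trans inf_le_right
    have hV : V ≤ A.dom i := (hj.trans inf_le_left).trans hU
    have h2 : x ∈ smoothLocus d fun y => (A.g j l y)⁻¹ * F y :=
      smoothLocus_mul (((A.holOn_inv_g j l hj' hl').smoothOn d).mem_smoothLocus hx) hF
    rw [A.conj_ev j l hj' hl' _ hx hF, LocOp.ev_restr _ _ _ hx, LocOp.ev_restr _ _ _ hx,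
      A.conj_ev j i inf_le_right (inf_le_left.trans hU) _ (hj hx) hF,
      A.conj_ev l i inf_le_right (inf_le_left.trans hU) _ (hl hx) h2, LocOp.ev_restr _ _ _ (hj hx),
      LocOp.ev_restr _ _ _ (hl hx), ← mul_assoc, A.cocycle j l i x (hj' hx) (hl' hx) (hV hx)]
    congr 1
    refine Q.ev_congr ?_
    filter_upwards [V.2.mem_nhds hx] with y hy
    rw [← A.cocycle j l i y (hj' hy) (hl' hy) (hV hy), mul_inv]
    ring

theorem TwDiffOp.ofTriv_restr (i : A.ι) (hU : U ≤ A.dom i) (Q : LocOp d U) (hQ : IsHolDiffOp d Q) :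
    HomOn.restr (le_inf le_rfl hU) ((TwDiffOp.ofTriv A i hU Q hQ).op i) = Q :=
  LocOp.ext_ev fun x hx F hF => by
    rw [LocOp.ev_restr _ _ _ hx]
    refine (A.conj_ev i i inf_le_right inf_le_right _ ⟨hx, hU hx⟩ hF).trans ?_
    rw [LocOp.ev_restr _ _ _ (show x ∈ U ⊓ A.dom i from ⟨hx, hU hx⟩), A.g_self (hU hx), one_mul]
    refine Q.ev_congr ?_
    filter_upwards [U.2.mem_nhds hx] with y hy
    rw [A.g_self (hU hy), inv_one, one_mul]

end TwistedOperators

/-! ### Uniqueness -/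

section Uniqueness

variable {n k : ℕ} {Y Z : Type*} [TopologicalSpace Y] [T2Space Y] [SecondCountableTopology Y]
  [ChartedSpace (Cn n) Y] [TopologicalSpace Z] [T2Space Z] [SecondCountableTopology Z]
  [ChartedSpace (Cn (n + k)) Z]
  [IsManifold 𝓘(ℂ, Cn (n + k)) ω Z] [IsManifold 𝓘(ℂ, Cn n) ω Y] {p : C(Z, Y)}
  (hs : Manifold.IsSubmersion 𝓘(ℂ, Cn (n + k)) 𝓘(ℂ, Cn n) ω p) (hpr : IsProperMap p)
  {L : HolLineBundle n Y} {U : Opens Y} {i : L.ι} {b : Chart n Y}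

/-- When i and b are defined on all of U, the change of trivialization recovers every `hat ξ τ` from
those with this i and b. -/
theorem hat_ext_triv (hi : U ≤ L.dom i) (hb : (U : Set Y) ⊆ b.1.source)
    {ξ η : (transferSheaf p hs.contMDiff L).sec U}
    (h : ∀ (a : Chart (n + k) Z) (z : Z), p z ∈ U → z ∈ a.1.source → ∀ f : Y → ℂ, p z ∈ smoothLocus n f →
      hat hs ξ (i, (a, b)) f z = hat hs η (i, (a, b)) f z) : ξ = η := by
  refine hat_ext hs fun τ z hz hτ f hf => ?_
  have hτ' : z ∈ (twistM p hs.contMDiff L).dom (i, (τ.2.1, b)) := ⟨hi hz, hτ.2.1, hb hz⟩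
  rw [hat_change hs ξ hz hτ hτ' hf, hat_change hs η hz hτ hτ' hf]
  exact congrArg _ (h _ z hz hτ.2.1 _ (baseFactor_mul_mem_smoothLocus hs hτ hτ' hf))

theorem hat_sum {ι : Type*} (S : Finset ι) (ζ : ι → (transferSheaf p hs.contMDiff L).sec U)
    {τ : (twistM p hs.contMDiff L).ι} {z : Z} (hz : p z ∈ U) (hτ : z ∈ (twistM p hs.contMDiff L).dom τ)
    {f : Y → ℂ} (hf : p z ∈ smoothLocus n f) :
    hat hs (∑ s ∈ S, ζ s) τ f z = ∑ s ∈ S, hat hs (ζ s) τ f z := by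
  classical
  induction S using Finset.induction_on with
  | empty =>
    rw [Finset.sum_empty, Finset.sum_empty, ← zero_smul ℂ (0 : (transferSheaf p hs.contMDiff L).sec U),
      hat_smul hs 0 _ hz hτ hf, zero_mul]
  | insert s S hs' ih => rw [Finset.sum_insert hs', Finset.sum_insert hs', ← ih, hat_add hs _ _ hz hτ hf]

theorem IsRightMul.hat_scalar {ξ η : (transferSheaf p hs.contMDiff L).sec U} {c : Z → ℂ}
    (hc : HolOn (n + k) c (Opens.comap p U))
    (h : IsRightMul p hs.contMDiff L ξ (TwDiffOp.scalar _ c hc) η) {τ : (twistM p hs.contMDiff L).ι} {z : Z}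
    (hz : p z ∈ U) (hτ : z ∈ (twistM p hs.contMDiff L).dom τ) {f : Y → ℂ} (hf : p z ∈ smoothLocus n f) :
    hat hs η τ f z = c z * hat hs ξ τ f z := by
  have hc' : HolOn (n + k) c (Opens.comap p U ⊓ (twistM p hs.contMDiff L).dom τ : Opens Z) :=
    hc.mono inter_subset_left
  have hξ := hat_mem_smoothLocus hs ξ hz hτ hf
  have hz' : z ∈ Opens.comap p U ⊓ (twistM p hs.contMDiff L).dom τ := ⟨hz, hτ⟩
  rw [(isRightMul_iff hs ξ η _).1 h τ z hz hτ f hf]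
  refine (trEv_eq le_rfl (IsTranspose.mul (a := τ.2.1) c hc') hz' hτ.2.1 hξ).trans ?_
  exact LocOp.mulOp_ev (hc'.smoothOn _) hz' hξ

theorem IsLeftMul.hat_ofTriv {ξ η : (transferSheaf p hs.contMDiff L).sec U} (hi : U ≤ L.dom i)
    (hb : (U : Set Y) ⊆ b.1.source) {Q Q' : LocOp n U} (hQ : IsTranspose n b Q Q')
    (h : IsLeftMul p hs.contMDiff L (TwDiffOp.ofTriv L i hi Q hQ.isHol.1) ξ η) {a : Chart (n + k) Z} {z : Z}
    (hz : p z ∈ U) (ha : z ∈ a.1.source) {f : Y → ℂ} (hf : p z ∈ smoothLocus n f) :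
    hat hs η (i, (a, b)) f z = hat hs ξ (i, (a, b)) (Q'.ev f) z := by
  have hτ : z ∈ (twistM p hs.contMDiff L).dom (i, (a, b)) := ⟨hi hz, ha, hb hz⟩
  rw [(isLeftMul_iff hs _ ξ η).1 h (i, (a, b)) z hz hτ f hf]
  have h1 : trEv b ((TwDiffOp.ofTriv L i hi Q hQ.isHol.1).op i) f =ᶠ[𝓝 (p z)] Q'.ev f := by
    filter_upwards [U.2.mem_nhds hz, (smoothLocus n f).2.mem_nhds hf] with y hy hyf
    exact trEv_eq (le_inf le_rfl hi) (by rwa [TwDiffOp.ofTriv_restr]) hy (hb hy) hyf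
  have h2 := LocOp.mem_smoothLocus_ev Q' hz hf
  exact hat_congr hs ξ hz hτ h1 (smoothLocus_congr h1.symm h2)

include hs hpr in
/-- A bimodule homomorphism is determined by the image of the unit section. -/
theorem IsBimoduleHom.eq_of_one {Φ Ψ : HomOn (transferSheaf p hs.contMDiff L) (homSheaf p hs.contMDiff L) ⊤}
    (hΦ : IsBimoduleHom p hs.contMDiff L Φ) (hΨ : IsBimoduleHom p hs.contMDiff L Ψ)
    (h1 : Φ.app ⊤ le_top (transferOne p hs.contMDiff L) = Ψ.app ⊤ le_top (transferOne p hs.contMDiff L)) :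
    Φ = Ψ := by
  refine HomOn.ext fun U hU ξ => HomOn.ext fun V hV h => absSec_ext fun i y hy hi => ?_
  obtain ⟨b, hb⟩ : ∃ b : Chart n Y, y ∈ b.1.source := (HolLineBundle.canonical n Y).cover y
  obtain ⟨B, S, hyB, hBU, hBb, hc, hdens⟩ := exists_expansion hs hpr ξ (hV hy) hi hb
  have hBi : B ≤ L.dom i := hBU.trans inf_le_right
  -- Q s is the operator with transpose ∂^s: the left action passes to transposes, and this makes it
  -- act on functions by ∂^s.
  choose Q hQ using fun s : Fin n →₀ ℕ => iterD_isTranspose b hBb (Finsupp.toMultiset s).toList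
  choose ζ hζ using fun s => exists_isRightMul hs
    ((transferSheaf p hs.contMDiff L).res (le_top : B ≤ ⊤) (transferOne p hs.contMDiff L))
    (TwDiffOp.scalar _ (symCoeff hs ξ i b s) (hc s))
  choose η hη using fun s => exists_isLeftMul hs (TwDiffOp.ofTriv L i hBi (Q s) (hQ s).isHol.1) (ζ s)
  -- Over B the expansion of ξ reads ξ = ∑ Q_s · 1 · c_s: the right factor c_s multiplies by the
  -- coefficient and the left factor differentiates f. Both actions commute with Φ and Ψ, which
  -- agree on 1.
  have hsum : (transferSheaf p hs.contMDiff L).res (hBU.trans inf_le_left) ξ = ∑ s ∈ S, η s := by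
    refine hat_ext_triv hs hBi hBb fun a z hz ha f hf => ?_
    have hτ : z ∈ (twistM p hs.contMDiff L).dom (i, (a, b)) := ⟨hBi hz, ha, hBb hz⟩
    rw [hat_res hs _ ξ hz hτ hf, hat_sum hs S η hz hτ hf,
      hat_eq_dens hs ξ (hBU hz).1 (hBi hz) ha (hBb hz) hf, hdens z hz f hf]
    refine Finset.sum_congr rfl fun s _ => ?_
    have h2 := LocOp.mem_smoothLocus_ev (iterOp b B hBb (Finsupp.toMultiset s).toList) hz hf
    rw [IsLeftMul.hat_ofTriv hs hBi hBb (hQ s) (hη s) hz ha hf,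
      IsRightMul.hat_scalar hs (hc s) (hζ s) hz hτ h2, hat_res hs _ _ hz hτ h2, hat_one hs hτ h2,
      iterOp_ev _ _ _ hz hf]
  have hone : Φ.app B le_top ((transferSheaf p hs.contMDiff L).res le_top (transferOne p hs.contMDiff L)) =
      Ψ.app B le_top ((transferSheaf p hs.contMDiff L).res le_top (transferOne p hs.contMDiff L)) := by
    rw [← Φ.res_app le_top le_top, ← Ψ.res_app le_top le_top, h1]
  have hB : (homSheaf p hs.contMDiff L).res (hBU.trans inf_le_left) (Φ.app U le_top ξ) =
      (homSheaf p hs.contMDiff L).res (hBU.trans inf_le_left) (Ψ.app U le_top ξ) := by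
    rw [Φ.res_app le_top, Ψ.res_app le_top, hsum, map_sum, map_sum]
    refine Finset.sum_congr rfl fun s _ => ?_
    rw [hΦ.1 B _ _ _ (hη s), hΨ.1 B _ _ _ (hη s), hΦ.2 B _ _ _ (hζ s), hΨ.2 B _ _ _ (hζ s), hone]
  have hyBV : y ∈ B ⊓ V := ⟨hyB, hy⟩
  have key : HomOn.app (Φ.app U hU ξ) (B ⊓ V) (inf_le_right.trans hV) =
      HomOn.app (Ψ.app U hU ξ) (B ⊓ V) (inf_le_right.trans hV) :=
    congrArg (fun φ => HomOn.app (F := pushforward p (twistM p hs.contMDiff L).absSheaf) (G := L.absSheaf)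
      φ (B ⊓ V) inf_le_left) hB
  -- Agreement is known for the restrictions to B only; the value at y is computed after restricting
  -- h to the preimage of B ⊓ V.
  have e : ∀ φ : (homSheaf p hs.contMDiff L).sec U,
      (HomOn.app (F := pushforward p (twistM p hs.contMDiff L).absSheaf) (G := L.absSheaf) φ V hV h).1 i y =
      (HomOn.app (F := pushforward p (twistM p hs.contMDiff L).absSheaf) (G := L.absSheaf) φ (B ⊓ V)
        (inf_le_right.trans hV) ((pushforward p (twistM p hs.contMDiff L).absSheaf).res inf_le_right h)).1 i y :=
    fun φ => (absSheaf_res_apply (inf_le_right : B ⊓ V ≤ V) _ i hyBV).symm.trans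
      (congrArg (fun s : L.absSec (B ⊓ V) => s.1 i y)
        (HomOn.res_app (F := pushforward p (twistM p hs.contMDiff L).absSheaf) (G := L.absSheaf) φ hV inf_le_right h))
  rw [e (Φ.app U hU ξ), e (Ψ.app U hU ξ), key]

theorem IsFiberIntegration.unique {φ ψ : (homSheaf p hs.contMDiff L).sec ⊤}
    (hφ : IsFiberIntegration p hs.contMDiff L φ) (hψ : IsFiberIntegration p hs.contMDiff L ψ) : φ = ψ :=
  HomOn.ext fun V _ h => absSec_ext fun i y hy hi => (hφ V h i y hy hi).trans (hψ V h i y hy hi).symm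

end Uniqueness

end DPush
end

theorem proposition3p6 {n k : ℕ}
    {Y : Type*} [TopologicalSpace Y] [T2Space Y] [SecondCountableTopology Y]
    [ChartedSpace (DPush.Cn n) Y] [IsManifold 𝓘(ℂ, DPush.Cn n) ω Y]
    {Z : Type*} [TopologicalSpace Z] [T2Space Z] [SecondCountableTopology Z]
    [ChartedSpace (DPush.Cn (n + k)) Z] [IsManifold 𝓘(ℂ, DPush.Cn (n + k)) ω Z]
    (p : C(Z, Y))
    (hp : Manifold.IsSubmersion 𝓘(ℂ, DPush.Cn (n + k)) 𝓘(ℂ, DPush.Cn n) ω p)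
    (hproper : IsProperMap p)
    (E : Y → Type*) [∀ y, AddCommGroup (E y)] [∀ y, Module ℂ (E y)]
    [∀ y, TopologicalSpace (E y)] [TopologicalSpace (Bundle.TotalSpace ℂ E)]
    [FiberBundle ℂ E] [VectorBundle ℂ ℂ E]
    [ContMDiffVectorBundle ω ℂ E 𝓘(ℂ, DPush.Cn n)] :
    -- the left and right actions on `L ⊗ H⁰p^D_*(𝒟_Z ⊗ M⁻¹)` are well defined
    (∀ (U : TopologicalSpace.Opens Y) (S : DPush.TwDiffOp (.ofVectorBundle E) U)
      (ξ : (DPush.transferSheaf p hp.contMDiff (.ofVectorBundle E)).sec U),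
      ∃! η, DPush.IsLeftMul p hp.contMDiff (.ofVectorBundle E) S ξ η) ∧
    (∀ (U : TopologicalSpace.Opens Y)
      (ξ : (DPush.transferSheaf p hp.contMDiff (.ofVectorBundle E)).sec U)
      (R : DPush.TwDiffOp (DPush.twistM p hp.contMDiff (.ofVectorBundle E))
        (TopologicalSpace.Opens.comap p U)),
      ∃! η, DPush.IsRightMul p hp.contMDiff (.ofVectorBundle E) ξ R η) ∧
    -- there is an injective bimodule homomorphism that sends the unit section to `p_!`
    ∃ Φ : DPush.HomOn (DPush.transferSheaf p hp.contMDiff (.ofVectorBundle E))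
        (DPush.homSheaf p hp.contMDiff (.ofVectorBundle E)) ⊤,
      DPush.IsBimoduleHom p hp.contMDiff (.ofVectorBundle E) Φ ∧
      DPush.IsFiberIntegration p hp.contMDiff (.ofVectorBundle E)
        (Φ.app ⊤ le_top (DPush.transferOne p hp.contMDiff (.ofVectorBundle E))) ∧
      (∀ U : TopologicalSpace.Opens Y, Function.Injective (Φ.app U le_top)) ∧
      -- and it is the only bimodule homomorphism that does so
      ∀ Ψ : DPush.HomOn (DPush.transferSheaf p hp.contMDiff (.ofVectorBundle E))
          (DPush.homSheaf p hp.contMDiff (.ofVectorBundle E)) ⊤,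
        DPush.IsBimoduleHom p hp.contMDiff (.ofVectorBundle E) Ψ →
        DPush.IsFiberIntegration p hp.contMDiff (.ofVectorBundle E)
          (Ψ.app ⊤ le_top (DPush.transferOne p hp.contMDiff (.ofVectorBundle E))) →
        Ψ = Φ := by
  refine ⟨fun U S ξ => DPush.existsUnique_isLeftMul hp S ξ, fun U ξ R => DPush.existsUnique_isRightMul hp ξ R, ?_⟩
  have hΦ : DPush.IsBimoduleHom p hp.contMDiff (.ofVectorBundle E) (DPush.actHom hp hproper _) :=
    ⟨fun _ S _ _ h => DPush.actHom_left hp hproper S h, fun _ _ _ _ h => DPush.actHom_right hp hproper h⟩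
  exact ⟨DPush.actHom hp hproper _, hΦ, DPush.actHom_one hp hproper, fun _ => DPush.actHom_injective hp hproper,
    fun Ψ hΨ h1 => hΨ.eq_of_one hp hproper hΦ (h1.unique hp (DPush.actHom_one hp hproper))⟩
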